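/- Let $0<\beta_1,\beta_2,\beta_3<1$ satisfy $(1-\beta_2)+(1-\beta_3)<1-\beta_1$, and define $\gamma$ by $1-\gamma=(1-\beta_2)+(1-\beta_3)$, so that $\beta_1<\gamma<1$. Let $a_2\neq a_3$ be complex numbers with $(1-\beta_2)a_2+(1-\beta_3)a_3=0$. On $\mathbf C^2$ with coordinates $(z,w)$ let $L_1=\{z=0\}$, $L_2=\{w=a_2z\}$, $L_3=\{w=a_3z\}$, and put $r=|z|^{\beta_1}$, $R=|w|^{\gamma}$, $\rho^2=r^2+R^2$. Let $$\phi(w)=|w|^{2\gamma}+\frac{\gamma^2}{\pi}\int_{\mathbf C}\left(|t-a_2|^{2\beta_2-2}|t-a_3|^{2\beta_3-2}-|t|^{2\gamma-2}\right)\log|w-t|\; i\,dt\wedge d\bar t,\qquad i\,dt\wedge d\bar t=2\,dx\,dy,$$ which is the potential of the flat metric $\gamma^2|w-a_2|^{2\beta_2-2}|w-a_3|^{2\beta_3-2}\,i\,dw\wedge d\bar w$. Let $\alpha_0\in(1,\gamma/\beta_1)$, let $\chi_1,\chi_2:\mathbf R\to\mathbf R$ be smooth with $\chi_1+\chi_2=1$,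 $\chi_1(s)=1$ for $s>2$ and $\chi_2(s)=1$ for $s<1$, and let $$\psi=|z|^{2\beta_1}+\chi_1(Rr^{-\alpha_0})\,|w|^{2\gamma}+\chi_2(Rr^{-\alpha_0})\,|z|^{2\gamma}\phi(w/z)\quad(z\ne0),\qquad \psi(0,w)=|w|^{2\gamma},\qquad \omega=i\partial\bar\partial\psi.$$ Then there is an open neighbourhood $U$ of $0\in\mathbf C^2$ on which $\omega$ is a Kähler metric, that is: $\psi$ is continuous on $U$ and smooth on $U\setminus(L_1\cup L_2\cup L_3)$, and $\omega$ is a smooth Kähler metric on $U\setminus(L_1\cup L_2\cup L_3)$. Moreover: 1. For $j=1,2,3$ the metric $\omega$ has standard cone singularities of angle $2\pi\beta_j$ along $(L_j\setminus\{0\})\cap U$. That is, for every $p\in (L_j\setminus\{0\})\cap U$ there are holomorphic coordinates $(z_1,z_2)$ centred at $p$ with $L_j=\{z_1=0\}$, in which $\omega=\beta_j^2|z_1|^{2\beta_j-2}i\,dz_1\wedge d\bar z_1+i\,dz_2\wedge d\bar z_2+\sigma$, where near $p$ and off $L_j$ the components of $\sigma$ with respect to the coframe $|z_1|^{\beta_j-1}dz_1,\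 dz_2$ are Hölder continuous of exponent $\min\{1,1/\beta_j-1\}$ as functions of $(|z_1|^{\beta_j-1}z_1,\,z_2)$, and tend to $0$ at $p$. 2. The tangent cone of $\omega$ at $0$ is $\mathbf C_{\beta_1}\times\mathbf C_\gamma$, i.e. $\mathbf C^2$ with the metric $\beta_1^2|z|^{2\beta_1-2}i\,dz\wedge d\bar z+\gamma^2|w|^{2\gamma-2}i\,dw\wedge d\bar w$, in the following sense. For $\lambda>0$ let $D_\lambda(z,w)=(\lambda^{1/\beta_1}z,\lambda^{1/\gamma}w)$, let $B=\{\rho<1\}$, and let $d_\lambda$ be the distance function on $B$ of the metric $\lambda^{-2}D_\lambda^*\omega$. Then for every $\epsilon>0$ there is $\lambda_0>0$ such that for all $0<\lambda<\lambda_0$ and all $x_1,x_2\in B$ the distances are finite and $$|d_\lambda(x_1,x_2)-d_{\mathbf C_{\beta_1}\times\mathbf C_\gamma}(x_1,x_2)|<\epsilon .$$ Here the line element of $\sum g_{i\bar j}\,i\,dz_i\wedge d\bar z_j$ is $\sum g_{i\bar j}\,dz_i\,d\bar z_j$, and the distance of a metric that is singular along some complex lines is the infimum of the lengths of continuous curves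 (in $B$ for $d_\lambda$, in $\mathbf C^2$ for the cone) which, away from finitely many times, are $C^1$ and avoid those lines. -/

import Mathlib

open Set Filter Topology MeasureTheory
open scoped ContDiff ENNReal NNReal

noncomputable section

namespace ConicalLines

/-! Calculus on `ℂ²`, with coordinates `(z, w)`, modelled on `ℂ × ℂ`. -/

/-- The standard basis vectors `(1, 0)` and `(0, 1)` of `ℂ²`. -/
def basisVec : Fin 2 → ℂ × ℂ := ![(1, 0), (0, 1)]

/-- The coordinate functions `z` and `w` on `ℂ²`. -/
def coord (i : Fin 2) (x : ℂ × ℂ) : ℂ := ![x.1, x.2] i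

/-- The Wirtinger derivative `∂f/∂z_i = (∂f/∂x_i - i ∂f/∂y_i) / 2`. -/
def dz (i : Fin 2) (f : ℂ × ℂ → ℂ) (x : ℂ × ℂ) : ℂ :=
  (fderiv ℝ f x (basisVec i) - Complex.I * fderiv ℝ f x (Complex.I • basisVec i)) / 2

/-- The Wirtinger derivative `∂f/∂z̄_i = (∂f/∂x_i + i ∂f/∂y_i) / 2`. -/
def dzbar (i : Fin 2) (f : ℂ × ℂ → ℂ) (x : ℂ × ℂ) : ℂ :=
  (fderiv ℝ f x (basisVec i) + Complex.I * fderiv ℝ f x (Complex.I • basisVec i)) / 2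

/-- A `(1,1)`-form `∑ g_{ij̄} i dz_i ∧ dz̄_j` on `ℂ²`, given by its matrix of coefficients. -/
abbrev HermField := ℂ × ℂ → Matrix (Fin 2) (Fin 2) ℂ

/-- The form `i∂∂̄ψ`, with coefficients `∂²ψ / ∂z_i ∂z̄_j`. -/
def ddbar (ψ : ℂ × ℂ → ℝ) : HermField := fun x =>
  Matrix.of fun i j => dz i (dzbar j fun y => (ψ y : ℂ)) x

/-- The squared length `∑ g_{ij̄} v_i v̄_j` of a tangent vector `v` at `x`
(so that `i dz ∧ dz̄` corresponds to the line element `|dz|²`). -/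
def normSq (g : HermField) (x v : ℂ × ℂ) : ℝ :=
  (∑ i, ∑ j, g x i j * coord i v * star (coord j v)).re

/-- `g` is a smooth Kähler metric on the (open) set `V`: smooth, Hermitian, positive definite,
and with closed associated form, i.e. `∂g_{ij̄}/∂z_k = ∂g_{kj̄}/∂z_i`. -/
structure IsKahlerOn (g : HermField) (V : Set (ℂ × ℂ)) : Prop where
  smooth : ∀ i j, ContDiffOn ℝ ∞ (fun x => g x i j) V
  hermitian : ∀ x ∈ V, (g x).IsHermitian
  pos : ∀ x ∈ V, ∀ v : ℂ × ℂ, v ≠ 0 → 0 < normSq g x v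
  closed : ∀ x ∈ V, ∀ i j k, dz k (fun y => g y i j) x = dz i (fun y => g y k j) x

/-- The complex Jacobian matrix `∂F_k/∂z_i` of a holomorphic map. -/
def jacobian (F : ℂ × ℂ → ℂ × ℂ) (x : ℂ × ℂ) : Matrix (Fin 2) (Fin 2) ℂ :=
  Matrix.of fun k i => coord k (fderiv ℂ F x (basisVec i))

/-- The pull-back `F^* g` by a holomorphic map:
`(F^* g)_{ij̄} = ∑ (∂F_k/∂z_i) g_{kl̄}(F) conj (∂F_l/∂z_j)`. -/
def pullback (F : ℂ × ℂ → ℂ × ℂ) (g : HermField) : HermField := fun x =>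
  (jacobian F x).transpose * g (F x) * (jacobian F x).map star

/-! Distance functions of metrics which are singular along a set `S`. -/

/-- `c : [0, 1] → U` is a curve from `x` to `y` which is continuous and, away from finitely many
times, continuously differentiable and disjoint from the singular set `S`. -/
structure IsAdmissible (S U : Set (ℂ × ℂ)) (x y : ℂ × ℂ) (c : ℝ → ℂ × ℂ) : Prop where
  cont : ContinuousOn c (Icc 0 1)
  mapsTo : MapsTo c (Icc 0 1) U
  source : c 0 = x
  target : c 1 = y
  regular : ∃ T : Finset ℝ, ContDiffOn ℝ 1 c (Ioo 0 1 \ (T : Set ℝ)) ∧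
    ∀ t ∈ Ioo (0 : ℝ) 1 \ (T : Set ℝ), c t ∉ S

/-- The length of a curve with respect to `g`. -/
def curveLength (g : HermField) (c : ℝ → ℂ × ℂ) : ℝ≥0∞ :=
  ∫⁻ t in Ioo (0 : ℝ) 1, ENNReal.ofReal (Real.sqrt (normSq g (c t) (deriv c t)))

/-- The distance function on `U` associated with a metric `g` on `U` which is singular along `S`:
the infimum of the lengths of the admissible curves in `U`. -/
def lengthDist (g : HermField) (S U : Set (ℂ × ℂ)) (x y : ℂ × ℂ) : ℝ≥0∞ :=
  ⨅ (c : ℝ → ℂ × ℂ) (_ : IsAdmissible S U x y c), curveLength g c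

/-! Standard cone singularities. -/

/-- The point `(z₁, z₂)` with `ζ = |z₁|^(β-1) z₁`, as a function of `(ζ, z₂)`. The Euclidean
distance in `(ζ, z₂)` is equivalent to the distance of `ℂ_β × ℂ`. -/
def ofConeCoord (β : ℝ) (q : ℂ × ℂ) : ℂ × ℂ := ((‖q.1‖ ^ (1 / β - 1) : ℝ) * q.1, q.2)

/-- The components, with respect to the coframe `|z₁|^(β-1) dz₁, dz₂`, of the form
`h - ω_{ℂ_β × ℂ}`, where
`ω_{ℂ_β × ℂ} = β² |z₁|^(2β-2) i dz₁ ∧ dz̄₁ + i dz₂ ∧ dz̄₂`. -/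
def coneError (β : ℝ) (h : HermField) : HermField := fun y =>
  let P : Matrix (Fin 2) (Fin 2) ℂ := Matrix.diagonal ![((‖y.1‖ ^ (1 - β) : ℝ) : ℂ), 1]
  P * h y * P - Matrix.diagonal ![((β ^ 2 : ℝ) : ℂ), 1]

/-- `g` has a standard cone singularity of angle `2πβ` along the curve `L` at `p ∈ L`: there are
holomorphic coordinates `(z₁, z₂)` centred at `p` in which `L = {z₁ = 0}` and
`g = ω_{ℂ_β × ℂ} + σ`, where the components of `σ` in the coframe `|z₁|^(β-1) dz₁, dz₂` vanish at
`p` and are Hölder continuous, with exponent `min (1, 1/β - 1)`, with respect to `ℂ_β × ℂ`. -/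
def HasConeSingularityAt (g : HermField) (L : Set (ℂ × ℂ)) (β : ℝ) (p : ℂ × ℂ) : Prop :=
  ∃ Φ : OpenPartialHomeomorph (ℂ × ℂ) (ℂ × ℂ),
    p ∈ Φ.source ∧ Φ p = 0 ∧
    DifferentiableOn ℂ Φ Φ.source ∧ DifferentiableOn ℂ Φ.symm Φ.target ∧
    (∀ x ∈ Φ.source, x ∈ L ↔ (Φ x).1 = 0) ∧
    ∃ ε : ℝ, 0 < ε ∧ MapsTo (ofConeCoord β) (Metric.ball 0 ε) Φ.target ∧
      ∀ i j,
        (∃ C : ℝ≥0, HolderOnWith C (min 1 (1 / β - 1)).toNNReal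
          (fun q => coneError β (pullback Φ.symm g) (ofConeCoord β q) i j)
          {q | q ∈ Metric.ball 0 ε ∧ q.1 ≠ 0}) ∧
        Tendsto (fun q => coneError β (pullback Φ.symm g) (ofConeCoord β q) i j)
          (𝓝[{q | q.1 ≠ 0}] 0) (𝓝 0)

/-! The model cone `ℂ_{β₁} × ℂ_γ`. -/

/-- The metric `β₁² |z|^(2β₁-2) i dz ∧ dz̄ + γ² |w|^(2γ-2) i dw ∧ dw̄` of `ℂ_{β₁} × ℂ_γ`. -/
def coneMetric (β₁ γ : ℝ) : HermField := fun x =>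
  Matrix.diagonal ![((β₁ ^ 2 * ‖x.1‖ ^ (2 * β₁ - 2) : ℝ) : ℂ),
    ((γ ^ 2 * ‖x.2‖ ^ (2 * γ - 2) : ℝ) : ℂ)]

/-- The distance function of `ℂ_{β₁} × ℂ_γ`. -/
def coneDist (β₁ γ : ℝ) : ℂ × ℂ → ℂ × ℂ → ℝ≥0∞ :=
  lengthDist (coneMetric β₁ γ) {x | x.1 = 0 ∨ x.2 = 0} univ

/-- The unit ball `{ρ < 1}` of `ℂ_{β₁} × ℂ_γ`, where `ρ² = |z|^(2β₁) + |w|^(2γ)`. -/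
def coneUnitBall (β₁ γ : ℝ) : Set (ℂ × ℂ) := {x | ‖x.1‖ ^ (2 * β₁) + ‖x.2‖ ^ (2 * γ) < 1}

/-- The dilation `D_s (z, w) = (s^(1/β₁) z, s^(1/γ) w)` of `ℂ_{β₁} × ℂ_γ`. -/
def dilation (β₁ γ s : ℝ) (x : ℂ × ℂ) : ℂ × ℂ :=
  ((s ^ (1 / β₁) : ℝ) * x.1, (s ^ (1 / γ) : ℝ) * x.2)

/-- The distance function on the unit ball of the rescaled metric `s⁻² D_s^* g`,
where `g` is singular along `S`. -/
def rescaledDist (β₁ γ : ℝ) (g : HermField) (S : Set (ℂ × ℂ)) (s : ℝ) :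
    ℂ × ℂ → ℂ × ℂ → ℝ≥0∞ :=
  lengthDist (fun x => (((s ^ 2)⁻¹ : ℝ) : ℂ) • pullback (dilation β₁ γ s) g x)
    (dilation β₁ γ s ⁻¹' S) (coneUnitBall β₁ γ)

/-- The tangent cone at `0` of the metric `g`, singular along `S`, is `ℂ_{β₁} × ℂ_γ`: the distance
functions of `s⁻² D_s^* g` converge to that of the cone, uniformly on the unit ball, as `s → 0`. -/
def HasTangentCone (β₁ γ : ℝ) (g : HermField) (S : Set (ℂ × ℂ)) : Prop :=
  ∀ ε : ℝ, 0 < ε → ∃ s₀ : ℝ, 0 < s₀ ∧ ∀ s : ℝ, 0 < s → s < s₀ →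
    ∀ x ∈ coneUnitBall β₁ γ, ∀ y ∈ coneUnitBall β₁ γ,
      rescaledDist β₁ γ g S s x y ≠ ⊤ ∧ coneDist β₁ γ x y ≠ ⊤ ∧
      |(rescaledDist β₁ γ g S s x y).toReal - (coneDist β₁ γ x y).toReal| < ε

/-! The glued potential. -/

/-- The potential on `ℂ` of the flat metric
`γ² |w - a₂|^(2β₂-2) |w - a₃|^(2β₃-2) i dw ∧ dw̄` given by the Green's function:
`|w|^(2γ) + (γ²/π) ∫ (|t-a₂|^(2β₂-2) |t-a₃|^(2β₃-2) - |t|^(2γ-2)) log |w-t| i dt ∧ dt̄`.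
The factor `2` comes from `i dt ∧ dt̄ = 2 dx dy`. -/
def flatPotential (β₂ β₃ γ : ℝ) (a₂ a₃ : ℂ) (w : ℂ) : ℝ :=
  ‖w‖ ^ (2 * γ) + γ ^ 2 / Real.pi *
    (2 * ∫ t : ℂ, (‖t - a₂‖ ^ (2 * β₂ - 2) * ‖t - a₃‖ ^ (2 * β₃ - 2) - ‖t‖ ^ (2 * γ - 2)) *
      Real.log ‖w - t‖)

/-- The glued potential
`|z|^(2β₁) + χ₁ |w|^(2γ) + χ₂ |z|^(2γ) φ(w/z)`, where `φ` is the flat potential and `χ₁`, `χ₂` are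
evaluated at `R r^(-α₀)`, with `r = |z|^β₁` and `R = |w|^γ`. On `{z = 0}`, where
`R r^(-α₀) = ∞`, it is `|w|^(2γ)`. -/
def gluedPotential (β₁ β₂ β₃ γ α₀ : ℝ) (a₂ a₃ : ℂ) (χ₁ χ₂ : ℝ → ℝ) (x : ℂ × ℂ) : ℝ :=
  open Classical in
  if x.1 = 0 then ‖x.2‖ ^ (2 * γ) else
    ‖x.1‖ ^ (2 * β₁)
      + χ₁ (‖x.2‖ ^ γ * (‖x.1‖ ^ β₁) ^ (-α₀)) * ‖x.2‖ ^ (2 * γ)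
      + χ₂ (‖x.2‖ ^ γ * (‖x.1‖ ^ β₁) ^ (-α₀)) * ‖x.1‖ ^ (2 * γ)
        * flatPotential β₂ β₃ γ a₂ a₃ (x.2 / x.1)

/-- The line `{z = 0}`. -/
def verticalLine : Set (ℂ × ℂ) := {x | x.1 = 0}

/-- The line `{w = a z}`. -/
def lineOfSlope (a : ℂ) : Set (ℂ × ℂ) := {x | x.2 = a * x.1}

end ConicalLines

end

open ConicalLines

/-!
Since `χ₁ + χ₂ = 1`, the potential is `ψ = |z|^(2β₁) + |w|^(2γ) + χ₂ |z|^(2γ) u(w/z)` with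
`u = φ - |·|^(2γ)`: a correction of the potential of the cone.

*The flat potential.* `φ` is a logarithmic potential of the flat density, so that
`∂∂̄φ = γ² |w - a₂|^(2β₂-2) |w - a₃|^(2β₃-2)`, and near each point `φ = |w - p|^(2β) k + N` with `k`
and `N` smooth (`FlatData.flatPotential_local`). As `(1-β₂) a₂ + (1-β₃) a₃ = 0`, the flat density
differs from `|w|^(2γ-2)` by `O(|w|^(2γ-4))` at infinity (`abs_excess_le_of_large`), whence
`u = O(|w|^γ)` and `∇u = O(|w|^(γ-1))` (`FlatData.exists_growth_bound`).

*Positivity.* For `|w| ≥ K |z|` the correction is estimated in the coordinates `(log z, log w)`,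
in which the cut-off function has bounded derivatives: its Levi form is at most
`C (|w/z|^(-γ) + |z|^(2β₁(α₀-1)))` times the cone metric (`GlueData.exists_outer_bound`). For
`|w| ≤ K |z|` and `z` small, `ψ = |z|^(2β₁) + |z|^(2γ) φ(w/z)`, whose Levi form is explicit
(`GlueData.normSq_inner`). There `|∂φ|² ≤ C ∂∂̄φ`, the mixed term is absorbed by completing the
square, and `|z|^(2γ-2)` is negligible against `|z|^(2β₁-2)` (`GlueData.exists_inner_lower`).

*Cone singularities.* Along `{z = 0}` the metric is that of the cone, and `w^γ` is a coordinate in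
which it is exactly the model. Along `{w = a_j z}` affine functions of `w/z` and of `z` are
coordinates, and the local form of `φ` gives the expansion of the metric. Instead of charts,
holomorphic parametrisations are constructed (`HasConeSingularityAt.of_param`).

*Tangent cone.* After rescaling, the metric is `ε`-close to the cone metric outside a sector around
`{w = 0}` whose aperture tends to `0`. Inside it only three one-sided bounds are available, uniform
in the scale (`IsNearCone`, `GlueData.isNearCone_rescaled`), and they suffice to compare distances
(`IsNearCone.exists_abs_dist_sub_le`). A curve which enters `{|w|^γ ≤ η}` is replaced, between its
first and last times there, by its projection to `{w = η^(1/γ)}`, which is not much longer; the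
new end points are at distance `O(η)` from the old ones (`lengthDist_le_of_proj`). A curve of the
cone leaving the unit ball is first contracted into it (`exists_curve_in_ball`).
-/

noncomputable section

namespace ConicalLines

open Real (norm_of_nonneg rpow_add rpow_mul zero_rpow norm_eq_abs mul_rpow rpow_natCast rpow_neg
  rpow_le_rpow_of_nonpos rpow_add_one rpow_one div_rpow rpow_two rpow_neg_one
  rpow_le_rpow_of_exponent_ge rpow_pos_of_pos rpow_le_rpow rpow_def_of_pos
  rpow_le_rpow_of_exponent_le rpow_le_one log)
open Complex (norm_real ofRealCLM star_def mul_conj re_ofReal_mul ofReal_ne_zero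
  continuous_ofReal conjCLE I_mul_I I)
open Metric (ball isOpen_ball mem_ball_self ball_subset_ball ball_mem_nhds)

/-! ### Wirtinger calculus in one complex variable -/

/-- The real-linear map `v ↦ p v + q v̄`; every real-linear map `ℂ → ℂ` is of this form. -/
def wirt (p q : ℂ) : ℂ →L[ℝ] ℂ :=
  p • ContinuousLinearMap.id ℝ ℂ + q • (conjCLE : ℂ →L[ℝ] ℂ)

@[simp] lemma wirt_apply (p q v : ℂ) : wirt p q v = p * v + q * star v := by
  simp [wirt]

lemma wirt_add (p q p' q' : ℂ) : wirt p q + wirt p' q' = wirt (p + p') (q + q') := by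
  ext v; simp; ring

lemma wirt_smul (c p q : ℂ) : c • wirt p q = wirt (c * p) (c * q) := by
  ext v; simp; ring

lemma wirt_congr {p q p' q' : ℂ} (h : p = p') (h' : q = q') : wirt p q = wirt p' q' := by
  rw [h, h']

/-- The Wirtinger derivative `∂f/∂ζ` of a function of one complex variable. -/
def dzeta (f : ℂ → ℂ) (x : ℂ) : ℂ := (fderiv ℝ f x 1 - I * fderiv ℝ f x I) / 2

/-- The Wirtinger derivative `∂f/∂ζ̄` of a function of one complex variable. -/
def dzetabar (f : ℂ → ℂ) (x : ℂ) : ℂ := (fderiv ℝ f x 1 + I * fderiv ℝ f x I) / 2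

lemma dzeta_eq {f : ℂ → ℂ} {p q x : ℂ} (h : HasFDerivAt f (wirt p q) x) : dzeta f x = p := by
  simp only [dzeta, h.fderiv, wirt_apply, star_one, star_def, Complex.conj_I]
  linear_combination (-p / 2 + q / 2) * I_mul_I

lemma dzetabar_eq {f : ℂ → ℂ} {p q x : ℂ} (h : HasFDerivAt f (wirt p q) x) :
    dzetabar f x = q := by
  simp only [dzetabar, h.fderiv, wirt_apply, star_one, star_def, Complex.conj_I]
  linear_combination (p / 2 - q / 2) * I_mul_I

lemma hasFDerivAt_wirt {f : ℂ → ℂ} {x : ℂ} (h : DifferentiableAt ℝ f x) :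
    HasFDerivAt f (wirt (dzeta f x) (dzetabar f x)) x := by
  convert h.hasFDerivAt using 1
  ext v
  have hv : v = v.re • (1 : ℂ) + v.im • I := by
    apply Complex.ext <;> simp
  have : fderiv ℝ f x v = v.re • fderiv ℝ f x 1 + v.im • fderiv ℝ f x I := by
    conv_lhs => rw [hv]
    rw [map_add, map_smul, map_smul]
  rw [this, wirt_apply, dzeta, dzetabar]
  apply Complex.ext <;> simp <;> ring

lemma dzeta_congr {f g : ℂ → ℂ} {x : ℂ} (h : f =ᶠ[𝓝 x] g) : dzeta f x = dzeta g x := by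
  simp only [dzeta, h.fderiv_eq]

lemma dzetabar_congr {f g : ℂ → ℂ} {x : ℂ} (h : f =ᶠ[𝓝 x] g) :
    dzetabar f x = dzetabar g x := by
  simp only [dzetabar, h.fderiv_eq]

lemma dzetabar_eventuallyEq {f g : ℂ → ℂ} {x : ℂ} (h : f =ᶠ[𝓝 x] g) :
    dzetabar f =ᶠ[𝓝 x] dzetabar g := by
  filter_upwards [eventually_eventually_nhds.2 h] with y hy using dzetabar_congr hy

/-- Chain rule for a real function of a real-valued function, both regarded as complex-valued. -/
lemma hasFDerivAt_ofReal_comp {E : Type*} [NormedAddCommGroup E] [NormedSpace ℝ E] {F : E → ℝ}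
    {L : E →L[ℝ] ℂ} {x : E} {ρ : ℝ → ℝ} {ρ' : ℝ}
    (hF : HasFDerivAt (fun y => (F y : ℂ)) L x) (hρ : HasDerivAt ρ ρ' (F x)) :
    HasFDerivAt (fun y => (ρ (F y) : ℂ)) ((ρ' : ℂ) • L) x := by
  have h1 : HasFDerivAt F (Complex.reCLM.comp L) x := by
    have := (Complex.reCLM.hasFDerivAt (x := ((F x : ℝ) : ℂ))).comp x hF
    exact this
  have h2 : L = ofRealCLM.comp (Complex.reCLM.comp L) :=
    hF.unique ((ofRealCLM.hasFDerivAt (x := F x)).comp x h1)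
  have h3 := (ofRealCLM.hasFDerivAt (x := ρ (F x))).comp x (hρ.comp_hasFDerivAt x h1)
  refine h3.congr_fderiv ?_
  conv_rhs => rw [h2]
  ext v
  simp

lemma hasFDerivAt_holo {f : ℂ → ℂ} {f' x : ℂ} (h : HasDerivAt f f' x) :
    HasFDerivAt f (wirt f' 0) x := by
  refine (h.hasFDerivAt.restrictScalars ℝ).congr_fderiv ?_
  ext v; simp [mul_comm]

lemma hasFDerivAt_antiholo {f : ℂ → ℂ} {f' x : ℂ} (h : HasDerivAt f f' x) :
    HasFDerivAt (fun y => star (f y)) (wirt 0 (star f')) x := by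
  have := (conjCLE : ℂ →L[ℝ] ℂ).hasFDerivAt.comp x (hasFDerivAt_holo h)
  refine this.congr_fderiv ?_
  ext v; simp

/-- Derivative of a product, in Wirtinger form. -/
lemma hasFDerivAt_wirt_mul {f g : ℂ → ℂ} {p q p' q' x : ℂ} (hf : HasFDerivAt f (wirt p q) x)
    (hg : HasFDerivAt g (wirt p' q') x) :
    HasFDerivAt (fun y => f y * g y) (wirt (f x * p' + g x * p) (f x * q' + g x * q)) x := by
  refine (hf.mul hg).congr_fderiv ?_
  rw [wirt_smul, wirt_smul, wirt_add]

/-- Derivative of a sum, in Wirtinger form. -/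
lemma hasFDerivAt_wirt_add {f g : ℂ → ℂ} {p q p' q' x : ℂ} (hf : HasFDerivAt f (wirt p q) x)
    (hg : HasFDerivAt g (wirt p' q') x) :
    HasFDerivAt (fun y => f y + g y) (wirt (p + p') (q + q')) x := by
  refine (hf.add hg).congr_fderiv ?_
  rw [ConicalLines.wirt_add]

/-- Derivative of `|ζ - b|² + e`. -/
lemma hasFDerivAt_normSq_sub (b : ℂ) (e : ℝ) (x : ℂ) :
    HasFDerivAt (fun y : ℂ => ((‖y - b‖ ^ 2 + e : ℝ) : ℂ)) (wirt (star (x - b)) (x - b)) x := by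
  have h1 : HasDerivAt (fun y : ℂ => y - b) 1 x := (hasDerivAt_id x).sub_const b
  have h2 := (hasFDerivAt_wirt_mul (hasFDerivAt_holo h1) (hasFDerivAt_antiholo h1)).add_const (e : ℂ)
  have h3 : (fun y : ℂ => ((‖y - b‖ ^ 2 + e : ℝ) : ℂ))
      = fun y : ℂ => (y - b) * star (y - b) + (e : ℂ) := by
    ext y
    rw [star_def, mul_conj, Complex.normSq_eq_norm_sq]
    push_cast; ring
  rw [h3]
  exact h2.congr_fderiv (wirt_congr (by simp) (by simp))

lemma hasFDerivAt_rpow_normSq_sub (b : ℂ) (e p : ℝ) (x : ℂ) (hx : 0 < ‖x - b‖ ^ 2 + e) :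
    HasFDerivAt (fun y : ℂ => (((‖y - b‖ ^ 2 + e) ^ p : ℝ) : ℂ))
      (wirt ((p * (‖x - b‖ ^ 2 + e) ^ (p - 1) : ℝ) * star (x - b))
        ((p * (‖x - b‖ ^ 2 + e) ^ (p - 1) : ℝ) * (x - b))) x := by
  have := hasFDerivAt_ofReal_comp (hasFDerivAt_normSq_sub b e x)
    (ρ := fun t => t ^ p) (Real.hasDerivAt_rpow_const (p := p) (Or.inl hx.ne'))
  rw [wirt_smul] at this
  exact this

lemma eventually_normSq_sub_pos (b : ℂ) (e : ℝ) (x : ℂ) (hx : 0 < ‖x - b‖ ^ 2 + e) :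
    ∀ᶠ y in 𝓝 x, 0 < ‖y - b‖ ^ 2 + e := by
  have : Continuous fun y : ℂ => ‖y - b‖ ^ 2 + e := by fun_prop
  exact this.continuousAt.eventually (lt_mem_nhds hx)

/-- The value of `∂∂̄ ((|ζ-b|² + e)^β k)` in terms of the derivatives of `k`. -/
def regLap (b : ℂ) (β : ℝ) (k : ℂ → ℂ) (e : ℝ) (x : ℂ) : ℂ :=
  (β * (β - 1) * (‖x - b‖ ^ 2 + e) ^ (β - 2) * ‖x - b‖ ^ 2
      + β * (‖x - b‖ ^ 2 + e) ^ (β - 1) : ℝ) * k x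
    + (β * (‖x - b‖ ^ 2 + e) ^ (β - 1) : ℝ) * ((x - b) * dzeta k x)
    + (β * (‖x - b‖ ^ 2 + e) ^ (β - 1) : ℝ) * (star (x - b) * dzetabar k x)
    + ((‖x - b‖ ^ 2 + e) ^ β : ℝ) * dzeta (dzetabar k) x

lemma dzetabar_reg (b : ℂ) (β : ℝ) {k : ℂ → ℂ} (e : ℝ) (x : ℂ) (hk : DifferentiableAt ℝ k x)
    (hx : 0 < ‖x - b‖ ^ 2 + e) :
    HasFDerivAt (fun y => (((‖y - b‖ ^ 2 + e) ^ β : ℝ) : ℂ) * k y)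
      (wirt ((((‖x - b‖ ^ 2 + e) ^ β : ℝ) : ℂ) * dzeta k x
          + k x * ((β * (‖x - b‖ ^ 2 + e) ^ (β - 1) : ℝ) * star (x - b)))
        ((((‖x - b‖ ^ 2 + e) ^ β : ℝ) : ℂ) * dzetabar k x
          + k x * ((β * (‖x - b‖ ^ 2 + e) ^ (β - 1) : ℝ) * (x - b)))) x :=
  hasFDerivAt_wirt_mul (hasFDerivAt_rpow_normSq_sub b e β x hx) (hasFDerivAt_wirt hk)

/-- Real differentiability of `∂̄ k` for smooth `k`. -/
lemma contDiffAt_dzetabar {k : ℂ → ℂ} {x : ℂ} (hk : ContDiffAt ℝ ∞ k x) :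
    ContDiffAt ℝ ∞ (dzetabar k) x := by
  have h : ContDiffAt ℝ ∞ (fderiv ℝ k) x := hk.fderiv_right (by simp)
  unfold dzetabar
  exact ((h.clm_apply contDiffAt_const).add
    (contDiffAt_const.mul (h.clm_apply contDiffAt_const))).div_const _

lemma contDiffAt_dzeta {k : ℂ → ℂ} {x : ℂ} (hk : ContDiffAt ℝ ∞ k x) :
    ContDiffAt ℝ ∞ (dzeta k) x := by
  have h : ContDiffAt ℝ ∞ (fderiv ℝ k) x := hk.fderiv_right (by simp)
  unfold dzeta
  exact ((h.clm_apply contDiffAt_const).sub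
    (contDiffAt_const.mul (h.clm_apply contDiffAt_const))).div_const _

lemma dzeta_dzetabar_reg (b : ℂ) (β : ℝ) {k : ℂ → ℂ} (e : ℝ) (x : ℂ)
    (hk : ContDiffAt ℝ ∞ k x) (hx : 0 < ‖x - b‖ ^ 2 + e) :
    dzeta (dzetabar fun y => (((‖y - b‖ ^ 2 + e) ^ β : ℝ) : ℂ) * k y) x
      = regLap b β k e x := by
  have hev : dzetabar (fun y => (((‖y - b‖ ^ 2 + e) ^ β : ℝ) : ℂ) * k y) =ᶠ[𝓝 x]
      fun y => (((‖y - b‖ ^ 2 + e) ^ β : ℝ) : ℂ) * dzetabar k y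
          + k y * (β * (((‖y - b‖ ^ 2 + e) ^ (β - 1) : ℝ) * (y - b))) := by
    filter_upwards [eventually_normSq_sub_pos b e x hx,
      (hk.of_le (m := 1) (by simp)).eventually (by simp)] with y hy hky
    rw [dzetabar_eq (dzetabar_reg b β e y (hky.differentiableAt (by simp)) hy)]
    push_cast; ring
  rw [dzeta_congr hev]
  have h1 := hasFDerivAt_wirt_mul (hasFDerivAt_rpow_normSq_sub b e β x hx)
    (hasFDerivAt_wirt ((contDiffAt_dzetabar hk).differentiableAt (by simp)))
  have h2 := hasFDerivAt_wirt_mul (hasFDerivAt_rpow_normSq_sub b e (β - 1) x hx)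
    (hasFDerivAt_holo ((hasDerivAt_id x).sub_const b))
  have h3 := hasFDerivAt_wirt_mul (hasFDerivAt_holo (hasDerivAt_const x (β : ℂ))) h2
  have h4 := hasFDerivAt_wirt_add h1
    (hasFDerivAt_wirt_mul (hasFDerivAt_wirt (hk.differentiableAt (by simp))) h3)
  have h5 : star (x - b) * (x - b) = ((‖x - b‖ ^ 2 : ℝ) : ℂ) := by
    rw [mul_comm, star_def, mul_conj, Complex.normSq_eq_norm_sq]
  refine (dzeta_eq h4).trans ?_
  rw [regLap, show β - 1 - 1 = β - 2 by ring]
  simp only [id]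
  push_cast at h5 ⊢
  linear_combination (β * (β - 1) * k x * (((‖x - b‖ ^ 2 + e) ^ (β - 2) : ℝ) : ℂ)) * h5

/-! ### The fundamental solution of the Laplacian in the plane -/

/-- Integration by parts for the operator `(∂ₓ + τ ∂ᵧ) / 2`, which is `∂` for `τ = -i` and `∂̄` for
`τ = i`. -/
lemma integral_wirtinger_mul (τ : ℂ) {f g : ℂ → ℂ} (hf : ContDiff ℝ 1 f) (hg : ContDiff ℝ 1 g)
    (hs : HasCompactSupport f) :
    ∫ x, (fderiv ℝ f x 1 + τ * fderiv ℝ f x I) / 2 * g x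
      = - ∫ x, f x * ((fderiv ℝ g x 1 + τ * fderiv ℝ g x I) / 2) := by
  have hf' : Continuous (fderiv ℝ f) := hf.continuous_fderiv (by simp)
  have hg' : Continuous (fderiv ℝ g) := hg.continuous_fderiv (by simp)
  have hc : ∀ v, Integrable (fun x => fderiv ℝ f x v * g x) := fun v =>
    ((hf'.clm_apply continuous_const).mul hg.continuous).integrable_of_hasCompactSupport
      ((hs.fderiv_apply (𝕜 := ℝ) v).mul_right)
  have hc' : ∀ v, Integrable (fun x => f x * fderiv ℝ g x v) := fun v =>
    (hf.continuous.mul (hg'.clm_apply continuous_const)).integrable_of_hasCompactSupport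
      hs.mul_right
  have h0 : Integrable (fun x => f x * g x) :=
    (hf.continuous.mul hg.continuous).integrable_of_hasCompactSupport hs.mul_right
  have key : ∀ v, ∫ x, fderiv ℝ f x v * g x = - ∫ x, f x * fderiv ℝ g x v := fun v => by
    rw [integral_mul_fderiv_eq_neg_fderiv_mul_of_integrable (hc v) (hc' v) h0
      (fun x _ => hf.differentiable (by simp) x) (fun x _ => hg.differentiable (by simp) x), neg_neg]
  have e1 : ∀ x, (fderiv ℝ f x 1 + τ * fderiv ℝ f x I) / 2 * g x = (1 / 2 : ℂ) *
      (fderiv ℝ f x 1 * g x) + (τ / 2) * (fderiv ℝ f x I * g x) := fun x => by ring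
  have e2 : ∀ x, f x * ((fderiv ℝ g x 1 + τ * fderiv ℝ g x I) / 2) = (1 / 2 : ℂ) *
      (f x * fderiv ℝ g x 1) + (τ / 2) * (f x * fderiv ℝ g x I) := fun x => by ring
  simp_rw [e1, e2]
  rw [integral_add ((hc _).const_mul _) ((hc _).const_mul _),
    integral_add ((hc' _).const_mul _) ((hc' _).const_mul _)]
  simp only [integral_const_mul, key]
  ring

lemma integral_dzeta_mul {f g : ℂ → ℂ} (hf : ContDiff ℝ 1 f) (hg : ContDiff ℝ 1 g)
    (hs : HasCompactSupport f) : ∫ x, dzeta f x * g x = - ∫ x, f x * dzeta g x := by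
  have h := integral_wirtinger_mul (-I) hf hg hs
  simp only [neg_mul, ← sub_eq_add_neg] at h
  exact h

lemma integral_dzetabar_mul {f g : ℂ → ℂ} (hf : ContDiff ℝ 1 f) (hg : ContDiff ℝ 1 g)
    (hs : HasCompactSupport f) : ∫ x, dzetabar f x * g x = - ∫ x, f x * dzetabar g x :=
  integral_wirtinger_mul I hf hg hs

/-- `∂̄∂` of the regularised logarithm `½ log (|ζ-w|² + e)`. -/
lemma dzeta_regLog (w : ℂ) (e : ℝ) (x : ℂ) (hx : 0 < ‖x - w‖ ^ 2 + e) :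
    dzeta (fun y => ((1 / 2 * log (‖y - w‖ ^ 2 + e) : ℝ) : ℂ)) x
      = (1 / 2 : ℂ) * ((((‖x - w‖ ^ 2 + e) ^ (-1 : ℝ) : ℝ) : ℂ) * star (x - w)) := by
  have := hasFDerivAt_ofReal_comp (hasFDerivAt_normSq_sub w e x)
    (ρ := fun t => 1 / 2 * log t) ((Real.hasDerivAt_log hx.ne').const_mul (1 / 2))
  rw [wirt_smul] at this
  rw [dzeta_eq this, rpow_neg_one]
  push_cast; ring

lemma dzetabar_dzeta_regLog (w : ℂ) (e : ℝ) (he : 0 < e) (x : ℂ) :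
    dzetabar (dzeta (fun y => ((1 / 2 * log (‖y - w‖ ^ 2 + e) : ℝ) : ℂ))) x
      = ((1 / 2 * e / (‖x - w‖ ^ 2 + e) ^ 2 : ℝ) : ℂ) := by
  have hp : ∀ y, 0 < ‖y - w‖ ^ 2 + e := fun y => by positivity
  rw [dzetabar_congr (Eventually.of_forall fun y => dzeta_regLog w e y (hp y))]
  have h2 := hasFDerivAt_wirt_mul (hasFDerivAt_rpow_normSq_sub w e (-1) x (hp x))
    (hasFDerivAt_antiholo ((hasDerivAt_id x).sub_const w))
  have h3 := hasFDerivAt_wirt_mul (hasFDerivAt_holo (hasDerivAt_const x (1 / 2 : ℂ))) h2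
  have h5 : star (x - w) * (x - w) = ((‖x - w‖ ^ 2 : ℝ) : ℂ) := by
    rw [mul_comm, star_def, mul_conj, Complex.normSq_eq_norm_sq]
  refine (dzetabar_eq h3).trans ?_
  have h6 : (‖x - w‖ ^ 2 + e) ^ ((-1 : ℝ) - 1) = ((‖x - w‖ ^ 2 + e) ^ 2)⁻¹ := by
    rw [show (-1 : ℝ) - 1 = -(2 : ℕ) by norm_num, rpow_neg (hp x).le, rpow_natCast]
  rw [h6, rpow_neg_one]
  simp only [id, star_one, mul_one]
  have h7 : ((‖x - w‖ ^ 2 + e : ℝ) : ℂ) ≠ 0 := by exact_mod_cast (hp x).ne'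
  have h8 : (1 / 2 * (((((‖x - w‖ ^ 2 + e)⁻¹ : ℝ) : ℂ)
      + star (x - w) * (((-1) * ((‖x - w‖ ^ 2 + e) ^ 2)⁻¹ : ℝ) * (x - w)))) + 0 : ℂ)
      = 1 / 2 * ((((‖x - w‖ ^ 2 + e)⁻¹ : ℝ) : ℂ)
        - ((((‖x - w‖ ^ 2 + e) ^ 2)⁻¹ : ℝ) : ℂ) * ((‖x - w‖ ^ 2 : ℝ) : ℂ)) := by
    rw [← h5]; push_cast; ring
  have h9 : (1 / 2 * e / (‖x - w‖ ^ 2 + e) ^ 2 : ℝ)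
      = 1 / 2 * ((‖x - w‖ ^ 2 + e)⁻¹ - ((‖x - w‖ ^ 2 + e) ^ 2)⁻¹ * ‖x - w‖ ^ 2) := by
    have := (hp x).ne'
    field_simp
    ring
  rw [h9]
  push_cast at h8 ⊢
  rw [← h8]
  ring

lemma integrableOn_norm_sub_rpow {p : ℝ} (hp : p < 2) (b c : ℂ) (R : ℝ) :
    IntegrableOn (fun x : ℂ => ‖x - b‖ ^ (-p)) (ball c R) := by
  have h0 : IntegrableOn (fun x : ℂ => ‖x‖ ^ (-p)) (ball 0 (R + ‖c - b‖)) := by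
    refine integrableOn_ball_of_norm_le_rpow (C := 1) (α := p) (by simp) (by simpa using hp)
      (ae_of_all _ fun x => ?_)
      (by fun_prop : Measurable fun x : ℂ => ‖x‖ ^ (-p)).aestronglyMeasurable
    rw [norm_of_nonneg (by positivity), one_mul]
  have h1 := (measurePreserving_sub_right (volume : Measure ℂ) b).integrableOn_comp_preimage
    (MeasurableEquiv.subRight b).measurableEmbedding (f := fun x : ℂ => ‖x‖ ^ (-p))
    (s := ball 0 (R + ‖c - b‖))
  refine (h1.2 h0).mono_set fun x hx => ?_
  rw [mem_preimage, mem_ball_zero_iff]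
  rw [mem_ball_iff_norm] at hx
  calc ‖x - b‖ = ‖(x - c) + (c - b)‖ := by ring_nf
    _ ≤ ‖x - c‖ + ‖c - b‖ := norm_add_le _ _
    _ < _ := by linarith

lemma abs_log_le_rpow {y δ : ℝ} (hy : 0 ≤ y) (hδ : 0 < δ) :
    |log y| ≤ (y ^ (-δ) + y ^ δ) / δ := by
  rcases hy.eq_or_lt with rfl | hy
  · simp only [Real.log_zero, abs_zero]; positivity
  · have h1 := Real.log_le_rpow_div hy.le hδ
    have h2 := Real.log_le_rpow_div (inv_nonneg.2 hy.le) hδ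
    rw [Real.log_inv, Real.inv_rpow hy.le, ← rpow_neg hy.le] at h2
    have h3 : 0 < y ^ δ / δ := by positivity
    have h4 : 0 < y ^ (-δ) / δ := by positivity
    rw [add_div, abs_le]
    constructor <;> linarith

lemma rpow_neg_mul_rpow_neg_le {x y p q : ℝ} (hx : 0 < x) (hy : 0 < y) (hp : 0 ≤ p)
    (hq : 0 ≤ q) : x ^ (-p) * y ^ (-q) ≤ x ^ (-(p + q)) + y ^ (-(p + q)) := by
  rcases le_total x y with h | h
  · have : y ^ (-q) ≤ x ^ (-q) := rpow_le_rpow_of_nonpos hx h (by linarith)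
    calc x ^ (-p) * y ^ (-q) ≤ x ^ (-p) * x ^ (-q) := by gcongr
      _ = x ^ (-(p + q)) := by rw [← rpow_add hx]; ring_nf
      _ ≤ _ := by linarith [rpow_pos_of_pos hy (-(p + q))]
  · have : x ^ (-p) ≤ y ^ (-p) := rpow_le_rpow_of_nonpos hy h (by linarith)
    calc x ^ (-p) * y ^ (-q) ≤ y ^ (-p) * y ^ (-q) := by gcongr
      _ = y ^ (-(p + q)) := by rw [← rpow_add hy]; ring_nf
      _ ≤ _ := by linarith [rpow_pos_of_pos hx (-(p + q))]

lemma ae_ne_point (b : ℂ) : ∀ᵐ x : ℂ, x ≠ b := by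
  simp [ae_iff]

lemma integrableOn_rpow_mul_log {p : ℝ} (hp0 : 0 ≤ p) (hp : p < 2) (b w c : ℂ) (R : ℝ) :
    IntegrableOn (fun x : ℂ => ‖x - b‖ ^ (-p) * |log ‖x - w‖|) (ball c R) := by
  set δ := (2 - p) / 2 with hδ
  have hδ0 : 0 < δ := by rw [hδ]; linarith
  set A := (R + ‖c - w‖) ^ δ
  have hb : IntegrableOn (fun x : ℂ => (‖x - b‖ ^ (-(p + δ)) + ‖x - w‖ ^ (-(p + δ))
      + A * ‖x - b‖ ^ (-p)) / δ) (ball c R) :=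
    (((integrableOn_norm_sub_rpow (by linarith) b c R).add
      (integrableOn_norm_sub_rpow (by linarith) w c R)).add
      ((integrableOn_norm_sub_rpow hp b c R).const_mul A)).div_const δ
  refine Integrable.mono' hb
    (by fun_prop : Measurable _).aestronglyMeasurable ?_
  filter_upwards [ae_restrict_mem isOpen_ball.measurableSet,
    ae_restrict_of_ae (ae_ne_point b), ae_restrict_of_ae (ae_ne_point w)] with x hx hxb hxw
  have h1 : 0 < ‖x - b‖ := norm_pos_iff.2 (sub_ne_zero.2 hxb)
  have h2 : 0 < ‖x - w‖ := norm_pos_iff.2 (sub_ne_zero.2 hxw)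
  rw [norm_of_nonneg (by positivity)]
  rw [mem_ball_iff_norm] at hx
  have h3 : ‖x - w‖ ^ δ ≤ A := by
    apply rpow_le_rpow h2.le _ hδ0.le
    calc ‖x - w‖ = ‖(x - c) + (c - w)‖ := by ring_nf
      _ ≤ ‖x - c‖ + ‖c - w‖ := norm_add_le _ _
      _ ≤ _ := by linarith
  have h4 : 0 < ‖x - b‖ ^ (-p) := by positivity
  calc ‖x - b‖ ^ (-p) * |log ‖x - w‖|
      ≤ ‖x - b‖ ^ (-p) * ((‖x - w‖ ^ (-δ) + ‖x - w‖ ^ δ) / δ) := by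
        gcongr; exact abs_log_le_rpow h2.le hδ0
    _ = (‖x - b‖ ^ (-p) * ‖x - w‖ ^ (-δ) + ‖x - w‖ ^ δ * ‖x - b‖ ^ (-p)) / δ := by ring
    _ ≤ _ := by
        gcongr
        exact rpow_neg_mul_rpow_neg_le h1 h2 hp0 hδ0.le

lemma regLap_eq_zero {b : ℂ} {β : ℝ} {k : ℂ → ℂ} {e : ℝ} {x : ℂ} (hx : x ∉ tsupport k) :
    regLap b β k e x = 0 := by
  have h : k =ᶠ[𝓝 x] fun _ => 0 := notMem_tsupport_iff_eventuallyEq.1 hx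
  have h1 : dzetabar k =ᶠ[𝓝 x] fun _ => 0 := by
    filter_upwards [dzetabar_eventuallyEq h] with y hy
    rw [hy]; simp [dzetabar]
  have h2 : dzeta (dzetabar k) x = 0 := by rw [dzeta_congr h1]; simp [dzeta]
  have h3 : dzeta k x = 0 := by rw [dzeta_congr h]; simp [dzeta]
  rw [regLap, h.eq_of_nhds, h1.eq_of_nhds, h2, h3]
  simp

lemma contDiff_dzetabar {k : ℂ → ℂ} (hk : ContDiff ℝ ∞ k) : ContDiff ℝ ∞ (dzetabar k) :=
  contDiff_iff_contDiffAt.2 fun _ => contDiffAt_dzetabar hk.contDiffAt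

lemma contDiff_dzeta {k : ℂ → ℂ} (hk : ContDiff ℝ ∞ k) : ContDiff ℝ ∞ (dzeta k) :=
  contDiff_iff_contDiffAt.2 fun _ => contDiffAt_dzeta hk.contDiffAt

lemma hasCompactSupport_dzetabar {k : ℂ → ℂ} (hs : HasCompactSupport k) :
    HasCompactSupport (dzetabar k) := by
  refine hs.mono' fun x hx => by_contra fun h => hx ?_
  rw [dzetabar_congr (notMem_tsupport_iff_eventuallyEq.1 h)]
  simp [dzetabar]

lemma hasCompactSupport_dzeta {k : ℂ → ℂ} (hs : HasCompactSupport k) :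
    HasCompactSupport (dzeta k) := by
  refine hs.mono' fun x hx => by_contra fun h => hx ?_
  rw [dzeta_congr (notMem_tsupport_iff_eventuallyEq.1 h)]
  simp [dzeta]

/-- The functions `∂∂̄ ((|ζ-b|² + e)^β k)` are dominated, uniformly in `e`, by `|ζ-b|^(2β-2)`. -/
lemma exists_regLap_bound (b : ℂ) {β : ℝ} (hβ0 : 0 < β) (hβ : β ≤ 1) {k : ℂ → ℂ}
    (hk : ContDiff ℝ ∞ k) (hs : HasCompactSupport k) :
    ∃ C, 0 ≤ C ∧ ∀ e, 0 ≤ e → e ≤ 1 → ∀ x, x ≠ b →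
      ‖regLap b β k e x‖ ≤ C * ‖x - b‖ ^ (-(2 - 2 * β)) := by
  obtain ⟨M₁, hM₁⟩ := hs.exists_bound_of_continuous hk.continuous
  obtain ⟨M₂, hM₂⟩ := (hasCompactSupport_dzeta hs).exists_bound_of_continuous
    (contDiff_dzeta hk).continuous
  obtain ⟨M₃, hM₃⟩ := (hasCompactSupport_dzetabar hs).exists_bound_of_continuous
    (contDiff_dzetabar hk).continuous
  obtain ⟨M₄, hM₄⟩ := (hasCompactSupport_dzeta
    (hasCompactSupport_dzetabar hs)).exists_bound_of_continuous (contDiff_dzeta (contDiff_dzetabar hk)).continuous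
  obtain ⟨R, hR⟩ := hs.isCompact.isBounded.exists_norm_le
  have h1 : 0 ≤ M₁ := (norm_nonneg _).trans (hM₁ 0)
  have h2 : 0 ≤ M₂ := (norm_nonneg _).trans (hM₂ 0)
  have h3 : 0 ≤ M₃ := (norm_nonneg _).trans (hM₃ 0)
  have h4 : 0 ≤ M₄ := (norm_nonneg _).trans (hM₄ 0)
  set S := |R| + ‖b‖
  have hS : 0 ≤ S := by positivity
  refine ⟨2 * M₁ + S * M₂ + S * M₃ + (S ^ 2 + 1) * M₄, by positivity, fun e he he1 x hx => ?_⟩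
  by_cases hxs : x ∈ tsupport k
  swap
  · rw [regLap_eq_zero hxs, norm_zero]; positivity
  have hs0 : 0 < ‖x - b‖ := norm_pos_iff.2 (sub_ne_zero.2 hx)
  have hsS : ‖x - b‖ ≤ S := (norm_sub_le _ _).trans (by
    have := (hR x hxs).trans (le_abs_self R)
    simp only [S]; linarith)
  set s := ‖x - b‖
  set q := s ^ 2 + e with hq
  have hq0 : 0 < q := by positivity
  set B := s ^ (-(2 - 2 * β)) with hB
  have hB0 : 0 < B := by positivity
  -- every power of the regularised radius `q` that occurs is at most a multiple of `B`
  have hqB : q ^ (β - 1) ≤ B := by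
    have : (s ^ 2) ^ (β - 1) = B := by
      rw [← rpow_natCast, ← rpow_mul hs0.le, hB]; congr 1; push_cast; ring
    rw [← this]
    exact rpow_le_rpow_of_nonpos (by positivity) (by linarith) (by linarith)
  have hq2 : q ^ (β - 2) * s ^ 2 ≤ B := by
    calc q ^ (β - 2) * s ^ 2 ≤ q ^ (β - 2) * q := by gcongr; linarith
      _ = q ^ (β - 1) := by
        rw [← rpow_add_one hq0.ne']; congr 1; ring
      _ ≤ B := hqB
  have hqβ : q ^ β ≤ B * (S ^ 2 + 1) := by
    calc q ^ β = q ^ (β - 1) * q := by rw [← rpow_add_one hq0.ne']; congr 1; ring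
      _ ≤ B * (S ^ 2 + 1) := by
        gcongr
        simp only [hq]
        gcongr
  have t1 : ‖((β * (β - 1) * q ^ (β - 2) * s ^ 2 + β * q ^ (β - 1) : ℝ) : ℂ) * k x‖
      ≤ 2 * B * M₁ := by
    rw [norm_mul, norm_real]
    gcongr
    · have e1 : 0 ≤ q ^ (β - 2) * s ^ 2 := by positivity
      have e2 : 0 < q ^ (β - 1) := by positivity
      have e3 : |β * (β - 1)| ≤ 1 := by rw [abs_le]; constructor <;> nlinarith
      calc ‖β * (β - 1) * q ^ (β - 2) * s ^ 2 + β * q ^ (β - 1)‖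
          = |(β * (β - 1)) * (q ^ (β - 2) * s ^ 2) + β * q ^ (β - 1)| := by
            rw [norm_eq_abs]; ring_nf
        _ ≤ |(β * (β - 1)) * (q ^ (β - 2) * s ^ 2)| + |β * q ^ (β - 1)| := abs_add_le _ _
        _ = |β * (β - 1)| * (q ^ (β - 2) * s ^ 2) + β * q ^ (β - 1) := by
            rw [abs_mul, abs_of_nonneg e1, abs_of_nonneg (by positivity : 0 ≤ β * q ^ (β - 1))]
        _ ≤ 1 * B + 1 * B := by gcongr
        _ = 2 * B := by ring
    · exact hM₁ x
  have hβq : ‖((β * q ^ (β - 1) : ℝ) : ℂ)‖ ≤ B := by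
    rw [norm_real, norm_of_nonneg (by positivity)]
    calc β * q ^ (β - 1) ≤ 1 * B := by gcongr
      _ = B := one_mul _
  have t2 : ‖((β * q ^ (β - 1) : ℝ) : ℂ) * ((x - b) * dzeta k x)‖ ≤ B * (S * M₂) := by
    rw [norm_mul, norm_mul]
    gcongr
    exact hM₂ x
  have t3 : ‖((β * q ^ (β - 1) : ℝ) : ℂ) * (star (x - b) * dzetabar k x)‖ ≤ B * (S * M₃) := by
    rw [norm_mul, norm_mul, norm_star]
    gcongr
    exact hM₃ x
  have t4 : ‖((q ^ β : ℝ) : ℂ) * dzeta (dzetabar k) x‖ ≤ B * (S ^ 2 + 1) * M₄ := by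
    rw [norm_mul, norm_real, norm_of_nonneg (by positivity)]
    gcongr
    exact hM₄ x
  have := norm_add₃_le.trans (add_le_add_three t1 t2 t3)
  calc ‖regLap b β k e x‖ ≤ 2 * B * M₁ + B * (S * M₂) + B * (S * M₃) + B * (S ^ 2 + 1) * M₄ := by
        unfold regLap
        exact (norm_add_le _ _).trans (add_le_add this t4)
    _ = _ := by ring

lemma contDiff_reg (b : ℂ) (β : ℝ) {e : ℝ} (he : 0 < e) {k : ℂ → ℂ} (hk : ContDiff ℝ ∞ k) :
    ContDiff ℝ ∞ fun y => (((‖y - b‖ ^ 2 + e) ^ β : ℝ) : ℂ) * k y := by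
  refine ContDiff.mul (ofRealCLM.contDiff.comp ?_) hk
  refine ContDiff.rpow_const_of_ne (((contDiff_id.sub contDiff_const).norm_sq ℝ).add
    contDiff_const) fun x => ?_
  have : 0 < ‖x - b‖ ^ 2 + e := by positivity
  exact this.ne'

/-- The fundamental solution identity with both singularities regularised: two integrations by
parts move `∂∂̄` to the logarithm. -/
lemma integral_regLap_mul_regLog (b w : ℂ) (β : ℝ) {k : ℂ → ℂ} (hk : ContDiff ℝ ∞ k)
    (hs : HasCompactSupport k) {e : ℝ} (he : 0 < e) :
    ∫ x, regLap b β k e x * ((1 / 2 * log (‖x - w‖ ^ 2 + e) : ℝ) : ℂ)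
      = ∫ x, (((‖x - b‖ ^ 2 + e) ^ β : ℝ) : ℂ) * k x
          * ((1 / 2 * e / (‖x - w‖ ^ 2 + e) ^ 2 : ℝ) : ℂ) := by
  set v : ℂ → ℂ := fun y => (((‖y - b‖ ^ 2 + e) ^ β : ℝ) : ℂ) * k y with hv
  set l : ℂ → ℂ := fun y => ((1 / 2 * log (‖y - w‖ ^ 2 + e) : ℝ) : ℂ) with hl
  have hvs : HasCompactSupport v := hs.mul_left
  have hvc : ContDiff ℝ ∞ v := contDiff_reg b β he hk
  have hlc : ContDiff ℝ ∞ l := by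
    refine ofRealCLM.contDiff.comp (contDiff_const.mul (ContDiff.log
      (((contDiff_id.sub contDiff_const).norm_sq ℝ).add contDiff_const) fun x => ?_))
    have : 0 < ‖x - w‖ ^ 2 + e := by positivity
    exact this.ne'
  have h1 : ∀ x, regLap b β k e x = dzeta (dzetabar v) x := fun x =>
    (dzeta_dzetabar_reg b β e x hk.contDiffAt (by positivity)).symm
  have h2 : ∀ x, ((1 / 2 * e / (‖x - w‖ ^ 2 + e) ^ 2 : ℝ) : ℂ) = dzetabar (dzeta l) x :=
    fun x => (dzetabar_dzeta_regLog w e he x).symm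
  simp_rw [h1, h2]
  rw [integral_dzeta_mul ((contDiff_dzetabar hvc).of_le (by simp)) (hlc.of_le (by simp))
    (hasCompactSupport_dzetabar hvs),
    integral_dzetabar_mul (hvc.of_le (by simp)) ((contDiff_dzeta hlc).of_le (by simp)) hvs, neg_neg]

lemma integral_cauchy_kernel :
    ∫ x : ℂ, (1 / 2 * ((1 + ‖x‖ ^ 2) ^ 2)⁻¹ : ℝ) = Real.pi / 2 := by
  have h := integral_fun_norm_addHaar (volume : Measure ℂ)
    (fun y : ℝ => (1 / 2 * ((1 + y ^ 2) ^ 2)⁻¹ : ℝ))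
  rw [h]
  have h1 : ∀ y ∈ Ici (0 : ℝ), HasDerivAt (fun y : ℝ => -(1 / 4) * (1 + y ^ 2)⁻¹)
      (y ^ (Module.finrank ℝ ℂ - 1) • (1 / 2 * ((1 + y ^ 2) ^ 2)⁻¹)) y := fun y _ => by
    have h2 : 1 + y ^ 2 ≠ 0 := by positivity
    have h3 : HasDerivAt (fun y : ℝ => 1 + y ^ 2) (2 * y) y := by
      simpa using (hasDerivAt_pow 2 y).const_add 1
    refine ((h3.fun_inv h2).const_mul (-(1 / 4))).congr_deriv ?_
    rw [Complex.finrank_real_complex, smul_eq_mul, show 2 - 1 = 1 from rfl, pow_one]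
    field_simp
    ring
  have h4 : Tendsto (fun y : ℝ => -(1 / 4) * (1 + y ^ 2)⁻¹) atTop (𝓝 (-(1 / 4) * 0)) := by
    refine Tendsto.const_mul _ (tendsto_inv_atTop_zero.comp ?_)
    exact tendsto_atTop_add_const_left _ _ (tendsto_pow_atTop (by norm_num))
  rw [integral_Ioi_of_hasDerivAt_of_nonneg' h1 (fun y hy => by
    have : (0 : ℝ) < y := hy
    positivity) h4]
  have h5 : (volume : Measure ℂ).real (ball 0 1) = Real.pi := by
    simp [Measure.real]
  rw [h5]
  simp
  ring

/-- The kernels `½ ε² / (|x-w|² + ε²)²` have mass `π/2` and concentrate at `w`. -/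
lemma tendsto_integral_cauchy_kernel {V : ℝ → ℂ → ℂ} (hVc : Continuous fun p : ℝ × ℂ => V p.1 p.2)
    {M : ℝ} (hbound : ∀ ε ∈ Ioc (0 : ℝ) 1, ∀ x, ‖V ε x‖ ≤ M) (w : ℂ) :
    Tendsto (fun ε : ℝ => ∫ x, V ε x * ((1 / 2 * ε ^ 2 / (‖x - w‖ ^ 2 + ε ^ 2) ^ 2 : ℝ) : ℂ))
      (𝓝[>] 0) (𝓝 ((Real.pi / 2 : ℝ) * V 0 w)) := by
  set κ : ℂ → ℝ := fun x => 1 / 2 * ((1 + ‖x‖ ^ 2) ^ 2)⁻¹ with hκ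
  have hκi : Integrable κ := by
    have := (integrable_rpow_neg_one_add_norm_sq (E := ℂ) (μ := volume) (r := 4)
      (by simp; norm_num)).const_mul (1 / 2)
    refine this.congr (ae_of_all _ fun x => ?_)
    have h0 : (0 : ℝ) < 1 + ‖x‖ ^ 2 := by positivity
    simp only [hκ]
    rw [show (-4 / 2 : ℝ) = -(2 : ℕ) by norm_num, rpow_neg h0.le, rpow_natCast]
  have hκ0 : ∀ x, 0 ≤ κ x := fun x => by simp only [hκ]; positivity
  have hκc : Continuous κ := by
    refine continuous_const.mul (Continuous.inv₀ (by fun_prop) fun x => ?_)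
    positivity
  -- the substitution `x ↦ w + ε x` turns the kernel into the fixed kernel `κ`
  have hsub : ∀ ε : ℝ, 0 < ε → ∫ x, V ε x * ((1 / 2 * ε ^ 2 / (‖x - w‖ ^ 2 + ε ^ 2) ^ 2 : ℝ) : ℂ)
      = ∫ x, V ε (w + ε • x) * (κ x : ℂ) := by
    intro ε hε
    set F : ℂ → ℂ := fun x => V ε x * ((1 / 2 * ε ^ 2 / (‖x - w‖ ^ 2 + ε ^ 2) ^ 2 : ℝ) : ℂ)
    have e1 : ∫ x, F x = ∫ x, F (w + x) := (integral_add_left_eq_self F w).symm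
    have e2 := Measure.integral_comp_smul (volume : Measure ℂ) (fun x => F (w + x)) ε
    rw [Complex.finrank_real_complex, abs_of_pos (by positivity)] at e2
    rw [e1, ← one_smul ℝ (∫ x, F (w + x)), ← mul_inv_cancel₀ (pow_pos hε 2).ne', mul_smul, ← e2,
      ← integral_smul]
    congr 1
    ext x
    have e3 : ‖ε • x‖ = ε * ‖x‖ := by rw [norm_smul, norm_of_nonneg hε.le]
    simp only [F, hκ, add_sub_cancel_left, e3]
    rw [Complex.real_smul, mul_left_comm, ← Complex.ofReal_mul]
    congr 2
    field_simp
    ring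
  clear_value κ
  have hc : ∀ ε, Continuous fun x : ℂ => V ε (w + ε • x) := fun ε =>
    hVc.comp (continuous_const.prodMk (continuous_const.add (continuous_const_smul ε)))
  have hc' : ∀ x, Continuous fun ε : ℝ => V ε (w + ε • x) := fun x =>
    hVc.comp (continuous_id.prodMk (continuous_const.add (continuous_id.smul continuous_const)))
  have hlim : Tendsto (fun ε : ℝ => ∫ x, V ε (w + ε • x) * (κ x : ℂ)) (𝓝[>] 0)
      (𝓝 (∫ x, V 0 w * (κ x : ℂ))) := by
    refine tendsto_integral_filter_of_dominated_convergence (fun x => M * κ x) ?_ ?_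
      (hκi.const_mul _) ?_
    · exact Eventually.of_forall fun ε =>
        ((hc ε).mul (continuous_ofReal.comp hκc)).aestronglyMeasurable
    · filter_upwards [Ioc_mem_nhdsGT (zero_lt_one' ℝ)] with ε hε
      refine ae_of_all _ fun x => ?_
      rw [norm_mul, norm_real, norm_of_nonneg (hκ0 x)]
      exact mul_le_mul_of_nonneg_right (hbound ε hε _) (hκ0 x)
    · refine ae_of_all _ fun x => Tendsto.mul ?_ tendsto_const_nhds
      have := (hc' x).tendsto 0
      rw [zero_smul, add_zero] at this
      exact this.mono_left nhdsWithin_le_nhds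
  have hval : ∫ x, V 0 w * (κ x : ℂ) = (Real.pi / 2 : ℝ) * V 0 w := by
    have : ∫ x, (κ x : ℂ) = ((∫ x, κ x : ℝ) : ℂ) := integral_ofReal
    rw [integral_const_mul, this, mul_comm, hκ, integral_cauchy_kernel]
  rw [← hval]
  refine hlim.congr' ?_
  filter_upwards [self_mem_nhdsWithin] with ε hε
  exact (hsub ε hε).symm

lemma exists_reg_bound (b : ℂ) {β : ℝ} (hβ : 0 < β) {k : ℂ → ℂ} (hk : Continuous k)
    (hs : HasCompactSupport k) : ∃ M : ℝ, ∀ ε ∈ Ioc (0 : ℝ) 1, ∀ x,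
      ‖(((‖x - b‖ ^ 2 + ε ^ 2) ^ β : ℝ) : ℂ) * k x‖ ≤ M := by
  obtain ⟨M, hM⟩ := hs.exists_bound_of_continuous hk
  obtain ⟨R, hR⟩ := hs.isCompact.isBounded.exists_norm_le
  have hM0 : 0 ≤ M := (norm_nonneg _).trans (hM 0)
  refine ⟨((|R| + ‖b‖) ^ 2 + 1) ^ β * M, fun ε hε x => ?_⟩
  by_cases hx : x ∈ tsupport k
  · rw [norm_mul, norm_real, norm_of_nonneg (by positivity)]
    have : ‖x - b‖ ≤ |R| + ‖b‖ := (norm_sub_le _ _).trans (by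
      have := (hR x hx).trans (le_abs_self R)
      linarith)
    have h2 : ε ^ 2 ≤ 1 := pow_le_one₀ hε.1.le hε.2
    gcongr
    exact hM x
  · rw [image_eq_zero_of_notMem_tsupport hx, mul_zero, norm_zero]
    positivity

lemma abs_regLog_le {y e : ℝ} (he : 0 ≤ e) (he1 : e ≤ 1) (hy : 0 < y) :
    |1 / 2 * log (y ^ 2 + e)| ≤ |log y| + (y ^ 2 + 1) := by
  have h1 : log y ≤ 1 / 2 * log (y ^ 2 + e) := by
    have : log (y ^ 2) ≤ log (y ^ 2 + e) := Real.log_le_log (by positivity) (by linarith)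
    rw [Real.log_pow] at this
    push_cast at this
    linarith
  have h2 : log (y ^ 2 + e) ≤ y ^ 2 + 1 :=
    (Real.log_le_sub_one_of_pos (by positivity)).trans (by linarith)
  rw [abs_le]
  constructor
  · have := neg_abs_le (log y)
    nlinarith [sq_nonneg y]
  · have := abs_nonneg (log y)
    nlinarith [sq_nonneg y]

lemma regLap_zero_eq (b : ℂ) (β : ℝ) {k : ℂ → ℂ} (hk : ContDiff ℝ ∞ k) {x : ℂ} (hx : x ≠ b) :
    dzeta (dzetabar fun y => ((‖y - b‖ ^ (2 * β) : ℝ) : ℂ) * k y) x = regLap b β k 0 x := by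
  have h : 0 < ‖x - b‖ := norm_pos_iff.2 (sub_ne_zero.2 hx)
  rw [← dzeta_dzetabar_reg b β 0 x hk.contDiffAt (by positivity)]
  congr 2
  ext y
  rw [add_zero, rpow_mul (norm_nonneg _)]
  norm_num

lemma tendsto_regLap (b : ℂ) (β : ℝ) (k : ℂ → ℂ) {x : ℂ} (hx : x ≠ b) :
    Tendsto (fun ε : ℝ => regLap b β k (ε ^ 2) x) (𝓝[>] 0) (𝓝 (regLap b β k 0 x)) := by
  have h : 0 < ‖x - b‖ := norm_pos_iff.2 (sub_ne_zero.2 hx)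
  have hq : Tendsto (fun ε : ℝ => ‖x - b‖ ^ 2 + ε ^ 2) (𝓝[>] 0) (𝓝 (‖x - b‖ ^ 2 + 0)) := by
    have : Continuous fun ε : ℝ => ‖x - b‖ ^ 2 + ε ^ 2 := by fun_prop
    have := this.tendsto 0
    rw [zero_pow two_ne_zero] at this
    exact this.mono_left nhdsWithin_le_nhds
  have hr : ∀ p : ℝ, Tendsto (fun ε : ℝ => (‖x - b‖ ^ 2 + ε ^ 2) ^ p) (𝓝[>] 0)
      (𝓝 ((‖x - b‖ ^ 2 + 0) ^ p)) := fun p =>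
    hq.rpow_const (Or.inl (by positivity))
  have hc : ∀ {f : ℝ → ℝ} {a : ℝ}, Tendsto f (𝓝[>] 0) (𝓝 a) →
      Tendsto (fun ε => ((f ε : ℝ) : ℂ)) (𝓝[>] 0) (𝓝 (a : ℂ)) := fun h =>
    (continuous_ofReal.tendsto _).comp h
  unfold regLap
  refine (((Tendsto.mul_const _ (hc ?_)).add (Tendsto.mul_const _ (hc ?_))).add
    (Tendsto.mul_const _ (hc ?_))).add (Tendsto.mul_const _ (hc (hr β)))
  · exact (((hr _).const_mul _).mul_const _).add ((hr _).const_mul _)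
  · exact (hr _).const_mul _
  · exact (hr _).const_mul _

lemma integrable_regLap_bound {k : ℂ → ℂ} (hs : HasCompactSupport k) (b w : ℂ) {β : ℝ}
    (hβ0 : 0 < β) (hβ : β ≤ 1) (C : ℝ) :
    Integrable ((tsupport k).indicator fun x : ℂ =>
      C * ‖x - b‖ ^ (-(2 - 2 * β)) * (|log ‖x - w‖| + (‖x - w‖ ^ 2 + 1))) := by
  rw [integrable_indicator_iff (isClosed_tsupport k).measurableSet]
  obtain ⟨R, hR⟩ := hs.isCompact.isBounded.exists_norm_le
  have hsub : tsupport k ⊆ ball 0 (|R| + 1) := fun x hx => by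
    rw [mem_ball_zero_iff]
    linarith [hR x hx, le_abs_self R]
  have h1 := ((integrableOn_rpow_mul_log (by linarith) (by linarith : 2 - 2 * β < 2) b w 0
    (|R| + 1)).mono_set hsub).const_mul C
  have h2 := IntegrableOn.mul_continuousOn (((integrableOn_norm_sub_rpow
    (by linarith : 2 - 2 * β < 2) b 0 (|R| + 1)).mono_set hsub).const_mul C)
    (by fun_prop : ContinuousOn (fun x : ℂ => ‖x - w‖ ^ 2 + 1) (tsupport k)) hs.isCompact
  refine (h1.add h2).congr (ae_of_all _ fun x => ?_)
  simp only [Pi.add_apply]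
  ring

lemma measurable_regLap (b : ℂ) (β : ℝ) {k : ℂ → ℂ} (hk : ContDiff ℝ ∞ k) (e : ℝ) :
    Measurable (regLap b β k e) := by
  have h1 := hk.continuous.measurable
  have h2 := (contDiff_dzeta hk).continuous.measurable
  have h3 := (contDiff_dzetabar hk).continuous.measurable
  have h4 := (contDiff_dzeta (contDiff_dzetabar hk)).continuous.measurable
  have h5 : Measurable fun x : ℂ => star (x - b) := by fun_prop
  unfold regLap
  fun_prop

lemma integrable_laplacian_rpow_mul (b : ℂ) {β : ℝ} (hβ0 : 0 < β) (hβ : β ≤ 1) {k : ℂ → ℂ}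
    (hk : ContDiff ℝ ∞ k) (hs : HasCompactSupport k) :
    Integrable (dzeta (dzetabar fun y => ((‖y - b‖ ^ (2 * β) : ℝ) : ℂ) * k y)) := by
  obtain ⟨C, hC0, hC⟩ := exists_regLap_bound b hβ0 hβ hk hs
  have h : Integrable (regLap b β k 0) := by
    refine Integrable.mono' (integrable_regLap_bound hs b b hβ0 hβ C)
      (measurable_regLap b β hk 0).aestronglyMeasurable ?_
    filter_upwards [ae_ne_point b] with x hxb
    by_cases hx : x ∈ tsupport k
    · rw [indicator_of_mem hx]
      refine (hC 0 le_rfl zero_le_one x hxb).trans (le_mul_of_one_le_right (by positivity) ?_)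
      have := abs_nonneg (log ‖x - b‖)
      nlinarith [sq_nonneg ‖x - b‖]
    · rw [indicator_of_notMem hx, regLap_eq_zero hx, norm_zero]
  refine h.congr ?_
  filter_upwards [ae_ne_point b] with x hxb
  rw [regLap_zero_eq b β hk hxb]

/-- The logarithmic potential inverts `∂∂̄` on the functions `|ζ-b|^(2β) k`, with `k` smooth and
compactly supported: the fundamental solution identity, with a mild singularity allowed at `b`. -/
theorem integral_laplacian_mul_log (b w : ℂ) {β : ℝ} (hβ0 : 0 < β) (hβ : β ≤ 1) {k : ℂ → ℂ}
    (hk : ContDiff ℝ ∞ k) (hs : HasCompactSupport k) :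
    Integrable (fun x => dzeta (dzetabar fun y => ((‖y - b‖ ^ (2 * β) : ℝ) : ℂ) * k y) x
        * (log ‖w - x‖ : ℂ)) ∧
    ∫ x, dzeta (dzetabar fun y => ((‖y - b‖ ^ (2 * β) : ℝ) : ℂ) * k y) x
        * (log ‖w - x‖ : ℂ)
      = (Real.pi / 2 : ℝ) * (((‖w - b‖ ^ (2 * β) : ℝ) : ℂ) * k w) := by
  obtain ⟨C, hC0, hC⟩ := exists_regLap_bound b hβ0 hβ hk hs
  obtain ⟨M, hM⟩ := exists_reg_bound b hβ0 hk.continuous hs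
  set g : ℂ → ℝ := (tsupport k).indicator fun x : ℂ =>
      C * ‖x - b‖ ^ (-(2 - 2 * β)) * (|log ‖x - w‖| + (‖x - w‖ ^ 2 + 1)) with hg
  have hgi : Integrable g := integrable_regLap_bound hs b w hβ0 hβ C
  have hdom : ∀ e, 0 ≤ e → e ≤ 1 → ∀ x, x ≠ b → x ≠ w →
      ‖regLap b β k e x * ((1 / 2 * log (‖x - w‖ ^ 2 + e) : ℝ) : ℂ)‖ ≤ g x := by
    intro e he he1 x hxb hxw
    have hxw' : 0 < ‖x - w‖ := norm_pos_iff.2 (sub_ne_zero.2 hxw)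
    by_cases hx : x ∈ tsupport k
    · rw [hg, indicator_of_mem hx, norm_mul, norm_real, norm_eq_abs]
      exact mul_le_mul (hC e he he1 x hxb) (abs_regLog_le he he1 hxw') (abs_nonneg _)
        (by positivity)
    · rw [hg, indicator_of_notMem hx, regLap_eq_zero hx, zero_mul, norm_zero]
  have hlogeq : ∀ x : ℂ, (1 / 2 * log (‖x - w‖ ^ 2 + 0) : ℝ) = log ‖w - x‖ := fun x => by
    rw [add_zero, Real.log_pow, norm_sub_rev]; push_cast; ring
  have hmeas : ∀ ε : ℝ, 0 < ε → AEStronglyMeasurable (fun x => regLap b β k (ε ^ 2) x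
      * ((1 / 2 * log (‖x - w‖ ^ 2 + ε ^ 2) : ℝ) : ℂ)) volume := fun ε hε => by
    have h1 : regLap b β k (ε ^ 2)
        = dzeta (dzetabar fun y => (((‖y - b‖ ^ 2 + ε ^ 2) ^ β : ℝ) : ℂ) * k y) := by
      ext x
      exact (dzeta_dzetabar_reg b β (ε ^ 2) x hk.contDiffAt (by positivity)).symm
    have h2 := (contDiff_dzeta (contDiff_dzetabar (contDiff_reg b β (pow_pos hε 2) hk))).continuous
    rw [← h1] at h2
    refine (h2.mul (continuous_ofReal.comp (continuous_const.mul
      (Continuous.log (by fun_prop) fun x => ?_)))).aestronglyMeasurable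
    have : 0 < ‖x - w‖ ^ 2 + ε ^ 2 := by positivity
    exact this.ne'
  have hpt : ∀ᵐ x : ℂ, Tendsto (fun ε : ℝ => regLap b β k (ε ^ 2) x
      * ((1 / 2 * log (‖x - w‖ ^ 2 + ε ^ 2) : ℝ) : ℂ)) (𝓝[>] 0)
      (𝓝 (regLap b β k 0 x * (log ‖w - x‖ : ℂ))) := by
    filter_upwards [ae_ne_point b, ae_ne_point w] with x hxb hxw
    have hxw' : 0 < ‖x - w‖ := norm_pos_iff.2 (sub_ne_zero.2 hxw)
    refine (tendsto_regLap b β k hxb).mul ((continuous_ofReal.tendsto _).comp ?_)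
    rw [← hlogeq x]
    have hq : Tendsto (fun ε : ℝ => ‖x - w‖ ^ 2 + ε ^ 2) (𝓝[>] 0) (𝓝 (‖x - w‖ ^ 2 + 0)) := by
      have : Continuous fun ε : ℝ => ‖x - w‖ ^ 2 + ε ^ 2 := by fun_prop
      have := this.tendsto 0
      rw [zero_pow two_ne_zero] at this
      exact this.mono_left nhdsWithin_le_nhds
    exact (hq.log (by positivity)).const_mul _
  -- both sides of the regularised identity converge as `ε → 0`
  have hlim := tendsto_integral_filter_of_dominated_convergence (l := 𝓝[>] (0 : ℝ))
    (μ := volume) (F := fun ε x => regLap b β k (ε ^ 2) x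
      * ((1 / 2 * log (‖x - w‖ ^ 2 + ε ^ 2) : ℝ) : ℂ))
    (f := fun x => regLap b β k 0 x * (log ‖w - x‖ : ℂ)) g
    (by filter_upwards [self_mem_nhdsWithin] with ε hε using hmeas ε hε)
    (by
      filter_upwards [Ioc_mem_nhdsGT (zero_lt_one' ℝ)] with ε hε
      filter_upwards [ae_ne_point b, ae_ne_point w] with x hxb hxw
      exact hdom _ (sq_nonneg _) (pow_le_one₀ hε.1.le hε.2) x hxb hxw) hgi hpt
  have hae : (fun x => dzeta (dzetabar fun y => ((‖y - b‖ ^ (2 * β) : ℝ) : ℂ) * k y) x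
      * (log ‖w - x‖ : ℂ)) =ᵐ[volume] fun x => regLap b β k 0 x * (log ‖w - x‖ : ℂ) := by
    filter_upwards [ae_ne_point b] with x hxb
    rw [regLap_zero_eq b β hk hxb]
  have hVc : Continuous fun p : ℝ × ℂ => (((‖p.2 - b‖ ^ 2 + p.1 ^ 2) ^ β : ℝ) : ℂ) * k p.2 := by
    refine Continuous.mul (continuous_ofReal.comp ?_) (hk.continuous.comp continuous_snd)
    exact Continuous.rpow_const (by fun_prop) fun _ => Or.inr hβ0.le
  have hlim2 := tendsto_integral_cauchy_kernel (V := fun ε x =>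
    (((‖x - b‖ ^ 2 + ε ^ 2) ^ β : ℝ) : ℂ) * k x) hVc hM w
  constructor
  · refine Integrable.congr (Integrable.mono' hgi ((measurable_regLap b β hk 0).mul
      (by fun_prop)).aestronglyMeasurable ?_) hae.symm
    filter_upwards [ae_ne_point b, ae_ne_point w] with x hxb hxw
    have := hdom 0 le_rfl zero_le_one x hxb hxw
    rwa [hlogeq x] at this
  · rw [integral_congr_ae hae]
    refine tendsto_nhds_unique hlim ?_
    have h0 : (((‖w - b‖ ^ (2 * β) : ℝ) : ℂ) * k w)
        = (((‖w - b‖ ^ 2 + 0 ^ 2) ^ β : ℝ) : ℂ) * k w := by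
      rw [zero_pow two_ne_zero, add_zero, rpow_mul (norm_nonneg _)]
      norm_num
    rw [h0]
    refine hlim2.congr' ?_
    filter_upwards [self_mem_nhdsWithin] with ε hε
    exact (integral_regLap_mul_regLog b w β hk hs (pow_pos hε 2)).symm

/-! ### Logarithmic potentials -/

/-- A holomorphic solution of the Euler-type equation `β K + (ζ - p) K' = H`, namely
`K(ζ) = ∫₀¹ s^(β-1) H(p + s (ζ - p)) ds`; then `(ζ - p)^β K` is a primitive of `(ζ - p)^(β-1) H`. -/
lemma exists_holomorphic_primitive {p : ℂ} {R β : ℝ} (hβ : 0 < β) {H : ℂ → ℂ}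
    (hH : DifferentiableOn ℂ H (ball p R)) :
    ∃ K : ℂ → ℂ, DifferentiableOn ℂ K (ball p R) ∧
      ∀ ζ ∈ ball p R, β * K ζ + (ζ - p) * deriv K ζ = H ζ := by
  have hHd : DifferentiableOn ℂ (deriv H) (ball p R) := hH.deriv isOpen_ball
  have hmem : ∀ ζ ∈ ball p R, ∀ s ∈ Icc (0 : ℝ) 1, p + s * (ζ - p) ∈ ball p R := by
    intro ζ hζ s hs
    rw [mem_ball_iff_norm] at hζ ⊢
    rw [add_sub_cancel_left, norm_mul, norm_real, norm_of_nonneg hs.1]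
    nlinarith [norm_nonneg (ζ - p), hs.2]
  have hline : ∀ ζ : ℂ, Continuous fun s : ℝ => p + s * (ζ - p) := fun ζ => by fun_prop
  have hcont : ∀ {G : ℂ → ℂ}, DifferentiableOn ℂ G (ball p R) → ∀ ζ ∈ ball p R,
      ContinuousOn (fun s : ℝ => G (p + s * (ζ - p))) (Icc 0 1) := fun hG ζ hζ =>
    hG.continuousOn.comp (hline ζ).continuousOn fun s hs => hmem ζ hζ s hs
  have hint : ∀ {G : ℂ → ℂ}, DifferentiableOn ℂ G (ball p R) → ∀ ζ ∈ ball p R,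
      ∀ q : ℝ, -1 < q →
      IntervalIntegrable (fun s : ℝ => ((s ^ q : ℝ) : ℂ) * G (p + s * (ζ - p))) volume 0 1 := by
    intro G hG ζ hζ q hq
    have hr : IntervalIntegrable (fun s : ℝ => ((s ^ q : ℝ) : ℂ)) volume 0 1 := by
      have h := intervalIntegral.intervalIntegrable_rpow' (a := 0) (b := 1) hq
      rw [intervalIntegrable_iff] at h ⊢
      exact h.ofReal
    refine IntervalIntegrable.mul_continuousOn hr ?_
    rw [uIcc_of_le zero_le_one]
    exact hcont hG ζ hζ
  set K : ℂ → ℂ := fun ζ => ∫ s in (0 : ℝ)..1, ((s ^ (β - 1) : ℝ) : ℂ) * H (p + s * (ζ - p))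
  -- differentiation under the integral sign
  have hK : ∀ ζ ∈ ball p R, HasDerivAt K
      (∫ s in (0 : ℝ)..1, ((s ^ β : ℝ) : ℂ) * deriv H (p + s * (ζ - p))) ζ := by
    intro ζ hζ
    have hζ' := mem_ball_iff_norm.1 hζ
    set r := (R + ‖ζ - p‖) / 2
    have hr1 : ‖ζ - p‖ < r := by simp only [r]; linarith
    have hr2 : r < R := by simp only [r]; linarith
    have hcl : Metric.closedBall p r ⊆ ball p R := Metric.closedBall_subset_ball hr2
    obtain ⟨M, hM⟩ := (isCompact_closedBall p r).exists_bound_of_continuousOn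
      (hHd.continuousOn.mono hcl)
    have hin : ∀ ξ ∈ ball p r, ∀ s ∈ Icc (0 : ℝ) 1,
        p + s * (ξ - p) ∈ Metric.closedBall p r := by
      intro ξ hξ s hs
      rw [mem_ball_iff_norm] at hξ
      rw [mem_closedBall_iff_norm, add_sub_cancel_left, norm_mul, norm_real,
        norm_of_nonneg hs.1]
      nlinarith [norm_nonneg (ξ - p), hs.2]
    have hb : ball p r ⊆ ball p R := ball_subset_ball hr2.le
    refine (intervalIntegral.hasDerivAt_integral_of_dominated_loc_of_deriv_le
      (F := fun ζ (s : ℝ) => ((s ^ (β - 1) : ℝ) : ℂ) * H (p + s * (ζ - p)))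
      (F' := fun ζ (s : ℝ) => ((s ^ β : ℝ) : ℂ) * deriv H (p + s * (ζ - p)))
      (bound := fun _ => M)
      (isOpen_ball.mem_nhds (mem_ball_iff_norm.2 hr1)) ?_ ?_ ?_ ?_ ?_ ?_).2
    · filter_upwards [isOpen_ball.mem_nhds hζ] with ξ hξ
      exact (intervalIntegrable_iff.1 (hint hH ξ hξ (β - 1) (by linarith))).aestronglyMeasurable
    · exact hint hH ζ hζ _ (by linarith)
    · exact (intervalIntegrable_iff.1 (hint hHd ζ hζ β (by linarith))).aestronglyMeasurable
    · refine ae_of_all _ fun s hs ξ hξ => ?_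
      rw [uIoc_of_le zero_le_one] at hs
      have h1 : s ^ β ≤ 1 := rpow_le_one hs.1.le hs.2 hβ.le
      have h2 : 0 < s ^ β := rpow_pos_of_pos hs.1 β
      have h3 := hM _ (hin ξ hξ s ⟨hs.1.le, hs.2⟩)
      rw [norm_mul, norm_real, norm_of_nonneg h2.le]
      nlinarith [norm_nonneg (deriv H (p + s * (ξ - p)))]
    · exact intervalIntegrable_const
    · refine ae_of_all _ fun s hs ξ hξ => ?_
      rw [uIoc_of_le zero_le_one] at hs
      have h1 : HasDerivAt H (deriv H (p + s * (ξ - p))) (p + s * (ξ - p)) :=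
        (hH.differentiableAt (isOpen_ball.mem_nhds
          (hcl (hin ξ hξ s ⟨hs.1.le, hs.2⟩)))).hasDerivAt
      have h2 : HasDerivAt (fun ξ : ℂ => p + s * (ξ - p)) s ξ := by
        simpa using (((hasDerivAt_id ξ).sub_const p).const_mul (s : ℂ)).const_add p
      refine ((h1.comp ξ h2).const_mul _).congr_deriv ?_
      have h3 : s ^ β = s ^ (β - 1) * s := by
        rw [← rpow_add_one hs.1.ne']; congr 1; ring
      rw [h3]; push_cast; ring
  refine ⟨K, fun ζ hζ => (hK ζ hζ).differentiableAt.differentiableWithinAt, fun ζ hζ => ?_⟩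
  rw [(hK ζ hζ).deriv]
  -- the left-hand side is the integral of the derivative of `s ↦ s^β H(p + s (ζ - p))`
  have hder : ∀ s ∈ Ioo (0 : ℝ) 1, HasDerivAt (fun s : ℝ => ((s ^ β : ℝ) : ℂ) * H (p + s * (ζ - p)))
      (β * (((s ^ (β - 1) : ℝ) : ℂ) * H (p + s * (ζ - p)))
        + (ζ - p) * (((s ^ β : ℝ) : ℂ) * deriv H (p + s * (ζ - p)))) s := by
    intro s hs
    have h1 : HasDerivAt H (deriv H (p + s * (ζ - p))) (p + s * (ζ - p)) :=
      (hH.differentiableAt (isOpen_ball.mem_nhds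
        (hmem ζ hζ s ⟨hs.1.le, hs.2.le⟩))).hasDerivAt
    have h2 : HasDerivAt (fun s : ℝ => p + s * (ζ - p)) (ζ - p) s := by
      simpa using ((ofRealCLM.hasDerivAt (x := s)).mul_const (ζ - p)).const_add p
    have h3 := (Real.hasDerivAt_rpow_const (p := β) (Or.inl hs.1.ne')).ofReal_comp
    refine (h3.mul (h1.comp s h2)).congr_deriv ?_
    push_cast
    simp only [Function.comp]
    ring
  have hF := intervalIntegral.integral_eq_sub_of_hasDerivAt_of_le zero_le_one
    ((continuous_ofReal.comp (Real.continuous_rpow_const hβ.le)).continuousOn.mul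
      (hcont hH ζ hζ)) hder
    (((hint hH ζ hζ _ (by linarith)).const_mul _).add
      ((hint hHd ζ hζ _ (by linarith)).const_mul _))
  rw [intervalIntegral.integral_add ((hint hH ζ hζ _ (by linarith)).const_mul _)
      ((hint hHd ζ hζ _ (by linarith)).const_mul _),
    intervalIntegral.integral_const_mul, intervalIntegral.integral_const_mul] at hF
  rw [hF]
  simp [zero_rpow hβ.ne']

/-- If `β K + (ζ - p) K' = H` then `∂∂̄ (|ζ-p|^(2β) |K|²) = |ζ-p|^(2β-2) |H|²`. -/
lemma laplacian_rpow_mul_normSq {p : ℂ} {R β : ℝ} {H K : ℂ → ℂ}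
    (hK : DifferentiableOn ℂ K (ball p R))
    (hKH : ∀ ζ ∈ ball p R, β * K ζ + (ζ - p) * deriv K ζ = H ζ) {ζ : ℂ}
    (hζ : ζ ∈ ball p R) (hζp : ζ ≠ p) :
    dzeta (dzetabar fun y => ((‖y - p‖ ^ (2 * β) : ℝ) : ℂ) * (K y * star (K y))) ζ
      = ((‖ζ - p‖ ^ (2 * β - 2) * ‖H ζ‖ ^ 2 : ℝ) : ℂ) := by
  have hs : 0 < ‖ζ - p‖ := norm_pos_iff.2 (sub_ne_zero.2 hζp)
  have hKc : ContDiffOn ℂ ∞ K (ball p R) := hK.contDiffOn isOpen_ball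
  have hKr : ∀ y ∈ ball p R, ContDiffAt ℝ ∞ K y := fun y hy =>
    (hKc.contDiffAt (isOpen_ball.mem_nhds hy)).restrict_scalars ℝ
  have hk : ContDiffAt ℝ ∞ (fun y => K y * star (K y)) ζ :=
    (hKr ζ hζ).mul (conjCLE.contDiff.contDiffAt.comp ζ (hKr ζ hζ))
  have hd : ∀ y ∈ ball p R, HasDerivAt K (deriv K y) y := fun y hy =>
    (hK.differentiableAt (isOpen_ball.mem_nhds hy)).hasDerivAt
  have hd' : HasDerivAt (deriv K) (deriv (deriv K) ζ) ζ :=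
    ((hK.deriv isOpen_ball).differentiableAt
      (isOpen_ball.mem_nhds hζ)).hasDerivAt
  have hw : ∀ y ∈ ball p R, HasFDerivAt (fun y => K y * star (K y))
      (wirt (star (K y) * deriv K y) (K y * star (deriv K y))) y := fun y hy =>
    (hasFDerivAt_wirt_mul (hasFDerivAt_holo (hd y hy)) (hasFDerivAt_antiholo (hd y hy))).congr_fderiv
      (wirt_congr (by ring) (by ring))
  have hev : dzetabar (fun y => K y * star (K y)) =ᶠ[𝓝 ζ] fun y => K y * star (deriv K y) := by
    filter_upwards [isOpen_ball.mem_nhds hζ] with y hy using dzetabar_eq (hw y hy)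
  have h2 := hasFDerivAt_wirt_mul (hasFDerivAt_holo (hd ζ hζ)) (hasFDerivAt_antiholo hd')
  have hreg := dzeta_dzetabar_reg p β 0 ζ hk (by positivity)
  have hfun : (fun y => ((‖y - p‖ ^ (2 * β) : ℝ) : ℂ) * (K y * star (K y)))
      = fun y => (((‖y - p‖ ^ 2 + 0) ^ β : ℝ) : ℂ) * (K y * star (K y)) := by
    ext y
    rw [add_zero, rpow_mul (norm_nonneg _)]
    norm_num
  rw [hfun, hreg, regLap, dzeta_congr hev, dzeta_eq h2, dzeta_eq (hw ζ hζ), dzetabar_eq (hw ζ hζ),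
    ← hKH ζ hζ, add_zero]
  set q := ‖ζ - p‖ ^ 2 with hq
  have hq0 : 0 < q := by positivity
  have e1 : q ^ (β - 2) * q = q ^ (β - 1) := by
    rw [← rpow_add_one hq0.ne']; congr 1; ring
  have e2 : q ^ β = q ^ (β - 1) * q := by
    rw [← rpow_add_one hq0.ne']; congr 1; ring
  have e3 : ‖ζ - p‖ ^ (2 * β - 2) = q ^ (β - 1) := by
    rw [hq, ← rpow_natCast, ← rpow_mul hs.le]; congr 1; push_cast; ring
  have e4 : ((q : ℝ) : ℂ) = (ζ - p) * star (ζ - p) := by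
    rw [star_def, mul_conj, Complex.normSq_eq_norm_sq]
  have e5 : ((‖β * K ζ + (ζ - p) * deriv K ζ‖ ^ 2 : ℝ) : ℂ)
      = (β * K ζ + (ζ - p) * deriv K ζ) * star (β * K ζ + (ζ - p) * deriv K ζ) := by
    rw [star_def, mul_conj, Complex.normSq_eq_norm_sq]
  have e6 : ((q ^ (β - 1) * ‖β * K ζ + (ζ - p) * deriv K ζ‖ ^ 2 : ℝ) : ℂ)
      = ((q ^ (β - 1) : ℝ) : ℂ)
        * ((β * K ζ + (ζ - p) * deriv K ζ) * star (β * K ζ + (ζ - p) * deriv K ζ)) := by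
    rw [Complex.ofReal_mul, e5]
  rw [mul_assoc (β * (β - 1)), e1, e3, e2, e6]
  clear_value q
  push_cast
  rw [e4]
  simp only [star_add, star_mul', star_def, Complex.conj_ofReal]
  ring

lemma norm_wirt_le (p q : ℂ) : ‖wirt p q‖ ≤ ‖p‖ + ‖q‖ := by
  refine ContinuousLinearMap.opNorm_le_bound _ (by positivity) fun v => ?_
  rw [wirt_apply]
  refine (norm_add_le _ _).trans ?_
  rw [norm_mul, norm_mul, norm_star, add_mul]

lemma hasFDerivAt_log_norm (x w : ℂ) (h : w ≠ x) :
    HasFDerivAt (fun w : ℂ => (log ‖w - x‖ : ℂ))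
      (wirt ((1 / 2) * (w - x)⁻¹) ((1 / 2) * star (w - x)⁻¹)) w := by
  have h0 : 0 < ‖w - x‖ := norm_pos_iff.2 (sub_ne_zero.2 h)
  have hne : w - x ≠ 0 := sub_ne_zero.2 h
  have h1 := hasFDerivAt_ofReal_comp (hasFDerivAt_normSq_sub x 0 w)
    (ρ := fun t => 1 / 2 * log t)
    ((Real.hasDerivAt_log (by positivity)).const_mul (1 / 2))
  have h2 : (fun w : ℂ => (log ‖w - x‖ : ℂ))
      = fun y => ((1 / 2 * log (‖y - x‖ ^ 2 + 0) : ℝ) : ℂ) := by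
    ext y; rw [add_zero, Real.log_pow]; push_cast; ring
  rw [h2]
  refine h1.congr_fderiv ?_
  rw [wirt_smul]
  have h3 : ((‖w - x‖ ^ 2 + 0 : ℝ) : ℂ) = (w - x) * star (w - x) := by
    rw [star_def, mul_conj, Complex.normSq_eq_norm_sq, add_zero]
  have h4 : star (w - x) ≠ 0 := star_ne_zero.2 hne
  apply wirt_congr
  · rw [Complex.ofReal_mul, Complex.ofReal_inv, h3]; push_cast; field_simp
  · rw [Complex.ofReal_mul, Complex.ofReal_inv, h3, star_inv₀]; push_cast; field_simp

/-- The logarithmic potential of a density is smooth, with vanishing `∂∂̄`, wherever the density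
vanishes. -/
lemma logPotential_harmonic {g : ℂ → ℂ} {p : ℂ} {δ : ℝ}
    (hg : Integrable g) (hgl : ∀ w, Integrable fun x => g x * (log ‖w - x‖ : ℂ))
    (hg0 : ∀ᵐ x, x ∈ ball p δ → g x = 0) :
    ContDiffOn ℝ ∞ (fun w => ∫ x, g x * (log ‖w - x‖ : ℂ)) (ball p δ) ∧
    ∀ w ∈ ball p δ, dzeta (dzetabar fun w => ∫ x, g x * (log ‖w - x‖ : ℂ)) w = 0 := by
  -- the two Wirtinger derivatives are Cauchy transforms
  set G : ℂ → ℂ := fun w => ∫ x, (1 / 2) * (g x * (w - x)⁻¹) with hG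
  set G' : ℂ → ℂ := fun w => ∫ x, (1 / 2) * (star (g x) * (w - x)⁻¹) with hG'
  have hfar : ∀ w₀ ∈ ball p δ, ∃ r > 0, ball w₀ r ⊆ ball p δ ∧
      ∀ w ∈ ball w₀ r, ∀ x ∉ ball p δ, r ≤ ‖w - x‖ := by
    intro w₀ hw₀
    rw [mem_ball_iff_norm] at hw₀
    refine ⟨(δ - ‖w₀ - p‖) / 2, by linarith, fun y hy => ?_, fun w hw x hx => ?_⟩
    · rw [mem_ball_iff_norm] at hy ⊢
      calc ‖y - p‖ = ‖(y - w₀) + (w₀ - p)‖ := by ring_nf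
        _ ≤ ‖y - w₀‖ + ‖w₀ - p‖ := norm_add_le _ _
        _ < δ := by linarith
    · rw [mem_ball_iff_norm] at hw hx
      push Not at hx
      have : ‖x - p‖ ≤ ‖w - x‖ + ‖w - w₀‖ + ‖w₀ - p‖ := by
        calc ‖x - p‖ = ‖(x - w) + (w - w₀) + (w₀ - p)‖ := by ring_nf
          _ ≤ ‖x - w‖ + ‖w - w₀‖ + ‖w₀ - p‖ := norm_add₃_le
          _ = _ := by rw [norm_sub_rev x w]
      linarith
  have hbd : ∀ {r : ℝ} {w x : ℂ}, 0 < r → r ≤ ‖w - x‖ → ‖(w - x)⁻¹‖ ≤ r⁻¹ := fun hr h => by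
    rw [norm_inv]; gcongr
  have hkm : ∀ w : ℂ, Measurable fun x : ℂ => (w - x)⁻¹ := fun w => by fun_prop
  -- Cauchy transforms of densities vanishing on the ball are holomorphic there
  have hholo : ∀ f : ℂ → ℂ, Integrable f → (∀ᵐ x, x ∈ ball p δ → f x = 0) →
      DifferentiableOn ℂ (fun w => ∫ x, (1 / 2) * (f x * (w - x)⁻¹)) (ball p δ) := by
    intro f hf hf0 w₀ hw₀
    obtain ⟨r, hr, hsub, hrb⟩ := hfar w₀ hw₀
    refine (hasDerivAt_integral_of_dominated_loc_of_deriv_le (μ := volume)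
      (F := fun w x => (1 / 2) * (f x * (w - x)⁻¹))
      (F' := fun w x => (1 / 2) * (f x * (-1 / (w - x) ^ 2)))
      (bound := fun x => (r⁻¹) ^ 2 * ‖f x‖) (ball_mem_nhds w₀ hr) ?_ ?_ ?_ ?_ ?_
      ?_).2.differentiableAt.differentiableWithinAt
    · exact Eventually.of_forall fun w =>
        (hf.aestronglyMeasurable.mul (hkm w).aestronglyMeasurable).const_mul _
    · refine Integrable.const_mul ?_ _
      refine Integrable.mono' (hf.norm.const_mul r⁻¹)
        (hf.aestronglyMeasurable.mul (hkm _).aestronglyMeasurable) ?_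
      filter_upwards [hf0] with x hx
      by_cases hxb : x ∈ ball p δ
      · rw [hx hxb]; simp
      · rw [norm_mul, mul_comm]
        have := hbd hr (hrb w₀ (mem_ball_self hr) x hxb)
        gcongr
    · exact (hf.aestronglyMeasurable.mul (by fun_prop : Measurable fun x : ℂ =>
        (-1 / (w₀ - x) ^ 2)).aestronglyMeasurable).const_mul _
    · filter_upwards [hf0] with x hx w hw
      by_cases hxb : x ∈ ball p δ
      · rw [hx hxb]; simp
      · have h1 := hbd hr (hrb w hw x hxb)
        have h2 : ‖(-1 / (w - x) ^ 2 : ℂ)‖ ≤ (r⁻¹) ^ 2 := by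
          rw [norm_div, norm_neg, norm_one, norm_pow, one_div, ← inv_pow, ← norm_inv]
          gcongr
        rw [norm_mul, norm_mul]
        have h3 : ‖(1 / 2 : ℂ)‖ ≤ 1 := by norm_num
        calc ‖(1 / 2 : ℂ)‖ * (‖f x‖ * ‖(-1 / (w - x) ^ 2 : ℂ)‖) ≤ 1 * (‖f x‖ * (r⁻¹) ^ 2) := by
              gcongr
          _ = _ := by ring
    · exact hf.norm.const_mul _
    · filter_upwards [hf0] with x hx w hw
      by_cases hxb : x ∈ ball p δ
      · simp only [hx hxb, zero_mul, mul_zero]; exact hasDerivAt_const _ _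
      · have hne : w - x ≠ 0 := norm_pos_iff.1 (hr.trans_le (hrb w hw x hxb))
        exact ((((hasDerivAt_id w).sub_const x).fun_inv hne).const_mul (f x)).const_mul (1 / 2)
  have hg0' : ∀ᵐ x, x ∈ ball p δ → star (g x) = 0 := by
    filter_upwards [hg0] with x hx h
    rw [hx h, star_zero]
  have hgs : Integrable fun x => star (g x) := conjCLE.toContinuousLinearMap.integrable_comp hg
  have hGd := hholo g hg hg0
  have hGd' := hholo _ hgs hg0'
  -- differentiation of the potential under the integral sign
  have hder : ∀ w₀ ∈ ball p δ, HasFDerivAt (fun w => ∫ x, g x * (log ‖w - x‖ : ℂ))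
      (wirt (G w₀) (star (G' w₀))) w₀ := by
    intro w₀ hw₀
    obtain ⟨r, hr, hsub, hrb⟩ := hfar w₀ hw₀
    set F' : ℂ → ℂ → ℂ →L[ℝ] ℂ := fun w x =>
      wirt ((1 / 2) * (g x * (w - x)⁻¹)) ((1 / 2) * (g x * star (w - x)⁻¹)) with hF'
    have hm1 : ∀ w : ℂ, AEStronglyMeasurable (fun x => (1 / 2) * (g x * (w - x)⁻¹)) volume := fun w =>
      (hg.aestronglyMeasurable.mul (hkm w).aestronglyMeasurable).const_mul _
    have hm2 : ∀ w : ℂ, AEStronglyMeasurable (fun x => (1 / 2) * (g x * star (w - x)⁻¹)) volume :=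
      fun w => (hg.aestronglyMeasurable.mul
        (by fun_prop : Measurable fun x : ℂ => star (w - x)⁻¹).aestronglyMeasurable).const_mul _
    have hF'm : AEStronglyMeasurable (F' w₀) volume := by
      have : F' w₀ = fun x => ((1 / 2) * (g x * (w₀ - x)⁻¹)) • (wirt 1 0)
          + ((1 / 2) * (g x * star (w₀ - x)⁻¹)) • wirt 0 1 := by
        ext x
        rw [hF']
        simp
      rw [this]
      exact ((hm1 w₀).smul aestronglyMeasurable_const).add
        ((hm2 w₀).smul aestronglyMeasurable_const)
    have hF'b : ∀ᵐ x, ∀ w ∈ ball w₀ r, ‖F' w x‖ ≤ r⁻¹ * ‖g x‖ := by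
      filter_upwards [hg0] with x hx w hw
      refine (norm_wirt_le _ _).trans ?_
      by_cases hxb : x ∈ ball p δ
      · rw [hx hxb]; simp
      · have h1 := hbd hr (hrb w hw x hxb)
        rw [norm_mul, norm_mul, norm_mul, norm_mul, norm_star]
        have h3 : ‖(1 / 2 : ℂ)‖ = 1 / 2 := by norm_num
        rw [h3]
        nlinarith [norm_nonneg (g x), norm_nonneg (w - x)⁻¹]
    have key := hasFDerivAt_integral_of_dominated_of_fderiv_le (μ := volume) (𝕜 := ℝ)
      (F := fun w x => g x * (log ‖w - x‖ : ℂ)) (F' := F')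
      (bound := fun x => r⁻¹ * ‖g x‖) (ball_mem_nhds w₀ hr)
      (Eventually.of_forall fun w => (hgl w).aestronglyMeasurable) (hgl w₀) hF'm hF'b
      (hg.norm.const_mul _) (by
        filter_upwards [hg0] with x hx w hw
        by_cases hxb : x ∈ ball p δ
        · simp only [hF', hx hxb, zero_mul, mul_zero]
          refine (hasFDerivAt_const _ _).congr_fderiv ?_
          ext v; simp
        · have hne : w ≠ x := fun h => by
            have := hrb w hw x hxb
            rw [h, sub_self, norm_zero] at this
            linarith
          refine ((hasFDerivAt_log_norm x w hne).const_mul (g x)).congr_fderiv ?_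
          rw [wirt_smul]
          exact wirt_congr (by ring) (by ring))
    have hF'i : Integrable (F' w₀) := Integrable.mono' (hg.norm.const_mul r⁻¹) hF'm (by
      filter_upwards [hF'b] with x hx using hx w₀ (mem_ball_self hr))
    refine key.congr_fderiv ?_
    have hi : ∀ k : ℂ → ℂ, (∀ x, ‖k x‖ = ‖(w₀ - x)⁻¹‖) →
        AEStronglyMeasurable (fun x => (1 / 2) * (g x * k x)) volume →
        Integrable fun x => (1 / 2) * (g x * k x) := fun k hk hm => by
      refine Integrable.mono' (hg.norm.const_mul r⁻¹) hm ?_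
      filter_upwards [hg0] with x hx
      by_cases hxb : x ∈ ball p δ
      · rw [hx hxb]; simp
      · have h1 := hbd hr (hrb w₀ (mem_ball_self hr) x hxb)
        rw [norm_mul, norm_mul, hk, show ‖(1 / 2 : ℂ)‖ = 1 / 2 by norm_num]
        nlinarith [norm_nonneg (g x), norm_nonneg (w₀ - x)⁻¹]
    have hi1 := hi _ (fun _ => rfl) (hm1 w₀)
    have hi2 := hi _ (fun _ => norm_star _) (hm2 w₀)
    ext v
    rw [ContinuousLinearMap.integral_apply hF'i, wirt_apply]
    simp only [hF', wirt_apply]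
    rw [integral_add (hi1.mul_const v) (hi2.mul_const _), integral_mul_const, integral_mul_const]
    congr 2
    have := (integral_conj (f := fun x => (1 / 2 : ℂ) * (star (g x) * (w₀ - x)⁻¹)) (μ := volume))
    simp only [hG']
    rw [star_def] at this ⊢
    rw [← this]
    refine integral_congr_ae (ae_of_all _ fun x => ?_)
    have h2 : (starRingEnd ℂ) 2 = 2 := map_ofNat _ 2
    simp [h2]
  constructor
  · have hsm : ContDiffOn ℝ ∞ (fun w => wirt (G w) (star (G' w))) (ball p δ) := by
      have h1 : ContDiffOn ℝ ∞ G (ball p δ) :=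
        (hGd.contDiffOn isOpen_ball).restrict_scalars ℝ
      have h2 : ContDiffOn ℝ ∞ G' (ball p δ) :=
        (hGd'.contDiffOn isOpen_ball).restrict_scalars ℝ
      unfold wirt
      exact (h1.smul contDiffOn_const).add
        ((conjCLE.contDiff.comp_contDiffOn h2).smul contDiffOn_const)
    refine (contDiffOn_infty_iff_fderiv_of_isOpen isOpen_ball).2
      ⟨fun w hw => (hder w hw).differentiableAt.differentiableWithinAt, hsm.congr fun w hw =>
        (hder w hw).fderiv⟩
  · intro w hw
    have hev : dzetabar (fun w => ∫ x, g x * (log ‖w - x‖ : ℂ)) =ᶠ[𝓝 w]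
        fun w => star (G' w) := by
      filter_upwards [isOpen_ball.mem_nhds hw] with y hy using dzetabar_eq (hder y hy)
    rw [dzeta_congr hev]
    exact dzeta_eq (hasFDerivAt_antiholo (hGd'.differentiableAt
      (isOpen_ball.mem_nhds hw)).hasDerivAt)

/-- Local form of the logarithmic potential of a density which, near `p`, is
`∂∂̄ (|ζ-p|^(2β) k - |ζ|^(2γ))` with `k` smooth: up to a smooth function with vanishing `∂∂̄`, the
potential is `(π/2) (|ζ-p|^(2β) k - |ζ|^(2γ))`. -/
lemma logPotential_local {h : ℂ → ℂ} (hi : Integrable h)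
    (hl : ∀ w, Integrable fun x => h x * (log ‖w - x‖ : ℂ)) {p : ℂ} {δ β γ : ℝ} (hδ : 0 < δ)
    (hβ0 : 0 < β) (hβ : β ≤ 1) (hγ0 : 0 < γ) (hγ : γ ≤ 1) {k : ℂ → ℂ}
    (hk : ContDiffOn ℝ ∞ k (ball p δ))
    (hh : ∀ᵐ x, x ∈ ball p δ →
      h x = dzeta (dzetabar fun y => ((‖y - p‖ ^ (2 * β) : ℝ) : ℂ) * k y) x
        - dzeta (dzetabar fun y => ((‖y - 0‖ ^ (2 * γ) : ℝ) : ℂ) * 1) x) :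
    ∃ N : ℂ → ℂ, ∃ δ' > 0, δ' ≤ δ ∧ ContDiffOn ℝ ∞ N (ball p δ') ∧
      (∀ w ∈ ball p δ', dzeta (dzetabar N) w = 0) ∧
      ∀ w ∈ ball p δ', ∫ x, h x * (log ‖w - x‖ : ℂ)
        = (Real.pi / 2 : ℝ) * (((‖w - p‖ ^ (2 * β) : ℝ) : ℂ) * k w
          - ((‖w - 0‖ ^ (2 * γ) : ℝ) : ℂ) * 1) + N w := by
  -- `L1`, `L0` are the Laplacians of the truncated functions; they account for `h` near `p`, and the
  -- potential of what remains is harmonic there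
  set χ : ContDiffBump p := ⟨δ / 3, 2 * δ / 3, by positivity, by linarith⟩ with hχ
  set c : ℂ → ℂ := fun y => (χ y : ℂ) with hc
  have hcs : ContDiff ℝ ∞ c := ofRealCLM.contDiff.comp χ.contDiff
  have htc : tsupport c ⊆ Metric.closedBall p (2 * δ / 3) := by
    refine closure_minimal (fun x hx => ?_) Metric.isClosed_closedBall
    by_contra h'
    refine hx ?_
    have : χ x = 0 := χ.zero_of_le_dist (by
      rw [Metric.mem_closedBall] at h'
      push Not at h'
      exact h'.le)
    simp [hc, this]
  have hccs : HasCompactSupport c :=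
    HasCompactSupport.of_support_subset_isCompact (isCompact_closedBall p (2 * δ / 3))
      ((subset_tsupport c).trans htc)
  have hkc : ContDiff ℝ ∞ fun y => c y * k y := by
    refine contDiff_iff_contDiffAt.2 fun x => ?_
    by_cases hx : x ∈ tsupport c
    swap
    · refine contDiffAt_const (c := (0 : ℂ)) |>.congr_of_eventuallyEq ?_
      filter_upwards [notMem_tsupport_iff_eventuallyEq.1 hx] with y hy
      simp [hy]
    have hx' : x ∈ ball p δ := Metric.closedBall_subset_ball (by linarith) (htc hx)
    exact hcs.contDiffAt.mul (hk.contDiffAt (isOpen_ball.mem_nhds hx'))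
  have hkcs : HasCompactSupport fun y => c y * k y := hccs.mul_right
  set L1 : ℂ → ℂ := dzeta (dzetabar fun y => ((‖y - p‖ ^ (2 * β) : ℝ) : ℂ) * (c y * k y))
  set L0 : ℂ → ℂ := dzeta (dzetabar fun y => ((‖y - 0‖ ^ (2 * γ) : ℝ) : ℂ) * c y)
  have hone : ∀ x ∈ ball p (δ / 3), ∀ᶠ y in 𝓝 x, c y = 1 := by
    intro x hx
    filter_upwards [isOpen_ball.mem_nhds hx] with y hy
    simp [hc, χ.one_of_mem_closedBall (Metric.ball_subset_closedBall hy)]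
  have hg0 : ∀ᵐ x, x ∈ ball p (δ / 3) → h x - L1 x + L0 x = 0 := by
    filter_upwards [hh] with x hx hxb
    rw [hx (ball_subset_ball (by linarith) hxb)]
    have e1 : L1 x = dzeta (dzetabar fun y => ((‖y - p‖ ^ (2 * β) : ℝ) : ℂ) * k y) x := by
      refine dzeta_congr (dzetabar_eventuallyEq ?_)
      filter_upwards [hone x hxb] with y hy
      rw [hy, one_mul]
    have e0 : L0 x = dzeta (dzetabar fun y => ((‖y - 0‖ ^ (2 * γ) : ℝ) : ℂ) * 1) x := by
      refine dzeta_congr (dzetabar_eventuallyEq ?_)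
      filter_upwards [hone x hxb] with y hy
      rw [hy]
    rw [e1, e0]; ring
  have i1 : Integrable L1 := integrable_laplacian_rpow_mul p hβ0 hβ hkc hkcs
  have i0 : Integrable L0 := integrable_laplacian_rpow_mul 0 hγ0 hγ hcs hccs
  have f1 : ∀ w, Integrable (fun x => L1 x * (log ‖w - x‖ : ℂ)) ∧
      ∫ x, L1 x * (log ‖w - x‖ : ℂ)
        = (Real.pi / 2 : ℝ) * (((‖w - p‖ ^ (2 * β) : ℝ) : ℂ) * (c w * k w)) :=
    fun w => integral_laplacian_mul_log p w hβ0 hβ hkc hkcs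
  have f0 : ∀ w, Integrable (fun x => L0 x * (log ‖w - x‖ : ℂ)) ∧
      ∫ x, L0 x * (log ‖w - x‖ : ℂ)
        = (Real.pi / 2 : ℝ) * (((‖w - 0‖ ^ (2 * γ) : ℝ) : ℂ) * c w) :=
    fun w => integral_laplacian_mul_log 0 w hγ0 hγ hcs hccs
  have hsplit : ∀ w x, (h x - L1 x + L0 x) * (log ‖w - x‖ : ℂ)
      = h x * (log ‖w - x‖ : ℂ) - L1 x * (log ‖w - x‖ : ℂ)
        + L0 x * (log ‖w - x‖ : ℂ) := fun w x => by ring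
  have hgl : ∀ w, Integrable fun x => (h x - L1 x + L0 x) * (log ‖w - x‖ : ℂ) := fun w => by
    simp_rw [hsplit]
    exact ((hl w).sub (f1 w).1).add (f0 w).1
  obtain ⟨hN, hN0⟩ := logPotential_harmonic ((hi.sub i1).add i0) hgl hg0
  refine ⟨_, δ / 3, by positivity, by linarith, hN, hN0, fun w hw => ?_⟩
  have hsum : ∫ x, (h - L1 + L0) x * (log ‖w - x‖ : ℂ)
      = (∫ x, h x * (log ‖w - x‖ : ℂ)) - (∫ x, L1 x * (log ‖w - x‖ : ℂ))
        + ∫ x, L0 x * (log ‖w - x‖ : ℂ) := by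
    have i : Integrable fun x => h x * (log ‖w - x‖ : ℂ) - L1 x * (log ‖w - x‖ : ℂ) :=
      (hl w).sub (f1 w).1
    rw [← integral_sub (hl w) (f1 w).1, ← integral_add i (f0 w).1]
    exact integral_congr_ae (ae_of_all _ fun x => hsplit w x)
  rw [hsum, (f1 w).2, (f0 w).2, (hone w hw).self_of_nhds]
  ring

/-! ### The flat density and its excess over the cone density -/

/-- The density `|t-a₂|^(2β₂-2) |t-a₃|^(2β₃-2)`. -/
def density (β₂ β₃ : ℝ) (a₂ a₃ t : ℂ) : ℝ := ‖t - a₂‖ ^ (2 * β₂ - 2) * ‖t - a₃‖ ^ (2 * β₃ - 2)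

/-- The difference between the densities of the flat metric with two cone points and of the
asymptotic cone. -/
def excess (β₂ β₃ γ : ℝ) (a₂ a₃ t : ℂ) : ℝ := density β₂ β₃ a₂ a₃ t - ‖t‖ ^ (2 * γ - 2)

/-- Up to a factor of modulus one, `H` is a branch of `(t - a)^s`. -/
lemma exists_branch {a p : ℂ} (h : p ≠ a) (s : ℝ) :
    ∃ H : ℂ → ℂ, DifferentiableOn ℂ H (ball p ‖p - a‖) ∧
      ∀ t ∈ ball p ‖p - a‖, ‖H t‖ = ‖t - a‖ ^ s := by
  have hpa : p - a ≠ 0 := sub_ne_zero.2 h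
  have hpos : 0 < ‖p - a‖ := norm_pos_iff.2 hpa
  have hslit : ∀ t ∈ ball p ‖p - a‖, (t - a) / (p - a) ∈ Complex.slitPlane := by
    intro t ht
    have e : 1 + (t - p) / (p - a) = (t - a) / (p - a) := by field_simp; ring
    rw [← e]
    refine Complex.mem_slitPlane_of_norm_lt_one ?_
    rw [norm_div, div_lt_one hpos]
    exact mem_ball_iff_norm.1 ht
  refine ⟨fun t => (‖p - a‖ ^ s : ℝ) * Complex.exp (s * Complex.log ((t - a) / (p - a))),
    fun t ht => ?_, fun t ht => ?_⟩
  · refine DifferentiableAt.differentiableWithinAt ?_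
    have hd : DifferentiableAt ℂ (fun t => (t - a) / (p - a)) t := by fun_prop
    exact (((hd.clog (hslit t ht)).const_mul _).cexp).const_mul _
  · have hne : (t - a) / (p - a) ≠ 0 := Complex.slitPlane_ne_zero (hslit t ht)
    have h0 : 0 < ‖(t - a) / (p - a)‖ := norm_pos_iff.2 hne
    rw [norm_mul, norm_real, norm_of_nonneg (by positivity), Complex.norm_exp,
      re_ofReal_mul, Complex.log_re, mul_comm s, ← rpow_def_of_pos h0, norm_div,
      div_rpow (norm_nonneg _) (norm_nonneg _)]
    field_simp

/-- Near every point `p`, the flat density is `|t-p|^(2β-2) |H|²` with `H` holomorphic, where `β` is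
the cone parameter at `p`. -/
lemma exists_density_branch {β₂ β₃ : ℝ} {a₂ a₃ : ℂ} (ha : a₂ ≠ a₃) (c : ℝ) {p : ℂ} {β : ℝ}
    (hp : (p = a₂ ∧ β = β₂) ∨ (p = a₃ ∧ β = β₃) ∨ (p ≠ a₂ ∧ p ≠ a₃ ∧ β = 1)) :
    ∃ R > 0, ∃ H : ℂ → ℂ, DifferentiableOn ℂ H (ball p R) ∧
      ∀ t ∈ ball p R, c ^ 2 * density β₂ β₃ a₂ a₃ t = ‖t - p‖ ^ (2 * β - 2) * ‖H t‖ ^ 2 := by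
  have hsq : ∀ (x s : ℝ), 0 ≤ x → (c * x ^ (s - 1)) ^ 2 = c ^ 2 * x ^ (2 * s - 2) := fun x s hx => by
    rw [mul_pow, ← rpow_natCast (x ^ (s - 1)), ← rpow_mul hx]
    congr 2; push_cast; ring
  have hc2 : ∀ z : ℂ, ‖(c : ℂ) * z‖ ^ 2 = (c * ‖z‖) ^ 2 := fun z => by
    rw [norm_mul, norm_real, norm_eq_abs, mul_pow, mul_pow, sq_abs]
  rcases hp with ⟨rfl, rfl⟩ | ⟨rfl, rfl⟩ | ⟨h2, h3, rfl⟩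
  · obtain ⟨H, hH, hHn⟩ := exists_branch ha (β₃ - 1)
    refine ⟨‖p - a₃‖, norm_pos_iff.2 (sub_ne_zero.2 ha), fun t => c * H t,
      (differentiableOn_const _).mul hH, fun t ht => ?_⟩
    rw [hc2, hHn t ht, hsq _ _ (norm_nonneg _), density]
    ring
  · obtain ⟨H, hH, hHn⟩ := exists_branch ha.symm (β₂ - 1)
    refine ⟨‖p - a₂‖, norm_pos_iff.2 (sub_ne_zero.2 ha.symm), fun t => c * H t,
      (differentiableOn_const _).mul hH, fun t ht => ?_⟩
    rw [hc2, hHn t ht, hsq _ _ (norm_nonneg _), density]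
    ring
  · obtain ⟨H, hH, hHn⟩ := exists_branch h2 (β₂ - 1)
    obtain ⟨H', hH', hHn'⟩ := exists_branch h3 (β₃ - 1)
    refine ⟨min ‖p - a₂‖ ‖p - a₃‖, lt_min (norm_pos_iff.2 (sub_ne_zero.2 h2))
      (norm_pos_iff.2 (sub_ne_zero.2 h3)), fun t => c * (H t * H' t),
      (differentiableOn_const _).mul ((hH.mono (ball_subset_ball (min_le_left _ _))).mul
        (hH'.mono (ball_subset_ball (min_le_right _ _)))), fun t ht => ?_⟩
    rw [hc2, norm_mul, hHn t (ball_subset_ball (min_le_left _ _) ht),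
      hHn' t (ball_subset_ball (min_le_right _ _) ht), ← mul_assoc, mul_pow,
      hsq _ _ (norm_nonneg _), density]
    have e := hsq ‖t - a₃‖ β₃ (norm_nonneg _)
    have : (‖t - a₃‖ ^ (β₃ - 1)) ^ 2 = ‖t - a₃‖ ^ (2 * β₃ - 2) := by
      rw [← rpow_natCast (_ ^ (β₃ - 1)), ← rpow_mul (norm_nonneg _)]
      congr 1; push_cast; ring
    rw [this]
    norm_num
    ring

lemma measurable_excess (β₂ β₃ γ : ℝ) (a₂ a₃ : ℂ) : Measurable (excess β₂ β₃ γ a₂ a₃) := by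
  unfold excess density
  fun_prop

lemma abs_excess_le {β₂ β₃ γ : ℝ} {a₂ a₃ : ℂ} (hβ₂ : β₂ < 1) (hβ₃ : β₃ < 1)
    (hγ : 1 - γ = (1 - β₂) + (1 - β₃)) {t : ℂ} (h2 : t ≠ a₂) (h3 : t ≠ a₃) :
    |excess β₂ β₃ γ a₂ a₃ t| ≤ ‖t - a₂‖ ^ (-(2 - 2 * γ)) + ‖t - a₃‖ ^ (-(2 - 2 * γ))
      + ‖t - 0‖ ^ (-(2 - 2 * γ)) := by
  have p2 : 0 < ‖t - a₂‖ := norm_pos_iff.2 (sub_ne_zero.2 h2)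
  have p3 : 0 < ‖t - a₃‖ := norm_pos_iff.2 (sub_ne_zero.2 h3)
  have h := rpow_neg_mul_rpow_neg_le p2 p3 (by linarith : 0 ≤ 2 - 2 * β₂)
    (by linarith : 0 ≤ 2 - 2 * β₃)
  rw [show 2 - 2 * β₂ + (2 - 2 * β₃) = 2 - 2 * γ by linarith, neg_sub, neg_sub] at h
  have hd : 0 ≤ density β₂ β₃ a₂ a₃ t := by unfold density; positivity
  have hz : 0 ≤ ‖t‖ ^ (2 * γ - 2) := by positivity
  rw [sub_zero, neg_sub, excess]
  refine (abs_sub _ _).trans ?_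
  rw [abs_of_nonneg hd, abs_of_nonneg hz]
  gcongr
  rw [neg_sub] at h
  exact h

/-- The first-order terms of the density at infinity cancel because the cone points have
barycentre `0`. -/
lemma abs_excess_le_of_large {β₂ β₃ γ : ℝ} {a₂ a₃ : ℂ}
    (hγ : 1 - γ = (1 - β₂) + (1 - β₃))
    (hmass : (1 - β₂ : ℂ) * a₂ + (1 - β₃ : ℂ) * a₃ = 0) :
    ∃ C R : ℝ, 0 ≤ C ∧ 1 ≤ R ∧ ∀ t : ℂ, R ≤ ‖t‖ →
      |excess β₂ β₃ γ a₂ a₃ t| ≤ C * ‖t‖ ^ (2 * γ - 4) := by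
  set A := |2 * β₂ - 2| * ‖a₂‖ ^ 2 + |2 * β₃ - 2| * ‖a₃‖ ^ 2 with hA
  have hA0 : 0 ≤ A := by positivity
  set R := 2 * ‖a₂‖ + 2 * ‖a₃‖ + A + 1 with hR
  have n2 := norm_nonneg a₂
  have n3 := norm_nonneg a₃
  refine ⟨2 * A, R, by positivity, by linarith, fun t ht => ?_⟩
  have ht1 : 1 ≤ ‖t‖ := by linarith
  have ht0 : 0 < ‖t‖ := by linarith
  have htne : t ≠ 0 := norm_pos_iff.1 ht0
  -- second-order expansion of `log |1 - a/t|`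
  have hlog : ∀ a : ℂ, 2 * ‖a‖ ≤ ‖t‖ →
      0 < ‖1 - a / t‖ ∧ |log ‖1 - a / t‖ + (a / t).re| ≤ ‖a‖ ^ 2 / ‖t‖ ^ 2 := by
    intro a hat
    have hs : ‖a / t‖ ≤ 1 / 2 := by
      rw [norm_div, div_le_iff₀ ht0]; linarith
    have hs' : ‖-(a / t)‖ < 1 := by rw [norm_neg]; linarith
    have h1 := Complex.norm_log_one_add_sub_self_le hs'
    rw [norm_neg, ← sub_eq_add_neg] at h1
    have hne : 1 - a / t ≠ 0 := by
      rw [sub_eq_add_neg]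
      exact Complex.slitPlane_ne_zero (Complex.mem_slitPlane_of_norm_lt_one hs')
    refine ⟨norm_pos_iff.2 hne, ?_⟩
    have h2 := (Complex.abs_re_le_norm _).trans h1
    rw [Complex.sub_re, Complex.log_re, Complex.neg_re, sub_neg_eq_add] at h2
    refine h2.trans ?_
    rw [norm_div, div_pow] at *
    have h3 : (1 - ‖a‖ / ‖t‖)⁻¹ ≤ 2 := by
      rw [inv_le_comm₀ (by linarith) (by norm_num)]; linarith
    have h4 : 0 ≤ ‖a‖ ^ 2 / ‖t‖ ^ 2 := by positivity
    nlinarith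
  obtain ⟨p2, l2⟩ := hlog a₂ (by linarith)
  obtain ⟨p3, l3⟩ := hlog a₃ (by linarith)
  set E := (2 * β₂ - 2) * log ‖1 - a₂ / t‖ + (2 * β₃ - 2) * log ‖1 - a₃ / t‖ with hE
  have hlin : (2 * β₂ - 2) * (a₂ / t).re + (2 * β₃ - 2) * (a₃ / t).re = 0 := by
    have : ((2 * β₂ - 2 : ℝ) : ℂ) * (a₂ / t) + ((2 * β₃ - 2 : ℝ) : ℂ) * (a₃ / t) = 0 := by
      push_cast
      linear_combination (-2 / t) * hmass
    have := congrArg Complex.re this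
    rwa [Complex.add_re, re_ofReal_mul, re_ofReal_mul, Complex.zero_re] at this
  have hEA : |E| ≤ A / ‖t‖ ^ 2 := by
    have : E = (2 * β₂ - 2) * (log ‖1 - a₂ / t‖ + (a₂ / t).re)
        + (2 * β₃ - 2) * (log ‖1 - a₃ / t‖ + (a₃ / t).re) := by
      rw [hE]; linear_combination -hlin
    rw [this]
    refine (abs_add_le _ _).trans ?_
    rw [abs_mul, abs_mul, hA, add_div, mul_div_assoc, mul_div_assoc]
    gcongr
  have hE1 : |E| ≤ 1 := hEA.trans (by
    rw [div_le_one (by positivity)]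
    nlinarith)
  have hexp : |Real.exp E - 1| ≤ 2 * |E| := Real.abs_exp_sub_one_le hE1
  have hd : ∀ a : ℂ, ‖t - a‖ = ‖t‖ * ‖1 - a / t‖ := fun a => by
    rw [← norm_mul]; congr 1; field_simp
  have hden : density β₂ β₃ a₂ a₃ t = ‖t‖ ^ (2 * γ - 2) * Real.exp E := by
    rw [density, hd, hd, mul_rpow ht0.le p2.le, mul_rpow ht0.le p3.le, hE, Real.exp_add,
      mul_comm (2 * β₂ - 2), mul_comm (2 * β₃ - 2), ← rpow_def_of_pos p2,
      ← rpow_def_of_pos p3, show 2 * γ - 2 = (2 * β₂ - 2) + (2 * β₃ - 2) by linarith,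
      rpow_add ht0]
    ring
  have h4 : ‖t‖ ^ (2 * γ - 2) / ‖t‖ ^ 2 = ‖t‖ ^ (2 * γ - 4) := by
    rw [← rpow_natCast ‖t‖ 2, ← Real.rpow_sub ht0]; congr 1; push_cast; ring
  have hpos : 0 < ‖t‖ ^ (2 * γ - 2) := by positivity
  calc |excess β₂ β₃ γ a₂ a₃ t| = ‖t‖ ^ (2 * γ - 2) * |Real.exp E - 1| := by
        rw [excess, hden, ← abs_of_pos hpos, ← abs_mul, abs_of_pos hpos]; congr 1; ring
    _ ≤ ‖t‖ ^ (2 * γ - 2) * (2 * (A / ‖t‖ ^ 2)) := by gcongr; linarith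
    _ = 2 * A * ‖t‖ ^ (2 * γ - 4) := by rw [← h4]; ring

/-- A function which is integrable near the origin and decays like `|t|^(-p)`, `p > 2`. -/
lemma integrable_of_decay {F : ℂ → ℝ} (hF : Measurable F) {R C p : ℝ} (hp : 2 < p) (hR : 1 ≤ R)
    (hin : IntegrableOn F (ball 0 R)) (hout : ∀ t, R ≤ ‖t‖ → |F t| ≤ C * ‖t‖ ^ (-p)) :
    Integrable F := by
  have hC : 0 ≤ C := by
    have h0 := hout (R : ℂ) (by rw [norm_real, norm_of_nonneg (by linarith)])
    have h1 : 0 < ‖(R : ℂ)‖ ^ (-p) := by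
      rw [norm_real, norm_of_nonneg (by linarith)]; positivity
    by_contra h
    push Not at h
    nlinarith [abs_nonneg (F R)]
  have h1 : IntegrableOn F (ball 0 R)ᶜ := by
    have h2 : Integrable fun t : ℂ => C * 2 ^ p * (1 + ‖t‖) ^ (-p) :=
      (integrable_one_add_norm (by simpa using hp)).const_mul _
    refine Integrable.mono' h2.integrableOn hF.aestronglyMeasurable ?_
    filter_upwards [ae_restrict_mem isOpen_ball.measurableSet.compl] with t ht
    rw [mem_compl_iff, mem_ball_zero_iff, not_lt] at ht
    rw [norm_eq_abs]
    refine (hout t ht).trans ?_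
    have ht0 : 0 < ‖t‖ := by linarith
    have : ‖t‖ ^ (-p) ≤ 2 ^ p * (1 + ‖t‖) ^ (-p) := by
      have e : (2 : ℝ) ^ p * (1 + ‖t‖) ^ (-p) = ((1 + ‖t‖) / 2) ^ (-p) := by
        rw [div_rpow (by positivity) (by norm_num), rpow_neg (by norm_num : (0:ℝ) ≤ 2)]
        field_simp
      rw [e]
      exact rpow_le_rpow_of_nonpos (by positivity) (by linarith) (by linarith)
    rw [mul_assoc]
    gcongr
  have := hin.union h1
  rwa [union_compl_self, integrableOn_univ] at this

/-- Integrability against the excess of weights bounded by a small power. -/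
lemma integrable_excess_mul {β₂ β₃ γ : ℝ} {a₂ a₃ : ℂ} (hβ₂ : β₂ < 1) (hβ₃ : β₃ < 1) (hγ0 : 0 < γ)
    (hγ : 1 - γ = (1 - β₂) + (1 - β₃))
    (hmass : (1 - β₂ : ℂ) * a₂ + (1 - β₃ : ℂ) * a₃ = 0) {m : ℂ → ℝ} (hm : Measurable m)
    {δ C R : ℝ} (hδ : δ < 2 - 2 * γ)
    (hloc : ∀ b : ℂ, ∀ r, IntegrableOn (fun t => ‖t - b‖ ^ (-(2 - 2 * γ)) * |m t|) (ball 0 r))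
    (hout : ∀ t, R ≤ ‖t‖ → |m t| ≤ C * ‖t‖ ^ δ) :
    Integrable fun t => excess β₂ β₃ γ a₂ a₃ t * m t := by
  obtain ⟨C', R', hC', hR', hfar⟩ := abs_excess_le_of_large (a₂ := a₂) (a₃ := a₃) hγ hmass
  refine integrable_of_decay (R := max R R') (C := C' * C) (p := 4 - 2 * γ - δ)
    ((measurable_excess _ _ _ _ _).mul hm) (by linarith) (hR'.trans (le_max_right _ _)) ?_ ?_
  · refine Integrable.mono' (((hloc a₂ _).add (hloc a₃ _)).add (hloc 0 _))
      ((measurable_excess _ _ _ _ _).mul hm).aestronglyMeasurable ?_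
    filter_upwards [ae_restrict_of_ae (ae_ne_point a₂), ae_restrict_of_ae (ae_ne_point a₃)] with
      t h2 h3
    rw [norm_mul, norm_eq_abs, norm_eq_abs]
    refine (mul_le_mul_of_nonneg_right (abs_excess_le hβ₂ hβ₃ hγ h2 h3) (abs_nonneg _)).trans ?_
    simp only [Pi.add_apply]
    rw [add_mul, add_mul]
  · intro t ht
    have ht0 : 0 < ‖t‖ := by linarith [le_max_right R R']
    rw [abs_mul]
    calc |excess β₂ β₃ γ a₂ a₃ t| * |m t| ≤ (C' * ‖t‖ ^ (2 * γ - 4)) * (C * ‖t‖ ^ δ) :=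
          mul_le_mul (hfar t ((le_max_right _ _).trans ht)) (hout t ((le_max_left _ _).trans ht))
            (abs_nonneg _) (by positivity)
      _ = C' * C * (‖t‖ ^ (2 * γ - 4) * ‖t‖ ^ δ) := by ring
      _ = _ := by rw [← rpow_add ht0]; congr 2; ring

section

/-! ### The flat potential -/

/-- The hypotheses on the flat metric `γ² |w-a₂|^(2β₂-2) |w-a₃|^(2β₃-2) |dw|²`: two distinct cone
points of angles `2πβ₂`, `2πβ₃`, whose curvature adds up to that of the cone of angle `2πγ`, and
whose barycentre, weighted by the curvatures, is the origin. -/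
structure FlatData (β₂ β₃ γ : ℝ) (a₂ a₃ : ℂ) : Prop where
  pos₂ : 0 < β₂
  lt₂ : β₂ < 1
  pos₃ : 0 < β₃
  lt₃ : β₃ < 1
  pos : 0 < γ
  lt : γ < 1
  angle : 1 - γ = (1 - β₂) + (1 - β₃)
  ne : a₂ ≠ a₃
  mass : (1 - β₂ : ℂ) * a₂ + (1 - β₃ : ℂ) * a₃ = 0

variable {β₂ β₃ γ : ℝ} {a₂ a₃ : ℂ}

lemma FlatData.integrable_excess (D : FlatData β₂ β₃ γ a₂ a₃) :
    Integrable (excess β₂ β₃ γ a₂ a₃) := by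
  have := integrable_excess_mul D.lt₂ D.lt₃ D.pos D.angle D.mass (m := fun _ => 1)
    measurable_const (δ := 0) (C := 1) (R := 0) (by linarith [D.lt])
    (fun b r => by
      simpa using integrableOn_norm_sub_rpow (by linarith [D.pos] : 2 - 2 * γ < 2) b 0 r)
    (fun t _ => by simp)
  simpa using this

lemma FlatData.integrable_excess_log (D : FlatData β₂ β₃ γ a₂ a₃) (w : ℂ) :
    Integrable fun t => excess β₂ β₃ γ a₂ a₃ t * log ‖w - t‖ := by
  have hδ : 0 < 1 - γ := by linarith [D.lt]
  refine integrable_excess_mul D.lt₂ D.lt₃ D.pos D.angle D.mass (by fun_prop) (δ := 1 - γ)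
    (C := 2 ^ (1 - γ) / (1 - γ)) (R := ‖w‖ + 1) (by linarith [D.lt]) (fun b r => ?_)
    (fun t ht => ?_)
  · simp_rw [norm_sub_rev w]
    exact integrableOn_rpow_mul_log (by linarith [D.lt]) (by linarith [D.pos]) b w 0 r
  · have h1 : 1 ≤ ‖w - t‖ := by
      rw [norm_sub_rev]; linarith [norm_sub_norm_le t w]
    have h2 : ‖w - t‖ ≤ 2 * ‖t‖ := by linarith [norm_sub_le w t]
    rw [abs_of_nonneg (Real.log_nonneg h1)]
    refine (Real.log_le_rpow_div (norm_nonneg _) hδ).trans ?_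
    rw [div_mul_eq_mul_div, ← mul_rpow (by norm_num) (norm_nonneg _)]
    gcongr

lemma flatPotential_eq (β₂ β₃ γ : ℝ) (a₂ a₃ w : ℂ) : flatPotential β₂ β₃ γ a₂ a₃ w
    = ‖w‖ ^ (2 * γ) + γ ^ 2 / Real.pi *
      (2 * ∫ t : ℂ, excess β₂ β₃ γ a₂ a₃ t * log ‖w - t‖) := rfl

lemma contDiffAt_ofReal {E : Type*} [NormedAddCommGroup E] [NormedSpace ℝ E] {f : E → ℝ} {x : E}
    {n : WithTop ℕ∞} (h : ContDiffAt ℝ n f x) : ContDiffAt ℝ n (fun y => (f y : ℂ)) x :=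
  ofRealCLM.contDiff.contDiffAt.comp x h

lemma eventually_differentiableAt {E F : Type*} [NormedAddCommGroup E] [NormedSpace ℝ E]
    [NormedAddCommGroup F] [NormedSpace ℝ F] {f : E → F} {x : E} (hf : ContDiffAt ℝ ∞ f x) :
    ∀ᶠ y in 𝓝 x, DifferentiableAt ℝ f y := by
  have h1 : ContDiffAt ℝ 1 f x := hf.of_le (by exact_mod_cast le_top)
  filter_upwards [h1.eventually (by simp)] with y h using h.differentiableAt (by simp)

lemma dzeta_dzetabar_add {f g : ℂ → ℂ} {x : ℂ} (hf : ContDiffAt ℝ ∞ f x)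
    (hg : ContDiffAt ℝ ∞ g x) :
    dzeta (dzetabar fun y => f y + g y) x = dzeta (dzetabar f) x + dzeta (dzetabar g) x := by
  have h1 : dzetabar (fun y => f y + g y) =ᶠ[𝓝 x] fun y => dzetabar f y + dzetabar g y := by
    filter_upwards [eventually_differentiableAt hf, eventually_differentiableAt hg] with y h1 h2
    exact dzetabar_eq (hasFDerivAt_wirt_add (hasFDerivAt_wirt h1) (hasFDerivAt_wirt h2))
  rw [dzeta_congr h1]
  exact dzeta_eq (hasFDerivAt_wirt_add
    (hasFDerivAt_wirt ((contDiffAt_dzetabar hf).differentiableAt (by simp)))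
    (hasFDerivAt_wirt ((contDiffAt_dzetabar hg).differentiableAt (by simp))))

lemma dzeta_dzetabar_const_mul (c : ℂ) {f : ℂ → ℂ} {x : ℂ} (hf : ContDiffAt ℝ ∞ f x) :
    dzeta (dzetabar fun y => c * f y) x = c * dzeta (dzetabar f) x := by
  have key : ∀ {f : ℂ → ℂ} {y : ℂ}, DifferentiableAt ℝ f y →
      HasFDerivAt (fun y => c * f y) (wirt (c * dzeta f y) (c * dzetabar f y)) y := by
    intro f y h
    refine ((hasFDerivAt_wirt h).const_mul c).congr_fderiv ?_
    rw [wirt_smul]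
  have h1 : dzetabar (fun y => c * f y) =ᶠ[𝓝 x] fun y => c * dzetabar f y := by
    filter_upwards [eventually_differentiableAt hf] with y h1 using dzetabar_eq (key h1)
  rw [dzeta_congr h1]
  exact dzeta_eq (key ((contDiffAt_dzetabar hf).differentiableAt (by simp)))

/-- Near every point `p` the flat potential is `|w-p|^(2β) k + N` with `k`, `N` smooth, where `β` is
the cone parameter at `p`; and it is a potential of the flat metric. -/
theorem FlatData.flatPotential_local (D : FlatData β₂ β₃ γ a₂ a₃) {p : ℂ} {β : ℝ}
    (hp : (p = a₂ ∧ β = β₂) ∨ (p = a₃ ∧ β = β₃) ∨ (p ≠ a₂ ∧ p ≠ a₃ ∧ β = 1)) :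
    ∃ k N : ℂ → ℝ, ∃ δ > 0, ContDiffOn ℝ ∞ k (ball p δ) ∧
      ContDiffOn ℝ ∞ N (ball p δ) ∧
      (∀ w ∈ ball p δ,
        flatPotential β₂ β₃ γ a₂ a₃ w = ‖w - p‖ ^ (2 * β) * k w + N w) ∧
      ∀ w ∈ ball p δ, w ≠ p →
        dzeta (dzetabar fun y => (flatPotential β₂ β₃ γ a₂ a₃ y : ℂ)) w
          = ((γ ^ 2 * density β₂ β₃ a₂ a₃ w : ℝ) : ℂ) := by
  have hβ : 0 < β ∧ β ≤ 1 := by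
    rcases hp with ⟨-, rfl⟩ | ⟨-, rfl⟩ | ⟨-, -, rfl⟩
    exacts [⟨D.pos₂, D.lt₂.le⟩, ⟨D.pos₃, D.lt₃.le⟩, ⟨one_pos, le_rfl⟩]
  obtain ⟨R, hR, H, hH, hHd⟩ := exists_density_branch D.ne γ hp
  obtain ⟨K, hK, hKH⟩ := exists_holomorphic_primitive hβ.1 hH
  have hKc : ContDiffOn ℝ ∞ K (ball p R) :=
    (hK.contDiffOn isOpen_ball).restrict_scalars ℝ
  have hk : ContDiffOn ℝ ∞ (fun y => K y * star (K y)) (ball p R) :=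
    hKc.mul (conjCLE.contDiff.comp_contDiffOn hKc)
  set h : ℂ → ℂ := fun t => ((γ ^ 2 * excess β₂ β₃ γ a₂ a₃ t : ℝ) : ℂ) with hh
  have hi : Integrable h := (D.integrable_excess.const_mul (γ ^ 2)).ofReal
  have hmul : ∀ w t, h t * (log ‖w - t‖ : ℂ)
      = ((γ ^ 2 * (excess β₂ β₃ γ a₂ a₃ t * log ‖w - t‖) : ℝ) : ℂ) := fun w t => by
    rw [hh]; push_cast; ring
  have hl : ∀ w, Integrable fun t => h t * (log ‖w - t‖ : ℂ) := fun w => by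
    simp_rw [hmul]
    exact ((D.integrable_excess_log w).const_mul (γ ^ 2)).ofReal
  have hlap : ∀ᵐ x, x ∈ ball p R →
      h x = dzeta (dzetabar fun y => ((‖y - p‖ ^ (2 * β) : ℝ) : ℂ) * (K y * star (K y))) x
        - dzeta (dzetabar fun y => ((‖y - 0‖ ^ (2 * γ) : ℝ) : ℂ) * 1) x := by
    filter_upwards [ae_ne_point p, ae_ne_point 0] with x hxp hx0 hx
    have e0 := laplacian_rpow_mul_normSq (p := 0) (R := ‖x‖ + 1) (β := γ) (H := fun _ => γ)
      (K := fun _ => 1) (by fun_prop) (by simp) (ζ := x) (by simp) hx0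
    rw [laplacian_rpow_mul_normSq hK hKH hx hxp, ← hHd x hx]
    simp only [star_one, mul_one] at e0 ⊢
    rw [e0, hh]
    simp only [excess, norm_real, sub_zero, norm_eq_abs, sq_abs]
    push_cast
    ring
  obtain ⟨N, δ, hδ, hδR, hN, hN0, hpot⟩ :=
    logPotential_local hi hl hR hβ.1 hβ.2 D.pos D.lt.le hk hlap
  have hpi : (Real.pi : ℂ) ≠ 0 := by exact_mod_cast Real.pi_ne_zero
  have hsub : ball p δ ⊆ ball p R := ball_subset_ball hδR
  have hform : ∀ w ∈ ball p δ, (flatPotential β₂ β₃ γ a₂ a₃ w : ℂ)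
      = ((‖w - p‖ ^ (2 * β) : ℝ) : ℂ) * (K w * star (K w)) + 2 / Real.pi * N w := by
    intro w hw
    have h1 := hpot w hw
    simp_rw [hmul] at h1
    rw [integral_complex_ofReal, integral_const_mul] at h1
    have h2 : N w = ((γ ^ 2 * ∫ t, excess β₂ β₃ γ a₂ a₃ t * log ‖w - t‖ : ℝ) : ℂ)
      - (Real.pi / 2 : ℝ) * (((‖w - p‖ ^ (2 * β) : ℝ) : ℂ) * (K w * star (K w))
          - ((‖w - 0‖ ^ (2 * γ) : ℝ) : ℂ) * 1) := by rw [h1]; ring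
    rw [h2, flatPotential_eq, sub_zero]
    push_cast
    field_simp
    ring
  have hkre : ∀ w, K w * star (K w) = ((‖K w‖ ^ 2 : ℝ) : ℂ) := fun w => by
    rw [star_def, Complex.mul_conj']; push_cast; rfl
  refine ⟨fun w => ‖K w‖ ^ 2, fun w => 2 / Real.pi * (N w).re, δ, hδ,
    (hKc.mono hsub).norm_sq ℝ, contDiffOn_const.mul (Complex.reCLM.contDiff.comp_contDiffOn hN),
    fun w hw => ?_, fun w hw hwp => ?_⟩
  · have := congrArg Complex.re (hform w hw)
    rw [hkre, ← Complex.ofReal_mul, Complex.add_re, Complex.ofReal_re, Complex.ofReal_re,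
      show (2 / Real.pi * N w : ℂ) = ((2 / Real.pi : ℝ) : ℂ) * N w by push_cast; rfl,
      re_ofReal_mul] at this
    exact this
  · have hnh := isOpen_ball.mem_nhds hw
    have hev : (fun y => (flatPotential β₂ β₃ γ a₂ a₃ y : ℂ)) =ᶠ[𝓝 w]
        fun y => ((‖y - p‖ ^ (2 * β) : ℝ) : ℂ) * (K y * star (K y)) + 2 / Real.pi * N y := by
      filter_upwards [hnh] with y hy using hform y hy
    have hs : ContDiffAt ℝ ∞ (fun y : ℂ => ((‖y - p‖ ^ (2 * β) : ℝ) : ℂ)) w := by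
      refine contDiffAt_ofReal (ContDiffAt.rpow_const_of_ne ?_ ?_)
      · exact (contDiffAt_id.sub contDiffAt_const).norm ℝ (sub_ne_zero.2 hwp)
      · exact norm_ne_zero_iff.2 (sub_ne_zero.2 hwp)
    rw [dzeta_congr (dzetabar_eventuallyEq hev),
      dzeta_dzetabar_add (hs.mul (hk.contDiffAt (isOpen_ball.mem_nhds (hsub hw))))
        (contDiffAt_const.mul (hN.contDiffAt hnh)),
      dzeta_dzetabar_const_mul _ (hN.contDiffAt hnh), hN0 w hw,
      laplacian_rpow_mul_normSq hK hKH (hsub hw) hwp, ← hHd w (hsub hw), mul_zero, add_zero]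

lemma FlatData.contDiffAt_flatPotential (D : FlatData β₂ β₃ γ a₂ a₃) {w : ℂ} (h2 : w ≠ a₂)
    (h3 : w ≠ a₃) : ContDiffAt ℝ ∞ (flatPotential β₂ β₃ γ a₂ a₃) w := by
  obtain ⟨k, N, δ, hδ, hk, hN, hform, -⟩ :=
    D.flatPotential_local (p := w) (Or.inr (Or.inr ⟨h2, h3, rfl⟩))
  have hnh := isOpen_ball.mem_nhds (mem_ball_self hδ : w ∈ ball w δ)
  have h1 : ContDiffAt ℝ ∞ (fun y => ‖y - w‖ ^ 2 * k y + N y) w :=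
    (((contDiffAt_id.sub contDiffAt_const).norm_sq ℝ).mul (hk.contDiffAt hnh)).add
      (hN.contDiffAt hnh)
  refine h1.congr_of_eventuallyEq ?_
  filter_upwards [hnh] with y hy
  rw [hform y hy]
  norm_num

lemma FlatData.dzeta_dzetabar_flatPotential (D : FlatData β₂ β₃ γ a₂ a₃) {w : ℂ} (h2 : w ≠ a₂)
    (h3 : w ≠ a₃) : dzeta (dzetabar fun y => (flatPotential β₂ β₃ γ a₂ a₃ y : ℂ)) w
      = ((γ ^ 2 * density β₂ β₃ a₂ a₃ w : ℝ) : ℂ) := by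
  -- the local form says nothing at its centre, where the identity follows by continuity
  obtain ⟨k, N, δ, hδ, hk, hN, hform, hlap⟩ :=
    D.flatPotential_local (p := w) (Or.inr (Or.inr ⟨h2, h3, rfl⟩))
  have hφ := contDiffAt_ofReal (D.contDiffAt_flatPotential h2 h3)
  have hc : ContinuousAt (dzeta (dzetabar fun y => (flatPotential β₂ β₃ γ a₂ a₃ y : ℂ))) w :=
    (contDiffAt_dzeta (contDiffAt_dzetabar hφ)).continuousAt
  have hd : ContinuousAt (fun y => ((γ ^ 2 * density β₂ β₃ a₂ a₃ y : ℝ) : ℂ)) w := by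
    have n2 : ‖w - a₂‖ ≠ 0 := norm_ne_zero_iff.2 (sub_ne_zero.2 h2)
    have n3 : ‖w - a₃‖ ≠ 0 := norm_ne_zero_iff.2 (sub_ne_zero.2 h3)
    refine continuous_ofReal.continuousAt.comp (continuousAt_const.mul
      (ContinuousAt.mul ?_ ?_))
    · exact ContinuousAt.rpow_const (by fun_prop) (Or.inl n2)
    · exact ContinuousAt.rpow_const (by fun_prop) (Or.inl n3)
  have hev : ∀ᶠ y in 𝓝[≠] w, dzeta (dzetabar fun y => (flatPotential β₂ β₃ γ a₂ a₃ y : ℂ)) y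
      = ((γ ^ 2 * density β₂ β₃ a₂ a₃ y : ℝ) : ℂ) := by
    filter_upwards [self_mem_nhdsWithin,
      mem_nhdsWithin_of_mem_nhds (isOpen_ball.mem_nhds (mem_ball_self hδ))] with
      y hy hyb using hlap y hyb hy
  exact tendsto_nhds_unique ((hc.tendsto.mono_left nhdsWithin_le_nhds).congr' hev)
    (hd.tendsto.mono_left nhdsWithin_le_nhds)

/-! ### Growth of the flat potential -/

/-- The difference of the potentials of the flat metric and of the asymptotic cone. -/
def potentialExcess (β₂ β₃ γ : ℝ) (a₂ a₃ w : ℂ) : ℝ :=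
  flatPotential β₂ β₃ γ a₂ a₃ w - ‖w‖ ^ (2 * γ)

lemma potentialExcess_eq (β₂ β₃ γ : ℝ) (a₂ a₃ w : ℂ) : potentialExcess β₂ β₃ γ a₂ a₃ w
    = 2 * γ ^ 2 / Real.pi * ∫ t : ℂ, excess β₂ β₃ γ a₂ a₃ t * log ‖w - t‖ := by
  rw [potentialExcess, flatPotential_eq]; ring

lemma rpow_sub_one_le_two_mul {γ a x : ℝ} (hγ0 : 0 < γ) (hγ1 : γ < 1) (ha : 0 < a) (hx : a / 2 ≤ x) :
    x ^ (γ - 1) ≤ 2 * a ^ (γ - 1) := by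
  have h1 : x ^ (γ - 1) ≤ (a / 2) ^ (γ - 1) :=
    rpow_le_rpow_of_nonpos (by positivity) hx (by linarith)
  have h2 : (a / 2) ^ (γ - 1) = 2 ^ (1 - γ) * a ^ (γ - 1) := by
    rw [div_rpow ha.le (by norm_num), show 1 - γ = -(γ - 1) by ring, rpow_neg (by norm_num)]
    field_simp
  have h3 : (2 : ℝ) ^ (1 - γ) ≤ 2 ^ (1 : ℝ) :=
    rpow_le_rpow_of_exponent_le (by norm_num) (by linarith)
  rw [rpow_one] at h3
  rw [h2] at h1
  exact h1.trans (by gcongr)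

/-- Decay of the Cauchy-type potential of the excess. -/
lemma FlatData.exists_kernel_bound (D : FlatData β₂ β₃ γ a₂ a₃) :
    ∃ C K : ℝ, 0 ≤ C ∧ 1 ≤ K ∧ ∀ w : ℂ, K ≤ ‖w‖ →
      Integrable (fun t => |excess β₂ β₃ γ a₂ a₃ t| * ‖w - t‖⁻¹) ∧
      ∫ t, |excess β₂ β₃ γ a₂ a₃ t| * ‖w - t‖⁻¹ ≤ C * ‖w‖ ^ (γ - 1) := by
  have hγ0 := D.pos
  have hγ1 := D.lt
  obtain ⟨A, R, hA, hR, hfar⟩ := abs_excess_le_of_large (a₂ := a₂) (a₃ := a₃) D.angle D.mass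
  have hm : Integrable fun t => excess β₂ β₃ γ a₂ a₃ t * (2 + 2 * ‖t‖ ^ (1 - γ)) := by
    refine integrable_excess_mul D.lt₂ D.lt₃ D.pos D.angle D.mass (by fun_prop) (δ := 1 - γ)
      (C := 4) (R := 1) (by linarith) (fun b r => ?_) (fun t ht => ?_)
    · refine Integrable.mono' ((integrableOn_norm_sub_rpow (by linarith : 2 - 2 * γ < 2)
        b 0 r).mul_const (2 + 2 * r ^ (1 - γ)))
        (by fun_prop : Measurable _).aestronglyMeasurable ?_
      filter_upwards [ae_restrict_mem isOpen_ball.measurableSet] with t ht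
      rw [mem_ball_zero_iff] at ht
      rw [norm_of_nonneg (by positivity), abs_of_nonneg (by positivity)]
      gcongr
    · have : 1 ≤ ‖t‖ ^ (1 - γ) := Real.one_le_rpow ht (by linarith)
      rw [abs_of_nonneg (by positivity)]
      linarith
  set ι : ℂ → ℝ := (ball (0 : ℂ) 1).indicator fun s => ‖s‖⁻¹ with hι
  have hιi : Integrable ι := by
    refine (integrable_indicator_iff isOpen_ball.measurableSet).2 ?_
    have := integrableOn_norm_sub_rpow (p := 1) (by norm_num) 0 0 1
    simpa [rpow_neg_one] using this
  have hι0 : ∀ s, 0 ≤ ι s := fun s => indicator_nonneg (fun _ _ => by positivity) s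
  refine ⟨2 * A * (∫ s, ι s) + ∫ t, |excess β₂ β₃ γ a₂ a₃ t * (2 + 2 * ‖t‖ ^ (1 - γ))|, 2 * R + 2,
    by have h1 : 0 ≤ ∫ s, ι s := integral_nonneg hι0
       have h2 : 0 ≤ ∫ t : ℂ, |excess β₂ β₃ γ a₂ a₃ t * (2 + 2 * ‖t‖ ^ (1 - γ))| :=
         integral_nonneg fun _ => abs_nonneg _
       positivity,
    by linarith, fun w hw => ?_⟩
  have hw0 : 0 < ‖w‖ := by linarith
  set G : ℂ → ℝ := fun t => (2 * A * ι (t - w)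
      + |excess β₂ β₃ γ a₂ a₃ t * (2 + 2 * ‖t‖ ^ (1 - γ))|) * ‖w‖ ^ (γ - 1) with hG
  have hGi : Integrable G := (((hιi.comp_sub_right w).const_mul (2 * A)).add hm.abs).mul_const _
  have hGint : ∫ t, G t = (2 * A * (∫ s, ι s)
      + ∫ t, |excess β₂ β₃ γ a₂ a₃ t * (2 + 2 * ‖t‖ ^ (1 - γ))|) * ‖w‖ ^ (γ - 1) := by
    rw [hG, integral_mul_const, integral_add ((hιi.comp_sub_right w).const_mul (2 * A)) hm.abs,
      integral_const_mul, integral_sub_right_eq_self ι w]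
  have hpow : ∀ x : ℝ, ‖w‖ / 2 ≤ x → x ^ (γ - 1) ≤ 2 * ‖w‖ ^ (γ - 1) := fun x hx =>
    rpow_sub_one_le_two_mul hγ0 hγ1 hw0 hx
  have hbd : ∀ t, |excess β₂ β₃ γ a₂ a₃ t| * ‖w - t‖⁻¹ ≤ G t := by
    intro t
    rw [hG]
    simp only
    by_cases ht : ‖w - t‖ < 1
    · -- near `w` the excess itself is small
      have htw : ‖w‖ / 2 ≤ ‖t‖ := by linarith [norm_sub_norm_le w t]
      have ht1 : 1 ≤ ‖t‖ := by linarith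
      have h1 : |excess β₂ β₃ γ a₂ a₃ t| ≤ 2 * A * ‖w‖ ^ (γ - 1) := by
        refine (hfar t (by linarith)).trans ?_
        have : ‖t‖ ^ (2 * γ - 4) ≤ ‖t‖ ^ (γ - 1) :=
          rpow_le_rpow_of_exponent_le ht1 (by linarith)
        nlinarith [hpow _ htw]
      have h2 : ι (t - w) = ‖w - t‖⁻¹ := by
        rw [hι, indicator_of_mem (by rwa [mem_ball_zero_iff, norm_sub_rev]), norm_sub_rev]
      rw [h2, add_mul]
      have h3 : 0 ≤ |excess β₂ β₃ γ a₂ a₃ t * (2 + 2 * ‖t‖ ^ (1 - γ))| * ‖w‖ ^ (γ - 1) := by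
        positivity
      have h4 := mul_le_mul_of_nonneg_right h1 (inv_nonneg.2 (norm_nonneg (w - t)))
      linarith
    · -- elsewhere the kernel is at most the weight `2 + 2 |t|^(1-γ)`, up to the factor `|w|^(γ-1)`
      push Not at ht
      have hk : ‖w - t‖⁻¹ ≤ (2 + 2 * ‖t‖ ^ (1 - γ)) * ‖w‖ ^ (γ - 1) := by
        have hwt : 0 < ‖w - t‖ := by linarith
        have hn : 0 ≤ ‖t‖ ^ (1 - γ) := by positivity
        have hn' : 0 ≤ ‖w‖ ^ (γ - 1) := by positivity
        rcases le_total (‖w‖ / 2) ‖w - t‖ with h | h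
        · have h1 : ‖w - t‖⁻¹ ≤ ‖w - t‖ ^ (γ - 1) := by
            rw [← rpow_neg_one]
            exact rpow_le_rpow_of_exponent_le ht (by linarith)
          nlinarith [hpow _ h, mul_nonneg hn hn']
        · have htw : ‖w‖ / 2 ≤ ‖t‖ := by linarith [norm_sub_norm_le w t]
          have ht0 : 0 < ‖t‖ := by linarith
          have h1 : ‖w - t‖⁻¹ ≤ 1 := inv_le_one_of_one_le₀ ht
          have h2 : (1 : ℝ) = ‖t‖ ^ (1 - γ) * ‖t‖ ^ (γ - 1) := by
            rw [← rpow_add ht0]; simp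
          have h3 := mul_le_mul_of_nonneg_left (hpow _ htw) hn
          nlinarith
      rw [add_mul]
      have h1 : 0 ≤ 2 * A * ι (t - w) * ‖w‖ ^ (γ - 1) := by have := hι0 (t - w); positivity
      have h2 : 0 ≤ 2 + 2 * ‖t‖ ^ (1 - γ) := by positivity
      rw [abs_mul, abs_of_nonneg h2, mul_assoc |excess β₂ β₃ γ a₂ a₃ t|]
      have := mul_le_mul_of_nonneg_left hk (abs_nonneg (excess β₂ β₃ γ a₂ a₃ t))
      linarith
  have hint : Integrable fun t => |excess β₂ β₃ γ a₂ a₃ t| * ‖w - t‖⁻¹ := by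
    refine hGi.mono' ((measurable_excess _ _ _ _ _).abs.mul
      (by fun_prop)).aestronglyMeasurable (ae_of_all _ fun t => ?_)
    rw [norm_of_nonneg (by positivity)]
    exact hbd t
  exact ⟨hint, (integral_mono hint hGi hbd).trans_eq hGint⟩

lemma abs_log_sub_log_le {a b : ℝ} (ha : 0 < a) (hb : 0 < b) :
    |log a - log b| ≤ |a - b| * (a⁻¹ + b⁻¹) := by
  have key : ∀ {a b : ℝ}, 0 < a → 0 < b → log a - log b ≤ |a - b| * (a⁻¹ + b⁻¹) := by
    intro a b ha hb
    rw [← Real.log_div ha.ne' hb.ne']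
    have h1 := Real.log_le_sub_one_of_pos (div_pos ha hb)
    have h2 : a / b - 1 = (a - b) * b⁻¹ := by field_simp
    have h3 : (a - b) * b⁻¹ ≤ |a - b| * b⁻¹ := by gcongr; exact le_abs_self _
    have h4 : 0 ≤ |a - b| * a⁻¹ := by positivity
    rw [mul_add]; linarith
  rw [abs_le]
  have h1 := key ha hb
  have h2 := key hb ha
  rw [abs_sub_comm b a, add_comm b⁻¹] at h2
  constructor <;> linarith

/-- The excess of the potential has gradient `O(|w|^(γ-1))`. -/
theorem FlatData.exists_fderiv_bound (D : FlatData β₂ β₃ γ a₂ a₃) :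
    ∃ C K : ℝ, 0 ≤ C ∧ 1 ≤ K ∧ ∀ w : ℂ, K ≤ ‖w‖ →
      ‖fderiv ℝ (potentialExcess β₂ β₃ γ a₂ a₃) w‖ ≤ C * ‖w‖ ^ (γ - 1) := by
  obtain ⟨C, K, hC, hK, hker⟩ := D.exists_kernel_bound
  have hγ1 := D.lt
  set c := 2 * γ ^ 2 / Real.pi with hc
  have hc0 : 0 ≤ c := by positivity
  -- the gradient bound follows from a Lipschitz bound, which avoids differentiating the integral
  have hlip : ∀ w w' : ℂ, K ≤ ‖w‖ → K ≤ ‖w'‖ →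
      |potentialExcess β₂ β₃ γ a₂ a₃ w' - potentialExcess β₂ β₃ γ a₂ a₃ w|
        ≤ c * (‖w' - w‖ * (C * ‖w'‖ ^ (γ - 1) + C * ‖w‖ ^ (γ - 1))) := by
    intro w w' hw hw'
    obtain ⟨i, hi⟩ := hker w hw
    obtain ⟨i', hi'⟩ := hker w' hw'
    rw [potentialExcess_eq, potentialExcess_eq, ← hc, ← mul_sub, abs_mul, abs_of_nonneg hc0,
      ← integral_sub (D.integrable_excess_log w') (D.integrable_excess_log w)]
    refine mul_le_mul_of_nonneg_left ?_ hc0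
    have hb : Integrable fun t => ‖w' - w‖ * (|excess β₂ β₃ γ a₂ a₃ t| * ‖w' - t‖⁻¹
        + |excess β₂ β₃ γ a₂ a₃ t| * ‖w - t‖⁻¹) := (i'.add i).const_mul _
    refine le_trans (norm_integral_le_of_norm_le (G := ℝ) hb ?_) ?_
    · filter_upwards [ae_ne_point w, ae_ne_point w'] with t ht ht'
      have p : 0 < ‖w - t‖ := norm_pos_iff.2 (sub_ne_zero.2 ht.symm)
      have p' : 0 < ‖w' - t‖ := norm_pos_iff.2 (sub_ne_zero.2 ht'.symm)
      rw [← mul_sub, norm_mul, norm_eq_abs, norm_eq_abs]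
      have h1 := abs_log_sub_log_le p' p
      have h2 : |‖w' - t‖ - ‖w - t‖| ≤ ‖w' - w‖ := by
        simpa using abs_norm_sub_norm_le (w' - t) (w - t)
      calc _ ≤ |excess β₂ β₃ γ a₂ a₃ t| * (‖w' - w‖ * (‖w' - t‖⁻¹ + ‖w - t‖⁻¹)) := by
            refine mul_le_mul_of_nonneg_left (h1.trans ?_) (abs_nonneg _)
            gcongr
        _ = _ := by ring
    · rw [integral_const_mul, integral_add i' i]
      gcongr
  refine ⟨c * (3 * C), 2 * K, by positivity, by linarith, fun w hw => ?_⟩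
  have hw0 : 0 < ‖w‖ := by linarith
  refine norm_fderiv_le_of_lip' ℝ (f := potentialExcess β₂ β₃ γ a₂ a₃) (by positivity) ?_
  filter_upwards [ball_mem_nhds w (by linarith : 0 < ‖w‖ / 2)] with w' hw'
  rw [mem_ball_iff_norm] at hw'
  have hw'1 : ‖w‖ / 2 ≤ ‖w'‖ := by
    have := norm_sub_norm_le w w'
    rw [norm_sub_rev] at this; linarith
  refine (hlip w w' (by linarith) (by linarith)).trans ?_
  have h2 := rpow_sub_one_le_two_mul D.pos hγ1 hw0 hw'1
  calc c * (‖w' - w‖ * (C * ‖w'‖ ^ (γ - 1) + C * ‖w‖ ^ (γ - 1)))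
      ≤ c * (‖w' - w‖ * (C * (2 * ‖w‖ ^ (γ - 1)) + C * ‖w‖ ^ (γ - 1))) := by gcongr
    _ = _ := by ring

lemma FlatData.contDiffAt_potentialExcess (D : FlatData β₂ β₃ γ a₂ a₃) {w : ℂ} (h2 : w ≠ a₂)
    (h3 : w ≠ a₃) (h0 : w ≠ 0) : ContDiffAt ℝ ∞ (potentialExcess β₂ β₃ γ a₂ a₃) w := by
  refine (D.contDiffAt_flatPotential h2 h3).sub (ContDiffAt.rpow_const_of_ne ?_ ?_)
  · exact contDiffAt_id.norm ℝ h0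
  · exact norm_ne_zero_iff.2 h0

/-- The excess of the potential is `O(|w|^γ)`, by integrating the gradient bound along rays. -/
theorem FlatData.exists_growth_bound (D : FlatData β₂ β₃ γ a₂ a₃) :
    ∃ C K : ℝ, 0 ≤ C ∧ 1 ≤ K ∧ ‖a₂‖ < K ∧ ‖a₃‖ < K ∧ ∀ w : ℂ, K ≤ ‖w‖ →
      |potentialExcess β₂ β₃ γ a₂ a₃ w| ≤ C * ‖w‖ ^ γ ∧
      ‖fderiv ℝ (potentialExcess β₂ β₃ γ a₂ a₃) w‖ ≤ C * ‖w‖ ^ (γ - 1) := by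
  obtain ⟨C, K₀, hC, hK₀, hfd⟩ := D.exists_fderiv_bound
  have hγ0 := D.pos
  set u := potentialExcess β₂ β₃ γ a₂ a₃ with hu
  set K := K₀ + ‖a₂‖ + ‖a₃‖ + 1 with hK
  have n2 := norm_nonneg a₂
  have n3 := norm_nonneg a₃
  have hK0 : 0 < K := by linarith
  have hne : ∀ w : ℂ, K ≤ ‖w‖ → w ≠ a₂ ∧ w ≠ a₃ ∧ w ≠ 0 := by
    intro w hw
    refine ⟨?_, ?_, ?_⟩ <;> rintro rfl
    · linarith
    · linarith
    · rw [norm_zero] at hw; linarith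
  have hdiff : ∀ w : ℂ, K ≤ ‖w‖ → ContDiffAt ℝ ∞ u w := fun w hw =>
    D.contDiffAt_potentialExcess (hne w hw).1 (hne w hw).2.1 (hne w hw).2.2
  obtain ⟨M, hM⟩ := (isCompact_sphere (0 : ℂ) K).exists_bound_of_continuousOn (f := u)
    fun w hw => (hdiff w (by simpa using hw.ge)).continuousAt.continuousWithinAt
  have hM0 : 0 ≤ M := by
    refine (norm_nonneg _).trans (hM (K : ℂ) ?_)
    simp [abs_of_pos hK0]
  refine ⟨C + M + C / γ, K, by positivity, by linarith, by linarith, by linarith, fun w hw => ?_⟩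
  have hw0 : 0 < ‖w‖ := by linarith
  constructor
  · -- the path `s ↦ (s/|w|) w`, for `K ≤ s ≤ |w|`
    set e : ℂ := w / ‖w‖ with he
    have hen : ‖e‖ = 1 := by
      rw [he, norm_div, norm_real, norm_norm, div_self hw0.ne']
    have hpath : ∀ s : ℝ, 0 ≤ s → ‖(s : ℂ) * e‖ = s := fun s hs => by
      rw [norm_mul, hen, mul_one, norm_real, norm_of_nonneg hs]
    have hder : ∀ s : ℝ, K ≤ s →
        HasDerivAt (fun s : ℝ => u (s * e)) (fderiv ℝ u (s * e) e) s := by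
      intro s hs
      have h1 : HasDerivAt (fun s : ℝ => (s : ℂ) * e) e s := by
        simpa using (ofRealCLM.hasDerivAt (x := s)).mul_const e
      have h2 := ((hdiff (s * e) (by rw [hpath s (by linarith)]; exact hs)).differentiableAt
        (by simp)).hasFDerivAt
      exact h2.comp_hasDerivAt s h1
    have hB : ∀ s : ℝ, K ≤ s →
        HasDerivAt (fun s : ℝ => M + C / γ * s ^ γ) (C * s ^ (γ - 1)) s := by
      intro s hs
      have := ((Real.hasDerivAt_rpow_const (p := γ) (x := s) (Or.inl (by linarith))).const_mul
        (C / γ)).const_add M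
      refine this.congr_deriv ?_
      rw [← mul_assoc, div_mul_cancel₀ _ hγ0.ne']
    have hmain := image_norm_le_of_norm_deriv_right_le_deriv_boundary' (a := K) (b := ‖w‖)
      (f := fun s : ℝ => u (s * e)) (f' := fun s => fderiv ℝ u (s * e) e)
      (B := fun s => M + C / γ * s ^ γ) (B' := fun s => C * s ^ (γ - 1))
      (fun s hs => (hder s hs.1).continuousAt.continuousWithinAt)
      (fun s hs => (hder s hs.1).hasDerivWithinAt) ?_
      (fun s hs => (hB s hs.1).continuousAt.continuousWithinAt)
      (fun s hs => (hB s hs.1).hasDerivWithinAt) ?_ (x := ‖w‖) ⟨hw, le_rfl⟩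
    · have hew : (‖w‖ : ℂ) * e = w := by
        have : (‖w‖ : ℂ) ≠ 0 := by exact_mod_cast hw0.ne'
        rw [he]; field_simp
      simp only [hew, norm_eq_abs] at hmain
      refine hmain.trans ?_
      have h1 : 1 ≤ ‖w‖ ^ γ := Real.one_le_rpow (by linarith) hγ0.le
      have h2 : M * 1 ≤ M * ‖w‖ ^ γ := by gcongr
      have h3 : 0 ≤ C * ‖w‖ ^ γ := by positivity
      rw [add_mul, add_mul]
      linarith
    · have h1 := hM (K * e) (by simp [hen, abs_of_pos hK0])
      have : 0 ≤ C / γ * K ^ γ := by positivity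
      linarith
    · intro s hs
      refine (ContinuousLinearMap.le_opNorm _ _).trans ?_
      rw [hen, mul_one]
      refine (hfd _ (by rw [hpath s (by linarith [hs.1])]; linarith [hs.1])).trans ?_
      rw [hpath s (by linarith [hs.1])]
  · refine (hfd w (by linarith)).trans ?_
    gcongr
    have : 0 ≤ C / γ := by positivity
    linarith

end

/-! ### Wirtinger calculus in two complex variables -/

/-- The real-linear form `v ↦ ∑ p_i v_i + ∑ q_i v̄_i` on `ℂ²`. -/
def wirt2 (p q : ℂ × ℂ) : ℂ × ℂ →L[ℝ] ℂ :=
  (wirt p.1 q.1).comp (ContinuousLinearMap.fst ℝ ℂ ℂ)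
    + (wirt p.2 q.2).comp (ContinuousLinearMap.snd ℝ ℂ ℂ)

@[simp] lemma wirt2_apply (p q v : ℂ × ℂ) :
    wirt2 p q v = (p.1 * v.1 + q.1 * star v.1) + (p.2 * v.2 + q.2 * star v.2) := by
  simp [wirt2]

lemma dz_eq {f : ℂ × ℂ → ℂ} {p q x : ℂ × ℂ} (h : HasFDerivAt f (wirt2 p q) x) (i : Fin 2) :
    dz i f x = coord i p := by
  fin_cases i
  · simp [dz, h.fderiv, coord, basisVec]
    linear_combination (-p.1 / 2 + q.1 / 2) * I_mul_I
  · simp [dz, h.fderiv, coord, basisVec]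
    linear_combination (-p.2 / 2 + q.2 / 2) * I_mul_I

lemma dzbar_eq {f : ℂ × ℂ → ℂ} {p q x : ℂ × ℂ} (h : HasFDerivAt f (wirt2 p q) x) (i : Fin 2) :
    dzbar i f x = coord i q := by
  fin_cases i
  · simp [dzbar, h.fderiv, coord, basisVec]
    linear_combination (p.1 / 2 - q.1 / 2) * I_mul_I
  · simp [dzbar, h.fderiv, coord, basisVec]
    linear_combination (p.2 / 2 - q.2 / 2) * I_mul_I

lemma hasFDerivAt_wirt2 {f : ℂ × ℂ → ℂ} {x : ℂ × ℂ} (h : DifferentiableAt ℝ f x) :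
    HasFDerivAt f (wirt2 (dz 0 f x, dz 1 f x) (dzbar 0 f x, dzbar 1 f x)) x := by
  convert h.hasFDerivAt using 1
  refine ContinuousLinearMap.ext fun v => ?_
  have hv : v = v.1.re • ((1, 0) : ℂ × ℂ) + v.1.im • (I • ((1, 0) : ℂ × ℂ))
      + (v.2.re • ((0, 1) : ℂ × ℂ) + v.2.im • (I • ((0, 1) : ℂ × ℂ))) := by
    apply Prod.ext <;> apply Complex.ext <;> simp
  have h1 : fderiv ℝ f x v = v.1.re • fderiv ℝ f x (1, 0)
      + v.1.im • fderiv ℝ f x (I • ((1, 0) : ℂ × ℂ))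
      + (v.2.re • fderiv ℝ f x (0, 1) + v.2.im • fderiv ℝ f x (I • ((0, 1) : ℂ × ℂ))) := by
    conv_lhs => rw [hv]
    simp only [map_add, map_smul]
  rw [h1, wirt2_apply]
  simp only [dz, dzbar, basisVec, Matrix.cons_val_zero, Matrix.cons_val_one]
  apply Complex.ext <;> simp <;> ring

lemma hasFDerivAt_wirt2_add {f g : ℂ × ℂ → ℂ} {p q p' q' x : ℂ × ℂ}
    (hf : HasFDerivAt f (wirt2 p q) x) (hg : HasFDerivAt g (wirt2 p' q') x) :
    HasFDerivAt (fun y => f y + g y) (wirt2 (p + p') (q + q')) x := by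
  refine (hf.add hg).congr_fderiv ?_
  refine ContinuousLinearMap.ext fun v => ?_
  simp
  ring

lemma hasFDerivAt_wirt2_mul {f g : ℂ × ℂ → ℂ} {p q p' q' x : ℂ × ℂ}
    (hf : HasFDerivAt f (wirt2 p q) x) (hg : HasFDerivAt g (wirt2 p' q') x) :
    HasFDerivAt (fun y => f y * g y) (wirt2 (f x • p' + g x • p) (f x • q' + g x • q)) x := by
  refine (hf.mul hg).congr_fderiv ?_
  refine ContinuousLinearMap.ext fun v => ?_
  simp
  ring

lemma hasFDerivAt_comp_fst {f : ℂ → ℂ} {p q : ℂ} {x : ℂ × ℂ} (hf : HasFDerivAt f (wirt p q) x.1) :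
    HasFDerivAt (fun y : ℂ × ℂ => f y.1) (wirt2 (p, 0) (q, 0)) x := by
  refine (hf.comp x (hasFDerivAt_fst (p := x))).congr_fderiv ?_
  refine ContinuousLinearMap.ext fun v => ?_
  simp

lemma hasFDerivAt_comp_snd {f : ℂ → ℂ} {p q : ℂ} {x : ℂ × ℂ} (hf : HasFDerivAt f (wirt p q) x.2) :
    HasFDerivAt (fun y : ℂ × ℂ => f y.2) (wirt2 (0, p) (0, q)) x := by
  refine (hf.comp x (hasFDerivAt_snd (p := x))).congr_fderiv ?_
  refine ContinuousLinearMap.ext fun v => ?_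
  simp

/-- Chain rule along a holomorphic curve in `ℂ²`. -/
lemma hasFDerivAt_comp_curve {f : ℂ × ℂ → ℂ} {G : ℂ → ℂ × ℂ} {p q v : ℂ × ℂ} {τ : ℂ}
    (hf : HasFDerivAt f (wirt2 p q) (G τ)) (hG : HasDerivAt G v τ) :
    HasFDerivAt (fun t => f (G t))
      (wirt (p.1 * v.1 + p.2 * v.2) (q.1 * star v.1 + q.2 * star v.2)) τ := by
  refine (hf.comp τ (hG.hasFDerivAt.restrictScalars ℝ)).congr_fderiv ?_
  ext t; simp
  ring

lemma apply_eq_smul_add {E : Type*} [NormedAddCommGroup E] [NormedSpace ℂ E] (L : ℂ × ℂ →L[ℂ] E)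
    (v : ℂ × ℂ) : L v = v.1 • L (1, 0) + v.2 • L (0, 1) := by
  rw [← map_smul, ← map_smul, ← map_add]
  congr 1
  apply Prod.ext <;> simp

/-- Chain rule for a holomorphic map of `ℂ²`. -/
lemma hasFDerivAt_comp_map {f : ℂ × ℂ → ℂ} {F : ℂ × ℂ → ℂ × ℂ} {p q x : ℂ × ℂ}
    {F' : ℂ × ℂ →L[ℂ] ℂ × ℂ} (hf : HasFDerivAt f (wirt2 p q) (F x)) (hF : HasFDerivAt F F' x) :
    HasFDerivAt (fun y => f (F y))
      (wirt2 (p.1 * (F' (1, 0)).1 + p.2 * (F' (1, 0)).2, p.1 * (F' (0, 1)).1 + p.2 * (F' (0, 1)).2)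
        (q.1 * star (F' (1, 0)).1 + q.2 * star (F' (1, 0)).2,
          q.1 * star (F' (0, 1)).1 + q.2 * star (F' (0, 1)).2)) x := by
  refine (hf.comp x (hF.restrictScalars ℝ)).congr_fderiv ?_
  refine ContinuousLinearMap.ext fun v => ?_
  simp [apply_eq_smul_add F' v]
  ring

lemma hasFDerivAt_holo2 {f : ℂ × ℂ → ℂ} {f' : ℂ × ℂ →L[ℂ] ℂ} {x : ℂ × ℂ}
    (h : HasFDerivAt f f' x) : HasFDerivAt f (wirt2 (f' (1, 0), f' (0, 1)) 0) x := by
  refine (h.restrictScalars ℝ).congr_fderiv ?_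
  refine ContinuousLinearMap.ext fun v => ?_
  simp [apply_eq_smul_add f' v]
  ring

lemma hasFDerivAt_antiholo2 {f : ℂ × ℂ → ℂ} {f' : ℂ × ℂ →L[ℂ] ℂ} {x : ℂ × ℂ}
    (h : HasFDerivAt f f' x) :
    HasFDerivAt (fun y => star (f y)) (wirt2 0 (star (f' (1, 0)), star (f' (0, 1)))) x := by
  have := (conjCLE : ℂ →L[ℝ] ℂ).hasFDerivAt.comp x (hasFDerivAt_holo2 h)
  refine this.congr_fderiv ?_
  refine ContinuousLinearMap.ext fun v => ?_
  simp

lemma contDiffAt_dz {f : ℂ × ℂ → ℂ} {x : ℂ × ℂ} (hf : ContDiffAt ℝ ∞ f x) (i : Fin 2) :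
    ContDiffAt ℝ ∞ (dz i f) x := by
  have h := hf.fderiv_right (m := ∞) (by simp)
  exact (((h.clm_apply contDiffAt_const).sub (contDiffAt_const.mul
    (h.clm_apply contDiffAt_const))).div_const 2)

lemma contDiffAt_dzbar {f : ℂ × ℂ → ℂ} {x : ℂ × ℂ} (hf : ContDiffAt ℝ ∞ f x) (i : Fin 2) :
    ContDiffAt ℝ ∞ (dzbar i f) x := by
  have h := hf.fderiv_right (m := ∞) (by simp)
  exact (((h.clm_apply contDiffAt_const).add (contDiffAt_const.mul
    (h.clm_apply contDiffAt_const))).div_const 2)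

lemma dz_congr {f g : ℂ × ℂ → ℂ} {x : ℂ × ℂ} (h : f =ᶠ[𝓝 x] g) (i : Fin 2) :
    dz i f x = dz i g x := by
  simp only [dz, h.fderiv_eq]

lemma dzbar_congr {f g : ℂ × ℂ → ℂ} {x : ℂ × ℂ} (h : f =ᶠ[𝓝 x] g) (i : Fin 2) :
    dzbar i f x = dzbar i g x := by
  simp only [dzbar, h.fderiv_eq]

lemma ddbar_congr {f g : ℂ × ℂ → ℝ} {x : ℂ × ℂ} (h : f =ᶠ[𝓝 x] g) : ddbar f x = ddbar g x := by
  ext i j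
  simp only [ddbar, Matrix.of_apply]
  refine dz_congr ?_ i
  filter_upwards [eventually_eventually_nhds.2 h] with y hy
  refine dzbar_congr ?_ j
  filter_upwards [hy] with y' hy'
  rw [hy']

/-- `∂²f/∂z_i∂z̄_j` in terms of the real second derivative. -/
lemma dz_dzbar_eq {f : ℂ × ℂ → ℂ} {x : ℂ × ℂ} (hf : ContDiffAt ℝ ∞ f x) (i j : Fin 2) :
    let D := fderiv ℝ (fderiv ℝ f) x
    let e := basisVec
    dz i (dzbar j f) x = (D (e i) (e j) + I * D (e i) (I • e j)
      - I * D (I • e i) (e j)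
      + D (I • e i) (I • e j)) / 4 := by
  intro D e
  have hd : HasFDerivAt (fderiv ℝ f) D x :=
    ((hf.fderiv_right (m := ∞) (by simp)).differentiableAt (by simp)).hasFDerivAt
  have h1 : HasFDerivAt (dzbar j f) ((2 : ℂ)⁻¹ • ((ContinuousLinearMap.apply ℝ ℂ (e j)).comp D
      + I • (ContinuousLinearMap.apply ℝ ℂ (I • e j)).comp D)) x := by
    have a1 := (ContinuousLinearMap.apply ℝ ℂ (e j)).hasFDerivAt.comp x hd
    have a2 := (ContinuousLinearMap.apply ℝ ℂ (I • e j)).hasFDerivAt.comp x hd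
    have := (a1.add (a2.const_mul I)).const_mul (2 : ℂ)⁻¹
    refine this.congr_of_eventuallyEq (Eventually.of_forall fun y => ?_)
    simp only [dzbar, div_eq_inv_mul]
    rfl
  rw [dz, h1.fderiv]
  simp only [smul_apply, add_apply,
    ContinuousLinearMap.comp_apply, ContinuousLinearMap.apply_apply, smul_eq_mul]
  linear_combination (-(1 / 4) * D (I • e i) (I • e j)) * I_mul_I

lemma isSymm_fderiv {f : ℂ × ℂ → ℂ} {x : ℂ × ℂ} (hf : ContDiffAt ℝ ∞ f x) (u v : ℂ × ℂ) :
    fderiv ℝ (fderiv ℝ f) x u v = fderiv ℝ (fderiv ℝ f) x v u :=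
  (hf.isSymmSndFDerivAt (by
    rw [minSmoothness_of_isRCLikeNormedField]
    exact WithTop.coe_le_coe.2 (le_top : (2 : ℕ∞) ≤ ⊤))).eq u v

lemma dz_dz_comm {f : ℂ × ℂ → ℂ} {x : ℂ × ℂ} (hf : ContDiffAt ℝ ∞ f x) (i j : Fin 2) :
    dz i (dz j f) x = dz j (dz i f) x := by
  have hd : HasFDerivAt (fderiv ℝ f) (fderiv ℝ (fderiv ℝ f) x) x :=
    ((hf.fderiv_right (m := ∞) (by simp)).differentiableAt (by simp)).hasFDerivAt
  set D := fderiv ℝ (fderiv ℝ f) x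
  have key : ∀ j, HasFDerivAt (dz j f) ((2 : ℂ)⁻¹ •
      ((ContinuousLinearMap.apply ℝ ℂ (basisVec j)).comp D
      - I • (ContinuousLinearMap.apply ℝ ℂ (I • basisVec j)).comp D)) x := by
    intro j
    have a1 := (ContinuousLinearMap.apply ℝ ℂ (basisVec j)).hasFDerivAt.comp x hd
    have a2 := (ContinuousLinearMap.apply ℝ ℂ (I • basisVec j)).hasFDerivAt.comp x hd
    have := (a1.sub (a2.const_mul I)).const_mul (2 : ℂ)⁻¹
    refine this.congr_of_eventuallyEq (Eventually.of_forall fun y => ?_)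
    simp only [dz, div_eq_inv_mul]
    rfl
  rw [dz, (key j).fderiv, dz, (key i).fderiv]
  simp only [smul_apply, sub_apply,
    ContinuousLinearMap.comp_apply, ContinuousLinearMap.apply_apply, smul_eq_mul]
  have s := isSymm_fderiv hf
  rw [show D (basisVec j) (basisVec i) = D (basisVec i) (basisVec j) from s _ _,
    show D (basisVec j) (I • basisVec i) = D (I • basisVec i) (basisVec j) from
      s _ _,
    show D (I • basisVec j) (basisVec i) = D (basisVec i) (I • basisVec j) from
      s _ _,
    show D (I • basisVec j) (I • basisVec i)
      = D (I • basisVec i) (I • basisVec j) from s _ _]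
  ring

/-- The form `i∂∂̄ψ` of a smooth function is smooth, Hermitian and closed; so it is a Kähler metric
wherever it is positive. -/
theorem isKahlerOn_ddbar {ψ : ℂ × ℂ → ℝ} {V : Set (ℂ × ℂ)}
    (hψ : ∀ x ∈ V, ContDiffAt ℝ ∞ ψ x)
    (hpos : ∀ x ∈ V, ∀ v : ℂ × ℂ, v ≠ 0 → 0 < normSq (ddbar ψ) x v) :
    IsKahlerOn (ddbar ψ) V where
  smooth i j x hx :=
    (contDiffAt_dz (contDiffAt_dzbar (contDiffAt_ofReal (hψ x hx)) j) i).contDiffWithinAt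
  pos := hpos
  closed x hx i j k := dz_dz_comm (contDiffAt_dzbar (contDiffAt_ofReal (hψ x hx)) j) k i
  hermitian x hx := by
    have hs := hψ x hx
    ext i j
    simp only [Matrix.conjTranspose_apply, ddbar, Matrix.of_apply]
    rw [dz_dzbar_eq (contDiffAt_ofReal hs), dz_dzbar_eq (contDiffAt_ofReal hs)]
    have hreal : ∀ u v : ℂ × ℂ, star (fderiv ℝ (fderiv ℝ fun y => (ψ y : ℂ)) x u v)
        = fderiv ℝ (fderiv ℝ fun y => (ψ y : ℂ)) x v u := by
      intro u v
      have h1 : fderiv ℝ (fun y => (ψ y : ℂ)) =ᶠ[𝓝 x]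
          fun y => (ContinuousLinearMap.compL ℝ (ℂ × ℂ) ℝ ℂ ofRealCLM) (fderiv ℝ ψ y) := by
        filter_upwards [eventually_differentiableAt hs] with y hy
        exact (ofRealCLM.hasFDerivAt.comp y hy.hasFDerivAt).fderiv
      have h2 : HasFDerivAt (fderiv ℝ ψ) (fderiv ℝ (fderiv ℝ ψ) x) x :=
        ((hs.fderiv_right (m := ∞) (by simp)).differentiableAt (by simp)).hasFDerivAt
      have h3 : fderiv ℝ (fderiv ℝ fun y => (ψ y : ℂ)) x u v
          = ((fderiv ℝ (fderiv ℝ ψ) x u v : ℝ) : ℂ) := by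
        have h4 := ((ContinuousLinearMap.compL ℝ (ℂ × ℂ) ℝ ℂ
          ofRealCLM).hasFDerivAt.comp x h2).fderiv
        rw [h1.fderiv_eq]
        exact congrArg (fun L : ℂ × ℂ →L[ℝ] ℂ × ℂ →L[ℝ] ℂ => L u v) h4
      rw [isSymm_fderiv (contDiffAt_ofReal hs) v u, h3]
      simp
    simp only [star_div₀, star_add, star_sub, star_mul', hreal]
    simp only [star_def, Complex.conj_I, map_ofNat]
    ring

/-- The Levi form along a holomorphic curve is the `∂∂̄` of the restriction to the curve. -/
theorem normSq_ddbar_curve {ψ : ℂ × ℂ → ℝ} {G : ℂ → ℂ × ℂ} (hψ : ContDiffAt ℝ ∞ ψ (G 0))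
    (hG : AnalyticAt ℂ G 0) :
    normSq (ddbar ψ) (G 0) (deriv G 0) = (dzeta (dzetabar fun τ => (ψ (G τ) : ℂ)) 0).re := by
  have hs := contDiffAt_ofReal hψ
  set f : ℂ × ℂ → ℂ := fun y => (ψ y : ℂ)
  have hd : ∀ᶠ τ in 𝓝 (0 : ℂ), HasDerivAt G (deriv G τ) τ := by
    filter_upwards [hG.eventually_analyticAt] with τ h using h.differentiableAt.hasDerivAt
  have hev : dzetabar (fun τ => f (G τ)) =ᶠ[𝓝 0] fun τ =>
      dzbar 0 f (G τ) * star (deriv G τ).1 + dzbar 1 f (G τ) * star (deriv G τ).2 := by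
    filter_upwards [hd, hG.continuousAt.eventually (eventually_differentiableAt hs)] with τ h1 h2
    rw [dzetabar_eq (hasFDerivAt_comp_curve (hasFDerivAt_wirt2 h2) h1)]
  have hG' : HasDerivAt (deriv G) (deriv (deriv G) 0) 0 := hG.deriv.differentiableAt.hasDerivAt
  have hG1 : HasDerivAt (fun τ => (deriv G τ).1) (deriv (deriv G) 0).1 0 :=
    hG'.hasFDerivAt.fst.hasDerivAt.congr_deriv (by simp)
  have hG2 : HasDerivAt (fun τ => (deriv G τ).2) (deriv (deriv G) 0).2 0 :=
    hG'.hasFDerivAt.snd.hasDerivAt.congr_deriv (by simp)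
  have hb : ∀ i, HasFDerivAt (fun τ => dzbar i f (G τ)) _ 0 := fun i =>
    hasFDerivAt_comp_curve (hasFDerivAt_wirt2
      ((contDiffAt_dzbar hs i).differentiableAt (by simp))) hd.self_of_nhds
  rw [dzeta_congr hev, dzeta_eq (hasFDerivAt_wirt_add
    (hasFDerivAt_wirt_mul (hb 0) (hasFDerivAt_antiholo hG1))
    (hasFDerivAt_wirt_mul (hb 1) (hasFDerivAt_antiholo hG2))), normSq]
  congr 1
  simp only [Fin.sum_univ_two, coord, Matrix.cons_val_zero, Matrix.cons_val_one, ddbar,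
    Matrix.of_apply, f]
  ring

/-- `i∂∂̄` commutes with the pull-back by a holomorphic map. -/
theorem pullback_ddbar {ψ : ℂ × ℂ → ℝ} {F : ℂ × ℂ → ℂ × ℂ} {x : ℂ × ℂ}
    (hψ : ContDiffAt ℝ ∞ ψ (F x)) (hF : ContDiffAt ℂ 2 F x) :
    pullback F (ddbar ψ) x = ddbar (fun y => ψ (F y)) x := by
  have hs := contDiffAt_ofReal hψ
  set f : ℂ × ℂ → ℂ := fun y => (ψ y : ℂ)
  have hd : ∀ᶠ y in 𝓝 x, HasFDerivAt F (fderiv ℂ F y) y := by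
    filter_upwards [hF.eventually (by simp)] with y h
    exact (h.differentiableAt (by simp)).hasFDerivAt
  have hF' : HasFDerivAt (fderiv ℂ F) (fderiv ℂ (fderiv ℂ F) x) x :=
    ((hF.fderiv_right (m := 1) (by norm_num)).differentiableAt (by simp)).hasFDerivAt
  have hcomp : ∀ l j, ∃ L, HasFDerivAt (fun y => coord l (fderiv ℂ F y (basisVec j)))
      (L : ℂ × ℂ →L[ℂ] ℂ) x := by
    intro l j
    have h1 := (ContinuousLinearMap.apply ℂ (ℂ × ℂ) (basisVec j)).hasFDerivAt.comp x hF'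
    fin_cases l
    · exact ⟨_, (ContinuousLinearMap.fst ℂ ℂ ℂ).hasFDerivAt.comp x h1⟩
    · exact ⟨_, (ContinuousLinearMap.snd ℂ ℂ ℂ).hasFDerivAt.comp x h1⟩
  have hev : ∀ j, dzbar j (fun y => f (F y)) =ᶠ[𝓝 x] fun y =>
      dzbar 0 f (F y) * star (coord 0 (fderiv ℂ F y (basisVec j)))
        + dzbar 1 f (F y) * star (coord 1 (fderiv ℂ F y (basisVec j))) := by
    intro j
    filter_upwards [hd, hF.continuousAt.eventually (eventually_differentiableAt hs)] with y h1 h2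
    rw [dzbar_eq (hasFDerivAt_comp_map (hasFDerivAt_wirt2 h2) h1)]
    fin_cases j <;> simp [coord, basisVec]
  have hb : ∀ i, HasFDerivAt (fun y => dzbar i f (F y)) _ x := fun i =>
    hasFDerivAt_comp_map (hasFDerivAt_wirt2
      ((contDiffAt_dzbar hs i).differentiableAt (by simp))) hd.self_of_nhds
  ext i j
  obtain ⟨L0, h0⟩ := hcomp 0 j
  obtain ⟨L1, h1⟩ := hcomp 1 j
  rw [show ddbar (fun y => ψ (F y)) x i j = dz i (dzbar j fun y => f (F y)) x from rfl,
    dz_congr (hev j), dz_eq (hasFDerivAt_wirt2_add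
    (hasFDerivAt_wirt2_mul (hb 0) (hasFDerivAt_antiholo2 h0))
    (hasFDerivAt_wirt2_mul (hb 1) (hasFDerivAt_antiholo2 h1)))]
  simp only [pullback, jacobian, Matrix.mul_apply, Fin.sum_univ_two, Matrix.transpose_apply,
    Matrix.map_apply, Matrix.of_apply, ddbar]
  fin_cases i <;> simp [coord, basisVec, f] <;> ring

lemma normSq_pullback (F : ℂ × ℂ → ℂ × ℂ) (g : HermField) (x v : ℂ × ℂ) :
    normSq (pullback F g) x v = normSq g (F x) (fderiv ℂ F x v) := by
  rw [normSq, normSq, apply_eq_smul_add (fderiv ℂ F x) v]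
  congr 1
  simp [pullback, jacobian, Matrix.mul_apply, Fin.sum_univ_two, coord, basisVec]
  ring

/-- The form `i∂∂̄ (A(z₂) + B(z₂) C(z₁))`. -/
lemma ddbar_add_mul {A B C : ℂ → ℝ} {x : ℂ × ℂ} (hA : ContDiffAt ℝ ∞ A x.2)
    (hB : ContDiffAt ℝ ∞ B x.2) (hC : ContDiffAt ℝ ∞ C x.1) :
    ddbar (fun y => A y.2 + B y.2 * C y.1) x = !![
      B x.2 * dzeta (dzetabar fun t => (C t : ℂ)) x.1,
      dzetabar (fun t => (B t : ℂ)) x.2 * dzeta (fun t => (C t : ℂ)) x.1;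
      dzeta (fun t => (B t : ℂ)) x.2 * dzetabar (fun t => (C t : ℂ)) x.1,
      dzeta (dzetabar fun t => (A t : ℂ)) x.2 + C x.1 * dzeta (dzetabar fun t => (B t : ℂ)) x.2] := by
  have sA := contDiffAt_ofReal hA
  have sB := contDiffAt_ofReal hB
  have sC := contDiffAt_ofReal hC
  set a : ℂ → ℂ := fun t => (A t : ℂ)
  set b : ℂ → ℂ := fun t => (B t : ℂ)
  set c : ℂ → ℂ := fun t => (C t : ℂ)
  have c1 : ContinuousAt (fun y : ℂ × ℂ => y.1) x := continuousAt_fst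
  have c2 : ContinuousAt (fun y : ℂ × ℂ => y.2) x := continuousAt_snd
  have hev : ∀ᶠ y in 𝓝 x, HasFDerivAt (fun y : ℂ × ℂ => ((A y.2 + B y.2 * C y.1 : ℝ) : ℂ))
      (wirt2 ((0, dzeta a y.2) + (b y.2 • (dzeta c y.1, 0) + c y.1 • (0, dzeta b y.2)))
        ((0, dzetabar a y.2) + (b y.2 • (dzetabar c y.1, 0) + c y.1 • (0, dzetabar b y.2)))) y := by
    filter_upwards [c2.eventually (eventually_differentiableAt sA),
      c2.eventually (eventually_differentiableAt sB),
      c1.eventually (eventually_differentiableAt sC)] with y h1 h2 h3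
    have := hasFDerivAt_wirt2_add (hasFDerivAt_comp_snd (hasFDerivAt_wirt h1))
      (hasFDerivAt_wirt2_mul (hasFDerivAt_comp_snd (hasFDerivAt_wirt h2))
        (hasFDerivAt_comp_fst (hasFDerivAt_wirt h3)))
    refine this.congr_of_eventuallyEq (Eventually.of_forall fun y => ?_)
    simp [a, b, c]
  have e0 : dzbar 0 (fun y : ℂ × ℂ => ((A y.2 + B y.2 * C y.1 : ℝ) : ℂ)) =ᶠ[𝓝 x]
      fun y => b y.2 * dzetabar c y.1 := by
    filter_upwards [hev] with y hy
    rw [dzbar_eq hy]; simp [coord]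
  have e1 : dzbar 1 (fun y : ℂ × ℂ => ((A y.2 + B y.2 * C y.1 : ℝ) : ℂ)) =ᶠ[𝓝 x]
      fun y => dzetabar a y.2 + c y.1 * dzetabar b y.2 := by
    filter_upwards [hev] with y hy
    rw [dzbar_eq hy]; simp [coord]
  have w : ∀ {f : ℂ → ℂ} {t : ℂ}, ContDiffAt ℝ ∞ f t →
      HasFDerivAt f (wirt (dzeta f t) (dzetabar f t)) t :=
    fun h => hasFDerivAt_wirt (h.differentiableAt (by simp))
  have d0 := hasFDerivAt_wirt2_mul (hasFDerivAt_comp_snd (w sB))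
    (hasFDerivAt_comp_fst (w (contDiffAt_dzetabar sC)))
  have d1 := hasFDerivAt_wirt2_add (hasFDerivAt_comp_snd (w (contDiffAt_dzetabar sA)))
    (hasFDerivAt_wirt2_mul (hasFDerivAt_comp_fst (w sC))
      (hasFDerivAt_comp_snd (w (contDiffAt_dzetabar sB))))
  ext i j
  fin_cases i <;> fin_cases j <;>
    simp only [ddbar, Matrix.of_apply, Fin.mk_zero, Fin.mk_one, Fin.isValue]
  · rw [dz_congr e0, dz_eq d0]; simp [coord, b]
  · rw [dz_congr e1, dz_eq d1]; simp [coord, mul_comm]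
  · rw [dz_congr e0, dz_eq d0]; simp [coord, mul_comm]
  · rw [dz_congr e1, dz_eq d1]; simp [coord, c]

section

/-! ### The Levi form of products and compositions in one variable -/

/-- The function `∂²f/∂ζ∂ζ̄` of a real function, as a real number. -/
def lap (f : ℂ → ℝ) (x : ℂ) : ℝ := (dzeta (dzetabar fun t => (f t : ℂ)) x).re

/-- The Wirtinger derivative `∂f/∂ζ` of a real function. -/
def grad (f : ℂ → ℝ) (x : ℂ) : ℂ := dzeta (fun t => (f t : ℂ)) x

lemma dzetabar_ofReal {f : ℂ → ℝ} {x : ℂ} (h : DifferentiableAt ℝ f x) :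
    dzetabar (fun t => (f t : ℂ)) x = star (grad f x) := by
  have h1 : HasFDerivAt (fun t => (f t : ℂ)) (ofRealCLM.comp (fderiv ℝ f x)) x :=
    ofRealCLM.hasFDerivAt.comp x h.hasFDerivAt
  simp [dzetabar, grad, dzeta, h1.fderiv]

lemma norm_grad_le {f : ℂ → ℝ} {x : ℂ} (h : DifferentiableAt ℝ f x) :
    ‖grad f x‖ ≤ ‖fderiv ℝ f x‖ := by
  have h1 : HasFDerivAt (fun t => (f t : ℂ)) (ofRealCLM.comp (fderiv ℝ f x)) x :=
    ofRealCLM.hasFDerivAt.comp x h.hasFDerivAt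
  have a1 : |fderiv ℝ f x 1| ≤ ‖fderiv ℝ f x‖ := by
    simpa using (fderiv ℝ f x).le_opNorm 1
  have a2 : |fderiv ℝ f x I| ≤ ‖fderiv ℝ f x‖ := by
    simpa using (fderiv ℝ f x).le_opNorm I
  rw [grad, dzeta, h1.fderiv, norm_div]
  have h2 := norm_sub_le ((fderiv ℝ f x 1 : ℝ) : ℂ) (I * ((fderiv ℝ f x I : ℝ) : ℂ))
  rw [norm_mul, Complex.norm_I, one_mul, norm_real, norm_real,
    norm_eq_abs, norm_eq_abs] at h2
  simp only [ContinuousLinearMap.comp_apply, Complex.ofRealCLM_apply]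
  rw [show ‖(2 : ℂ)‖ = 2 by simp, div_le_iff₀ (by norm_num)]
  linarith

lemma grad_congr {f g : ℂ → ℝ} {x : ℂ} (h : f =ᶠ[𝓝 x] g) : grad f x = grad g x :=
  dzeta_congr (by filter_upwards [h] with y hy; rw [hy])

lemma lap_congr {f g : ℂ → ℝ} {x : ℂ} (h : f =ᶠ[𝓝 x] g) : lap f x = lap g x := by
  rw [lap, lap, dzeta_congr (dzetabar_eventuallyEq _)]
  filter_upwards [h] with y hy
  rw [hy]

lemma hasFDerivAt_grad {f : ℂ → ℝ} {x : ℂ} (h : DifferentiableAt ℝ f x) :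
    HasFDerivAt (fun t => (f t : ℂ)) (wirt (grad f x) (star (grad f x))) x := by
  rw [← dzetabar_ofReal h]
  exact hasFDerivAt_wirt (ofRealCLM.hasFDerivAt.comp x h.hasFDerivAt).differentiableAt

lemma grad_mul {f g : ℂ → ℝ} {x : ℂ} (hf : DifferentiableAt ℝ f x) (hg : DifferentiableAt ℝ g x) :
    grad (fun t => f t * g t) x = f x * grad g x + g x * grad f x := by
  have := hasFDerivAt_wirt_mul (hasFDerivAt_grad hf) (hasFDerivAt_grad hg)
  simp_rw [← Complex.ofReal_mul] at this
  exact dzeta_eq this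

lemma grad_add {f g : ℂ → ℝ} {x : ℂ} (hf : DifferentiableAt ℝ f x) (hg : DifferentiableAt ℝ g x) :
    grad (fun t => f t + g t) x = grad f x + grad g x := by
  have := hasFDerivAt_wirt_add (hasFDerivAt_grad hf) (hasFDerivAt_grad hg)
  simp_rw [← Complex.ofReal_add] at this
  exact dzeta_eq this

lemma lap_add {f g : ℂ → ℝ} {x : ℂ} (hf : ContDiffAt ℝ ∞ f x) (hg : ContDiffAt ℝ ∞ g x) :
    lap (fun t => f t + g t) x = lap f x + lap g x := by
  rw [lap, lap, lap, ← Complex.add_re, ← dzeta_dzetabar_add (contDiffAt_ofReal hf)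
    (contDiffAt_ofReal hg)]
  simp_rw [Complex.ofReal_add]

lemma lap_mul {f g : ℂ → ℝ} {x : ℂ} (hf : ContDiffAt ℝ ∞ f x) (hg : ContDiffAt ℝ ∞ g x) :
    lap (fun t => f t * g t) x
      = f x * lap g x + g x * lap f x + 2 * (grad f x * star (grad g x)).re := by
  have hev : dzetabar (fun t => ((f t * g t : ℝ) : ℂ)) =ᶠ[𝓝 x] fun t =>
      (f t : ℂ) * dzetabar (fun t => (g t : ℂ)) t + (g t : ℂ) * dzetabar (fun t => (f t : ℂ)) t := by
    filter_upwards [eventually_differentiableAt hf, eventually_differentiableAt hg] with t h1 h2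
    have := hasFDerivAt_wirt_mul (hasFDerivAt_grad h1) (hasFDerivAt_grad h2)
    simp_rw [← Complex.ofReal_mul] at this
    rw [dzetabar_eq this, dzetabar_ofReal h1, dzetabar_ofReal h2]
  have w : ∀ {f : ℂ → ℂ}, ContDiffAt ℝ ∞ f x →
      HasFDerivAt f (wirt (dzeta f x) (dzetabar f x)) x :=
    fun h => hasFDerivAt_wirt (h.differentiableAt (by simp))
  have hf' := hf.differentiableAt (by simp : (∞ : WithTop ℕ∞) ≠ 0)
  have hg' := hg.differentiableAt (by simp : (∞ : WithTop ℕ∞) ≠ 0)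
  rw [lap, dzeta_congr hev, dzeta_eq (hasFDerivAt_wirt_add
    (hasFDerivAt_wirt_mul (hasFDerivAt_grad hf')
      (w (contDiffAt_dzetabar (contDiffAt_ofReal hg))))
    (hasFDerivAt_wirt_mul (hasFDerivAt_grad hg')
      (w (contDiffAt_dzetabar (contDiffAt_ofReal hf))))), dzetabar_ofReal hf', dzetabar_ofReal hg']
  simp only [Complex.add_re, re_ofReal_mul, lap]
  simp only [Complex.mul_re, star_def, Complex.conj_re, Complex.conj_im]
  ring

lemma hasFDerivAt_wirt_comp {f g : ℂ → ℂ} {p q g' x : ℂ} (hf : HasFDerivAt f (wirt p q) (g x))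
    (hg : HasDerivAt g g' x) :
    HasFDerivAt (fun t => f (g t)) (wirt (p * g') (q * star g')) x := by
  refine (hf.comp x (hg.hasFDerivAt.restrictScalars ℝ)).congr_fderiv ?_
  ext v; simp; ring

lemma grad_comp {f : ℂ → ℝ} {g : ℂ → ℂ} {g' x : ℂ} (hf : DifferentiableAt ℝ f (g x))
    (hg : HasDerivAt g g' x) : grad (fun t => f (g t)) x = grad f (g x) * g' :=
  dzeta_eq (hasFDerivAt_wirt_comp (hasFDerivAt_grad hf) hg)

lemma lap_comp {f : ℂ → ℝ} {g : ℂ → ℂ} {g' x : ℂ} (hf : ContDiffAt ℝ ∞ f (g x))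
    (hg : AnalyticAt ℂ g x) (hg' : HasDerivAt g g' x) :
    lap (fun t => f (g t)) x = ‖g'‖ ^ 2 * lap f (g x) := by
  have hd : ∀ᶠ t in 𝓝 x, HasDerivAt g (deriv g t) t := by
    filter_upwards [hg.eventually_analyticAt] with τ h using h.differentiableAt.hasDerivAt
  have hev : dzetabar (fun t => (f (g t) : ℂ)) =ᶠ[𝓝 x] fun t =>
      dzetabar (fun t => (f t : ℂ)) (g t) * star (deriv g t) := by
    filter_upwards [hd, hg.continuousAt.eventually (eventually_differentiableAt hf)] with t h1 h2
    rw [dzetabar_eq (hasFDerivAt_wirt_comp (hasFDerivAt_grad h2) h1), dzetabar_ofReal h2]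
  have h1 := hasFDerivAt_wirt_comp (hasFDerivAt_wirt
    ((contDiffAt_dzetabar (contDiffAt_ofReal hf)).differentiableAt (by simp))) hd.self_of_nhds
  rw [lap, dzeta_congr hev, dzeta_eq (hasFDerivAt_wirt_mul h1
    (hasFDerivAt_antiholo hg.deriv.differentiableAt.hasDerivAt)), hg'.deriv, mul_zero, zero_add,
    show star g' * (dzeta (dzetabar fun t => (f t : ℂ)) (g x) * g')
      = ((‖g'‖ ^ 2 : ℝ) : ℂ) * dzeta (dzetabar fun t => (f t : ℂ)) (g x) by
        rw [Complex.ofReal_pow, ← Complex.mul_conj', star_def]; ring,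
    re_ofReal_mul, lap]

lemma contDiffAt_norm_rpow (s : ℝ) {x : ℂ} (hx : x ≠ 0) :
    ContDiffAt ℝ ∞ (fun y : ℂ => ‖y‖ ^ s) x :=
  ContDiffAt.rpow_const_of_ne (contDiffAt_id.norm ℝ hx) (norm_ne_zero_iff.2 hx)

lemma dzeta_dzetabar_norm_rpow (s : ℝ) {x : ℂ} (hx : x ≠ 0) :
    dzeta (dzetabar fun y : ℂ => ((‖y‖ ^ (2 * s) : ℝ) : ℂ)) x
      = ((s ^ 2 * ‖x‖ ^ (2 * s - 2) : ℝ) : ℂ) := by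
  have := laplacian_rpow_mul_normSq (p := 0) (R := ‖x‖ + 1) (β := s) (H := fun _ => s)
      (K := fun _ => 1) (by fun_prop) (by simp) (ζ := x) (by simp) hx
  simp only [star_one, mul_one, sub_zero] at this
  rw [this]
  congr 1
  rw [norm_real, norm_eq_abs, sq_abs, mul_comm]

lemma lap_norm_rpow (s : ℝ) {x : ℂ} (hx : x ≠ 0) :
    lap (fun y : ℂ => ‖y‖ ^ (2 * s)) x = s ^ 2 * ‖x‖ ^ (2 * s - 2) := by
  rw [lap, dzeta_dzetabar_norm_rpow s hx, Complex.ofReal_re]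

lemma grad_norm_sub_rpow (b : ℂ) (s : ℝ) {x : ℂ} (hx : x ≠ b) :
    grad (fun y : ℂ => ‖y - b‖ ^ (2 * s)) x = (s * ‖x - b‖ ^ (2 * s - 2) : ℝ) * star (x - b) := by
  have h0 : 0 < ‖x - b‖ := norm_pos_iff.2 (sub_ne_zero.2 hx)
  have e : ∀ (y : ℂ) (p : ℝ), (‖y - b‖ ^ 2 + 0) ^ p = ‖y - b‖ ^ (2 * p) := fun y p => by
    rw [add_zero, ← rpow_natCast, ← rpow_mul (norm_nonneg _)]; norm_num
  have h := hasFDerivAt_rpow_normSq_sub b 0 s x (by positivity)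
  simp_rw [e] at h
  rw [grad, dzeta_eq h]
  congr 4; ring

lemma grad_norm_rpow (s : ℝ) {x : ℂ} (hx : x ≠ 0) :
    grad (fun y : ℂ => ‖y‖ ^ (2 * s)) x = (s * ‖x‖ ^ (2 * s - 2) : ℝ) * star x := by
  simpa using grad_norm_sub_rpow 0 s hx

/-- Derivatives of a function of a real-linear function. -/
lemma grad_lap_comp_re {X : ℝ → ℝ} (hX : ContDiff ℝ ∞ X) (m : ℂ) (c : ℝ) (x : ℂ) :
    ContDiffAt ℝ ∞ (fun τ : ℂ => X ((τ * m).re + c)) x ∧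
    grad (fun τ : ℂ => X ((τ * m).re + c)) x = (deriv X ((x * m).re + c) : ℝ) * (m / 2) ∧
    lap (fun τ : ℂ => X ((τ * m).re + c)) x
      = deriv (deriv X) ((x * m).re + c) * (‖m‖ ^ 2 / 4) := by
  have hlin : ∀ y : ℂ, HasFDerivAt (fun τ : ℂ => (((τ * m).re + c : ℝ) : ℂ))
      (wirt (m / 2) (star m / 2)) y := by
    intro y
    have h1 : HasFDerivAt (fun τ : ℂ => (m / 2) * τ + (star m / 2) * star τ + c)
        (wirt (m / 2) (star m / 2)) y := by
      have := (wirt (m / 2) (star m / 2)).hasFDerivAt (x := y)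
      refine (this.add_const (c : ℂ)).congr_of_eventuallyEq (Eventually.of_forall fun τ => ?_)
      simp
    refine h1.congr_of_eventuallyEq (Eventually.of_forall fun τ => ?_)
    apply Complex.ext <;> simp <;> ring
  have hd : ∀ {Y : ℝ → ℝ}, ContDiff ℝ ∞ Y → ∀ y, HasFDerivAt
      (fun τ : ℂ => ((Y ((τ * m).re + c) : ℝ) : ℂ))
      (wirt ((deriv Y ((y * m).re + c) : ℝ) * (m / 2))
        ((deriv Y ((y * m).re + c) : ℝ) * (star m / 2))) y := by
    intro Y hY y
    have := hasFDerivAt_ofReal_comp (hlin y)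
      ((hY.differentiable (by simp)) ((y * m).re + c)).hasDerivAt
    rwa [wirt_smul] at this
  have hre : ContDiff ℝ ∞ fun τ : ℂ => (τ * m).re + c :=
    (Complex.reCLM.contDiff.comp (contDiff_id.mul contDiff_const)).add contDiff_const
  refine ⟨(hX.comp hre).contDiffAt, dzeta_eq (hd hX x), ?_⟩
  have hX' : ContDiff ℝ ∞ (deriv X) := hX.deriv'
  have hev : dzetabar (fun τ : ℂ => ((X ((τ * m).re + c) : ℝ) : ℂ)) = fun τ =>
      ((deriv X ((τ * m).re + c) : ℝ) : ℂ) * (star m / 2) := by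
    ext τ; exact dzetabar_eq (hd hX τ)
  rw [lap, hev, dzeta_eq (hasFDerivAt_wirt_mul (hd hX' x)
    (hasFDerivAt_holo (hasDerivAt_const x (star m / 2)))), mul_zero, zero_add]
  have : star m / 2 * ((deriv (deriv X) ((x * m).re + c) : ℝ) * (m / 2))
      = ((deriv (deriv X) ((x * m).re + c) * (‖m‖ ^ 2 / 4) : ℝ) : ℂ) := by
    push_cast
    rw [← Complex.mul_conj', star_def]; ring
  rw [this, Complex.ofReal_re]

/-! ### The glued potential -/

/-- The hypotheses on the glued potential: the data of the flat metric, an angle `β₁ < γ`, an exponent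
`1 < α₀ < γ / β₁` and a partition of unity `χ₁ + χ₂ = 1`. -/
structure GlueData (β₁ β₂ β₃ γ α₀ : ℝ) (a₂ a₃ : ℂ) (χ₁ χ₂ : ℝ → ℝ) : Prop
    extends FlatData β₂ β₃ γ a₂ a₃ where
  pos₁ : 0 < β₁
  lt_γ : β₁ < γ
  one_lt : 1 < α₀
  mul_lt : α₀ * β₁ < γ
  smooth : ContDiff ℝ ∞ χ₂
  sum : ∀ s, χ₁ s + χ₂ s = 1
  eq_one : ∀ s, 2 < s → χ₁ s = 1
  eq_one' : ∀ s, s < 1 → χ₂ s = 1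

variable {β₁ β₂ β₃ γ α₀ : ℝ} {a₂ a₃ : ℂ} {χ₁ χ₂ : ℝ → ℝ}

/-- The glued potential attached to the data. -/
abbrev GlueData.pot (_ : GlueData β₁ β₂ β₃ γ α₀ a₂ a₃ χ₁ χ₂) : ℂ × ℂ → ℝ :=
  gluedPotential β₁ β₂ β₃ γ α₀ a₂ a₃ χ₁ χ₂

/-- The quotient `R r^(-α₀)`. -/
def ratio (β₁ γ α₀ : ℝ) (x : ℂ × ℂ) : ℝ := ‖x.2‖ ^ γ * (‖x.1‖ ^ β₁) ^ (-α₀)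

/-- The difference `χ₂ |z|^(2γ) (φ(w/z) - |w/z|^(2γ))` of the glued potential and the potential
of the cone. -/
def correction (β₁ β₂ β₃ γ α₀ : ℝ) (a₂ a₃ : ℂ) (χ₂ : ℝ → ℝ) (x : ℂ × ℂ) : ℝ :=
  χ₂ (ratio β₁ γ α₀ x) * (‖x.1‖ ^ (2 * γ) * potentialExcess β₂ β₃ γ a₂ a₃ (x.2 / x.1))

variable (D : GlueData β₁ β₂ β₃ γ α₀ a₂ a₃ χ₁ χ₂)

lemma GlueData.pot_eq {x : ℂ × ℂ} (hx : x.1 ≠ 0) :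
    D.pot x = ‖x.1‖ ^ (2 * β₁) + ‖x.2‖ ^ (2 * γ) + correction β₁ β₂ β₃ γ α₀ a₂ a₃ χ₂ x := by
  have h0 : 0 < ‖x.1‖ := norm_pos_iff.2 hx
  have h1 : ‖x.2‖ ^ (2 * γ) = ‖x.1‖ ^ (2 * γ) * ‖x.2 / x.1‖ ^ (2 * γ) := by
    rw [← mul_rpow (norm_nonneg _) (norm_nonneg _), norm_div]
    congr 1; field_simp
  have h2 := D.sum (ratio β₁ γ α₀ x)
  rw [GlueData.pot, gluedPotential, if_neg hx, correction, potentialExcess]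
  change _ + χ₁ (ratio β₁ γ α₀ x) * _ + χ₂ (ratio β₁ γ α₀ x) * _ * _ = _
  rw [h1]
  linear_combination (‖x.1‖ ^ (2 * γ) * ‖x.2 / x.1‖ ^ (2 * γ)) * h2

lemma GlueData.pot_eq_outer {x : ℂ × ℂ}
    (h : x.1 = 0 ∨ 2 < ratio β₁ γ α₀ x) : D.pot x = ‖x.1‖ ^ (2 * β₁) + ‖x.2‖ ^ (2 * γ) := by
  by_cases hx : x.1 = 0
  · rw [GlueData.pot, gluedPotential, if_pos hx, hx, norm_zero, zero_rpow, zero_add]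
    have := D.pos₁
    positivity
  · have h2 := h.resolve_left hx
    have h3 : χ₂ (ratio β₁ γ α₀ x) = 0 := by linarith [D.sum (ratio β₁ γ α₀ x), D.eq_one _ h2]
    rw [D.pot_eq hx, correction, h3, zero_mul, add_zero]

lemma GlueData.pot_eq_inner {x : ℂ × ℂ} (hx : x.1 ≠ 0)
    (h : ratio β₁ γ α₀ x < 1) : D.pot x
      = ‖x.1‖ ^ (2 * β₁) + ‖x.1‖ ^ (2 * γ) * flatPotential β₂ β₃ γ a₂ a₃ (x.2 / x.1) := by
  have h1 := D.eq_one' _ h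
  have h2 : χ₁ (ratio β₁ γ α₀ x) = 0 := by linarith [D.sum (ratio β₁ γ α₀ x)]
  rw [GlueData.pot, gluedPotential, if_neg hx]
  change _ + χ₁ (ratio β₁ γ α₀ x) * _ + χ₂ (ratio β₁ γ α₀ x) * _ * _ = _
  rw [h1, h2]
  ring

lemma GlueData.continuousAt_ratio (D : GlueData β₁ β₂ β₃ γ α₀ a₂ a₃ χ₁ χ₂) {x : ℂ × ℂ}
    (hx : x.1 ≠ 0) : ContinuousAt (ratio β₁ γ α₀) x := by
  have h0 : 0 < ‖x.1‖ := norm_pos_iff.2 hx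
  have hβ := D.pos₁
  have h1 : ‖x.1‖ ^ β₁ ≠ 0 := by positivity
  refine ContinuousAt.mul (ContinuousAt.rpow_const (by fun_prop) (Or.inr D.pos.le))
    (ContinuousAt.rpow_const (ContinuousAt.rpow_const (by fun_prop) (Or.inr hβ.le)) (Or.inl h1))

lemma contDiffAt_ratio (β₁ γ α₀ : ℝ) {x : ℂ × ℂ} (h1 : x.1 ≠ 0) (h2 : x.2 ≠ 0) :
    ContDiffAt ℝ ∞ (ratio β₁ γ α₀) x := by
  have h0 : 0 < ‖x.1‖ := norm_pos_iff.2 h1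
  have a1 : ContDiffAt ℝ ∞ (fun y : ℂ × ℂ => ‖y.1‖ ^ β₁) x :=
    (contDiffAt_norm_rpow β₁ h1).comp x contDiffAt_fst
  have a2 : ContDiffAt ℝ ∞ (fun y : ℂ × ℂ => ‖y.2‖ ^ γ) x :=
    (contDiffAt_norm_rpow γ h2).comp x contDiffAt_snd
  exact a2.mul (a1.rpow_const_of_ne (by positivity))

lemma contDiffAt_quotient {x : ℂ × ℂ} (h1 : x.1 ≠ 0) :
    ContDiffAt ℝ ∞ (fun y : ℂ × ℂ => y.2 / y.1) x := by
  simp_rw [div_eq_mul_inv]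
  exact contDiffAt_snd.mul (contDiffAt_fst.inv h1)

lemma quotient_ne {a : ℂ} {x : ℂ × ℂ} (h1 : x.1 ≠ 0) (h : x ∉ lineOfSlope a) : x.2 / x.1 ≠ a :=
  fun h' => h (by rw [← h']; exact (div_mul_cancel₀ _ h1).symm)

lemma GlueData.contDiffAt_inner (D : GlueData β₁ β₂ β₃ γ α₀ a₂ a₃ χ₁ χ₂) {x : ℂ × ℂ}
    (h1 : x.1 ≠ 0) (h2 : x.2 / x.1 ≠ a₂) (h3 : x.2 / x.1 ≠ a₃) :
    ContDiffAt ℝ ∞ (fun x : ℂ × ℂ =>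
      ‖x.1‖ ^ (2 * β₁) + ‖x.1‖ ^ (2 * γ) * flatPotential β₂ β₃ γ a₂ a₃ (x.2 / x.1)) x := by
  have a1 : ∀ s : ℝ, ContDiffAt ℝ ∞ (fun y : ℂ × ℂ => ‖y.1‖ ^ s) x := fun s =>
    (contDiffAt_norm_rpow s h1).comp x contDiffAt_fst
  have a2 : ContDiffAt ℝ ∞ (fun y : ℂ × ℂ => flatPotential β₂ β₃ γ a₂ a₃ (y.2 / y.1)) x :=
    ContDiffAt.comp (g := flatPotential β₂ β₃ γ a₂ a₃) x (D.contDiffAt_flatPotential h2 h3)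
      (contDiffAt_quotient h1)
  exact (a1 _).add ((a1 _).mul a2)

lemma eventually_fst_ne {x : ℂ × ℂ} (h1 : x.1 ≠ 0) : ∀ᶠ y : ℂ × ℂ in 𝓝 x, y.1 ≠ 0 :=
  continuousAt_fst.eventually_ne h1

lemma GlueData.contDiffAt_pot {x : ℂ × ℂ}
    (h1 : x.1 ≠ 0) (h2 : x.2 / x.1 ≠ a₂) (h3 : x.2 / x.1 ≠ a₃) : ContDiffAt ℝ ∞ D.pot x := by
  -- where `|w|^(2γ)` is not smooth, the cut-off function is constant
  by_cases hw : x.2 = 0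
  · refine (D.contDiffAt_inner h1 h2 h3).congr_of_eventuallyEq ?_
    have h0 : ratio β₁ γ α₀ x < 1 := by
      rw [ratio, hw, norm_zero, zero_rpow D.pos.ne', zero_mul]; exact one_pos
    filter_upwards [eventually_fst_ne h1, (D.continuousAt_ratio h1).eventually (gt_mem_nhds h0)]
      with y hy hy' using D.pot_eq_inner hy hy'
  · have a1 : ∀ s : ℝ, ContDiffAt ℝ ∞ (fun y : ℂ × ℂ => ‖y.1‖ ^ s) x := fun s =>
      (contDiffAt_norm_rpow s h1).comp x contDiffAt_fst
    have a2 : ∀ s : ℝ, ContDiffAt ℝ ∞ (fun y : ℂ × ℂ => ‖y.2‖ ^ s) x := fun s =>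
      (contDiffAt_norm_rpow s hw).comp x contDiffAt_snd
    have a3 : ContDiffAt ℝ ∞ (fun y : ℂ × ℂ => potentialExcess β₂ β₃ γ a₂ a₃ (y.2 / y.1)) x :=
      ContDiffAt.comp (g := potentialExcess β₂ β₃ γ a₂ a₃) x
        (D.contDiffAt_potentialExcess h2 h3 (div_ne_zero hw h1)) (contDiffAt_quotient h1)
    have a4 : ContDiffAt ℝ ∞ (fun y => χ₂ (ratio β₁ γ α₀ y)) x :=
      D.smooth.contDiffAt.comp x (contDiffAt_ratio β₁ γ α₀ h1 hw)
    refine (((a1 (2 * β₁)).add (a2 (2 * γ))).add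
      (a4.mul ((a1 (2 * γ)).mul a3))).congr_of_eventuallyEq ?_
    filter_upwards [eventually_fst_ne h1] with y hy using D.pot_eq hy

lemma normSq_coneMetric (β₁ γ : ℝ) (x v : ℂ × ℂ) : normSq (coneMetric β₁ γ) x v
    = β₁ ^ 2 * ‖x.1‖ ^ (2 * β₁ - 2) * ‖v.1‖ ^ 2 + γ ^ 2 * ‖x.2‖ ^ (2 * γ - 2) * ‖v.2‖ ^ 2 := by
  have h : ∀ (r : ℝ) (v : ℂ), (r : ℂ) * v * star v = ((r * ‖v‖ ^ 2 : ℝ) : ℂ) := fun r v => by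
    rw [star_def, mul_assoc, Complex.mul_conj']; push_cast; rfl
  simp only [normSq, coneMetric, Fin.sum_univ_two, coord, Matrix.cons_val_zero,
    Matrix.cons_val_one, Matrix.diagonal_apply_eq, Matrix.diagonal_apply_ne _ (by decide : (0 : Fin 2) ≠ 1),
    Matrix.diagonal_apply_ne _ (by decide : (1 : Fin 2) ≠ 0), zero_mul, zero_add, add_zero]
  rw [h, h, ← Complex.ofReal_add, Complex.ofReal_re]

/-- The Levi form of the potential in the region where it is `|z|^(2β₁) + |z|^(2γ) φ(w/z)`. -/
theorem GlueData.normSq_inner {x : ℂ × ℂ}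
    (h1 : x.1 ≠ 0) (h2 : x.2 / x.1 ≠ a₂) (h3 : x.2 / x.1 ≠ a₃) (hr : ratio β₁ γ α₀ x < 1)
    (v : ℂ × ℂ) :
    normSq (ddbar D.pot) x v = β₁ ^ 2 * ‖x.1‖ ^ (2 * β₁ - 2) * ‖v.1‖ ^ 2
      + ‖x.1‖ ^ (2 * γ - 2) * (γ ^ 2 * flatPotential β₂ β₃ γ a₂ a₃ (x.2 / x.1) * ‖v.1‖ ^ 2
        + 2 * γ * (v.1 * star (grad (flatPotential β₂ β₃ γ a₂ a₃) (x.2 / x.1)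
          * (v.2 - x.2 / x.1 * v.1))).re
        + γ ^ 2 * density β₂ β₃ a₂ a₃ (x.2 / x.1) * ‖v.2 - x.2 / x.1 * v.1‖ ^ 2) := by
  obtain ⟨z, w⟩ := x
  simp only at h1 h2 h3 ⊢
  set φ := flatPotential β₂ β₃ γ a₂ a₃ with hφ
  set ζ := w / z with hζ
  set η := v.2 - ζ * v.1 with hη
  have hz : 0 < ‖z‖ := norm_pos_iff.2 h1
  have hev : D.pot =ᶠ[𝓝 (z, w)] fun x : ℂ × ℂ =>
      ‖x.1‖ ^ (2 * β₁) + ‖x.1‖ ^ (2 * γ) * φ (x.2 / x.1) := by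
    filter_upwards [eventually_fst_ne (x := (z, w)) h1,
      (D.continuousAt_ratio (x := (z, w)) h1).eventually (gt_mem_nhds hr)] with y hy hy'
      using D.pot_eq_inner hy hy'
  -- a holomorphic curve with velocity `v` along which `z` and `w / z` are affine
  set G : ℂ → ℂ × ℂ := fun τ => (z + τ * v.1, (z + τ * v.1) * (ζ + τ * (η / z))) with hG
  have hG0 : G 0 = (z, w) := by simp [hG, hζ, mul_div_cancel₀ _ h1]
  have hGa : AnalyticAt ℂ G 0 := by rw [hG]; fun_prop
  have hl : ∀ c d : ℂ, HasDerivAt (fun τ : ℂ => c + τ * d) d 0 := fun c d => by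
    simpa using ((hasDerivAt_id (0 : ℂ)).mul_const d).const_add c
  have hGd : HasDerivAt G v 0 := by
    have := (hl z v.1).prodMk ((hl z v.1).mul (hl ζ (η / z)))
    refine this.congr_deriv (Prod.ext rfl ?_)
    simp only [zero_mul, add_zero, hη]
    field_simp
    ring
  have hs : ContDiffAt ℝ ∞ (fun x : ℂ × ℂ =>
      ‖x.1‖ ^ (2 * β₁) + ‖x.1‖ ^ (2 * γ) * φ (x.2 / x.1)) (G 0) := by
    rw [hG0]; exact D.contDiffAt_inner (x := (z, w)) h1 h2 h3
  have key := normSq_ddbar_curve hs hGa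
  rw [hGd.deriv, hG0] at key
  have hgn : normSq (ddbar D.pot) (z, w) v = normSq (ddbar fun x : ℂ × ℂ =>
      ‖x.1‖ ^ (2 * β₁) + ‖x.1‖ ^ (2 * γ) * φ (x.2 / x.1)) (z, w) v := by
    simp only [normSq, ddbar_congr hev]
  rw [hgn, key]
  have aff : ∀ c d : ℂ, AnalyticAt ℂ (fun τ : ℂ => c + τ * d) 0 := fun c d => by fun_prop
  have z0 : z + 0 * v.1 = z := by ring
  have ζ0 : ζ + 0 * (η / z) = ζ := by ring
  have hφs : ContDiffAt ℝ ∞ φ (ζ + 0 * (η / z)) := by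
    rw [ζ0]; exact D.contDiffAt_flatPotential h2 h3
  have hns : ∀ s : ℝ, ContDiffAt ℝ ∞ (fun y : ℂ => ‖y‖ ^ s) (z + 0 * v.1) := fun s => by
    rw [z0]; exact contDiffAt_norm_rpow s h1
  have affr : ∀ c d : ℂ, ContDiffAt ℝ ∞ (fun τ : ℂ => c + τ * d) 0 := fun c d => by fun_prop
  have sA : ContDiffAt ℝ ∞ (fun τ : ℂ => ‖z + τ * v.1‖ ^ (2 * β₁)) 0 :=
    ContDiffAt.comp (f := fun τ => z + τ * v.1) 0 (hns (2 * β₁)) (affr _ _)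
  have sB : ContDiffAt ℝ ∞ (fun τ : ℂ => ‖z + τ * v.1‖ ^ (2 * γ)) 0 :=
    ContDiffAt.comp (f := fun τ => z + τ * v.1) 0 (hns (2 * γ)) (affr _ _)
  have sC : ContDiffAt ℝ ∞ (fun τ : ℂ => φ (ζ + τ * (η / z))) 0 :=
    ContDiffAt.comp (f := fun τ => ζ + τ * (η / z)) 0 hφs (affr _ _)
  have hne : ∀ᶠ τ : ℂ in 𝓝 0, z + τ * v.1 ≠ 0 :=
    (aff z v.1).continuousAt.eventually_ne (by rwa [z0])
  have hcongr : (fun τ => ‖(G τ).1‖ ^ (2 * β₁) + ‖(G τ).1‖ ^ (2 * γ) * φ ((G τ).2 / (G τ).1))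
      =ᶠ[𝓝 0] fun τ => ‖z + τ * v.1‖ ^ (2 * β₁) + ‖z + τ * v.1‖ ^ (2 * γ) * φ (ζ + τ * (η / z)) := by
    filter_upwards [hne] with τ hτ
    simp only [hG, mul_div_cancel_left₀ _ hτ]
  change lap (fun τ => ‖(G τ).1‖ ^ (2 * β₁) + ‖(G τ).1‖ ^ (2 * γ) * φ ((G τ).2 / (G τ).1)) 0 = _
  rw [lap_congr hcongr, lap_add sA (sB.mul sC), lap_mul sB sC,
    lap_comp (f := fun y : ℂ => ‖y‖ ^ (2 * β₁)) (g := fun τ => z + τ * v.1) (hns _) (aff _ _) (hl _ _),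
    lap_comp (f := fun y : ℂ => ‖y‖ ^ (2 * γ)) (g := fun τ => z + τ * v.1) (hns _) (aff _ _) (hl _ _),
    lap_comp (g := fun τ => ζ + τ * (η / z)) hφs (aff _ _) (hl _ _),
    grad_comp (f := fun y : ℂ => ‖y‖ ^ (2 * γ)) (g := fun τ => z + τ * v.1) ((hns _).differentiableAt (by simp)) (hl _ _),
    grad_comp (g := fun τ => ζ + τ * (η / z)) (hφs.differentiableAt (by simp)) (hl _ _), z0, ζ0, lap_norm_rpow _ h1,
    lap_norm_rpow _ h1, grad_norm_rpow _ h1, lap,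
    D.dzeta_dzetabar_flatPotential h2 h3, Complex.ofReal_re, norm_div]
  have hcross : ((γ * ‖z‖ ^ (2 * γ - 2) : ℝ) : ℂ) * star z * v.1 * star (grad φ ζ * (η / z))
      = ((γ * ‖z‖ ^ (2 * γ - 2) : ℝ) : ℂ) * (v.1 * star (grad φ ζ * η)) := by
    have hsz : star z ≠ 0 := star_ne_zero.2 h1
    rw [star_mul', star_mul', star_div₀]
    field_simp
  have hp : ‖z‖ ^ (2 * γ) = ‖z‖ ^ (2 * γ - 2) * ‖z‖ ^ 2 := by
    rw [← rpow_natCast ‖z‖ 2, ← rpow_add hz]; congr 1; push_cast; ring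
  rw [hcross, re_ofReal_mul, hp]
  field_simp
  ring

end

section

variable {β₁ β₂ β₃ γ α₀ : ℝ} {a₂ a₃ : ℂ} {χ₁ χ₂ : ℝ → ℝ}
  (D : GlueData β₁ β₂ β₃ γ α₀ a₂ a₃ χ₁ χ₂)

/-! ### Comparison with the cone metric -/

/-- Bounds for a function and its derivatives `∂` and `∂∂̄` at a point, on the scale `s⁻¹`. -/
structure LeviBound (f : ℂ → ℝ) (x : ℂ) (C s : ℝ) : Prop where
  smooth : ContDiffAt ℝ ∞ f x
  value : |f x| ≤ C
  grad_le : ‖grad f x‖ ≤ C * s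
  lap_le : |lap f x| ≤ C * s ^ 2

lemma LeviBound.mul {f g : ℂ → ℝ} {x : ℂ} {C C' s : ℝ} (hs : 0 ≤ s) (hf : LeviBound f x C s)
    (hg : LeviBound g x C' s) : LeviBound (fun t => f t * g t) x (4 * C * C') s := by
  have c0 : 0 ≤ C := (abs_nonneg _).trans hf.value
  have c0' : 0 ≤ C' := (abs_nonneg _).trans hg.value
  have hn : ∀ r : ℝ, ‖(r : ℂ)‖ = |r| := fun r => by rw [norm_real, norm_eq_abs]
  refine ⟨hf.smooth.mul hg.smooth, ?_, ?_, ?_⟩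
  · rw [abs_mul]
    calc |f x| * |g x| ≤ C * C' := mul_le_mul hf.value hg.value (abs_nonneg _) c0
      _ ≤ 4 * C * C' := by nlinarith [mul_nonneg c0 c0']
  · rw [grad_mul (hf.smooth.differentiableAt (by simp)) (hg.smooth.differentiableAt (by simp))]
    refine (norm_add_le _ _).trans ?_
    rw [norm_mul, norm_mul, hn, hn]
    calc |f x| * ‖grad g x‖ + |g x| * ‖grad f x‖ ≤ C * (C' * s) + C' * (C * s) :=
          add_le_add (mul_le_mul hf.value hg.grad_le (norm_nonneg _) c0)
            (mul_le_mul hg.value hf.grad_le (norm_nonneg _) c0')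
      _ ≤ 4 * C * C' * s := by nlinarith [mul_nonneg (mul_nonneg c0 c0') hs]
  · rw [lap_mul hf.smooth hg.smooth]
    have h1 : |f x * lap g x| ≤ C * (C' * s ^ 2) := by
      rw [abs_mul]; exact mul_le_mul hf.value hg.lap_le (abs_nonneg _) c0
    have h2 : |g x * lap f x| ≤ C' * (C * s ^ 2) := by
      rw [abs_mul]; exact mul_le_mul hg.value hf.lap_le (abs_nonneg _) c0'
    have h3 : |(grad f x * star (grad g x)).re| ≤ (C * s) * (C' * s) := by
      refine (Complex.abs_re_le_norm _).trans ?_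
      rw [norm_mul, norm_star]
      exact mul_le_mul hf.grad_le hg.grad_le (norm_nonneg _) (by positivity)
    rw [abs_le] at *
    constructor <;> nlinarith

/-- The cut-off function, in logarithmic coordinates, is bounded with its derivatives. -/
lemma exists_cutoff_bound {χ : ℝ → ℝ} (hχ : ContDiff ℝ ∞ χ) (h1 : ∀ s, s < 1 → χ s = 1)
    (h2 : ∀ s, 2 < s → χ s = 0) :
    ∃ C : ℝ, 0 ≤ C ∧ ∀ l, |χ (Real.exp l)| ≤ C ∧ |deriv (fun l => χ (Real.exp l)) l| ≤ C ∧
      |deriv (deriv fun l => χ (Real.exp l)) l| ≤ C := by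
  set X : ℝ → ℝ := fun l => χ (Real.exp l) with hX
  have hXs : ContDiff ℝ ∞ X := hχ.comp Real.contDiff_exp
  have hX' : ContDiff ℝ ∞ (deriv X) := hXs.deriv'
  have hX'' : ContDiff ℝ ∞ (deriv (deriv X)) := hX'.deriv'
  have hloc : ∀ l ∉ Icc (0 : ℝ) (log 2), (∀ᶠ y in 𝓝 l, X y = 1) ∨ ∀ᶠ y in 𝓝 l, X y = 0 := by
    intro l hl
    rw [mem_Icc, not_and_or, not_le, not_le] at hl
    rcases hl with hl | hl
    · left
      filter_upwards [gt_mem_nhds hl] with y hy using h1 _ (Real.exp_zero ▸ Real.exp_lt_exp.2 hy)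
    · right
      filter_upwards [lt_mem_nhds hl] with y hy
      refine h2 _ ?_
      rwa [← Real.log_lt_iff_lt_exp (by norm_num)]
  have hout : ∀ l ∉ Icc (0 : ℝ) (log 2), |X l| ≤ 1 ∧ deriv X l = 0 ∧ deriv (deriv X) l = 0 := by
    intro l hl
    obtain ⟨c, hc, hev⟩ : ∃ c : ℝ, |c| ≤ 1 ∧ X =ᶠ[𝓝 l] fun _ => c := by
      rcases hloc l hl with h | h
      · exact ⟨1, by simp, h⟩
      · exact ⟨0, by simp, h⟩
    refine ⟨by rw [hev.eq_of_nhds]; exact hc, by rw [hev.deriv_eq, deriv_const], ?_⟩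
    rw [hev.deriv.deriv_eq]
    simp
  obtain ⟨C0, hC0⟩ := isCompact_Icc.exists_bound_of_continuousOn
    (hXs.continuous.continuousOn (s := Icc 0 (log 2)))
  obtain ⟨C1, hC1⟩ := isCompact_Icc.exists_bound_of_continuousOn
    (hX'.continuous.continuousOn (s := Icc 0 (log 2)))
  obtain ⟨C2, hC2⟩ := isCompact_Icc.exists_bound_of_continuousOn
    (hX''.continuous.continuousOn (s := Icc 0 (log 2)))
  refine ⟨1 + |C0| + |C1| + |C2|, by positivity, fun l => ?_⟩
  have n0 := abs_nonneg C0
  have n1 := abs_nonneg C1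
  have n2 := abs_nonneg C2
  by_cases hl : l ∈ Icc (0 : ℝ) (log 2)
  · have := hC0 l hl
    have := hC1 l hl
    have := hC2 l hl
    simp only [norm_eq_abs] at *
    refine ⟨?_, ?_, ?_⟩ <;> linarith [le_abs_self C0, le_abs_self C1, le_abs_self C2]
  · obtain ⟨b0, b1, b2⟩ := hout l hl
    refine ⟨by linarith, ?_, ?_⟩
    · rw [b1, abs_zero]; linarith
    · rw [b2, abs_zero]; linarith

lemma FlatData.lap_potentialExcess (D : FlatData β₂ β₃ γ a₂ a₃) {w : ℂ} (h2 : w ≠ a₂)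
    (h3 : w ≠ a₃) (h0 : w ≠ 0) :
    lap (potentialExcess β₂ β₃ γ a₂ a₃) w = γ ^ 2 * excess β₂ β₃ γ a₂ a₃ w := by
  have h := lap_add (D.contDiffAt_potentialExcess h2 h3 h0) (contDiffAt_norm_rpow (2 * γ) h0)
  have e : (fun t => potentialExcess β₂ β₃ γ a₂ a₃ t + ‖t‖ ^ (2 * γ))
      = flatPotential β₂ β₃ γ a₂ a₃ := by
    ext t; simp [potentialExcess]
  rw [e, lap_norm_rpow γ h0, lap, D.dzeta_dzetabar_flatPotential h2 h3, Complex.ofReal_re] at h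
  rw [excess]
  linarith

lemma norm_mul_exp_rpow {z : ℂ} (hz : z ≠ 0) (σ : ℂ) (s : ℝ) :
    ‖z * Complex.exp σ‖ ^ s = Real.exp (s * log ‖z‖ + s * σ.re) := by
  have h0 : 0 < ‖z‖ := norm_pos_iff.2 hz
  rw [norm_mul, Complex.norm_exp, mul_rpow h0.le (Real.exp_pos _).le,
    rpow_def_of_pos h0, ← Real.exp_mul, ← Real.exp_add]
  ring_nf

lemma hasDerivAt_mul_exp (c σ : ℂ) :
    HasDerivAt (fun τ : ℂ => c * Complex.exp (τ * σ)) (c * σ) 0 := by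
  have h1 : HasDerivAt (fun τ : ℂ => τ * σ) σ 0 := by
    simpa using (hasDerivAt_id (0 : ℂ)).mul_const σ
  simpa using (h1.cexp).const_mul c

lemma analyticAt_mul_exp (c σ : ℂ) : AnalyticAt ℂ (fun τ : ℂ => c * Complex.exp (τ * σ)) 0 := by
  fun_prop

lemma contDiffAt_comp_mul_exp {f : ℂ → ℝ} {c : ℂ} (hf : ContDiffAt ℝ ∞ f c) (σ : ℂ) :
    ContDiffAt ℝ ∞ (fun τ : ℂ => f (c * Complex.exp (τ * σ))) 0 :=
  ContDiffAt.comp (g := f) (f := fun τ : ℂ => c * Complex.exp (τ * σ)) 0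
    (by simpa using hf) ((analyticAt_mul_exp c σ).contDiffAt.restrict_scalars ℝ)

lemma grad_comp_mul_exp {f : ℂ → ℝ} {c : ℂ} (hf : ContDiffAt ℝ ∞ f c) (σ : ℂ) :
    grad (fun τ : ℂ => f (c * Complex.exp (τ * σ))) 0 = grad f c * (c * σ) := by
  have e : c * Complex.exp (0 * σ) = c := by simp
  have := grad_comp (f := f) (g := fun τ : ℂ => c * Complex.exp (τ * σ)) (x := 0)
    (by rw [e]; exact hf.differentiableAt (by simp)) (hasDerivAt_mul_exp c σ)
  rwa [e] at this

lemma lap_comp_mul_exp {f : ℂ → ℝ} {c : ℂ} (hf : ContDiffAt ℝ ∞ f c) (σ : ℂ) :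
    lap (fun τ : ℂ => f (c * Complex.exp (τ * σ))) 0 = ‖c * σ‖ ^ 2 * lap f c := by
  have e : c * Complex.exp (0 * σ) = c := by simp
  have := lap_comp (f := f) (g := fun τ : ℂ => c * Complex.exp (τ * σ)) (x := 0)
    (by rw [e]; exact hf) (analyticAt_mul_exp c σ) (hasDerivAt_mul_exp c σ)
  rwa [e] at this

lemma contDiffAt_norm_rpow_exp (s : ℝ) {c : ℂ} (hc : c ≠ 0) (σ : ℂ) :
    ContDiffAt ℝ ∞ (fun τ : ℂ => ‖c * Complex.exp (τ * σ)‖ ^ s) 0 :=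
  contDiffAt_comp_mul_exp (contDiffAt_norm_rpow s hc) σ

lemma lap_norm_rpow_exp (s : ℝ) {c : ℂ} (hc : c ≠ 0) (σ : ℂ) :
    lap (fun τ : ℂ => ‖c * Complex.exp (τ * σ)‖ ^ (2 * s)) 0
      = s ^ 2 * ‖c‖ ^ (2 * s - 2) * ‖c * σ‖ ^ 2 := by
  rw [lap_comp_mul_exp (contDiffAt_norm_rpow (2 * s) hc), lap_norm_rpow s hc]
  ring

lemma leviBound_norm_rpow_exp {z σ : ℂ} {s γ : ℝ} (hx : z ≠ 0) (hγ0 : 0 < γ) (hγ1 : γ ≤ 1)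
    (hσs : ‖σ‖ ≤ s) :
    LeviBound (fun τ : ℂ => ‖z * Complex.exp (τ * σ)‖ ^ (2 * γ)) 0 (‖z‖ ^ (2 * γ)) s := by
  have hz : 0 < ‖z‖ := norm_pos_iff.2 hx
  have hzp : ‖z‖ ^ (2 * γ - 2) * ‖z‖ ^ 2 = ‖z‖ ^ (2 * γ) := by
    rw [← rpow_natCast ‖z‖ 2, ← rpow_add hz]; congr 1; push_cast; ring
  have hs : 0 ≤ s := (norm_nonneg _).trans hσs
  refine ⟨contDiffAt_norm_rpow_exp _ hx _, ?_, ?_, ?_⟩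
  · simp [abs_of_nonneg (Real.rpow_nonneg hz.le _)]
  · rw [grad_comp_mul_exp (contDiffAt_norm_rpow (2 * γ) hx), grad_norm_rpow γ hx, norm_mul,
      norm_mul, norm_star, norm_mul, norm_real, norm_of_nonneg (by positivity)]
    calc γ * ‖z‖ ^ (2 * γ - 2) * ‖z‖ * (‖z‖ * ‖σ‖)
        = γ * ‖σ‖ * (‖z‖ ^ (2 * γ - 2) * ‖z‖ ^ 2) := by ring
      _ ≤ 1 * s * ‖z‖ ^ (2 * γ) := by rw [hzp]; gcongr
      _ = _ := by ring
  · rw [lap_norm_rpow_exp γ hx, norm_mul, abs_of_nonneg (by positivity)]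
    calc γ ^ 2 * ‖z‖ ^ (2 * γ - 2) * (‖z‖ * ‖σ‖) ^ 2
        = γ ^ 2 * ‖σ‖ ^ 2 * (‖z‖ ^ (2 * γ - 2) * ‖z‖ ^ 2) := by ring
      _ ≤ 1 ^ 2 * s ^ 2 * ‖z‖ ^ (2 * γ) := by rw [hzp]; gcongr
      _ = _ := by ring

/-- The growth of the potential excess `u`, in the coordinate `log ζ`: `u` and its derivatives are
`O(|ζ|^γ)`. -/
lemma FlatData.leviBound_potentialExcess_exp (D : FlatData β₂ β₃ γ a₂ a₃) {ζ κ : ℂ}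
    {s Cu Ce : ℝ} (hζ1 : 1 ≤ ‖ζ‖) (hζ2 : ζ ≠ a₂) (hζ3 : ζ ≠ a₃) (hκ : ‖κ‖ ≤ s) (hCu : 0 ≤ Cu)
    (hCe : 0 ≤ Ce) (u1 : |potentialExcess β₂ β₃ γ a₂ a₃ ζ| ≤ Cu * ‖ζ‖ ^ γ)
    (u2 : ‖fderiv ℝ (potentialExcess β₂ β₃ γ a₂ a₃) ζ‖ ≤ Cu * ‖ζ‖ ^ (γ - 1))
    (u3 : |excess β₂ β₃ γ a₂ a₃ ζ| ≤ Ce * ‖ζ‖ ^ (2 * γ - 4)) :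
    LeviBound (fun τ : ℂ => potentialExcess β₂ β₃ γ a₂ a₃ (ζ * Complex.exp (τ * κ))) 0
      ((Cu + Ce) * ‖ζ‖ ^ γ) s := by
  have hγ0 := D.pos
  have hγ1 := D.lt
  have hζ0 : 0 < ‖ζ‖ := by linarith
  have hζne : ζ ≠ 0 := norm_pos_iff.1 hζ0
  have hs0 : 0 ≤ s := (norm_nonneg _).trans hκ
  have hUs := D.contDiffAt_potentialExcess hζ2 hζ3 hζne
  have hp1 : ‖ζ‖ ^ (γ - 1) * ‖ζ‖ = ‖ζ‖ ^ γ := by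
    rw [← rpow_add_one hζ0.ne']; congr 1; ring
  have hζγ : 0 < ‖ζ‖ ^ γ := by positivity
  refine ⟨contDiffAt_comp_mul_exp hUs κ, ?_, ?_, ?_⟩
  · simp only [zero_mul, Complex.exp_zero, mul_one]
    refine u1.trans ?_
    gcongr
    linarith
  · rw [grad_comp_mul_exp hUs, norm_mul, norm_mul]
    have h1 := (norm_grad_le (hUs.differentiableAt (by simp))).trans u2
    calc ‖grad (potentialExcess β₂ β₃ γ a₂ a₃) ζ‖ * (‖ζ‖ * ‖κ‖)
        ≤ (Cu * ‖ζ‖ ^ (γ - 1)) * (‖ζ‖ * s) := by gcongr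
      _ = Cu * ‖ζ‖ ^ γ * s := by rw [← hp1]; ring
      _ ≤ (Cu + Ce) * ‖ζ‖ ^ γ * s := by gcongr; linarith
  · rw [lap_comp_mul_exp hUs, D.lap_potentialExcess hζ2 hζ3 hζne, norm_mul, abs_mul, abs_mul,
      abs_of_nonneg (sq_nonneg γ), abs_of_nonneg (by positivity)]
    have h2 : ‖ζ‖ ^ 2 * ‖ζ‖ ^ (2 * γ - 4) ≤ ‖ζ‖ ^ γ := by
      rw [← rpow_natCast ‖ζ‖ 2, ← rpow_add hζ0]
      exact rpow_le_rpow_of_exponent_le hζ1 (by push_cast; linarith)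
    calc (‖ζ‖ * ‖κ‖) ^ 2 * (γ ^ 2 * |excess β₂ β₃ γ a₂ a₃ ζ|)
        ≤ (‖ζ‖ * s) ^ 2 * (1 ^ 2 * (Ce * ‖ζ‖ ^ (2 * γ - 4))) := by gcongr
      _ = Ce * (‖ζ‖ ^ 2 * ‖ζ‖ ^ (2 * γ - 4)) * s ^ 2 := by ring
      _ ≤ Ce * ‖ζ‖ ^ γ * s ^ 2 := by gcongr
      _ ≤ (Cu + Ce) * ‖ζ‖ ^ γ * s ^ 2 := by gcongr; linarith

set_option maxHeartbeats 800000 in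
/-- In the region `|w| ≥ K |z|` the metric is close to the cone metric: the correction to the
potential is estimated in the logarithmic coordinates `(log z, log w)`. -/
theorem GlueData.exists_outer_bound :
    ∃ C K : ℝ, 0 ≤ C ∧ 1 ≤ K ∧ ‖a₂‖ < K ∧ ‖a₃‖ < K ∧ ∀ x v : ℂ × ℂ, x.1 ≠ 0 → ‖x.1‖ ≤ 1 →
      K ≤ ‖x.2 / x.1‖ →
      |normSq (ddbar D.pot) x v - normSq (coneMetric β₁ γ) x v|
        ≤ C * (‖x.2 / x.1‖ ^ (-γ) + ‖x.1‖ ^ (2 * (β₁ * (α₀ - 1))))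
          * normSq (coneMetric β₁ γ) x v := by
  have hγ0 := D.pos
  have hγ1 := D.lt
  have hβ0 := D.pos₁
  have hα := D.one_lt
  have hαγ := D.mul_lt
  obtain ⟨Cu, K, hCu, hK1, hK2, hK3, hu⟩ := D.toFlatData.exists_growth_bound
  obtain ⟨Ce, R, hCe, hR, hfar⟩ := abs_excess_le_of_large (a₂ := a₂) (a₃ := a₃) D.angle D.mass
  obtain ⟨CA, hCA, hcut⟩ := exists_cutoff_bound D.smooth D.eq_one'
    (fun s hs => by linarith [D.sum s, D.eq_one s hs])
  set U := potentialExcess β₂ β₃ γ a₂ a₃ with hU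
  refine ⟨16 * CA * (Cu + Ce) * 2 * (2 / β₁ ^ 2 + 1 / γ ^ 2), max K R, by positivity,
    hK1.trans (le_max_left _ _), hK2.trans_le (le_max_left _ _), hK3.trans_le (le_max_left _ _),
    fun x v hx hx1 hxK => ?_⟩
  obtain ⟨z, w⟩ := x
  simp only at hx hx1 hxK ⊢
  set ζ := w / z with hζ
  have hz : 0 < ‖z‖ := norm_pos_iff.2 hx
  have hζK : K ≤ ‖ζ‖ := (le_max_left _ _).trans hxK
  have hζR : R ≤ ‖ζ‖ := (le_max_right _ _).trans hxK
  have hζ1 : 1 ≤ ‖ζ‖ := hK1.trans hζK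
  have hζ0 : 0 < ‖ζ‖ := by linarith
  have hζne : ζ ≠ 0 := norm_pos_iff.1 hζ0
  have hζ2 : ζ ≠ a₂ := by rintro h; rw [h] at hζK; linarith
  have hζ3 : ζ ≠ a₃ := by rintro h; rw [h] at hζK; linarith
  have hwne : w ≠ 0 := by rintro rfl; simp [hζ] at hζne
  have hw : 0 < ‖w‖ := norm_pos_iff.2 hwne
  have hψ : ContDiffAt ℝ ∞ D.pot (z, w) := D.contDiffAt_pot hx hζ2 hζ3
  set T := normSq (coneMetric β₁ γ) (z, w) v with hT
  have hTeq : T = β₁ ^ 2 * ‖z‖ ^ (2 * β₁ - 2) * ‖v.1‖ ^ 2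
      + γ ^ 2 * ‖w‖ ^ (2 * γ - 2) * ‖v.2‖ ^ 2 := normSq_coneMetric _ _ _ _
  have hT0 : 0 ≤ T := by rw [hTeq]; positivity
  -- the holomorphic curve with velocity `v` which is a line in logarithmic coordinates
  set σ₁ := v.1 / z with hσ₁
  set σ₂ := v.2 / w with hσ₂
  set G : ℂ → ℂ × ℂ := fun τ => (z * Complex.exp (τ * σ₁), w * Complex.exp (τ * σ₂)) with hG
  have hG0 : G 0 = (z, w) := by simp [hG]
  have hGa : AnalyticAt ℂ G 0 := (analyticAt_mul_exp _ _).prod (analyticAt_mul_exp _ _)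
  have hGd : HasDerivAt G v 0 := by
    refine ((hasDerivAt_mul_exp z σ₁).prodMk (hasDerivAt_mul_exp w σ₂)).congr_deriv (Prod.ext ?_ ?_)
    · simp only [hσ₁]; field_simp
    · simp only [hσ₂]; field_simp
  have key := normSq_ddbar_curve (G := G) (by rw [hG0]; exact hψ) hGa
  rw [hGd.deriv, hG0] at key
  rw [key]
  change |lap (fun τ => D.pot (G τ)) 0 - T| ≤ _
  have hv1 : z * σ₁ = v.1 := by rw [hσ₁]; field_simp
  have hv2 : w * σ₂ = v.2 := by rw [hσ₂]; field_simp
  have hlap12 : lap (fun τ : ℂ => ‖z * Complex.exp (τ * σ₁)‖ ^ (2 * β₁)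
      + ‖w * Complex.exp (τ * σ₂)‖ ^ (2 * γ)) 0 = T := by
    rw [lap_add (contDiffAt_norm_rpow_exp _ hx _) (contDiffAt_norm_rpow_exp _ hwne _),
      lap_norm_rpow_exp _ hx, lap_norm_rpow_exp _ hwne, hv1, hv2, hTeq]
  by_cases hr : 2 < ratio β₁ γ α₀ (z, w)
  · have hev : (fun τ => D.pot (G τ)) =ᶠ[𝓝 0] fun τ : ℂ => ‖z * Complex.exp (τ * σ₁)‖ ^ (2 * β₁)
        + ‖w * Complex.exp (τ * σ₂)‖ ^ (2 * γ) := by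
      have hc : ContinuousAt (ratio β₁ γ α₀) (G 0) := by rw [hG0]; exact D.continuousAt_ratio hx
      filter_upwards [(hc.comp hGa.continuousAt).eventually
        (lt_mem_nhds (by simpa only [Function.comp, hG0] using hr))] with τ hτ
      exact D.pot_eq_outer (Or.inr hτ)
    rw [lap_congr hev, hlap12, sub_self, abs_zero]
    positivity
  push Not at hr
  -- in logarithmic coordinates `log (R r^(-α₀))` is a real-linear function
  set m : ℂ := γ * σ₂ - (α₀ * β₁ : ℝ) * σ₁ with hm
  set l : ℝ := γ * log ‖w‖ - α₀ * β₁ * log ‖z‖ with hl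
  have hratio : ∀ τ, ratio β₁ γ α₀ (G τ) = Real.exp ((τ * m).re + l) := by
    intro τ
    have e : (‖z * Complex.exp (τ * σ₁)‖ ^ β₁) ^ (-α₀)
        = ‖z * Complex.exp (τ * σ₁)‖ ^ (-(α₀ * β₁)) := by
      rw [← rpow_mul (norm_nonneg _)]; congr 1; ring
    simp only [ratio, hG]
    rw [e, norm_mul_exp_rpow hx, norm_mul_exp_rpow hwne, ← Real.exp_add, hm, hl]
    congr 1
    simp
    ring
  set X : ℝ → ℝ := fun t => χ₂ (Real.exp t) with hX
  have hXs : ContDiff ℝ ∞ X := D.smooth.comp Real.contDiff_exp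
  have hquot : ∀ τ : ℂ, w * Complex.exp (τ * σ₂) / (z * Complex.exp (τ * σ₁))
      = ζ * Complex.exp (τ * (σ₂ - σ₁)) := by
    intro τ
    rw [mul_sub, Complex.exp_sub, hζ]
    field_simp
  have hpot : (fun τ => D.pot (G τ)) = fun τ : ℂ => (‖z * Complex.exp (τ * σ₁)‖ ^ (2 * β₁)
      + ‖w * Complex.exp (τ * σ₂)‖ ^ (2 * γ)) + X ((τ * m).re + l)
        * (‖z * Complex.exp (τ * σ₁)‖ ^ (2 * γ) * U (ζ * Complex.exp (τ * (σ₂ - σ₁)))) := by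
    ext τ
    rw [D.pot_eq (x := G τ) (mul_ne_zero hx (Complex.exp_ne_zero _)), correction, hratio]
    simp only [hG, hquot, hX, hU]
  set s := ‖σ₁‖ + ‖σ₂‖ with hs
  have hs0 : 0 ≤ s := by positivity
  obtain ⟨x1, x2, x3⟩ := grad_lap_comp_re hXs m l 0
  obtain ⟨c1, c2, c3⟩ := hcut ((0 * m).re + l)
  have hms : ‖m‖ ≤ s := by
    rw [hm, hs]
    refine (norm_sub_le _ _).trans ?_
    rw [norm_mul, norm_mul, norm_real, norm_real,
      norm_of_nonneg hγ0.le, norm_of_nonneg (by positivity)]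
    nlinarith [norm_nonneg σ₁, norm_nonneg σ₂]
  have bA : LeviBound (fun τ : ℂ => X ((τ * m).re + l)) 0 CA s := by
    refine ⟨x1, c1, ?_, ?_⟩
    · rw [x2, norm_mul, norm_real, norm_eq_abs, norm_div]
      refine mul_le_mul c2 ?_ (by positivity) hCA
      rw [show ‖(2 : ℂ)‖ = 2 by simp]
      linarith [norm_nonneg m]
    · rw [x3, abs_mul, abs_of_nonneg (by positivity : 0 ≤ ‖m‖ ^ 2 / 4)]
      refine mul_le_mul c3 ?_ (by positivity) hCA
      have : ‖m‖ ^ 2 ≤ s ^ 2 := by gcongr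
      nlinarith [sq_nonneg ‖m‖]
  have hσs : ‖σ₁‖ ≤ s := by rw [hs]; linarith [norm_nonneg σ₂]
  have hκ : ‖σ₂ - σ₁‖ ≤ s := by rw [hs, add_comm]; exact norm_sub_le _ _
  have bB := leviBound_norm_rpow_exp hx hγ0 hγ1.le hσs
  have bU := D.toFlatData.leviBound_potentialExcess_exp hζ1 hζ2 hζ3 hκ hCu hCe (hu ζ hζK).1
    (hu ζ hζK).2 (hfar ζ hζR)
  have bE := bA.mul hs0 (bB.mul hs0 bU)
  have sab : ContDiffAt ℝ ∞ (fun τ : ℂ => ‖z * Complex.exp (τ * σ₁)‖ ^ (2 * β₁)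
      + ‖w * Complex.exp (τ * σ₂)‖ ^ (2 * γ)) 0 := 
    (contDiffAt_norm_rpow_exp _ hx _).add (contDiffAt_norm_rpow_exp _ hwne _)
  rw [hpot, lap_add sab bE.smooth, hlap12, add_sub_cancel_left]
  refine bE.lap_le.trans ?_
  -- compare the size `|z|^γ |w|^γ` of the correction with the two parts of the cone metric
  set M := ‖z‖ ^ (2 * γ) * ‖ζ‖ ^ γ with hM
  have hM1 : M = ‖z‖ ^ γ * ‖w‖ ^ γ := by
    rw [hM, hζ, norm_div, div_rpow hw.le hz.le, two_mul, rpow_add hz]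
    have : ‖z‖ ^ γ ≠ 0 := by positivity
    field_simp
  have hMw : M = ‖ζ‖ ^ (-γ) * ‖w‖ ^ (2 * γ) := by
    rw [hM1, hζ, norm_div, rpow_neg (by positivity), div_rpow hw.le hz.le, two_mul,
      rpow_add hw]
    have : ‖w‖ ^ γ ≠ 0 := by positivity
    field_simp
  have hMz : M ≤ 2 * ‖z‖ ^ (2 * (β₁ * (α₀ - 1))) * ‖z‖ ^ (2 * β₁) := by
    have h1 : ‖w‖ ^ γ ≤ 2 * ‖z‖ ^ (α₀ * β₁) := by
      have e : (‖z‖ ^ β₁) ^ (-α₀) = (‖z‖ ^ (α₀ * β₁))⁻¹ := by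
        rw [← rpow_mul hz.le, ← rpow_neg hz.le]; congr 1; ring
      have h2 : ‖w‖ ^ γ * (‖z‖ ^ (α₀ * β₁))⁻¹ ≤ 2 := by rw [← e]; exact hr
      rwa [← div_eq_mul_inv, div_le_iff₀ (by positivity)] at h2
    have h3 : ‖z‖ ^ γ ≤ ‖z‖ ^ (α₀ * β₁) :=
      rpow_le_rpow_of_exponent_ge hz hx1 hαγ.le
    calc M ≤ ‖z‖ ^ (α₀ * β₁) * (2 * ‖z‖ ^ (α₀ * β₁)) := by
          rw [hM1]; gcongr
      _ = 2 * (‖z‖ ^ (α₀ * β₁) * ‖z‖ ^ (α₀ * β₁)) := by ring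
      _ = _ := by rw [← rpow_add hz, mul_assoc, ← rpow_add hz]; congr 2; ring
  have hT1 : ‖z‖ ^ (2 * β₁) * ‖σ₁‖ ^ 2 ≤ T / β₁ ^ 2 := by
    rw [le_div_iff₀ (by positivity), hTeq, ← hv1, norm_mul]
    have : ‖z‖ ^ (2 * β₁ - 2) * ‖z‖ ^ 2 = ‖z‖ ^ (2 * β₁) := by
      rw [← rpow_natCast ‖z‖ 2, ← rpow_add hz]; congr 1; push_cast; ring
    have h2 : 0 ≤ γ ^ 2 * ‖w‖ ^ (2 * γ - 2) * ‖v.2‖ ^ 2 := by positivity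
    rw [← this]
    linarith
  have hT2 : ‖w‖ ^ (2 * γ) * ‖σ₂‖ ^ 2 ≤ T / γ ^ 2 := by
    rw [le_div_iff₀ (by positivity), hTeq, ← hv2, norm_mul]
    have : ‖w‖ ^ (2 * γ - 2) * ‖w‖ ^ 2 = ‖w‖ ^ (2 * γ) := by
      rw [← rpow_natCast ‖w‖ 2, ← rpow_add hw]; congr 1; push_cast; ring
    have h2 : 0 ≤ β₁ ^ 2 * ‖z‖ ^ (2 * β₁ - 2) * ‖v.1‖ ^ 2 := by positivity
    rw [← this]
    linarith
  set e := ‖z‖ ^ (2 * (β₁ * (α₀ - 1))) with he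
  have he0 : 0 ≤ e := by positivity
  have hq0 : 0 ≤ ‖ζ‖ ^ (-γ) := by positivity
  have hM0 : 0 ≤ M := by positivity
  have m1 : M * ‖σ₁‖ ^ 2 ≤ 2 * e * (T / β₁ ^ 2) := by
    calc M * ‖σ₁‖ ^ 2 ≤ (2 * e * ‖z‖ ^ (2 * β₁)) * ‖σ₁‖ ^ 2 := by gcongr
      _ = 2 * e * (‖z‖ ^ (2 * β₁) * ‖σ₁‖ ^ 2) := by ring
      _ ≤ _ := by gcongr
  have m2 : M * ‖σ₂‖ ^ 2 ≤ ‖ζ‖ ^ (-γ) * (T / γ ^ 2) := by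
    calc M * ‖σ₂‖ ^ 2 = ‖ζ‖ ^ (-γ) * (‖w‖ ^ (2 * γ) * ‖σ₂‖ ^ 2) := by rw [hMw]; ring
      _ ≤ _ := by gcongr
  have ms : M * s ^ 2 ≤ 2 * (2 * e * (T / β₁ ^ 2) + ‖ζ‖ ^ (-γ) * (T / γ ^ 2)) := by
    have : s ^ 2 ≤ 2 * (‖σ₁‖ ^ 2 + ‖σ₂‖ ^ 2) := by rw [hs]; nlinarith [sq_nonneg (‖σ₁‖ - ‖σ₂‖)]
    nlinarith [mul_le_mul_of_nonneg_left this hM0]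
  have fin : 2 * e * (T / β₁ ^ 2) + ‖ζ‖ ^ (-γ) * (T / γ ^ 2)
      ≤ (2 / β₁ ^ 2 + 1 / γ ^ 2) * (‖ζ‖ ^ (-γ) + e) * T := by
    have p1 : 0 ≤ 2 / β₁ ^ 2 * (‖ζ‖ ^ (-γ)) * T := by positivity
    have p2 : 0 ≤ 1 / γ ^ 2 * e * T := by positivity
    calc _ = 2 / β₁ ^ 2 * e * T + 1 / γ ^ 2 * ‖ζ‖ ^ (-γ) * T := by ring
      _ ≤ _ := by nlinarith
  calc 4 * CA * (4 * ‖z‖ ^ (2 * γ) * ((Cu + Ce) * ‖ζ‖ ^ γ)) * s ^ 2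
      = 16 * CA * (Cu + Ce) * (M * s ^ 2) := by rw [hM]; ring
    _ ≤ 16 * CA * (Cu + Ce) * (2 * ((2 / β₁ ^ 2 + 1 / γ ^ 2) * (‖ζ‖ ^ (-γ) + e) * T)) :=
        mul_le_mul_of_nonneg_left (by linarith) (by positivity)
    _ = _ := by ring

end

section

variable {β₁ β₂ β₃ γ α₀ : ℝ} {a₂ a₃ : ℂ} {χ₁ χ₂ : ℝ → ℝ}
  (D : GlueData β₁ β₂ β₃ γ α₀ a₂ a₃ χ₁ χ₂)

lemma exists_rpow_lt {s ε : ℝ} (hs : 0 < s) (hε : 0 < ε) :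
    ∃ r₀ : ℝ, 0 < r₀ ∧ r₀ ≤ 1 ∧ ∀ r : ℝ, 0 ≤ r → r < r₀ → r ^ s < ε := by
  refine ⟨min 1 (ε ^ (1 / s)), by positivity, min_le_left _ _, fun r hr h => ?_⟩
  have h1 : r < ε ^ (1 / s) := h.trans_le (min_le_right _ _)
  calc r ^ s < (ε ^ (1 / s)) ^ s := Real.rpow_lt_rpow hr h1 hs
    _ = ε := by rw [← rpow_mul hε.le]; field_simp; exact rpow_one ε

/-- In the region `|w| ≥ K |z|`, near the origin, the metric is as close to the cone metric as one
wishes. -/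
theorem GlueData.exists_close_to_cone {ε : ℝ}
    (hε : 0 < ε) :
    ∃ K r₀ : ℝ, 1 ≤ K ∧ ‖a₂‖ < K ∧ ‖a₃‖ < K ∧ 0 < r₀ ∧ r₀ ≤ 1 ∧ ∀ x v : ℂ × ℂ, x.1 ≠ 0 →
      ‖x.1‖ < r₀ → K ≤ ‖x.2 / x.1‖ →
      |normSq (ddbar D.pot) x v - normSq (coneMetric β₁ γ) x v|
        ≤ ε * normSq (coneMetric β₁ γ) x v := by
  obtain ⟨C, K, hC, hK1, hK2, hK3, h⟩ := D.exists_outer_bound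
  have hγ := D.pos
  have he : 0 < 2 * (β₁ * (α₀ - 1)) := by
    have := mul_pos D.pos₁ (sub_pos.2 D.one_lt); linarith
  obtain ⟨r₀, hr0, hr1, hr⟩ := exists_rpow_lt he (by positivity : 0 < ε / (2 * (C + 1)))
  obtain ⟨r₁, hr10, hr11, hr'⟩ := exists_rpow_lt hγ (by positivity : 0 < ε / (2 * (C + 1)))
  refine ⟨max K (2 / r₁), r₀, hK1.trans (le_max_left _ _), hK2.trans_le (le_max_left _ _),
    hK3.trans_le (le_max_left _ _), hr0, hr1, fun x v hx hxr hxK => ?_⟩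
  refine (h x v hx (hxr.le.trans hr1) ((le_max_left _ _).trans hxK)).trans ?_
  have hT : 0 ≤ normSq (coneMetric β₁ γ) x v := by rw [normSq_coneMetric]; positivity
  refine mul_le_mul_of_nonneg_right ?_ hT
  have h1 := hr _ (norm_nonneg _) hxr
  have h2 : 2 / r₁ ≤ ‖x.2 / x.1‖ := (le_max_right _ _).trans hxK
  have h2' : 0 < 2 / r₁ := by positivity
  have h3 : ‖x.2 / x.1‖ ^ (-γ) < ε / (2 * (C + 1)) := by
    rw [rpow_neg (norm_nonneg _), ← Real.inv_rpow (norm_nonneg _)]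
    refine hr' _ (by positivity) ?_
    rw [inv_lt_comm₀ (by linarith) hr10]
    refine lt_of_lt_of_le ?_ h2
    rw [lt_div_iff₀ hr10, inv_mul_cancel₀ hr10.ne']
    norm_num
  calc C * (‖x.2 / x.1‖ ^ (-γ) + ‖x.1‖ ^ (2 * (β₁ * (α₀ - 1))))
      ≤ C * (ε / (2 * (C + 1)) + ε / (2 * (C + 1))) := by gcongr
    _ = ε * (C / (C + 1)) := by field_simp; ring
    _ ≤ ε * 1 := by gcongr; rw [div_le_one (by positivity)]; linarith
    _ = ε := mul_one ε

/-! ### The region `|w| ≤ K |z|` -/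

/-- The gradient of the flat potential from its local form. -/
lemma grad_local {β : ℝ} {p w : ℂ} {k N φ : ℂ → ℝ} {δ : ℝ} (hk : ContDiffOn ℝ ∞ k (ball p δ))
    (hN : ContDiffOn ℝ ∞ N (ball p δ))
    (hφ : ∀ w ∈ ball p δ, φ w = ‖w - p‖ ^ (2 * β) * k w + N w)
    (hw : w ∈ ball p δ) (hwp : w ≠ p) :
    grad φ w = (‖w - p‖ ^ (2 * β) : ℝ) * grad k w
      + k w * ((β * ‖w - p‖ ^ (2 * β - 2) : ℝ) * star (w - p)) + grad N w := by
  have hnh := isOpen_ball.mem_nhds hw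
  have hs : ContDiffAt ℝ ∞ (fun y : ℂ => ‖y - p‖ ^ (2 * β)) w :=
    ContDiffAt.rpow_const_of_ne ((contDiffAt_id.sub contDiffAt_const).norm ℝ (sub_ne_zero.2 hwp))
      (norm_ne_zero_iff.2 (sub_ne_zero.2 hwp))
  have hkd := (hk.contDiffAt hnh).differentiableAt (by simp)
  have hNd := (hN.contDiffAt hnh).differentiableAt (by simp)
  have hsd := hs.differentiableAt (by simp)
  rw [grad_congr (g := fun w => ‖w - p‖ ^ (2 * β) * k w + N w)
    (by filter_upwards [hnh] with y hy using hφ y hy), grad_add (hsd.fun_mul hkd) hNd,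
    grad_mul hsd hkd, grad_norm_sub_rpow p β hwp]

lemma continuousAt_grad {f : ℂ → ℝ} {x : ℂ} (hf : ContDiffAt ℝ ∞ f x) : ContinuousAt (grad f) x :=
  (contDiffAt_dzeta (contDiffAt_ofReal hf)).continuousAt

lemma FlatData.exists_density_lower (D : FlatData β₂ β₃ γ a₂ a₃) {p : ℂ} {β : ℝ}
    (hp : (p = a₂ ∧ β = β₂) ∨ (p = a₃ ∧ β = β₃) ∨ (p ≠ a₂ ∧ p ≠ a₃ ∧ β = 1)) :
    ∃ c > 0, ∀ᶠ t in 𝓝 p, c * ‖t - p‖ ^ (2 * β - 2) ≤ density β₂ β₃ a₂ a₃ t := by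
  have key : ∀ (a : ℂ) (s : ℝ), p ≠ a → ∃ c > 0, ∀ᶠ t in 𝓝 p, c ≤ ‖t - a‖ ^ s := by
    intro a s h
    have hpos : 0 < ‖p - a‖ := norm_pos_iff.2 (sub_ne_zero.2 h)
    have hc : ContinuousAt (fun t : ℂ => ‖t - a‖ ^ s) p :=
      ContinuousAt.rpow_const (by fun_prop) (Or.inl hpos.ne')
    refine ⟨‖p - a‖ ^ s / 2, by positivity, ?_⟩
    filter_upwards [hc.eventually (lt_mem_nhds (half_lt_self (by positivity :
      0 < ‖p - a‖ ^ s)))] with t ht using ht.le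
  rcases hp with ⟨rfl, rfl⟩ | ⟨rfl, rfl⟩ | ⟨h2, h3, rfl⟩
  · obtain ⟨c, hc, h⟩ := key a₃ (2 * β₃ - 2) D.ne
    refine ⟨c, hc, ?_⟩
    filter_upwards [h] with t ht
    rw [density, mul_comm]
    gcongr
  · obtain ⟨c, hc, h⟩ := key a₂ (2 * β₂ - 2) D.ne.symm
    refine ⟨c, hc, ?_⟩
    filter_upwards [h] with t ht
    rw [density]
    gcongr
  · obtain ⟨c, hc, h⟩ := key a₂ (2 * β₂ - 2) h2
    obtain ⟨c', hc', h'⟩ := key a₃ (2 * β₃ - 2) h3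
    refine ⟨c * c', by positivity, ?_⟩
    filter_upwards [h, h'] with t ht ht'
    rw [density, mul_one, sub_self, Real.rpow_zero, mul_one]
    gcongr

/-- The flat metric has cone angle `2πβ` at `p`, with `β = 1` at ordinary points. -/
lemma exists_cone_parameter (β₂ β₃ : ℝ) (a₂ a₃ p : ℂ) :
    ∃ β, (p = a₂ ∧ β = β₂) ∨ (p = a₃ ∧ β = β₃) ∨ (p ≠ a₂ ∧ p ≠ a₃ ∧ β = 1) := by
  by_cases h2 : p = a₂
  · exact ⟨β₂, Or.inl ⟨h2, rfl⟩⟩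
  · by_cases h3 : p = a₃
    · exact ⟨β₃, Or.inr (Or.inl ⟨h3, rfl⟩)⟩
    · exact ⟨1, Or.inr (Or.inr ⟨h2, h3, rfl⟩)⟩

lemma FlatData.cone_parameter_mem (D : FlatData β₂ β₃ γ a₂ a₃) {p : ℂ} {β : ℝ}
    (hp : (p = a₂ ∧ β = β₂) ∨ (p = a₃ ∧ β = β₃) ∨ (p ≠ a₂ ∧ p ≠ a₃ ∧ β = 1)) :
    0 < β ∧ β ≤ 1 := by
  rcases hp with ⟨-, rfl⟩ | ⟨-, rfl⟩ | ⟨-, -, rfl⟩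
  exacts [⟨D.pos₂, D.lt₂.le⟩, ⟨D.pos₃, D.lt₃.le⟩, ⟨one_pos, le_rfl⟩]

lemma FlatData.continuous_flatPotential (D : FlatData β₂ β₃ γ a₂ a₃) :
    Continuous (flatPotential β₂ β₃ γ a₂ a₃) := by
  refine continuous_iff_continuousAt.2 fun p => ?_
  obtain ⟨β, hp⟩ := exists_cone_parameter β₂ β₃ a₂ a₃ p
  have hβ := D.cone_parameter_mem hp
  obtain ⟨k, N, δ, hδ, hk, hN, hform, -⟩ := D.flatPotential_local hp
  have hnh := isOpen_ball.mem_nhds (mem_ball_self hδ : p ∈ ball p δ)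
  have h1 : ContinuousAt (fun w : ℂ => ‖w - p‖ ^ (2 * β)) p :=
    ContinuousAt.rpow_const (by fun_prop) (Or.inr (by linarith [hβ.1]))
  refine ((h1.mul (hk.contDiffAt hnh).continuousAt).add
    (hN.contDiffAt hnh).continuousAt).congr ?_
  filter_upwards [hnh] with w hw using (hform w hw).symm

/-- On compact sets the gradient of the flat potential is bounded in the flat metric. -/
theorem FlatData.exists_inner_bound (D : FlatData β₂ β₃ γ a₂ a₃) (K : ℝ) :
    ∃ C : ℝ, 0 ≤ C ∧ ∀ ζ : ℂ, ‖ζ‖ ≤ K → ζ ≠ a₂ → ζ ≠ a₃ →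
      |flatPotential β₂ β₃ γ a₂ a₃ ζ| ≤ C ∧
      ‖grad (flatPotential β₂ β₃ γ a₂ a₃) ζ‖ ^ 2 ≤ C * density β₂ β₃ a₂ a₃ ζ := by
  have hd0 : ∀ t, 0 ≤ density β₂ β₃ a₂ a₃ t := fun t => by unfold density; positivity
  suffices h : ∃ C : ℝ, 0 ≤ C ∧ ∀ ζ ∈ Metric.closedBall (0 : ℂ) K, ζ ≠ a₂ → ζ ≠ a₃ →
      |flatPotential β₂ β₃ γ a₂ a₃ ζ| ≤ C ∧
      ‖grad (flatPotential β₂ β₃ γ a₂ a₃) ζ‖ ^ 2 ≤ C * density β₂ β₃ a₂ a₃ ζ by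
    obtain ⟨C, hC, h⟩ := h
    exact ⟨C, hC, fun ζ hζ => h ζ (by simpa using hζ)⟩
  refine (isCompact_closedBall (0 : ℂ) K).induction_on
    (p := fun S => ∃ C : ℝ, 0 ≤ C ∧ ∀ ζ ∈ S, ζ ≠ a₂ → ζ ≠ a₃ →
      |flatPotential β₂ β₃ γ a₂ a₃ ζ| ≤ C ∧
      ‖grad (flatPotential β₂ β₃ γ a₂ a₃) ζ‖ ^ 2 ≤ C * density β₂ β₃ a₂ a₃ ζ)
    ⟨0, le_rfl, by simp⟩ (fun S T hST ⟨C, hC, h⟩ => ⟨C, hC, fun ζ hζ => h ζ (hST hζ)⟩) ?_ ?_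
  · rintro S T ⟨C, hC, h⟩ ⟨C', hC', h'⟩
    refine ⟨max C C', le_max_of_le_left hC, fun ζ hζ n2 n3 => ?_⟩
    rcases hζ with hζ | hζ
    · obtain ⟨e1, e2⟩ := h ζ hζ n2 n3
      exact ⟨e1.trans (le_max_left _ _), e2.trans
        (mul_le_mul_of_nonneg_right (le_max_left _ _) (hd0 _))⟩
    · obtain ⟨e1, e2⟩ := h' ζ hζ n2 n3
      exact ⟨e1.trans (le_max_right _ _), e2.trans
        (mul_le_mul_of_nonneg_right (le_max_right _ _) (hd0 _))⟩
  · intro p _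
    obtain ⟨β, hp⟩ := exists_cone_parameter β₂ β₃ a₂ a₃ p
    obtain ⟨hβ0, hβ1⟩ := D.cone_parameter_mem hp
    obtain ⟨k, N, δ, hδ, hk, hN, hform, -⟩ := D.flatPotential_local hp
    obtain ⟨c, hc, hlow⟩ := D.exists_density_lower hp
    have hnh := isOpen_ball.mem_nhds (mem_ball_self hδ : p ∈ ball p δ)
    set φ := flatPotential β₂ β₃ γ a₂ a₃ with hφ
    have hbd : ∀ {F : Type} [NormedAddCommGroup F] {f : ℂ → F}, ContinuousAt f p →
        ∀ᶠ t in 𝓝 p, ‖f t‖ ≤ ‖f p‖ + 1 := fun hf => by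
      filter_upwards [hf.norm.eventually (gt_mem_nhds (lt_add_one _))] with t ht using ht.le
    set M := |φ p| + 1 + (|k p| + 1) + (‖grad k p‖ + 1) + (‖grad N p‖ + 1) with hM
    have hM0 : 0 ≤ M := by positivity
    have hev : ∀ᶠ ζ in 𝓝 p, ζ ≠ a₂ → ζ ≠ a₃ →
        |φ ζ| ≤ M ∧ ‖grad φ ζ‖ ^ 2 ≤ (9 * M ^ 2 / c) * density β₂ β₃ a₂ a₃ ζ := by
      filter_upwards [hbd D.continuous_flatPotential.continuousAt,
        hbd (hk.contDiffAt hnh).continuousAt, hbd (continuousAt_grad (hk.contDiffAt hnh)),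
        hbd (continuousAt_grad (hN.contDiffAt hnh)), hnh, hlow,
        ball_mem_nhds p one_pos] with ζ b0 b1 b2 b3 hζ hl hζ1 n2 n3
      rw [norm_eq_abs, norm_eq_abs] at b0 b1
      have p0 := abs_nonneg (φ p)
      have p1 := abs_nonneg (k p)
      have p2 := norm_nonneg (grad k p)
      have p3 := norm_nonneg (grad N p)
      refine ⟨by rw [hM]; linarith, ?_⟩
      -- each term of the gradient of the local form is at most of order `|ζ - p|^(β - 1)`
      have hbig : ∀ s : ℝ, 0 < s → s ≤ 1 → ‖(s ^ (2 * β) : ℝ) * grad k ζ‖ + s * ‖(k ζ : ℂ)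
          * ((β * s ^ (2 * β - 2) : ℝ) : ℂ)‖ + ‖grad N ζ‖ ≤ 3 * M * s ^ (β - 1) := by
        intro s hs hs1
        have e1 : s ^ (2 * β) ≤ s ^ (β - 1) :=
          rpow_le_rpow_of_exponent_ge hs hs1 (by linarith)
        have e2 : s * s ^ (2 * β - 2) ≤ s ^ (β - 1) := by
          rw [mul_comm, ← rpow_add_one hs.ne']
          exact rpow_le_rpow_of_exponent_ge hs hs1 (by linarith)
        have e3 : 1 ≤ s ^ (β - 1) := Real.one_le_rpow_of_pos_of_le_one_of_nonpos hs hs1 (by linarith)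
        rw [norm_mul, norm_mul, norm_real, norm_real, norm_real,
          norm_of_nonneg (by positivity), norm_eq_abs, norm_of_nonneg (by positivity)]
        have f1 : s ^ (2 * β) * ‖grad k ζ‖ ≤ s ^ (β - 1) * M := by
          gcongr; rw [hM]; linarith
        have f2 : s * (|k ζ| * (β * s ^ (2 * β - 2))) ≤ M * s ^ (β - 1) := by
          calc s * (|k ζ| * (β * s ^ (2 * β - 2))) = |k ζ| * (β * (s * s ^ (2 * β - 2))) := by ring
            _ ≤ M * (1 * s ^ (β - 1)) := by gcongr; rw [hM]; linarith
            _ = _ := by ring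
        have f3 : ‖grad N ζ‖ ≤ M * s ^ (β - 1) := by
          calc ‖grad N ζ‖ ≤ M * 1 := by rw [hM]; linarith
            _ ≤ _ := by gcongr
        linarith
      have hgoal : ζ ≠ p → ‖grad φ ζ‖ ^ 2 ≤ (9 * M ^ 2 / c) * density β₂ β₃ a₂ a₃ ζ := by
        intro hζp
        have hs : 0 < ‖ζ - p‖ := norm_pos_iff.2 (sub_ne_zero.2 hζp)
        have h1 : ‖grad φ ζ‖ ≤ 3 * M * ‖ζ - p‖ ^ (β - 1) := by
          refine le_trans ?_ (hbig _ hs (mem_ball_iff_norm.1 hζ1).le)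
          rw [grad_local hk hN hform hζ hζp]
          refine (norm_add_le _ _).trans (add_le_add_left ((norm_add_le _ _).trans ?_) _)
          rw [← mul_assoc, norm_mul _ (star _), norm_star]
          linarith
        calc ‖grad φ ζ‖ ^ 2 ≤ (3 * M * ‖ζ - p‖ ^ (β - 1)) ^ 2 := by gcongr
          _ = 9 * M ^ 2 / c * (c * ‖ζ - p‖ ^ (2 * β - 2)) := by
              have : (‖ζ - p‖ ^ (β - 1)) ^ 2 = ‖ζ - p‖ ^ (2 * β - 2) := by
                rw [← rpow_natCast (_ ^ (β - 1)), ← rpow_mul hs.le]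
                congr 1; push_cast; ring
              rw [mul_pow, this]; field_simp; ring
          _ ≤ _ := by gcongr
      by_cases hζp : ζ = p
      · -- at an ordinary point the local form is smooth at its centre
        have hβ : β = 1 := by
          rcases hp with ⟨h, -⟩ | ⟨h, -⟩ | ⟨-, -, h⟩
          exacts [absurd (hζp.trans h) n2, absurd (hζp.trans h) n3, h]
        subst hβ
        have hg : grad φ ζ = grad N ζ := by
          have hkd := (hk.contDiffAt hnh).differentiableAt (by simp)
          have hNd := (hN.contDiffAt hnh).differentiableAt (by simp)
          have hfd : HasFDerivAt (fun w : ℂ => (((‖w - p‖ ^ 2 + 0 : ℝ)) : ℂ)) (wirt 0 0) p := by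
            simpa using hasFDerivAt_normSq_sub p 0 p
          have h2 := hasFDerivAt_wirt_add (hasFDerivAt_wirt_mul hfd (hasFDerivAt_grad hkd))
            (hasFDerivAt_grad hNd)
          rw [hζp]
          refine (dzeta_congr (g := fun w : ℂ => (((‖w - p‖ ^ 2 + 0 : ℝ)) : ℂ) * (k w : ℂ)
            + (N w : ℂ)) ?_).trans ((dzeta_eq h2).trans (by simp))
          filter_upwards [hnh] with w hw
          rw [hform w hw]
          norm_num
        rw [hg]
        have h3 : ‖grad N ζ‖ ≤ 3 * M := by linarith
        have h4 : c ≤ density β₂ β₃ a₂ a₃ ζ := by simpa [hζp] using hl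
        calc ‖grad N ζ‖ ^ 2 ≤ (3 * M) ^ 2 := by gcongr
          _ = 9 * M ^ 2 / c * c := by field_simp; ring
          _ ≤ _ := by gcongr
      · exact hgoal hζp
    refine ⟨_, mem_nhdsWithin_of_mem_nhds hev, M + 9 * M ^ 2 / c, by positivity,
      fun ζ hζ n2 n3 => ?_⟩
    obtain ⟨e1, e2⟩ := hζ n2 n3
    have h9 : 0 ≤ 9 * M ^ 2 / c := by positivity
    refine ⟨by linarith, e2.trans ?_⟩
    exact mul_le_mul_of_nonneg_right (by linarith) (hd0 _)

lemma GlueData.exists_ratio_lt (D : GlueData β₁ β₂ β₃ γ α₀ a₂ a₃ χ₁ χ₂) {K : ℝ} (hK : 0 < K) :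
    ∃ r₀ : ℝ, 0 < r₀ ∧ r₀ ≤ 1 ∧ ∀ x : ℂ × ℂ, x.1 ≠ 0 → ‖x.1‖ < r₀ → ‖x.2 / x.1‖ ≤ K →
      ratio β₁ γ α₀ x < 1 := by
  have hγ := D.pos
  obtain ⟨r₀, h0, h1, h⟩ := exists_rpow_lt (sub_pos.2 D.mul_lt) (by positivity : 0 < (K ^ γ)⁻¹)
  refine ⟨r₀, h0, h1, fun x hx hxr hxK => ?_⟩
  have hz : 0 < ‖x.1‖ := norm_pos_iff.2 hx
  have e : ratio β₁ γ α₀ x = ‖x.2 / x.1‖ ^ γ * ‖x.1‖ ^ (γ - α₀ * β₁) := by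
    rw [ratio, ← rpow_mul hz.le, norm_div, div_rpow (norm_nonneg _) hz.le,
      Real.rpow_sub hz, show β₁ * -α₀ = -(α₀ * β₁) by ring, rpow_neg hz.le]
    have : ‖x.1‖ ^ γ ≠ 0 := by positivity
    field_simp
  have hKγ : 0 < K ^ γ := by positivity
  calc ratio β₁ γ α₀ x ≤ K ^ γ * ‖x.1‖ ^ (γ - α₀ * β₁) := by rw [e]; gcongr
    _ < K ^ γ * (K ^ γ)⁻¹ := by gcongr; exact h _ hz.le hxr
    _ = 1 := mul_inv_cancel₀ hKγ.ne'

/-- Completing the square in the inner formula. -/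
lemma GlueData.exists_inner_lower {K ε : ℝ} (hK : 0 < K)
    (hε : 0 < ε) :
    ∃ r₀ : ℝ, 0 < r₀ ∧ r₀ ≤ 1 ∧ ∀ x v : ℂ × ℂ, x.1 ≠ 0 → ‖x.1‖ < r₀ → ‖x.2 / x.1‖ ≤ K →
      x.2 / x.1 ≠ a₂ → x.2 / x.1 ≠ a₃ →
      (1 - ε) * (β₁ ^ 2 * ‖x.1‖ ^ (2 * β₁ - 2) * ‖v.1‖ ^ 2) ≤ normSq (ddbar D.pot) x v := by
  obtain ⟨C, hC, hin⟩ := D.toFlatData.exists_inner_bound K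
  obtain ⟨r₀, h0, h1, hr⟩ := D.exists_ratio_lt hK
  have hβ := D.pos₁
  have hγ := D.pos
  obtain ⟨r₁, h10, h11, hs⟩ := exists_rpow_lt (by linarith [D.lt_γ] : 0 < 2 * γ - 2 * β₁)
    (by positivity : 0 < ε * β₁ ^ 2 / (2 * (C + 1)))
  refine ⟨min r₀ r₁, by positivity, (min_le_left _ _).trans h1, fun x v hx hxr hxK n2 n3 => ?_⟩
  have hz : 0 < ‖x.1‖ := norm_pos_iff.2 hx
  rw [D.normSq_inner hx n2 n3 (hr x hx (hxr.trans_le (min_le_left _ _)) hxK)]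
  obtain ⟨b1, b2⟩ := hin _ hxK n2 n3
  set φ := flatPotential β₂ β₃ γ a₂ a₃
  set ζ := x.2 / x.1
  set η := v.2 - ζ * v.1
  set f := density β₂ β₃ a₂ a₃ ζ with hf
  have hf0 : 0 < f := by
    have := norm_pos_iff.2 (sub_ne_zero.2 n2)
    have := norm_pos_iff.2 (sub_ne_zero.2 n3)
    rw [hf, density]; positivity
  have hγ1 := D.lt
  -- the cross term is absorbed in the last one
  have hcross : -(C * ‖v.1‖ ^ 2 + γ ^ 2 * f * ‖η‖ ^ 2)
      ≤ 2 * γ * (v.1 * star (grad φ ζ * η)).re := by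
    have e1 := (abs_le.1 (Complex.abs_re_le_norm (v.1 * star (grad φ ζ * η)))).1
    rw [norm_mul, norm_star, norm_mul] at e1
    have e2 : 2 * (γ * (‖grad φ ζ‖ * ‖v.1‖ * ‖η‖)) * f
        ≤ (C * ‖v.1‖ ^ 2 + γ ^ 2 * f * ‖η‖ ^ 2) * f := by
      have := mul_le_mul_of_nonneg_right b2 (sq_nonneg ‖v.1‖)
      nlinarith [sq_nonneg (‖grad φ ζ‖ * ‖v.1‖ - γ * f * ‖η‖)]
    have e3 := le_of_mul_le_mul_right e2 hf0
    nlinarith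
  have hφb : -(C * ‖v.1‖ ^ 2) ≤ γ ^ 2 * φ ζ * ‖v.1‖ ^ 2 := by
    have e1 : -C ≤ γ ^ 2 * φ ζ := by
      have g1 : γ ^ 2 ≤ 1 := by nlinarith
      calc -C ≤ γ ^ 2 * (-C) := by nlinarith
        _ ≤ γ ^ 2 * φ ζ := mul_le_mul_of_nonneg_left (abs_le.1 b1).1 (sq_nonneg γ)
    nlinarith [sq_nonneg ‖v.1‖]
  -- the terms of order `|z|^(2γ - 2)` are negligible, because `β₁ < γ`
  have hsm : ‖x.1‖ ^ (2 * γ - 2) * (2 * C) ≤ ε * (β₁ ^ 2 * ‖x.1‖ ^ (2 * β₁ - 2)) := by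
    have e1 := hs _ hz.le (hxr.trans_le (min_le_right _ _))
    have e2 : ‖x.1‖ ^ (2 * γ - 2) = ‖x.1‖ ^ (2 * γ - 2 * β₁) * ‖x.1‖ ^ (2 * β₁ - 2) := by
      rw [← rpow_add hz]; congr 1; ring
    rw [lt_div_iff₀ (by positivity)] at e1
    rw [e2]
    have e3 : 0 < ‖x.1‖ ^ (2 * β₁ - 2) := by positivity
    have e4 : 0 < ‖x.1‖ ^ (2 * γ - 2 * β₁) := by positivity
    nlinarith
  have hfin : ‖x.1‖ ^ (2 * γ - 2) * (-(2 * C * ‖v.1‖ ^ 2))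
      ≤ ‖x.1‖ ^ (2 * γ - 2) * (γ ^ 2 * φ ζ * ‖v.1‖ ^ 2 + 2 * γ * (v.1 * star (grad φ ζ * η)).re
        + γ ^ 2 * f * ‖η‖ ^ 2) := by
    gcongr
    linarith
  nlinarith [mul_le_mul_of_nonneg_right hsm (sq_nonneg ‖v.1‖)]

/-- The `z`-part of the cone metric is a lower bound, up to a factor close to one. -/
theorem GlueData.exists_fst_lower {ε : ℝ} (hε : 0 < ε) :
    ∃ r₀ : ℝ, 0 < r₀ ∧ r₀ ≤ 1 ∧ ∀ x v : ℂ × ℂ, x.1 ≠ 0 → ‖x.1‖ < r₀ →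
      x.2 / x.1 ≠ a₂ → x.2 / x.1 ≠ a₃ →
      (1 - ε) * (β₁ ^ 2 * ‖x.1‖ ^ (2 * β₁ - 2) * ‖v.1‖ ^ 2) ≤ normSq (ddbar D.pot) x v := by
  obtain ⟨K, r₀, hK1, -, -, h0, h1, hout⟩ := D.exists_close_to_cone (lt_min hε one_pos)
  obtain ⟨r₁, h10, h11, hin⟩ := D.exists_inner_lower (by linarith : 0 < K) hε
  refine ⟨min r₀ r₁, by positivity, (min_le_left _ _).trans h1, fun x v hx hxr n2 n3 => ?_⟩
  rcases le_total K ‖x.2 / x.1‖ with h | h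
  · have e := (abs_le.1 (hout x v hx (hxr.trans_le (min_le_left _ _)) h)).1
    have e1 : β₁ ^ 2 * ‖x.1‖ ^ (2 * β₁ - 2) * ‖v.1‖ ^ 2 ≤ normSq (coneMetric β₁ γ) x v := by
      rw [normSq_coneMetric]
      have : 0 ≤ γ ^ 2 * ‖x.2‖ ^ (2 * γ - 2) * ‖v.2‖ ^ 2 := by positivity
      linarith
    have e2 : 0 ≤ β₁ ^ 2 * ‖x.1‖ ^ (2 * β₁ - 2) * ‖v.1‖ ^ 2 := by positivity
    have e3 := min_le_left ε 1
    have e4 := min_le_right ε 1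
    nlinarith
  · exact hin x v hx (hxr.trans_le (min_le_right _ _)) h n2 n3

/-- The glued metric is positive near the origin. -/
theorem GlueData.exists_pos :
    ∃ r₀ : ℝ, 0 < r₀ ∧ r₀ ≤ 1 ∧ ∀ x v : ℂ × ℂ, x.1 ≠ 0 → ‖x.1‖ < r₀ →
      x.2 / x.1 ≠ a₂ → x.2 / x.1 ≠ a₃ → v ≠ 0 → 0 < normSq (ddbar D.pot) x v := by
  have hβ := D.pos₁
  have hγ := D.pos
  obtain ⟨K, r₀, hK1, -, -, h0, h1, hout⟩ := D.exists_close_to_cone (half_pos one_pos)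
  obtain ⟨r₁, h10, h11, hlow⟩ := D.exists_fst_lower (half_pos one_pos)
  obtain ⟨r₂, h20, h21, hr⟩ := D.exists_ratio_lt (by linarith : 0 < K)
  refine ⟨min r₀ (min r₁ r₂), by positivity, (min_le_left _ _).trans h1,
    fun x v hx hxr n2 n3 hv => ?_⟩
  have hz : 0 < ‖x.1‖ := norm_pos_iff.2 hx
  rw [lt_min_iff, lt_min_iff] at hxr
  by_cases hv1 : v.1 = 0
  · have hv2 : v.2 ≠ 0 := fun h => hv (Prod.ext hv1 h)
    have hv20 : 0 < ‖v.2‖ := norm_pos_iff.2 hv2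
    rcases le_total K ‖x.2 / x.1‖ with h | h
    · have e := (abs_le.1 (hout x v hx hxr.1 h)).1
      have hw : x.2 ≠ 0 := by rintro h'; rw [h', zero_div, norm_zero] at h; linarith
      have hw0 : 0 < ‖x.2‖ := norm_pos_iff.2 hw
      have e1 : 0 < normSq (coneMetric β₁ γ) x v := by
        rw [normSq_coneMetric, hv1]
        positivity
      linarith
    · rw [D.normSq_inner hx n2 n3 (hr x hx hxr.2.2 h), hv1]
      have := norm_pos_iff.2 (sub_ne_zero.2 n2)
      have := norm_pos_iff.2 (sub_ne_zero.2 n3)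
      have hd : 0 < density β₂ β₃ a₂ a₃ (x.2 / x.1) := by rw [density]; positivity
      simp only [norm_zero, zero_mul, mul_zero, Complex.zero_re, sub_zero, ne_eq, OfNat.ofNat_ne_zero,
        not_false_eq_true, zero_pow, add_zero, zero_add]
      positivity
  · have hv10 : 0 < ‖v.1‖ := norm_pos_iff.2 hv1
    refine lt_of_lt_of_le ?_ (hlow x v hx hxr.2.1 n2 n3)
    positivity

lemma norm_sub_smul_eq {a : ℂ} {x : ℂ × ℂ} (hx : x.1 ≠ 0) (s : ℝ) :
    ‖x.2 - a * x.1‖ ^ s = ‖x.1‖ ^ s * ‖x.2 / x.1 - a‖ ^ s := by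
  rw [← mul_rpow (norm_nonneg _) (norm_nonneg _), ← norm_mul]
  congr 2
  field_simp

/-- The `w`-part of the metric is bounded by the density of the flat metrics on the vertical
lines. -/
theorem GlueData.exists_snd_upper :
    ∃ r₀ C : ℝ, 0 < r₀ ∧ r₀ ≤ 1 ∧ 0 ≤ C ∧ ∀ (x : ℂ × ℂ) (v : ℂ), x.1 ≠ 0 → ‖x.1‖ < r₀ →
      x.2 / x.1 ≠ a₂ → x.2 / x.1 ≠ a₃ → normSq (ddbar D.pot) x (0, v)
        ≤ C * (‖x.2 - a₂ * x.1‖ ^ (2 * β₂ - 2) * ‖x.2 - a₃ * x.1‖ ^ (2 * β₃ - 2)) * ‖v‖ ^ 2 := by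
  have hγ := D.pos
  have hγ1 := D.lt
  obtain ⟨K, r₀, hK1, hK2, hK3, h0, h1, hout⟩ := D.exists_close_to_cone one_pos
  obtain ⟨r₂, h20, h21, hr⟩ := D.exists_ratio_lt (by linarith : 0 < K)
  have hang := D.angle
  refine ⟨min r₀ r₂, 2 * 2 ^ (2 - 2 * γ), by positivity, (min_le_left _ _).trans h1, by positivity,
    fun x v hx hxr n2 n3 => ?_⟩
  rw [lt_min_iff] at hxr
  have hz : 0 < ‖x.1‖ := norm_pos_iff.2 hx
  have p2 := norm_pos_iff.2 (sub_ne_zero.2 n2)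
  have p3 := norm_pos_iff.2 (sub_ne_zero.2 n3)
  rcases le_total K ‖x.2 / x.1‖ with h | h
  · have e := (abs_le.1 (hout x (0, v) hx hxr.1 h)).2
    rw [normSq_coneMetric] at e
    simp only [norm_zero, ne_eq, OfNat.ofNat_ne_zero, not_false_eq_true, zero_pow, mul_zero,
      zero_add] at e
    have hw : x.2 ≠ 0 := by rintro h'; rw [h', zero_div, norm_zero] at h; linarith
    have hw0 : 0 < ‖x.2‖ := norm_pos_iff.2 hw
    -- in this region `|w - a z| ≤ 2 |w|`
    have hle : ∀ (a : ℂ) (s : ℝ), ‖a‖ < K → x.2 / x.1 ≠ a → s ≤ 0 →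
        (2 * ‖x.2‖) ^ s ≤ ‖x.2 - a * x.1‖ ^ s := by
      intro a s ha hne hs
      have q : 0 < ‖x.2 - a * x.1‖ := by
        rw [norm_pos_iff, sub_ne_zero]
        intro h'
        exact hne (by rw [h', mul_div_cancel_right₀ _ hx])
      refine rpow_le_rpow_of_nonpos q ?_ hs
      rw [norm_div, le_div_iff₀ hz] at h
      have := norm_sub_le x.2 (a * x.1)
      rw [norm_mul] at this
      nlinarith
    have q1 := hle a₂ (2 * β₂ - 2) hK2 n2 (by linarith [D.lt₂])
    have q2 := hle a₃ (2 * β₃ - 2) hK3 n3 (by linarith [D.lt₃])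
    have q3 : 2 ^ (2 - 2 * γ) * ((2 * ‖x.2‖) ^ (2 * β₂ - 2) * (2 * ‖x.2‖) ^ (2 * β₃ - 2))
        = ‖x.2‖ ^ (2 * γ - 2) := by
      rw [← rpow_add (by positivity), show 2 * β₂ - 2 + (2 * β₃ - 2) = 2 * γ - 2 by linarith,
        mul_rpow (by norm_num) hw0.le, ← mul_assoc, ← rpow_add (by norm_num)]
      simp
    have q4 : ‖x.2‖ ^ (2 * γ - 2) ≤ 2 ^ (2 - 2 * γ)
        * (‖x.2 - a₂ * x.1‖ ^ (2 * β₂ - 2) * ‖x.2 - a₃ * x.1‖ ^ (2 * β₃ - 2)) := by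
      rw [← q3]; gcongr
    have q5 : γ ^ 2 ≤ 1 := by nlinarith
    calc normSq (ddbar D.pot) x (0, v) ≤ 2 * (γ ^ 2 * ‖x.2‖ ^ (2 * γ - 2) * ‖v‖ ^ 2) := by linarith
      _ ≤ 2 * (1 * (2 ^ (2 - 2 * γ)
        * (‖x.2 - a₂ * x.1‖ ^ (2 * β₂ - 2) * ‖x.2 - a₃ * x.1‖ ^ (2 * β₃ - 2))) * ‖v‖ ^ 2) := by
          gcongr
      _ = _ := by ring
  · rw [D.normSq_inner hx n2 n3 (hr x hx hxr.2 h), norm_sub_smul_eq hx, norm_sub_smul_eq hx]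
    simp only [norm_zero, zero_mul, mul_zero, Complex.zero_re, sub_zero, ne_eq, OfNat.ofNat_ne_zero,
      not_false_eq_true, zero_pow, add_zero, zero_add]
    have q : ‖x.1‖ ^ (2 * γ - 2) = ‖x.1‖ ^ (2 * β₂ - 2) * ‖x.1‖ ^ (2 * β₃ - 2) := by
      rw [← rpow_add hz]; congr 1; linarith
    have q5 : γ ^ 2 ≤ 1 := by nlinarith
    have q6 : (1 : ℝ) ≤ 2 ^ (2 - 2 * γ) := Real.one_le_rpow (by norm_num) (by linarith)
    rw [density, q]
    set A := ‖x.1‖ ^ (2 * β₂ - 2) * ‖x.1‖ ^ (2 * β₃ - 2) with hA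
    set B := ‖x.2 / x.1 - a₂‖ ^ (2 * β₂ - 2) * ‖x.2 / x.1 - a₃‖ ^ (2 * β₃ - 2) with hB
    calc A * (γ ^ 2 * B * ‖v‖ ^ 2) ≤ A * (1 * B * ‖v‖ ^ 2) := by gcongr
      _ = 1 * (A * B * ‖v‖ ^ 2) := by ring
      _ ≤ (2 * 2 ^ (2 - 2 * γ)) * (A * B * ‖v‖ ^ 2) := by gcongr; linarith
      _ = _ := by rw [hA, hB]; ring

lemma FlatData.ne_zero (D : FlatData β₂ β₃ γ a₂ a₃) : a₂ ≠ 0 ∧ a₃ ≠ 0 := by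
  have h2 : (1 - β₂ : ℂ) ≠ 0 := by
    have := D.lt₂
    exact_mod_cast (by linarith : (1 - β₂ : ℝ) ≠ 0)
  have h3 : (1 - β₃ : ℂ) ≠ 0 := by
    have := D.lt₃
    exact_mod_cast (by linarith : (1 - β₃ : ℝ) ≠ 0)
  have hm := D.mass
  constructor <;> rintro rfl
  · have : a₃ = 0 := by simpa [h3] using hm
    exact D.ne this.symm
  · have : a₂ = 0 := by simpa [h2] using hm
    exact D.ne this

/-- The `z`-part of the metric along the line `{w = 0}`. -/
theorem GlueData.exists_fst_upper :
    ∃ r₀ C : ℝ, 0 < r₀ ∧ r₀ ≤ 1 ∧ 0 ≤ C ∧ ∀ (z v : ℂ), z ≠ 0 → ‖z‖ < r₀ →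
      normSq (ddbar D.pot) (z, 0) (v, 0) ≤ C * ‖z‖ ^ (2 * β₁ - 2) * ‖v‖ ^ 2 := by
  obtain ⟨n2, n3⟩ := D.toFlatData.ne_zero
  obtain ⟨r₂, h20, h21, hr⟩ := D.exists_ratio_lt one_pos
  refine ⟨r₂, β₁ ^ 2 + γ ^ 2 * |flatPotential β₂ β₃ γ a₂ a₃ 0|, h20, h21, by positivity,
    fun z v hx hxr => ?_⟩
  have hz : 0 < ‖z‖ := norm_pos_iff.2 hx
  rw [D.normSq_inner (x := (z, 0)) hx (by simpa using n2.symm) (by simpa using n3.symm)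
    (hr (z, 0) hx hxr (by simp))]
  simp only [zero_div, zero_mul, sub_zero, mul_zero, star_zero, Complex.zero_re, norm_zero, ne_eq,
    OfNat.ofNat_ne_zero, not_false_eq_true, zero_pow, add_zero]
  have h1 : ‖z‖ ^ (2 * γ - 2) ≤ ‖z‖ ^ (2 * β₁ - 2) :=
    rpow_le_rpow_of_exponent_ge hz (hxr.le.trans h21) (by linarith [D.lt_γ])
  have h2 : γ ^ 2 * flatPotential β₂ β₃ γ a₂ a₃ 0 * ‖v‖ ^ 2
      ≤ γ ^ 2 * |flatPotential β₂ β₃ γ a₂ a₃ 0| * ‖v‖ ^ 2 := by gcongr; exact le_abs_self _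
  calc _ ≤ β₁ ^ 2 * ‖z‖ ^ (2 * β₁ - 2) * ‖v‖ ^ 2
        + ‖z‖ ^ (2 * β₁ - 2) * (γ ^ 2 * |flatPotential β₂ β₃ γ a₂ a₃ 0| * ‖v‖ ^ 2) := by
        refine add_le_add_right ?_ _
        refine (mul_le_mul_of_nonneg_left h2 (by positivity)).trans ?_
        gcongr
    _ = _ := by ring

/-! ### Continuity of the glued potential -/

lemma FlatData.exists_potentialExcess_le (D : FlatData β₂ β₃ γ a₂ a₃) :
    ∃ C : ℝ, 0 ≤ C ∧ ∀ ζ, |potentialExcess β₂ β₃ γ a₂ a₃ ζ| ≤ C * (1 + ‖ζ‖ ^ γ) := by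
  obtain ⟨C, K, hC, -, -, -, h⟩ := D.exists_growth_bound
  have hc : Continuous (potentialExcess β₂ β₃ γ a₂ a₃) :=
    D.continuous_flatPotential.sub (continuous_norm.rpow_const fun _ => Or.inr
      (by linarith [D.pos]))
  obtain ⟨M, hM⟩ := (isCompact_closedBall (0 : ℂ) K).exists_bound_of_continuousOn
    hc.continuousOn
  refine ⟨C + |M|, by positivity, fun ζ => ?_⟩
  have h0 : 0 ≤ ‖ζ‖ ^ γ := by positivity
  rcases le_total K ‖ζ‖ with hζ | hζ
  · have := (h ζ hζ).1
    nlinarith [abs_nonneg M, mul_nonneg (abs_nonneg M) h0]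
  · have := hM ζ (by simpa using hζ)
    rw [norm_eq_abs] at this
    nlinarith [le_abs_self M, mul_nonneg (abs_nonneg M) h0, mul_nonneg hC h0]

/-- At the origin the correction is controlled by `|z|^(2γ) + |z|^γ |w|^γ`. -/
theorem GlueData.continuous_pot : Continuous D.pot := by
  have hβ := D.pos₁
  have hγ := D.pos
  have hα := D.one_lt
  have c1 : Continuous fun x : ℂ × ℂ => ‖x.1‖ ^ (2 * β₁) :=
    continuous_fst.norm.rpow_const fun _ => Or.inr (by linarith)
  have c2 : Continuous fun x : ℂ × ℂ => ‖x.2‖ ^ (2 * γ) :=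
    continuous_snd.norm.rpow_const fun _ => Or.inr (by linarith)
  refine continuous_iff_continuousAt.2 fun x => ?_
  by_cases hx : x.1 = 0
  · by_cases hw : x.2 = 0
    · -- at the origin
      obtain ⟨C, hC, hu⟩ := D.toFlatData.exists_potentialExcess_le
      obtain ⟨CA, hCA, hcut⟩ := exists_cutoff_bound D.smooth D.eq_one'
        (fun s hs => by linarith [D.sum s, D.eq_one s hs])
      have hχ : ∀ s, 0 ≤ s → |χ₂ s| ≤ CA + 1 := by
        intro s hs
        rcases hs.eq_or_lt with rfl | hs
        · rw [D.eq_one' 0 (by norm_num), abs_one]; linarith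
        · have := (hcut (log s)).1
          rw [Real.exp_log hs] at this
          linarith
      have hx0 : x = 0 := Prod.ext hx hw
      have hp0 : D.pot x = 0 := by
        rw [D.pot_eq_outer (Or.inl hx), hx, hw, norm_zero, zero_rpow (by linarith),
          zero_rpow (by linarith), add_zero]
      have c3 : Continuous fun x : ℂ × ℂ => ‖x.1‖ ^ γ * ‖x.2‖ ^ γ :=
        (continuous_fst.norm.rpow_const fun _ => Or.inr hγ.le).mul
          (continuous_snd.norm.rpow_const fun _ => Or.inr hγ.le)
      have c4 : Continuous fun x : ℂ × ℂ => ‖x.1‖ ^ (2 * γ) :=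
        continuous_fst.norm.rpow_const fun _ => Or.inr (by linarith)
      set B : ℂ × ℂ → ℝ := fun x => ‖x.1‖ ^ (2 * β₁) + ‖x.2‖ ^ (2 * γ)
        + (CA + 1) * (C * (‖x.1‖ ^ (2 * γ) + ‖x.1‖ ^ γ * ‖x.2‖ ^ γ)) with hB
      have hBc : Continuous B := (c1.add c2).add ((c4.add c3).const_mul C |>.const_mul (CA + 1))
      have hB0 : B x = 0 := by
        simp only [hB, hx, hw, norm_zero]
        rw [zero_rpow (by linarith), zero_rpow (by linarith), zero_rpow (by linarith)]
        simp
      have hle : ∀ y, ‖D.pot y‖ ≤ B y := by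
        intro y
        have n1 : 0 ≤ ‖y.1‖ ^ (2 * β₁) := by positivity
        have n2 : 0 ≤ ‖y.2‖ ^ (2 * γ) := by positivity
        rw [norm_eq_abs]
        by_cases hy : y.1 = 0
        · rw [D.pot_eq_outer (Or.inl hy), abs_of_nonneg (by positivity), hB]
          have : 0 ≤ (CA + 1) * (C * (‖y.1‖ ^ (2 * γ) + ‖y.1‖ ^ γ * ‖y.2‖ ^ γ)) := by positivity
          simp only
          linarith
        · have hz : 0 < ‖y.1‖ := norm_pos_iff.2 hy
          rw [D.pot_eq hy]
          refine (abs_add_le _ _).trans ?_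
          rw [abs_of_nonneg (add_nonneg n1 n2), hB]
          refine add_le_add_right ?_ _
          rw [correction, abs_mul, abs_mul, abs_of_nonneg (by positivity : 0 ≤ ‖y.1‖ ^ (2 * γ))]
          have h1 := hχ (ratio β₁ γ α₀ y) (by unfold ratio; positivity)
          have h2 := hu (y.2 / y.1)
          have h3 : ‖y.1‖ ^ (2 * γ) * (C * (1 + ‖y.2 / y.1‖ ^ γ))
              = C * (‖y.1‖ ^ (2 * γ) + ‖y.1‖ ^ γ * ‖y.2‖ ^ γ) := by
            rw [norm_div, div_rpow (norm_nonneg _) hz.le, two_mul, rpow_add hz]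
            have : ‖y.1‖ ^ γ ≠ 0 := by positivity
            field_simp
          rw [← h3]
          gcongr
      have hlim : Tendsto B (𝓝 x) (𝓝 0) := by rw [← hB0]; exact hBc.continuousAt
      rw [ContinuousAt, hp0]
      exact squeeze_zero_norm hle hlim
    · -- near `{z = 0}` the potential is that of the cone
      have hw0 : 0 < ‖x.2‖ := norm_pos_iff.2 hw
      refine (c1.add c2).continuousAt.congr ?_
      have c5 : Continuous fun x : ℂ × ℂ => ‖x.2‖ ^ γ - 2 * ‖x.1‖ ^ (α₀ * β₁) :=
        (continuous_snd.norm.rpow_const fun _ => Or.inr hγ.le).sub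
          ((continuous_fst.norm.rpow_const fun _ => Or.inr (by positivity)).const_mul 2)
      have h0 : 0 < ‖x.2‖ ^ γ - 2 * ‖x.1‖ ^ (α₀ * β₁) := by
        rw [hx, norm_zero, zero_rpow (by positivity), mul_zero, sub_zero]; positivity
      filter_upwards [c5.continuousAt.eventually (lt_mem_nhds h0)] with y hy
      refine (D.pot_eq_outer ?_).symm
      by_cases hy1 : y.1 = 0
      · exact Or.inl hy1
      · right
        have hz : 0 < ‖y.1‖ := norm_pos_iff.2 hy1
        rw [ratio, ← rpow_mul hz.le, show β₁ * -α₀ = -(α₀ * β₁) by ring,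
          rpow_neg hz.le, ← div_eq_mul_inv, lt_div_iff₀ (by positivity)]
        linarith
  · have hcr := D.continuousAt_ratio hx
    have hq : ContinuousAt (fun y : ℂ × ℂ => y.2 / y.1) x := (contDiffAt_quotient hx).continuousAt
    have hu : Continuous (potentialExcess β₂ β₃ γ a₂ a₃) :=
      D.toFlatData.continuous_flatPotential.sub (continuous_norm.rpow_const fun _ => Or.inr
        (by linarith))
    have c4 : Continuous fun x : ℂ × ℂ => ‖x.1‖ ^ (2 * γ) :=
      continuous_fst.norm.rpow_const fun _ => Or.inr (by linarith)
    refine ((c1.add c2).continuousAt.add ((D.smooth.continuous.continuousAt.comp hcr).mul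
      (c4.continuousAt.mul (ContinuousAt.comp (g := potentialExcess β₂ β₃ γ a₂ a₃)
        hu.continuousAt hq)))).congr ?_
    filter_upwards [eventually_fst_ne hx] with y hy using (D.pot_eq hy).symm

end

section

/-! ### Local Hölder continuity -/

/-- `f` is Hölder continuous of exponent `α` on some neighbourhood of `x`. -/
def HolderNear {X Y : Type*} [NormedAddCommGroup X] [NormedAddCommGroup Y] (α : ℝ) (f : X → Y)
    (x : X) : Prop :=
  (fun p : X × X => f p.1 - f p.2) =O[𝓝 (x, x)] fun p => ‖p.1 - p.2‖ ^ α

section HolderNear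

variable {X Y Z : Type*} [NormedAddCommGroup X] [NormedAddCommGroup Y] [NormedAddCommGroup Z]
  {α : ℝ} {x : X}

lemma HolderNear.continuousAt {f : X → Y} (h : HolderNear α f x) (hα : 0 < α) :
    ContinuousAt f x := by
  have h1 : Tendsto (fun y : X => (y, x)) (𝓝 x) (𝓝 (x, x)) :=
    (continuous_id.prodMk continuous_const).tendsto x
  have h2 := h.comp_tendsto h1
  have h3 : Tendsto (fun y : X => ‖y - x‖ ^ α) (𝓝 x) (𝓝 0) := by
    have : ContinuousAt (fun y : X => ‖y - x‖ ^ α) x :=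
      ContinuousAt.rpow_const (by fun_prop) (Or.inr hα.le)
    simpa [ContinuousAt, zero_rpow hα.ne'] using this
  have h4 := h2.trans_tendsto h3
  simpa [ContinuousAt] using tendsto_sub_nhds_zero_iff.1 h4

lemma holderNear_const (c : Y) : HolderNear α (fun _ : X => c) x := by
  simp only [HolderNear, sub_self]
  exact Asymptotics.isBigO_zero _ _

lemma HolderNear.add {f g : X → Y} (hf : HolderNear α f x) (hg : HolderNear α g x) :
    HolderNear α (fun y => f y + g y) x := by
  exact (Asymptotics.IsBigO.add hf hg).congr_left fun p => (add_sub_add_comm _ _ _ _).symm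

lemma HolderNear.mul {f g : X → ℂ} (hα : 0 < α) (hf : HolderNear α f x) (hg : HolderNear α g x) :
    HolderNear α (fun y => f y * g y) x := by
  have b1 : (fun p : X × X => f p.1) =O[𝓝 (x, x)] fun _ => (1 : ℝ) :=
    Tendsto.isBigO_one ℝ ((hf.continuousAt hα).tendsto.comp (continuous_fst.tendsto (x, x)))
  have b2 : (fun p : X × X => g p.2) =O[𝓝 (x, x)] fun _ => (1 : ℝ) :=
    Tendsto.isBigO_one ℝ ((hg.continuousAt hα).tendsto.comp (continuous_snd.tendsto (x, x)))
  have := (b1.mul hg).add (Asymptotics.IsBigO.mul hf b2 |>.congr_right fun p => mul_comm _ _)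
  refine (this.congr_left fun p => ?_).congr_right fun p => ?_
  · ring
  · ring

lemma HolderNear.of_isometry {f : X → Y} {g : X → Z} (hf : HolderNear α f x)
    (h : ∀ y z, ‖g y - g z‖ = ‖f y - f z‖) : HolderNear α g x :=
  Asymptotics.IsBigO.trans (g := fun p : X × X => f p.1 - f p.2)
    (Asymptotics.isBigO_of_le _ fun p => (h p.1 p.2).le) hf

lemma HolderNear.comp {f : Y → Z} {g : X → Y} {a b : ℝ} (hf : HolderNear a f (g x))
    (hg : HolderNear b g x) (ha : 0 < a) (hb : 0 < b) (hα : a * b = α) :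
    HolderNear α (fun y => f (g y)) x := by
  have hc := hg.continuousAt hb
  have h1 : Tendsto (fun p : X × X => (g p.1, g p.2)) (𝓝 (x, x)) (𝓝 (g x, g x)) :=
    (hc.tendsto.comp (continuous_fst.tendsto (x, x))).prodMk_nhds
      (hc.tendsto.comp (continuous_snd.tendsto (x, x)))
  refine (hf.comp_tendsto h1).trans ?_
  have h2 := Asymptotics.IsBigO.rpow ha.le
    (Eventually.of_forall fun p => by positivity) (Asymptotics.IsBigO.norm_left hg)
  refine h2.congr_right fun p => ?_
  rw [← rpow_mul (norm_nonneg _), mul_comm b, hα]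

lemma HolderNear.mono {f : X → Y} {a : ℝ} (hf : HolderNear a f x) (h : α ≤ a) (hα : 0 < α) :
    HolderNear α f x := by
  refine Asymptotics.IsBigO.trans hf (Asymptotics.IsBigO.of_bound 1 ?_)
  have : ∀ᶠ p : X × X in 𝓝 (x, x), ‖p.1 - p.2‖ < 1 := by
    have : ContinuousAt (fun p : X × X => ‖p.1 - p.2‖) (x, x) := by fun_prop
    exact this.eventually (gt_mem_nhds (by simp))
  filter_upwards [this] with p hp
  rw [one_mul, norm_of_nonneg (by positivity), norm_of_nonneg (by positivity)]
  rcases (norm_nonneg (p.1 - p.2)).eq_or_lt' with h0 | h0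
  · rw [h0, zero_rpow hα.ne', zero_rpow (hα.trans_le h).ne']
  · exact rpow_le_rpow_of_exponent_ge h0 hp.le h

lemma _root_.ContDiffAt.holderNear [NormedSpace ℝ X] [NormedSpace ℝ Y] {f : X → Y}
    (h : ContDiffAt ℝ 1 f x) : HolderNear 1 f x := by
  simp only [HolderNear, rpow_one]
  exact (h.hasStrictFDerivAt one_ne_zero).isBigO_sub.norm_right

lemma holderNear_norm_rpow (s : ℝ) (hs : 0 < s) (c : ℂ) :
    HolderNear (min 1 s) (fun y : ℂ => ‖y‖ ^ s) c := by
  rcases le_total s 1 with h | h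
  · rw [min_eq_right h]
    refine Asymptotics.IsBigO.of_bound 1 (Eventually.of_forall fun p => ?_)
    have key : ∀ y z : ℂ, ‖y‖ ^ s - ‖z‖ ^ s ≤ ‖y - z‖ ^ s := fun y z => by
      have h1 : ‖y‖ ≤ ‖y - z‖ + ‖z‖ := by simpa using norm_add_le (y - z) z
      have h2 := Real.rpow_add_le_add_rpow (norm_nonneg (y - z)) (norm_nonneg z) hs.le h
      have h3 := rpow_le_rpow (norm_nonneg y) h1 hs.le
      linarith
    rw [one_mul, norm_of_nonneg (by positivity : 0 ≤ ‖p.1 - p.2‖ ^ s), norm_eq_abs, abs_le]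
    have k1 := key p.1 p.2
    have k2 := key p.2 p.1
    rw [norm_sub_rev] at k2
    constructor <;> linarith
  · rw [min_eq_left h]
    have h1 : HolderNear 1 (fun t : ℝ => t ^ s) ‖c‖ :=
      (Real.contDiffAt_rpow_const (n := 1) (Or.inr (by simpa using h))).holderNear
    have h2 : HolderNear 1 (fun y : ℂ => ‖y‖) c := by
      simp only [HolderNear, rpow_one]
      exact Asymptotics.isBigO_of_le _ fun p => by simpa using abs_norm_sub_norm_le p.1 p.2
    exact h1.comp h2 one_pos one_pos (by norm_num)

lemma HolderNear.exists_holderOnWith {f : X → Y} (h : HolderNear α f x) (hα : 0 < α) :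
    ∃ (C : ℝ≥0) (δ : ℝ), 0 < δ ∧ HolderOnWith C α.toNNReal f (ball x δ) := by
  obtain ⟨C, hC, hb⟩ := h.exists_nonneg
  obtain ⟨δ, hδ, hs⟩ := Metric.mem_nhds_iff.1 hb.bound
  refine ⟨C.toNNReal, δ, hδ, fun y hy z hz => ?_⟩
  have h1 : ‖f y - f z‖ ≤ C * ‖y - z‖ ^ α := by
    have : (y, z) ∈ ball (x, x) δ := by
      rw [← ball_prod_same]; exact ⟨hy, hz⟩
    have := hs this
    simpa [abs_of_nonneg (Real.rpow_nonneg (norm_nonneg (y - z)) α)] using this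
  rw [edist_eq_enorm_sub, edist_eq_enorm_sub, ← ofReal_norm, ← ofReal_norm, Real.coe_toNNReal _ hα.le,
    ENNReal.ofReal_rpow_of_nonneg (norm_nonneg _) hα.le]
  change _ ≤ ENNReal.ofReal C * _
  rw [← ENNReal.ofReal_mul hC]
  exact ENNReal.ofReal_le_ofReal h1

end HolderNear

end

/-! ### Holomorphic charts and cone singularities -/

/-- A holomorphic map of `ℂ²` with injective derivative at `0` is the inverse of a holomorphic
chart near its value at `0`. -/
lemma exists_chart {F : ℂ × ℂ → ℂ × ℂ} (hF : ContDiffAt ℂ 1 F 0)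
    (hinj : Function.Injective (fderiv ℂ F 0)) {V : Set (ℂ × ℂ)} (hV : V ∈ 𝓝 0) :
    ∃ Φ : OpenPartialHomeomorph (ℂ × ℂ) (ℂ × ℂ), F 0 ∈ Φ.source ∧ Φ (F 0) = 0 ∧
      DifferentiableOn ℂ Φ Φ.source ∧ DifferentiableOn ℂ Φ.symm Φ.target ∧
      (∀ y, Φ.symm y = F y) ∧ Φ.target ⊆ V := by
  let T : (ℂ × ℂ) ≃L[ℂ] (ℂ × ℂ) :=
    (LinearEquiv.ofInjectiveEndo (fderiv ℂ F 0 : (ℂ × ℂ) →ₗ[ℂ] (ℂ × ℂ)) hinj).toContinuousLinearEquiv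
  have hT : HasFDerivAt F (T : (ℂ × ℂ) →L[ℂ] (ℂ × ℂ)) 0 := by
    refine (hF.differentiableAt one_ne_zero).hasFDerivAt.congr_fderiv ?_
    exact ContinuousLinearMap.ext fun v => rfl
  let e := hF.toOpenPartialHomeomorph F hT one_ne_zero
  have he0 : (0 : ℂ × ℂ) ∈ e.source := hF.mem_toOpenPartialHomeomorph_source hT one_ne_zero
  have heF : ∀ y, e y = F y := fun y => rfl
  have hinv : ContDiffAt ℂ 1 e.symm (F 0) := hF.to_localInverse hT one_ne_zero
  let S : Set (ℂ × ℂ) := {y | DifferentiableAt ℂ F y ∧ DifferentiableAt ℂ e.symm (F y) ∧ y ∈ V}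
  have hS : S ∈ 𝓝 0 := by
    filter_upwards [hF.eventually (by simp), hF.continuousAt.eventually (hinv.eventually (by simp)),
      hV] with y h1 h2 h3
    exact ⟨h1.differentiableAt one_ne_zero, h2.differentiableAt one_ne_zero, h3⟩
  have hsrc : (e.restr S).source = e.source ∩ interior S := rfl
  refine ⟨(e.restr S).symm, ?_, ?_, ?_, ?_, fun y => rfl, ?_⟩
  · rw [OpenPartialHomeomorph.symm_source, ← heF]
    exact (e.restr S).map_source (hsrc ▸ ⟨he0, mem_interior_iff_mem_nhds.2 hS⟩)
  · exact e.left_inv he0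
  · intro y hy
    have hy' := (e.restr S).map_target hy
    have h1 := (interior_subset (hsrc ▸ hy').2 : _ ∈ S).2.1
    have h2 : F ((e.restr S).symm y) = y := (e.restr S).right_inv hy
    rw [h2] at h1
    exact h1.differentiableWithinAt
  · intro y hy
    exact (interior_subset (hsrc ▸ hy : y ∈ e.source ∩ interior S).2 : y ∈ S).1.differentiableWithinAt
  · intro y hy
    exact (interior_subset (hsrc ▸ hy : y ∈ e.source ∩ interior S).2 : y ∈ S).2.2

lemma pullback_congr {F G : ℂ × ℂ → ℂ × ℂ} {x : ℂ × ℂ} (h : F =ᶠ[𝓝 x] G) (g : HermField) :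
    pullback F g x = pullback G g x := by
  simp only [pullback, jacobian, h.fderiv_eq, h.eq_of_nhds]

lemma continuousAt_ofConeCoord {β : ℝ} (h0 : 0 < β) (h1 : β < 1) :
    ContinuousAt (ofConeCoord β) 0 := by
  have hs : 0 < 1 / β - 1 := by rw [sub_pos, lt_div_iff₀ h0]; linarith
  refine ContinuousAt.prodMk ?_ continuousAt_snd
  refine ContinuousAt.mul (continuous_ofReal.continuousAt.comp ?_) continuousAt_fst
  exact ContinuousAt.rpow_const (by fun_prop) (Or.inr hs.le)

lemma ofConeCoord_zero (β : ℝ) : ofConeCoord β 0 = 0 := by simp [ofConeCoord]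

/-- Criterion for a cone singularity in terms of a holomorphic parametrisation `F` of a
neighbourhood of `F 0`: the components of the error are, off the divisor, locally Hölder functions
vanishing at `0`. -/
theorem HasConeSingularityAt.of_param {g : HermField} {L : Set (ℂ × ℂ)} {β : ℝ} (h0 : 0 < β)
    (h1 : β < 1) {F : ℂ × ℂ → ℂ × ℂ} (hF : ContDiffAt ℂ 1 F 0)
    (hinj : Function.Injective (fderiv ℂ F 0)) (hL : ∀ᶠ y in 𝓝 0, (F y ∈ L ↔ y.1 = 0))
    {E : Fin 2 → Fin 2 → ℂ × ℂ → ℂ} (hE : ∀ i j, HolderNear (min 1 (1 / β - 1)) (E i j) 0)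
    (hE0 : ∀ i j, E i j 0 = 0)
    (heq : ∀ᶠ q : ℂ × ℂ in 𝓝 0, q.1 ≠ 0 →
      ∀ i j, coneError β (pullback F g) (ofConeCoord β q) i j = E i j q) :
    HasConeSingularityAt g L β (F 0) := by
  have hs : 0 < 1 / β - 1 := by rw [sub_pos, lt_div_iff₀ h0]; linarith
  have hα : 0 < min 1 (1 / β - 1) := lt_min one_pos hs
  obtain ⟨Φ, hp, hΦ, hd, hd', hsymm, hV⟩ := exists_chart hF hinj hL
  have hpb : ∀ y ∈ Φ.target, pullback Φ.symm g y = pullback F g y := fun y _ =>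
    pullback_congr (Eventually.of_forall hsymm) g
  have ht0 : (0 : ℂ × ℂ) ∈ Φ.target := hΦ ▸ Φ.map_source hp
  have hev : ∀ᶠ q : ℂ × ℂ in 𝓝 0, ofConeCoord β q ∈ Φ.target :=
    (continuousAt_ofConeCoord h0 h1).eventually
      (by rw [ofConeCoord_zero]; exact Φ.open_target.mem_nhds ht0)
  have heq' : ∀ᶠ q : ℂ × ℂ in 𝓝 0, q.1 ≠ 0 →
      ∀ i j, coneError β (pullback Φ.symm g) (ofConeCoord β q) i j = E i j q := by
    filter_upwards [heq, hev] with q h hq hq1 i j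
    rw [← h hq1 i j]
    simp only [coneError, hpb _ hq]
  choose C δ hδ hH using fun i j => (hE i j).exists_holderOnWith hα
  have hev2 : ∀ᶠ q : ℂ × ℂ in 𝓝 0, ∀ i j, q ∈ ball 0 (δ i j) :=
    eventually_all.2 fun i => eventually_all.2 fun j => ball_mem_nhds _ (hδ i j)
  obtain ⟨ε, hε, hball⟩ := Metric.mem_nhds_iff.1 ((heq'.and hev).and hev2)
  refine ⟨Φ, hp, hΦ, hd, hd', fun x hx => ?_, ε, hε, fun q hq => (hball hq).1.2,
    fun i j => ⟨⟨C i j, ?_⟩, ?_⟩⟩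
  · have h2 : F (Φ x) ∈ L ↔ (Φ x).1 = 0 := hV (Φ.map_source hx)
    rw [← h2, ← hsymm, Φ.left_inv hx]
  · intro q hq q' hq'
    simp only
    rw [(hball hq.1).1.1 hq.2 i j, (hball hq'.1).1.1 hq'.2 i j]
    exact hH i j q ((hball hq.1).2 i j) q' ((hball hq'.1).2 i j)
  · have hc := ((hE i j).continuousAt hα).tendsto
    rw [hE0] at hc
    refine (hc.mono_left nhdsWithin_le_nhds).congr' ?_
    filter_upwards [mem_nhdsWithin_of_mem_nhds heq', self_mem_nhdsWithin] with q h hq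
    exact (h hq i j).symm

section

variable {β₁ β₂ β₃ γ α₀ : ℝ} {a₂ a₃ : ℂ} {χ₁ χ₂ : ℝ → ℝ}
  (D : GlueData β₁ β₂ β₃ γ α₀ a₂ a₃ χ₁ χ₂)


/-! ### Cone singularities along the lines -/

lemma fderiv_comp_affine (f : ℂ → ℂ) (a : ℂ) (c : ℝ) (x : ℂ) :
    fderiv ℝ (fun t => f (a + c * t)) x = c • fderiv ℝ f (a + c * x) := by
  have h1 : (fun t : ℂ => f (a + c * t)) = fun t => (fun s => f (a + s)) (c • t) := by
    ext t; simp
  rw [h1, fderiv_comp_smul (f := fun s => f (a + s)), fderiv_comp_add_left]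
  simp

lemma dzeta_comp_affine (f : ℂ → ℂ) (a : ℂ) (c : ℝ) (x : ℂ) :
    dzeta (fun t => f (a + c * t)) x = c * dzeta f (a + c * x) := by
  simp only [dzeta, fderiv_comp_affine, smul_apply, Complex.real_smul]
  ring

lemma dzetabar_comp_affine (f : ℂ → ℂ) (a : ℂ) (c : ℝ) (x : ℂ) :
    dzetabar (fun t => f (a + c * t)) x = c * dzetabar f (a + c * x) := by
  simp only [dzetabar, fderiv_comp_affine, smul_apply, Complex.real_smul]
  ring

lemma dzeta_const_mul_ofReal (c : ℝ) (f : ℂ → ℂ) (x : ℂ) :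
    dzeta (fun t => (c : ℂ) * f t) x = c * dzeta f x := by
  have h : (fun t => (c : ℂ) * f t) = fun t => c • f t := by ext t; simp
  rw [dzeta, dzeta, h, show (fun t => c • f t) = c • f from rfl, fderiv_const_smul_field]
  simp only [Pi.smul_apply, smul_apply, Complex.real_smul]
  ring

lemma dzeta_dzetabar_comp_affine (f : ℂ → ℂ) (a : ℂ) (c : ℝ) (x : ℂ) :
    dzeta (dzetabar fun t => f (a + c * t)) x = c ^ 2 * dzeta (dzetabar f) (a + c * x) := by
  have h : (dzetabar fun t => f (a + c * t)) = fun t => (c : ℂ) * dzetabar f (a + c * t) :=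
    funext fun t => dzetabar_comp_affine f a c t
  rw [h, dzeta_const_mul_ofReal, dzeta_comp_affine]
  ring

lemma coneError_apply (β : ℝ) (h : HermField) (y : ℂ × ℂ) : coneError β h y =
    !![(‖y.1‖ ^ (2 - 2 * β) : ℝ) * h y 0 0 - (β ^ 2 : ℝ), (‖y.1‖ ^ (1 - β) : ℝ) * h y 0 1;
      (‖y.1‖ ^ (1 - β) : ℝ) * h y 1 0, h y 1 1 - 1] := by
  have e : ‖y.1‖ ^ (2 - 2 * β) = ‖y.1‖ ^ (1 - β) * ‖y.1‖ ^ (1 - β) := by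
    rw [show 2 - 2 * β = (1 - β) * 2 by ring, rpow_mul (norm_nonneg _), rpow_two, sq]
  ext i j
  fin_cases i <;> fin_cases j <;>
    simp [coneError, Matrix.mul_apply, Matrix.diagonal, e] <;> ring

lemma norm_ofConeCoord_fst {β : ℝ} (h0 : 0 < β) (q : ℂ × ℂ) :
    ‖(ofConeCoord β q).1‖ = ‖q.1‖ ^ (1 / β) := by
  rw [ofConeCoord, norm_mul, norm_real, norm_of_nonneg (by positivity)]
  rcases (norm_nonneg q.1).eq_or_lt' with h | h
  · rw [h, mul_zero, zero_rpow (by positivity)]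
  · rw [← rpow_add_one h.ne']; congr 1; ring

lemma eventually_outer {β₁ γ α₀ : ℝ} (hβ : 0 < β₁) (hγ : 0 < γ) (hα : 0 < α₀) {w : ℂ}
    (hw : w ≠ 0) : ∀ᶠ x : ℂ × ℂ in 𝓝 (0, w), x.1 = 0 ∨ 2 < ratio β₁ γ α₀ x := by
  have hc : ContinuousAt (fun x : ℂ × ℂ => ‖x.2‖ ^ γ - 2 * (‖x.1‖ ^ β₁) ^ α₀) (0, w) := by
    refine ContinuousAt.sub (ContinuousAt.rpow_const (by fun_prop) (Or.inr hγ.le))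
      (continuousAt_const.mul (ContinuousAt.rpow_const (ContinuousAt.rpow_const (by fun_prop)
        (Or.inr hβ.le)) (Or.inr hα.le)))
  have h0 : 0 < ‖w‖ := norm_pos_iff.2 hw
  have hpos : 0 < ‖w‖ ^ γ - 2 * (‖(0 : ℂ)‖ ^ β₁) ^ α₀ := by
    rw [norm_zero, zero_rpow hβ.ne', zero_rpow hα.ne']; simp only [mul_zero, sub_zero]
    positivity
  filter_upwards [hc.eventually (lt_mem_nhds hpos)] with x hx
  rw [or_iff_not_imp_left]
  intro h1
  have h1' : 0 < ‖x.1‖ := norm_pos_iff.2 h1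
  have h2 : 0 < (‖x.1‖ ^ β₁) ^ α₀ := by positivity
  rw [ratio, rpow_neg (by positivity), ← div_eq_mul_inv, lt_div_iff₀ h2]
  linarith

/-- The metric has a cone singularity along `{z = 0}` away from the origin: in the coordinate
`w ^ γ` it is isometric to `ℂ_{β₁} × ℂ`. -/
theorem GlueData.hasConeSingularityAt_vertical {w : ℂ}
    (hw : w ≠ 0) : HasConeSingularityAt (ddbar D.pot) verticalLine β₁ (0, w) := by
  have hγ := D.pos
  have hβ := D.pos₁
  have hw0 : 0 < ‖w‖ := norm_pos_iff.2 hw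
  have hc0 : 0 < ‖w‖ ^ γ := by positivity
  have hcne : ((‖w‖ ^ γ : ℝ) : ℂ) ≠ 0 := by exact_mod_cast hc0.ne'
  set c : ℝ := ‖w‖ ^ γ with hc
  -- an inverse branch of `w ↦ w ^ γ`, up to a constant, so that `|b t|^γ = |c + t|`
  set b : ℂ → ℂ := fun t => w * Complex.exp ((1 / γ : ℝ) * Complex.log (1 + t / c)) with hb
  have hslit : ∀ᶠ t : ℂ in 𝓝 0, 1 + t / c ∈ Complex.slitPlane := by
    have : ContinuousAt (fun t : ℂ => 1 + t / c) 0 := by fun_prop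
    refine this.eventually (Complex.isOpen_slitPlane.mem_nhds ?_)
    simp
  have hbd : ∀ t : ℂ, 1 + t / c ∈ Complex.slitPlane → ContDiffAt ℂ 2 b t := by
    intro t ht
    refine contDiffAt_const.mul (ContDiffAt.cexp (contDiffAt_const.mul ?_))
    exact ContDiffAt.comp (g := Complex.log) t (Complex.contDiffAt_log ht) (by fun_prop)
  have hb0 : b 0 = w := by simp [hb]
  have hbn : ∀ t : ℂ, 1 + t / c ∈ Complex.slitPlane → ‖b t‖ ^ (2 * γ) = ‖(c : ℂ) + t‖ ^ (2 : ℝ) := by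
    intro t ht
    have hne : 0 < ‖1 + t / c‖ := norm_pos_iff.2 (Complex.slitPlane_ne_zero ht)
    have e1 : ‖(c : ℂ) + t‖ = c * ‖1 + t / c‖ := by
      have : (c : ℂ) + t = c * (1 + t / c) := by field_simp
      rw [this, norm_mul, norm_real, norm_of_nonneg hc0.le]
    rw [hb, norm_mul, Complex.norm_exp, re_ofReal_mul, Complex.log_re, e1,
      mul_rpow hw0.le (Real.exp_pos _).le, mul_rpow hc0.le hne.le, ← Real.exp_mul,
      mul_comm 2 γ, rpow_mul hw0.le, ← hc, rpow_def_of_pos hne]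
    have e2 : 1 / γ * log ‖1 + t / c‖ * (γ * 2) = log ‖1 + t / c‖ * 2 := by
      rw [mul_comm γ, ← mul_assoc, mul_assoc, mul_assoc, mul_comm (1 / γ), mul_assoc, mul_assoc,
        mul_one_div_cancel hγ.ne', mul_one]
    rw [e2]
  have hder : HasDerivAt b (w * ((1 / γ : ℝ) * (1 / c))) 0 := by
    have h1 : HasDerivAt (fun t : ℂ => 1 + t / c) (1 / c) 0 :=
      ((hasDerivAt_id (0 : ℂ)).div_const (c : ℂ)).const_add 1
    have h2 := ((h1.clog (by simp)).const_mul ((1 / γ : ℝ) : ℂ)).cexp.const_mul w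
    rw [hb]
    simpa using h2
  set F : ℂ × ℂ → ℂ × ℂ := fun y => (y.1, b y.2) with hF
  have hFd : ∀ y : ℂ × ℂ, 1 + y.2 / c ∈ Complex.slitPlane → ContDiffAt ℂ 2 F y := fun y hy =>
    contDiffAt_fst.prodMk (ContDiffAt.comp (g := b) (f := Prod.snd) y (hbd _ hy) contDiffAt_snd)
  have hF0 : F 0 = (0, w) := by simp [hF, hb0]
  have hslit' : ∀ᶠ y : ℂ × ℂ in 𝓝 0, 1 + y.2 / c ∈ Complex.slitPlane :=
    (continuous_snd.tendsto (0 : ℂ × ℂ)).eventually hslit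
  have hFc := (hFd 0 (by simp)).continuousAt
  rw [← hF0]
  refine HasConeSingularityAt.of_param hβ (by linarith [D.lt_γ, D.lt])
    ((hFd 0 (by simp)).of_le (by norm_num)) ?_ (Eventually.of_forall fun y => Iff.rfl)
    (E := fun _ _ _ => 0) (fun _ _ => holderNear_const 0) (fun _ _ => rfl) ?_
  · have h1 : HasFDerivAt F ((ContinuousLinearMap.fst ℂ ℂ ℂ).prod
        (((ContinuousLinearMap.toSpanSingleton ℂ (w * ((1 / γ : ℝ) * (1 / c))))).comp
          (ContinuousLinearMap.snd ℂ ℂ ℂ))) 0 :=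
      hasFDerivAt_fst.prodMk (HasFDerivAt.comp (g := b) (0 : ℂ × ℂ) hder.hasFDerivAt hasFDerivAt_snd)
    rw [h1.fderiv]
    have hne : w * ((1 / γ : ℝ) * (1 / c)) ≠ 0 := by
      have : (γ : ℂ) ≠ 0 := by exact_mod_cast hγ.ne'
      push_cast
      exact mul_ne_zero hw (mul_ne_zero (one_div_ne_zero this) (one_div_ne_zero hcne))
    intro u v huv
    simp only [ContinuousLinearMap.prod_apply, Prod.mk.injEq, ContinuousLinearMap.coe_fst',
      ContinuousLinearMap.comp_apply, ContinuousLinearMap.coe_snd',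
      ContinuousLinearMap.toSpanSingleton_apply, smul_eq_mul] at huv
    exact Prod.ext huv.1 (mul_right_cancel₀ hne huv.2)
  · have hout : ∀ᶠ y in 𝓝 (0 : ℂ × ℂ), ∀ᶠ x in 𝓝 (F y), x.1 = 0 ∨ 2 < ratio β₁ γ α₀ x := by
      refine hFc.tendsto.eventually (p := fun x' => ∀ᶠ x in 𝓝 x', x.1 = 0 ∨ 2 < ratio β₁ γ α₀ x) ?_
      rw [hF0]
      exact (eventually_outer hβ hγ (by linarith [D.one_lt]) hw).eventually_nhds
    have hcc : ContinuousAt (fun y : ℂ × ℂ => b y.2) 0 :=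
      continuousAt_snd.comp_of_eq hFc rfl
    have hbne : ∀ᶠ y in 𝓝 (0 : ℂ × ℂ), b y.2 ≠ 0 :=
      hcc.eventually_ne (by simpa [hb0] using hw)
    -- the potential is `|z|^(2β₁) + |c + t|^2` here, and the error vanishes identically
    have key : ∀ᶠ y in 𝓝 (0 : ℂ × ℂ), y.1 ≠ 0 →
        coneError β₁ (pullback F (ddbar D.pot)) y = 0 := by
      filter_upwards [hslit'.eventually_nhds, hout, hbne] with y hy1 hy2 hy3 hy
      have hsm : ContDiffAt ℝ ∞ D.pot (F y) := by
        have : ContDiffAt ℝ ∞ (fun x : ℂ × ℂ => ‖x.1‖ ^ (2 * β₁) + ‖x.2‖ ^ (2 * γ)) (F y) :=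
          ((contDiffAt_norm_rpow (2 * β₁) (x := (F y).1) hy).comp _ contDiffAt_fst).add
            ((contDiffAt_norm_rpow (2 * γ) (x := (F y).2) hy3).comp _ contDiffAt_snd)
        refine this.congr_of_eventuallyEq ?_
        filter_upwards [hy2] with x hx using D.pot_eq_outer hx
      have hFy := hFd y hy1.self_of_nhds
      have e1 : (fun y => D.pot (F y)) =ᶠ[𝓝 y] fun y : ℂ × ℂ =>
          (fun t : ℂ => ‖(c : ℂ) + (1 : ℝ) * t‖ ^ (2 * (1 : ℝ))) y.2
            + (fun _ : ℂ => (1 : ℝ)) y.2 * (fun t : ℂ => ‖t‖ ^ (2 * β₁)) y.1 := by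
        filter_upwards [hy1, hFy.continuousAt.eventually hy2.eventually_nhds] with t ht ht2
        rw [D.pot_eq_outer ht2.self_of_nhds]
        simp only [hF, hbn _ ht, Complex.ofReal_one, one_mul, mul_one]
        ring
      have hcy : (c : ℂ) + (1 : ℝ) * y.2 ≠ 0 := by
        intro h
        have := Complex.slitPlane_ne_zero hy1.self_of_nhds
        apply this
        field_simp
        simpa using h
      rw [coneError_apply, pullback_ddbar hsm hFy, ddbar_congr e1,
        ddbar_add_mul (A := fun t : ℂ => ‖(c : ℂ) + (1 : ℝ) * t‖ ^ (2 * (1 : ℝ)))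
          (B := fun _ => 1) (C := fun t => ‖t‖ ^ (2 * β₁))]
      · have hz : dzetabar (fun _ : ℂ => ((1 : ℝ) : ℂ)) = fun _ => 0 := by
          ext t; simp [dzetabar]
        have hz' : dzeta (fun _ : ℂ => ((1 : ℝ) : ℂ)) y.2 = 0 := by simp [dzeta]
        have hz2 : dzeta (fun _ : ℂ => (0 : ℂ)) y.2 = 0 := by simp [dzeta]
        have hA := dzeta_dzetabar_comp_affine (fun t : ℂ => ((‖t‖ ^ (2 * (1 : ℝ)) : ℝ) : ℂ)) c 1 y.2
        rw [dzeta_dzetabar_norm_rpow 1 hcy] at hA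
        rw [hA, dzeta_dzetabar_norm_rpow β₁ hy, hz, hz', hz2]
        have hy0 : 0 < ‖y.1‖ := norm_pos_iff.2 hy
        have e2 : ‖y.1‖ ^ (2 - 2 * β₁) * (β₁ ^ 2 * ‖y.1‖ ^ (2 * β₁ - 2)) = β₁ ^ 2 := by
          rw [mul_left_comm, ← rpow_add hy0]; simp
        ext i j
        fin_cases i <;> fin_cases j <;> simp [-Complex.ofReal_pow]
        rw [← Complex.ofReal_mul] 
        exact sub_eq_zero.2 (by exact_mod_cast e2)
      · exact ContDiffAt.comp (g := fun t : ℂ => ‖t‖ ^ (2 * (1 : ℝ))) y.2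
          (contDiffAt_norm_rpow (2 * 1) hcy) (by fun_prop)
      · exact contDiffAt_const
      · exact contDiffAt_norm_rpow _ hy
    have hco := continuousAt_ofConeCoord hβ (by linarith [D.lt_γ, D.lt] : β₁ < 1)
    rw [ContinuousAt, ofConeCoord_zero] at hco
    filter_upwards [hco.eventually key] with q hq hq1 i j
    rw [hq]
    · rfl
    · rw [← norm_ne_zero_iff, norm_ofConeCoord_fst hβ]
      have := norm_pos_iff.2 hq1
      positivity

end

section

variable {β₁ β₂ β₃ γ α₀ : ℝ} {a₂ a₃ : ℂ} {χ₁ χ₂ : ℝ → ℝ}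
  (D : GlueData β₁ β₂ β₃ γ α₀ a₂ a₃ χ₁ χ₂)


/-- Parametrisation of a neighbourhood of a point `(z₀, p z₀)` by affine functions of `z` and
`w / z`. -/
def slopeParam (z₀ p : ℂ) (e e' : ℝ) (y : ℂ × ℂ) : ℂ × ℂ :=
  (z₀ + e * y.2, (z₀ + e * y.2) * (p + e' * y.1))

lemma contDiff_slopeParam (z₀ p : ℂ) (e e' : ℝ) : ContDiff ℂ 2 (slopeParam z₀ p e e') := by
  unfold slopeParam
  fun_prop

/-- The coefficients of the metric in the coordinates given by `slopeParam`. -/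
lemma GlueData.pullback_slopeParam {z₀ p : ℂ} {e e' : ℝ}
    {y : ℂ × ℂ} (hz : z₀ + e * y.2 ≠ 0) (h2 : p + e' * y.1 ≠ a₂) (h3 : p + e' * y.1 ≠ a₃)
    (hr : ratio β₁ γ α₀ (slopeParam z₀ p e e' y) < 1) :
    pullback (slopeParam z₀ p e e') (ddbar D.pot) y =
      !![((‖z₀ + e * y.2‖ ^ (2 * γ) * (e' ^ 2 * (γ ^ 2 * density β₂ β₃ a₂ a₃ (p + e' * y.1))) : ℝ) : ℂ),
        star (grad (fun t => ‖z₀ + e * t‖ ^ (2 * γ)) y.2)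
          * (e' * grad (flatPotential β₂ β₃ γ a₂ a₃) (p + e' * y.1));
        grad (fun t => ‖z₀ + e * t‖ ^ (2 * γ)) y.2
          * (e' * star (grad (flatPotential β₂ β₃ γ a₂ a₃) (p + e' * y.1))),
        ((e ^ 2 * (β₁ ^ 2 * ‖z₀ + e * y.2‖ ^ (2 * β₁ - 2)) + flatPotential β₂ β₃ γ a₂ a₃ (p + e' * y.1)
          * (e ^ 2 * (γ ^ 2 * ‖z₀ + e * y.2‖ ^ (2 * γ - 2))) : ℝ) : ℂ)] := by
  set φ := flatPotential β₂ β₃ γ a₂ a₃ with hφ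
  have hF := (contDiff_slopeParam z₀ p e e').contDiffAt (x := y)
  have hq : ∀ t : ℂ × ℂ, z₀ + e * t.2 ≠ 0 →
      (slopeParam z₀ p e e' t).2 / (slopeParam z₀ p e e' t).1 = p + e' * t.1 := fun t ht =>
    mul_div_cancel_left₀ _ ht
  have hsm : ContDiffAt ℝ ∞ D.pot (slopeParam z₀ p e e' y) :=
    D.contDiffAt_pot hz (by rwa [hq y hz]) (by rwa [hq y hz])
  have hsC : ContDiffAt ℝ ∞ φ (p + e' * y.1) := D.contDiffAt_flatPotential h2 h3
  have hA : ∀ s : ℝ, ContDiffAt ℝ ∞ (fun t : ℂ => ‖z₀ + e * t‖ ^ s) y.2 := fun s =>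
    ContDiffAt.comp (g := fun t : ℂ => ‖t‖ ^ s) y.2 (contDiffAt_norm_rpow s hz) (by fun_prop)
  have e1 : (fun y => D.pot (slopeParam z₀ p e e' y)) =ᶠ[𝓝 y] fun y : ℂ × ℂ =>
      (fun t : ℂ => ‖z₀ + e * t‖ ^ (2 * β₁)) y.2
        + (fun t : ℂ => ‖z₀ + e * t‖ ^ (2 * γ)) y.2 * (fun t : ℂ => φ (p + e' * t)) y.1 := by
    have c1 : ContinuousAt (fun y : ℂ × ℂ => z₀ + e * y.2) y := by fun_prop
    have c2 : ContinuousAt (fun y => ratio β₁ γ α₀ (slopeParam z₀ p e e' y)) y :=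
      ContinuousAt.comp (g := ratio β₁ γ α₀) (D.continuousAt_ratio hz) hF.continuousAt
    filter_upwards [c1.eventually_ne hz, c2.eventually (gt_mem_nhds hr)] with t ht1 ht2
    rw [D.pot_eq_inner ht1 ht2, hq t ht1]
    rfl
  have l1 := dzeta_dzetabar_comp_affine (fun t => (φ t : ℂ)) p e' y.1
  rw [D.dzeta_dzetabar_flatPotential h2 h3] at l1
  have l2 : ∀ s : ℝ, dzeta (dzetabar fun t : ℂ => ((‖z₀ + e * t‖ ^ (2 * s) : ℝ) : ℂ)) y.2
      = (e : ℂ) ^ 2 * ((s ^ 2 * ‖z₀ + e * y.2‖ ^ (2 * s - 2) : ℝ) : ℂ) := fun s => by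
    rw [← dzeta_dzetabar_norm_rpow s hz]
    exact dzeta_dzetabar_comp_affine (fun t : ℂ => ((‖t‖ ^ (2 * s) : ℝ) : ℂ)) z₀ e y.2
  have l3 : dzeta (fun t : ℂ => (φ (p + e' * t) : ℂ)) y.1 = e' * grad φ (p + e' * y.1) :=
    dzeta_comp_affine (fun t => (φ t : ℂ)) p e' y.1
  have l4 : dzetabar (fun t : ℂ => (φ (p + e' * t) : ℂ)) y.1 = e' * star (grad φ (p + e' * y.1)) := by
    rw [← dzetabar_ofReal (hsC.differentiableAt (by simp))]
    exact dzetabar_comp_affine (fun t => (φ t : ℂ)) p e' y.1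
  rw [pullback_ddbar hsm hF, ddbar_congr e1, ddbar_add_mul (A := fun t => ‖z₀ + e * t‖ ^ (2 * β₁))
    (B := fun t => ‖z₀ + e * t‖ ^ (2 * γ)) (C := fun t => φ (p + e' * t)) (hA _) (hA _)
    (ContDiffAt.comp (g := φ) y.1 hsC (by fun_prop)), l1, l2, l2, l3, l4,
    dzetabar_ofReal ((hA (2 * γ)).differentiableAt (by simp)), grad]
  push_cast
  rfl

lemma density_eq_of_slope {p p' : ℂ} {β β' : ℝ} (h : (p = a₂ ∧ β = β₂ ∧ p' = a₃ ∧ β' = β₃) ∨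
    (p = a₃ ∧ β = β₃ ∧ p' = a₂ ∧ β' = β₂)) (t : ℂ) :
    density β₂ β₃ a₂ a₃ t = ‖t - p‖ ^ (2 * β - 2) * ‖t - p'‖ ^ (2 * β' - 2) := by
  rcases h with ⟨rfl, rfl, rfl, rfl⟩ | ⟨rfl, rfl, rfl, rfl⟩
  · rfl
  · exact mul_comm _ _

end

section

variable {β₁ β₂ β₃ γ α₀ : ℝ} {a₂ a₃ : ℂ} {χ₁ χ₂ : ℝ → ℝ}
  (D : GlueData β₁ β₂ β₃ γ α₀ a₂ a₃ χ₁ χ₂)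

lemma holderNear_comp_snd {f : ℂ → ℂ} {α : ℝ} (hα : 0 < α) (hα1 : α ≤ 1)
    (hf : ContDiffAt ℝ 1 f 0) : HolderNear α (fun q : ℂ × ℂ => f q.2) 0 :=
  (ContDiffAt.holderNear (f := fun q : ℂ × ℂ => f q.2)
    (ContDiffAt.comp (g := f) (0 : ℂ × ℂ) hf contDiffAt_snd)).mono hα1 hα

lemma holderNear_norm_rpow_fst {α s : ℝ} (hα : 0 < α) (hα1 : α ≤ 1) (hs : α ≤ s) :
    HolderNear α (fun q : ℂ × ℂ => ((‖q.1‖ ^ s : ℝ) : ℂ)) 0 := by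
  have h1 : HolderNear α (fun y : ℂ => ((‖y‖ ^ s : ℝ) : ℂ)) 0 :=
    ((holderNear_norm_rpow s (hα.trans_le hs) 0).mono (le_min hα1 hs) hα).of_isometry fun y z => by
      rw [← Complex.ofReal_sub, norm_real]
  exact HolderNear.comp (f := fun y : ℂ => ((‖y‖ ^ s : ℝ) : ℂ)) (g := Prod.fst) (x := (0 : ℂ × ℂ)) h1
    (contDiffAt_fst.holderNear (f := Prod.fst)) hα one_pos (mul_one α)

/-- A smooth function of the holomorphic coordinate `z₁` is Hölder in the cone coordinate. -/
lemma holderNear_comp_ofConeCoord {β α : ℝ} (hα : 0 < α) (hα1 : α ≤ 1) (hs : α ≤ 1 / β - 1)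
    {f : ℂ → ℂ} (p : ℂ) (e' : ℝ) (hf : ContDiffAt ℝ 1 f p) :
    HolderNear α (fun q => f (p + e' * (ofConeCoord β q).1)) 0 := by
  have h1 : HolderNear α (fun q => (ofConeCoord β q).1) 0 :=
    (holderNear_norm_rpow_fst hα hα1 hs).mul hα
      ((contDiffAt_fst.holderNear (f := Prod.fst)).mono hα1 hα)
  have h2 : ContDiffAt ℝ 1 (fun t : ℂ => f (p + e' * t)) (ofConeCoord β 0).1 :=
    ContDiffAt.comp (g := f) _ (by simpa [ofConeCoord_zero] using hf) (by fun_prop)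
  exact h2.holderNear.comp (g := fun q => (ofConeCoord β q).1) h1 one_pos hα (one_mul α)

lemma HolderNear.star {X : Type*} [NormedAddCommGroup X] {α : ℝ} {x : X} {f : X → ℂ}
    (h : HolderNear α f x) : HolderNear α (fun y => star (f y)) x :=
  h.of_isometry fun y z => by rw [← star_sub, norm_star]

/-- The metric has a cone singularity along each of the lines `{w = a_j z}` near the origin. -/
theorem GlueData.exists_hasConeSingularityAt_slope
    {p p' : ℂ} {β β' : ℝ} (h : (p = a₂ ∧ β = β₂ ∧ p' = a₃ ∧ β' = β₃) ∨
      (p = a₃ ∧ β = β₃ ∧ p' = a₂ ∧ β' = β₂)) :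
    ∃ r₀ : ℝ, 0 < r₀ ∧ ∀ z : ℂ, z ≠ 0 → ‖z‖ < r₀ →
      HasConeSingularityAt (ddbar D.pot) (lineOfSlope p) β (z, p * z) := by
  have hγ := D.pos
  have hβ₁ := D.pos₁
  set φ := flatPotential β₂ β₃ γ a₂ a₃ with hφ
  have h0 : 0 < β := by rcases h with ⟨-, rfl, -⟩ | ⟨-, rfl, -⟩; exacts [D.pos₂, D.pos₃]
  have h1 : β < 1 := by rcases h with ⟨-, rfl, -⟩ | ⟨-, rfl, -⟩; exacts [D.lt₂, D.lt₃]
  have hpp : p ≠ p' := by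
    rcases h with ⟨rfl, -, rfl, -⟩ | ⟨rfl, -, rfl, -⟩; exacts [D.ne, D.ne.symm]
  have hne23 : ∀ t : ℂ, t ≠ p → t ≠ p' → t ≠ a₂ ∧ t ≠ a₃ := by
    rcases h with ⟨rfl, -, rfl, -⟩ | ⟨rfl, -, rfl, -⟩
    exacts [fun t h h' => ⟨h, h'⟩, fun t h h' => ⟨h', h⟩]
  have hdens := density_eq_of_slope h
  obtain ⟨k, N, δ, hδ, hk, hN, hform, -⟩ := D.flatPotential_local (p := p) (β := β)
    (by rcases h with ⟨rfl, rfl, -⟩ | ⟨rfl, rfl, -⟩; exacts [Or.inl ⟨rfl, rfl⟩, Or.inr (Or.inl ⟨rfl, rfl⟩)])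
  replace hform : ∀ t ∈ ball p δ, φ t = ‖t - p‖ ^ (2 * β) * k t + N t := hform
  have hnh : ball p δ ∈ 𝓝 p := ball_mem_nhds p hδ
  obtain ⟨r₁, h10, -, hr1⟩ := D.exists_ratio_lt (K := ‖p‖ + 1) (by positivity)
  obtain ⟨r₂, h20, -, hr2⟩ := exists_rpow_lt (by linarith [D.lt_γ] : 0 < 2 * γ - 2 * β₁)
    (by positivity : 0 < β₁ ^ 2 / (γ ^ 2 * (|φ p| + 1)))
  refine ⟨min r₁ r₂, by positivity, fun z₀ hz₀ hzr => ?_⟩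
  rw [lt_min_iff] at hzr
  have hz0 : 0 < ‖z₀‖ := norm_pos_iff.2 hz₀
  -- the scale of the second coordinate, from the coefficient of the metric along the line
  set S : ℝ := β₁ ^ 2 * ‖z₀‖ ^ (2 * β₁ - 2) + φ p * (γ ^ 2 * ‖z₀‖ ^ (2 * γ - 2)) with hS
  have hSpos : 0 < S := by
    have e1 := hr2 _ (norm_nonneg _) hzr.2
    rw [lt_div_iff₀ (by positivity)] at e1
    have e2 : ‖z₀‖ ^ (2 * γ - 2) = ‖z₀‖ ^ (2 * β₁ - 2) * ‖z₀‖ ^ (2 * γ - 2 * β₁) := by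
      rw [← rpow_add hz0]; congr 1; ring
    have e3 : S = ‖z₀‖ ^ (2 * β₁ - 2) * (β₁ ^ 2 + φ p * (γ ^ 2 * ‖z₀‖ ^ (2 * γ - 2 * β₁))) := by
      rw [hS, e2]; ring
    have e4 : -|φ p| * (γ ^ 2 * ‖z₀‖ ^ (2 * γ - 2 * β₁)) ≤ φ p * (γ ^ 2 * ‖z₀‖ ^ (2 * γ - 2 * β₁)) := by
      have := neg_abs_le (φ p)
      gcongr
    have e5 : 0 < γ ^ 2 * ‖z₀‖ ^ (2 * γ - 2 * β₁) := by positivity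
    rw [e3]
    have : 0 < β₁ ^ 2 + φ p * (γ ^ 2 * ‖z₀‖ ^ (2 * γ - 2 * β₁)) := by nlinarith
    positivity
  set e : ℝ := 1 / √S with he
  have heS : e ^ 2 * S = 1 := by
    rw [he, div_pow, Real.sq_sqrt hSpos.le, one_pow, one_div_mul_cancel hSpos.ne']
  have hepos : 0 < e := by positivity
  -- the scale of the first coordinate, from the coefficient transversal to the line
  set m : ℂ → ℝ := fun t => ‖t - p'‖ ^ (2 * β' - 2) with hm
  have hpp0 : 0 < ‖p - p'‖ := norm_pos_iff.2 (sub_ne_zero.2 hpp)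
  have hmp : 0 < m p := by simp only [hm]; positivity
  set e' : ℝ := (β ^ 2 / (‖z₀‖ ^ (2 * γ) * (γ ^ 2 * m p))) ^ (1 / (2 * β)) with he'
  have hepos' : 0 < e' := by positivity
  have he'S : ‖z₀‖ ^ (2 * γ) * (γ ^ 2 * m p) * e' ^ (2 * β) = β ^ 2 := by
    rw [he', ← rpow_mul (by positivity), one_div_mul_cancel (by positivity), rpow_one]
    field_simp
  set α := min 1 (1 / β - 1) with hα
  have hαpos : 0 < α := lt_min one_pos (by rw [sub_pos, lt_div_iff₀ h0]; linarith)
  have hα1 : α ≤ 1 := min_le_left _ _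
  have hαs : α ≤ 1 / β - 1 := min_le_right _ _
  have hβi : 1 < 1 / β := by rw [lt_div_iff₀ h0]; linarith
  set y1 : ℂ × ℂ → ℂ := fun q => (ofConeCoord β q).1 with hy1
  set gB : ℂ → ℂ := grad (fun t => ‖z₀ + e * t‖ ^ (2 * γ)) with hgB
  -- the components of the error in the cone coordinates: `X` is `e' |y₁|^(1-β) ∂φ`, and `E00`, `E11`
  -- are the diagonal entries, all expanded into products of Hölder functions
  set X : ℂ × ℂ → ℂ := fun q => (e' : ℂ) * (((e' ^ (2 * β) : ℝ) : ℂ) *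
      (((‖q.1‖ ^ (1 / β + 1) : ℝ) : ℂ) * grad k (p + e' * y1 q))
    + (((β * e' ^ (2 * β - 1) : ℝ) : ℂ) * (((k (p + e' * y1 q) : ℝ) : ℂ) * star q.1)
      + ((‖q.1‖ ^ (1 / β - 1) : ℝ) : ℂ) * grad N (p + e' * y1 q))) with hX
  set E00 : ℂ × ℂ → ℂ := fun q => ((‖z₀ + e * q.2‖ ^ (2 * γ) : ℝ) : ℂ) *
    (((e' ^ (2 * β) * γ ^ 2 : ℝ) : ℂ) * ((m (p + e' * y1 q) : ℝ) : ℂ)) + ((-β ^ 2 : ℝ) : ℂ) with hE00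
  set E11 : ℂ × ℂ → ℂ := fun q => ((e ^ 2 * (β₁ ^ 2 * ‖z₀ + e * q.2‖ ^ (2 * β₁ - 2)) : ℝ) : ℂ)
    + ((((e' ^ (2 * β) : ℝ) : ℂ) * (((‖q.1‖ ^ (2 : ℝ) : ℝ) : ℂ) * ((k (p + e' * y1 q) : ℝ) : ℂ))
        + ((N (p + e' * y1 q) : ℝ) : ℂ))
      * ((e ^ 2 * (γ ^ 2 * ‖z₀ + e * q.2‖ ^ (2 * γ - 2)) : ℝ) : ℂ) + ((-1 : ℝ) : ℂ)) with hE11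
  have hy10 : y1 0 = 0 := by simp [hy1, ofConeCoord_zero]
  have hkp : ContDiffAt ℝ ∞ k p := hk.contDiffAt hnh
  have hNp : ContDiffAt ℝ ∞ N p := hN.contDiffAt hnh
  have hzs : ∀ s : ℝ, ContDiffAt ℝ ∞ (fun t : ℂ => ‖z₀ + e * t‖ ^ s) 0 := fun s =>
    ContDiffAt.comp (g := fun t : ℂ => ‖t‖ ^ s) 0 (contDiffAt_norm_rpow s (by simpa using hz₀))
      (by fun_prop)
  have l1 : (1 : WithTop ℕ∞) ≤ ((⊤ : ℕ∞) : WithTop ℕ∞) := by exact_mod_cast le_top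
  have H1 : ∀ f : ℂ → ℂ, ContDiffAt ℝ 1 f p → HolderNear α (fun q => f (p + e' * y1 q)) 0 :=
    fun f hf => holderNear_comp_ofConeCoord hαpos hα1 hαs p e' hf
  have H2 : ∀ f : ℂ → ℂ, ContDiffAt ℝ 1 f 0 → HolderNear α (fun q : ℂ × ℂ => f q.2) 0 :=
    fun f hf => holderNear_comp_snd hαpos hα1 hf
  have Hk := H1 (fun t => (k t : ℂ)) ((contDiffAt_ofReal hkp).of_le l1)
  have HN := H1 (fun t => (N t : ℂ)) ((contDiffAt_ofReal hNp).of_le l1)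
  have Hgk := H1 (grad k) ((contDiffAt_dzeta (contDiffAt_ofReal hkp)).of_le l1)
  have HgN := H1 (grad N) ((contDiffAt_dzeta (contDiffAt_ofReal hNp)).of_le l1)
  have HgB := H2 gB ((contDiffAt_dzeta (contDiffAt_ofReal (hzs (2 * γ)))).of_le l1)
  have Hq : HolderNear α (fun q : ℂ × ℂ => star q.1) 0 :=
    HolderNear.star ((contDiffAt_fst.holderNear (f := Prod.fst)).mono hα1 hαpos)
  have Hm : HolderNear α (fun q => ((m (p + e' * y1 q) : ℝ) : ℂ)) 0 := by
    refine H1 (fun t => (m t : ℂ)) ((contDiffAt_ofReal ?_).of_le l1)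
    exact ContDiffAt.comp (g := fun t : ℂ => ‖t‖ ^ (2 * β' - 2)) p
      (contDiffAt_norm_rpow _ (sub_ne_zero.2 hpp)) (by fun_prop)
  have HX : HolderNear α X 0 :=
    (holderNear_const _).mul hαpos (((holderNear_const _).mul hαpos
      ((holderNear_norm_rpow_fst hαpos hα1 (by linarith)).mul hαpos Hgk)).add
      (((holderNear_const _).mul hαpos (Hk.mul hαpos Hq)).add
      ((holderNear_norm_rpow_fst hαpos hα1 hαs).mul hαpos HgN)))
  have HE00 : HolderNear α E00 0 :=
    ((H2 (fun t => ((‖z₀ + e * t‖ ^ (2 * γ) : ℝ) : ℂ)) ((contDiffAt_ofReal (hzs _)).of_le l1)).mul hαpos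
      ((holderNear_const _).mul hαpos Hm)).add (holderNear_const _)
  have HE11 : HolderNear α E11 0 :=
    (H2 (fun t => ((e ^ 2 * (β₁ ^ 2 * ‖z₀ + e * t‖ ^ (2 * β₁ - 2)) : ℝ) : ℂ))
      ((contDiffAt_ofReal (contDiffAt_const.mul (contDiffAt_const.mul (hzs _)))).of_le l1)).add
    (((((holderNear_const _).mul hαpos ((holderNear_norm_rpow_fst hαpos hα1
      (by linarith)).mul hαpos Hk)).add HN).mul hαpos
      (H2 (fun t => ((e ^ 2 * (γ ^ 2 * ‖z₀ + e * t‖ ^ (2 * γ - 2)) : ℝ) : ℂ))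
      ((contDiffAt_ofReal (contDiffAt_const.mul (contDiffAt_const.mul (hzs _)))).of_le l1))).add
      (holderNear_const _))
  have hF0 : slopeParam z₀ p e e' 0 = (z₀, p * z₀) := by simp [slopeParam, mul_comm]
  have hzne : ∀ᶠ y : ℂ × ℂ in 𝓝 0, z₀ + e * y.2 ≠ 0 := by
    have : ContinuousAt (fun y : ℂ × ℂ => z₀ + e * y.2) 0 := by fun_prop
    exact this.eventually_ne (by simpa using hz₀)
  rw [← hF0]
  refine HasConeSingularityAt.of_param h0 h1
    ((contDiff_slopeParam z₀ p e e').contDiffAt.of_le (by norm_num)) ?_ ?_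
    (E := fun i j q => (!![E00 q, star (gB q.2) * X q; gB q.2 * star (X q), E11 q] :
      Matrix (Fin 2) (Fin 2) ℂ) i j) ?_ ?_ ?_
  -- the derivative at `0` is injective
  · have a1 : HasFDerivAt (fun y : ℂ × ℂ => z₀ + e * y.2)
        ((e : ℂ) • ContinuousLinearMap.snd ℂ ℂ ℂ) 0 :=
      (hasFDerivAt_snd.const_mul (e : ℂ)).const_add z₀
    have a2 : HasFDerivAt (fun y : ℂ × ℂ => p + e' * y.1)
        ((e' : ℂ) • ContinuousLinearMap.fst ℂ ℂ ℂ) 0 :=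
      (hasFDerivAt_fst.const_mul (e' : ℂ)).const_add p
    have a3 := a1.prodMk (a1.fun_mul a2)
    change Function.Injective (fderiv ℂ (fun y : ℂ × ℂ =>
      (z₀ + e * y.2, (z₀ + e * y.2) * (p + e' * y.1))) 0)
    rw [a3.fderiv]
    have c1 : (e : ℂ) ≠ 0 := by exact_mod_cast hepos.ne'
    have c2 : (e' : ℂ) ≠ 0 := by exact_mod_cast hepos'.ne'
    intro u v huv
    simp only [ContinuousLinearMap.prod_apply, Prod.mk.injEq, add_apply, smul_apply,
      ContinuousLinearMap.coe_fst', ContinuousLinearMap.coe_snd', smul_eq_mul, Prod.fst_zero,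
      Prod.snd_zero, mul_zero, add_zero] at huv
    have u2 : u.2 = v.2 := mul_left_cancel₀ c1 huv.1
    have u1 := huv.2
    rw [u2] at u1
    exact Prod.ext (mul_left_cancel₀ c2 (mul_left_cancel₀ hz₀ (add_right_cancel u1))) u2
  · filter_upwards [hzne] with y hy
    have c2 : (e' : ℂ) ≠ 0 := by exact_mod_cast hepos'.ne'
    change (z₀ + e * y.2) * (p + e' * y.1) = p * (z₀ + e * y.2) ↔ y.1 = 0
    rw [mul_comm p, mul_right_inj' hy, add_eq_left, mul_eq_zero, or_iff_right c2]
  · refine Fin.forall_fin_two.2 ⟨Fin.forall_fin_two.2 ⟨HE00, ?_⟩, Fin.forall_fin_two.2 ⟨?_, HE11⟩⟩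
    · exact (HolderNear.star HgB).mul hαpos HX
    · exact HgB.mul hαpos (HolderNear.star HX)
  · have hX0 : X 0 = 0 := by
      simp only [hX, Prod.fst_zero, norm_zero, star_zero, mul_zero]
      rw [zero_rpow (by linarith), zero_rpow (by linarith)]
      simp
    refine Fin.forall_fin_two.2 ⟨Fin.forall_fin_two.2 ⟨?_, ?_⟩, Fin.forall_fin_two.2 ⟨?_, ?_⟩⟩
    · change E00 0 = 0
      simp only [hE00, hy10, Prod.snd_zero, mul_zero, add_zero]
      rw [← Complex.ofReal_mul, ← Complex.ofReal_mul, ← Complex.ofReal_add, Complex.ofReal_eq_zero]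
      linarith
    · change star (gB 0) * X 0 = 0
      rw [hX0, mul_zero]
    · change gB 0 * star (X 0) = 0
      rw [hX0, star_zero, mul_zero]
    · change E11 0 = 0
      have hφp : φ p = N p := by
        rw [hform p (mem_ball_self hδ), sub_self, norm_zero, zero_rpow (by positivity)]
        ring
      simp only [hE11, hy10, Prod.snd_zero, Prod.fst_zero, norm_zero, mul_zero, add_zero]
      rw [zero_rpow two_ne_zero, Complex.ofReal_zero, zero_mul, mul_zero, zero_add,
        ← Complex.ofReal_mul, ← Complex.ofReal_add, ← Complex.ofReal_add, Complex.ofReal_eq_zero,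
        ← hφp]
      linarith
  -- off the line these are the components of the error
  · have hco := continuousAt_ofConeCoord h0 h1
    rw [ContinuousAt, ofConeCoord_zero] at hco
    have hy1c : Tendsto (fun y : ℂ × ℂ => p + e' * y.1) (𝓝 0) (𝓝 p) := by
      have : Continuous (fun y : ℂ × ℂ => p + e' * y.1) := by fun_prop
      simpa using this.tendsto 0
    have hz1c : Tendsto (fun y : ℂ × ℂ => ‖z₀ + e * y.2‖) (𝓝 0) (𝓝 ‖z₀‖) := by
      have : Continuous (fun y : ℂ × ℂ => ‖z₀ + e * y.2‖) := by fun_prop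
      simpa using this.tendsto 0
    filter_upwards [hco.eventually hzne, hco.eventually (hy1c.eventually (eventually_mem_set.2 hnh)),
      hco.eventually (hy1c.eventually_ne hpp),
      hco.eventually (hy1c.eventually (eventually_mem_set.2 (ball_mem_nhds p one_pos))),
      hco.eventually (hz1c.eventually (gt_mem_nhds hzr.1))] with q q1 q2 q3 q4 q5 hq
    have hqn : 0 < ‖q.1‖ := norm_pos_iff.2 hq
    have hyn : ‖y1 q‖ = ‖q.1‖ ^ (1 / β) := norm_ofConeCoord_fst h0 q
    have hyp : 0 < ‖y1 q‖ := by rw [hyn]; positivity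
    have hζp : p + e' * y1 q ≠ p := by
      rw [Ne, add_eq_left, mul_eq_zero, not_or]
      exact ⟨by exact_mod_cast hepos'.ne', norm_pos_iff.1 hyp⟩
    obtain ⟨n2, n3⟩ := hne23 _ hζp q3
    have hrat : ratio β₁ γ α₀ (slopeParam z₀ p e e' (ofConeCoord β q)) < 1 := by
      refine hr1 _ q1 q5 ?_
      change ‖(z₀ + e * (ofConeCoord β q).2) * (p + e' * y1 q) / (z₀ + e * (ofConeCoord β q).2)‖ ≤ _
      rw [mul_div_cancel_left₀ _ q1]
      have h3 : ‖p + e' * y1 q - p‖ < 1 := mem_ball_iff_norm.1 q4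
      have h4 := norm_add_le p (p + e' * y1 q - p)
      rw [add_sub_cancel] at h4
      linarith
    have hsub : p + e' * y1 q - p = e' * y1 q := by ring
    have hns : ‖p + e' * y1 q - p‖ = e' * ‖y1 q‖ := by
      rw [hsub, norm_mul, norm_real, norm_of_nonneg hepos'.le]
    have hstar : star (y1 q) = ((‖q.1‖ ^ (1 / β - 1) : ℝ) : ℂ) * star q.1 := by
      simp only [hy1, ofConeCoord, star_mul', star_def, Complex.conj_ofReal]
    have hqq : (ofConeCoord β q).2 = q.2 := rfl
    have hpow : ∀ s : ℝ, ‖y1 q‖ ^ s = ‖q.1‖ ^ (s / β) := fun s => by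
      rw [hyn, ← rpow_mul hqn.le]; congr 1; ring
    have c00 : ((‖y1 q‖ ^ (2 - 2 * β) : ℝ) : ℂ) * ((‖z₀ + e * q.2‖ ^ (2 * γ) * (e' ^ 2 *
        (γ ^ 2 * density β₂ β₃ a₂ a₃ (p + e' * y1 q))) : ℝ) : ℂ) - ((β ^ 2 : ℝ) : ℂ) = E00 q := by
      rw [hdens, hns, mul_rpow hepos'.le hyp.le]
      have d1 : ‖y1 q‖ ^ (2 - 2 * β) * ‖y1 q‖ ^ (2 * β - 2) = 1 := by
        rw [← rpow_add hyp]; simp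
      have d2 : e' ^ (2 : ℕ) * e' ^ (2 * β - 2) = e' ^ (2 * β) := by
        rw [← rpow_natCast, ← rpow_add hepos']; congr 1; push_cast; ring
      simp only [hE00]
      rw [← Complex.ofReal_mul, ← Complex.ofReal_sub, ← Complex.ofReal_mul, ← Complex.ofReal_mul,
        ← Complex.ofReal_add, ← d2]
      congr 1
      simp only [hm]
      linear_combination ‖z₀ + e * q.2‖ ^ (2 * γ) * e' ^ 2 * γ ^ 2 * e' ^ (2 * β - 2) *
        ‖p + e' * y1 q - p'‖ ^ (2 * β' - 2) * d1
    have cX : ((‖y1 q‖ ^ (1 - β) : ℝ) : ℂ) * (e' * grad φ (p + e' * y1 q)) = X q := by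
      rw [grad_local hk hN hform q2 hζp, hns, hsub, mul_rpow hepos'.le hyp.le,
        mul_rpow hepos'.le hyp.le, star_mul', hstar]
      have d1 : ‖y1 q‖ ^ (1 - β) * ‖y1 q‖ ^ (2 * β) = ‖q.1‖ ^ (1 / β + 1) := by
        rw [← rpow_add hyp, hpow]; congr 1; field_simp; ring
      have d2 : ‖y1 q‖ ^ (1 - β) * ‖y1 q‖ ^ (2 * β - 2) * ‖q.1‖ ^ (1 / β - 1) = 1 := by
        have hs0 : (1 - β + (2 * β - 2)) / β + (1 / β - 1) = 0 := by field_simp; ring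
        rw [← rpow_add hyp, hpow, ← rpow_add hqn, hs0, Real.rpow_zero]
      have d3 : ‖y1 q‖ ^ (1 - β) = ‖q.1‖ ^ (1 / β - 1) := by
        rw [hpow]; congr 1; field_simp
      have d4 : e' ^ (2 * β - 2) * e' = e' ^ (2 * β - 1) := by
        rw [← rpow_add_one hepos'.ne']; congr 1; ring
      have d1' := congrArg (fun x : ℝ => (x : ℂ)) d1
      have d2' := congrArg (fun x : ℝ => (x : ℂ)) d2
      have d3' := congrArg (fun x : ℝ => (x : ℂ)) d3
      have d4' := congrArg (fun x : ℝ => (x : ℂ)) d4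
      simp only [Complex.ofReal_mul, Complex.ofReal_one] at d1' d2' d3' d4'
      simp only [hX, Complex.ofReal_mul, star_def, Complex.conj_ofReal]
      rw [← d1', ← d4', ← d3']
      rw [← d3'] at d2'
      linear_combination ((k (p + e' * y1 q) : ℂ)) * β * (e' ^ (2 * β - 2) : ℝ) * e' ^ 2 *
        (starRingEnd ℂ) q.1 * d2'
    have c10 : ((‖y1 q‖ ^ (1 - β) : ℝ) : ℂ) * (e' * star (grad φ (p + e' * y1 q))) = star (X q) := by
      rw [← cX]
      simp only [star_mul', star_def, Complex.conj_ofReal]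
    have c11 : ((e ^ 2 * (β₁ ^ 2 * ‖z₀ + e * q.2‖ ^ (2 * β₁ - 2)) + φ (p + e' * y1 q)
          * (e ^ 2 * (γ ^ 2 * ‖z₀ + e * q.2‖ ^ (2 * γ - 2))) : ℝ) : ℂ) - 1 = E11 q := by
      rw [hform _ q2, hns, mul_rpow hepos'.le hyp.le]
      have d1 : ‖y1 q‖ ^ (2 * β) = ‖q.1‖ ^ (2 : ℝ) := by
        rw [hpow]; congr 1; field_simp
      rw [d1]
      simp only [hE11]
      push_cast
      ring
    rw [coneError_apply, D.pullback_slopeParam q1 n2 n3 hrat]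
    refine Fin.forall_fin_two.2 ⟨Fin.forall_fin_two.2 ⟨c00, ?_⟩, Fin.forall_fin_two.2 ⟨?_, c11⟩⟩
    · change ((‖y1 q‖ ^ (1 - β) : ℝ) : ℂ) * (star (gB q.2) * (e' * grad φ (p + e' * y1 q)))
        = star (gB q.2) * X q
      rw [← cX]; ring
    · change ((‖y1 q‖ ^ (1 - β) : ℝ) : ℂ) * (gB q.2 * (e' * star (grad φ (p + e' * y1 q))))
        = gB q.2 * star (X q)
      rw [← c10]; ring

end

/-! ### Lengths of curves and distance functions -/

/-- A curve `c : [a, b] → U` which is continuous and, away from finitely many times, continuously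
differentiable and disjoint from `S`. -/
structure IsArc (S U : Set (ℂ × ℂ)) (a b : ℝ) (c : ℝ → ℂ × ℂ) : Prop where
  cont : ContinuousOn c (Icc a b)
  mapsTo : MapsTo c (Icc a b) U
  regular : ∃ T : Finset ℝ, ContDiffOn ℝ 1 c (Ioo a b \ (T : Set ℝ)) ∧
    ∀ t ∈ Ioo a b \ (T : Set ℝ), c t ∉ S

/-- The length of a curve between the times `a` and `b`. -/
def arcLength (g : HermField) (c : ℝ → ℂ × ℂ) (a b : ℝ) : ℝ≥0∞ :=
  ∫⁻ t in Ioo a b, ENNReal.ofReal (Real.sqrt (normSq g (c t) (deriv c t)))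

lemma normSq_real_smul (g : HermField) (x v : ℂ × ℂ) (m : ℝ) :
    normSq g x (m • v) = m ^ 2 * normSq g x v := by
  have h : ∀ i, coord i (m • v) = m * coord i v := fun i => by
    fin_cases i <;> simp [coord]
  rw [normSq, normSq, ← re_ofReal_mul, Finset.mul_sum]
  refine congrArg _ (Finset.sum_congr rfl fun i _ => ?_)
  rw [Finset.mul_sum]
  refine Finset.sum_congr rfl fun j _ => ?_
  rw [h, h, star_mul', star_def, Complex.conj_ofReal]
  push_cast
  ring

lemma IsAdmissible.isArc {S U : Set (ℂ × ℂ)} {x y : ℂ × ℂ} {c : ℝ → ℂ × ℂ}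
    (h : IsAdmissible S U x y c) : IsArc S U 0 1 c :=
  ⟨h.cont, h.mapsTo, h.regular⟩

lemma isOpen_Ioo_diff_finset (a b : ℝ) (T : Finset ℝ) : IsOpen (Ioo a b \ (T : Set ℝ)) :=
  isOpen_Ioo.sdiff T.finite_toSet.isClosed

lemma IsArc.mono {S U : Set (ℂ × ℂ)} {a b a' b' : ℝ} {c : ℝ → ℂ × ℂ} (h : IsArc S U a b c)
    (ha : a ≤ a') (hb : b' ≤ b) : IsArc S U a' b' c := by
  obtain ⟨T, h1, h2⟩ := h.regular
  have hs : Ioo a' b' \ (T : Set ℝ) ⊆ Ioo a b \ (T : Set ℝ) :=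
    sdiff_subset_sdiff_left (Ioo_subset_Ioo ha hb)
  exact ⟨h.cont.mono (Icc_subset_Icc ha hb), h.mapsTo.mono_left (Icc_subset_Icc ha hb), T,
    h1.mono hs, fun t ht => h2 t (hs ht)⟩

lemma deriv_comp_linear (c : ℝ → ℂ × ℂ) (m k t : ℝ) :
    deriv (fun s => c (m * s + k)) t = m • deriv c (m * t + k) := by
  have h := deriv_comp_mul_left m (fun s => c (s + k)) t
  rw [h, deriv_comp_add_const]

/-- Invariance of the length under affine reparametrisations. -/
lemma arcLength_comp_linear (g : HermField) (c : ℝ → ℂ × ℂ) {m : ℝ} (hm : m ≠ 0) (k a b : ℝ) :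
    arcLength g (fun s => c (m * s + k)) a b
      = ∫⁻ t in (fun s => m * s + k) '' Ioo a b,
          ENNReal.ofReal (Real.sqrt (normSq g (c t) (deriv c t))) := by
  rw [lintegral_image_eq_lintegral_abs_deriv_mul measurableSet_Ioo (f' := fun _ => m)
    (fun t _ => by simpa using (((hasDerivAt_id t).const_mul m).add_const k).hasDerivWithinAt)
    (fun s _ t _ h => mul_left_cancel₀ hm (add_right_cancel h))]
  refine lintegral_congr fun t => ?_
  rw [deriv_comp_linear, normSq_real_smul, Real.sqrt_mul (sq_nonneg _), Real.sqrt_sq_eq_abs,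
    ENNReal.ofReal_mul (abs_nonneg _)]

lemma IsArc.comp_linear {S U : Set (ℂ × ℂ)} {a b a' b' : ℝ} {c : ℝ → ℂ × ℂ} (h : IsArc S U a b c)
    {m k : ℝ} (hm : m ≠ 0) (h1 : MapsTo (fun s => m * s + k) (Icc a' b') (Icc a b))
    (h2 : MapsTo (fun s => m * s + k) (Ioo a' b') (Ioo a b)) :
    IsArc S U a' b' (fun s => c (m * s + k)) := by
  obtain ⟨T, hT1, hT2⟩ := h.regular
  have hmaps : MapsTo (fun s => m * s + k)
      (Ioo a' b' \ ((T.image fun t => (t - k) / m : Finset ℝ) : Set ℝ)) (Ioo a b \ (T : Set ℝ)) := by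
    refine fun t ht => ⟨h2 ht.1, fun hT => ht.2 ?_⟩
    simp only [Finset.coe_image, mem_image]
    exact ⟨_, hT, by field_simp; ring⟩
  refine ⟨h.cont.comp (by fun_prop) h1, h.mapsTo.comp h1, T.image fun t => (t - k) / m, ?_,
    fun t ht => hT2 _ (hmaps ht)⟩
  exact hT1.comp (by fun_prop) hmaps

/-- The distance of the end points is at most the length of an arc. -/
lemma lengthDist_le {g : HermField} {S U : Set (ℂ × ℂ)} {a b : ℝ} {c : ℝ → ℂ × ℂ}
    (h : IsArc S U a b c) (hab : a < b) :
    lengthDist g S U (c a) (c b) ≤ arcLength g c a b := by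
  have hm : b - a ≠ 0 := (sub_pos.2 hab).ne'
  have himg : (fun s => (b - a) * s + a) '' Ioo 0 1 = Ioo a b := by
    rw [image_affine_Ioo (sub_pos.2 hab)]; simp
  have hcl : MapsTo (fun s => (b - a) * s + a) (Icc 0 1) (Icc a b) := by
    intro s hs
    constructor <;> nlinarith [hs.1, hs.2]
  have harc := h.comp_linear (k := a) hm hcl (fun s hs => himg ▸ mem_image_of_mem _ hs)
  refine (iInf₂_le (fun s => c ((b - a) * s + a))
    ⟨harc.cont, harc.mapsTo, by simp, by simp, harc.regular⟩).trans ?_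
  rw [arcLength, ← himg]
  exact (arcLength_comp_linear g c hm a 0 1).le

lemma lengthDist_comm (g : HermField) (S U : Set (ℂ × ℂ)) (x y : ℂ × ℂ) :
    lengthDist g S U x y = lengthDist g S U y x := by
  have key : ∀ x y, lengthDist g S U x y ≤ lengthDist g S U y x := by
    intro x y
    refine le_iInf₂ fun c hc => ?_
    have himg : (fun s : ℝ => (-1) * s + 1) '' Ioo 0 1 = Ioo (0 : ℝ) 1 := by
      have : (fun s : ℝ => (-1) * s + 1) = fun s => 1 - s := by ext s; ring
      rw [this, image_const_sub_Ioo]; simp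
    have harc := hc.isArc.comp_linear (a' := 0) (b' := 1) (m := -1) (k := 1) (by norm_num)
      (fun s hs => by constructor <;> linarith [hs.1, hs.2])
      (fun s hs => by constructor <;> linarith [hs.1, hs.2])
    refine (iInf₂_le (fun s => c (-1 * s + 1)) ⟨harc.cont, harc.mapsTo, by simpa using hc.target,
      by simpa using hc.source, harc.regular⟩).trans ?_
    have := arcLength_comp_linear g c (m := -1) (by norm_num) 1 0 1
    rw [himg] at this
    exact this.le
  exact le_antisymm (key x y) (key y x)

lemma arcLength_add_le (g : HermField) (c : ℝ → ℂ × ℂ) {a b d : ℝ} (h1 : a ≤ b) (h2 : b ≤ d) :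
    arcLength g c a b + arcLength g c b d ≤ arcLength g c a d := by
  rw [arcLength, arcLength, arcLength, ← lintegral_union measurableSet_Ioo]
  · exact lintegral_mono_set (union_subset (Ioo_subset_Ioo_right h2) (Ioo_subset_Ioo_left h1))
  · exact disjoint_left.2 fun t ht ht' => lt_asymm ht.2 ht'.1

lemma arcLength_le_add (g : HermField) (c : ℝ → ℂ × ℂ) (a b d : ℝ) :
    arcLength g c a d ≤ arcLength g c a b + arcLength g c b d := by
  rw [arcLength, arcLength, arcLength, setLIntegral_congr (Ioo_ae_eq_Ioc (a := a) (b := b))]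
  refine (lintegral_mono_set ?_).trans (lintegral_union_le _ _ _)
  intro t ht
  rcases le_or_gt t b with h | h
  exacts [Or.inl ⟨ht.1, h⟩, Or.inr ⟨h, ht.2⟩]

lemma arcLength_congr (g : HermField) {c c' : ℝ → ℂ × ℂ} {a b : ℝ} (h : EqOn c c' (Ioo a b)) :
    arcLength g c a b = arcLength g c' a b := by
  refine setLIntegral_congr_fun measurableSet_Ioo fun t ht => ?_
  have : c =ᶠ[𝓝 t] c' := h.eventuallyEq_of_mem (Ioo_mem_nhds ht.1 ht.2)
  simp only [this.deriv_eq, h ht]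

lemma lengthDist_triangle (g : HermField) (S U : Set (ℂ × ℂ)) (x y z : ℂ × ℂ) :
    lengthDist g S U x z ≤ lengthDist g S U x y + lengthDist g S U y z := by
  have key : ∀ c₁ c₂, IsAdmissible S U x y c₁ → IsAdmissible S U y z c₂ →
      lengthDist g S U x z ≤ curveLength g c₁ + curveLength g c₂ := by
    intro c₁ c₂ h₁ h₂
    -- the two curves are concatenated on `[0, 2]`
    set c : ℝ → ℂ × ℂ := fun t => if t ≤ 1 then c₁ t else c₂ (1 * t + (-1)) with hc
    have e1 : EqOn c c₁ (Icc 0 1) := fun t ht => if_pos ht.2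
    have e2 : EqOn c (fun t => c₂ (1 * t + (-1))) (Icc 1 2) := fun t ht => by
      rcases ht.1.eq_or_lt with h | h
      · subst h; simp [hc, h₁.target, h₂.source]
      · exact if_neg (not_le.2 h)
    have arc2 : IsArc S U 1 2 (fun t => c₂ (1 * t + (-1))) :=
      h₂.isArc.comp_linear one_ne_zero (fun s hs => by constructor <;> linarith [hs.1, hs.2])
        (fun s hs => by constructor <;> linarith [hs.1, hs.2])
    obtain ⟨T₁, s1, o1⟩ := h₁.regular
    obtain ⟨T₂, s2, o2⟩ := arc2.regular
    have hcov : Icc (0 : ℝ) 2 = Icc 0 1 ∪ Icc 1 2 := (Icc_union_Icc_eq_Icc zero_le_one one_le_two).symm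
    have hsplit : ∀ t ∈ Ioo (0 : ℝ) 2 \ ((insert 1 (T₁ ∪ T₂) : Finset ℝ) : Set ℝ),
        (t ∈ Ioo (0 : ℝ) 1 \ (T₁ : Set ℝ)) ∨ t ∈ Ioo (1 : ℝ) 2 \ (T₂ : Set ℝ) := by
      intro t ht
      have h3 := ht.2
      simp only [Finset.coe_insert, Finset.coe_union, mem_insert_iff, mem_union, not_or] at h3
      rcases lt_or_gt_of_ne h3.1 with h | h
      · exact Or.inl ⟨⟨ht.1.1, h⟩, h3.2.1⟩
      · exact Or.inr ⟨⟨h, ht.1.2⟩, h3.2.2⟩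
    have arc : IsArc S U 0 2 c := by
      refine ⟨?_, ?_, insert 1 (T₁ ∪ T₂), ?_, ?_⟩
      · rw [hcov]
        exact (h₁.cont.congr e1).union_of_isClosed (arc2.cont.congr e2) isClosed_Icc isClosed_Icc
      · rw [hcov]
        exact MapsTo.union (h₁.mapsTo.congr e1.symm) (arc2.mapsTo.congr e2.symm)
      · intro t ht
        refine ContDiffAt.contDiffWithinAt ?_
        rcases hsplit t ht with h | h
        · refine (s1.contDiffAt ((isOpen_Ioo_diff_finset _ _ _).mem_nhds h)).congr_of_eventuallyEq ?_
          filter_upwards [Ioo_mem_nhds h.1.1 h.1.2] with s hs using e1 (Ioo_subset_Icc_self hs)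
        · refine (s2.contDiffAt ((isOpen_Ioo_diff_finset _ _ _).mem_nhds h)).congr_of_eventuallyEq ?_
          filter_upwards [Ioo_mem_nhds h.1.1 h.1.2] with s hs using e2 (Ioo_subset_Icc_self hs)
      · intro t ht
        rcases hsplit t ht with h | h
        · rw [e1 (Ioo_subset_Icc_self h.1)]; exact o1 t h
        · rw [e2 (Ioo_subset_Icc_self h.1)]; exact o2 t h
    have h3 := lengthDist_le (g := g) arc two_pos
    have hx : c 0 = x := by rw [e1 (by simp), h₁.source]
    have hz : c 2 = z := by rw [e2 (by simp)]; norm_num [h₂.target]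
    rw [hx, hz] at h3
    refine h3.trans ((arcLength_le_add g c 0 1 2).trans (add_le_add ?_ ?_))
    · exact (arcLength_congr g (e1.mono Ioo_subset_Icc_self)).le
    · rw [arcLength_congr g (e2.mono Ioo_subset_Icc_self), arcLength_comp_linear g c₂ one_ne_zero]
      have : (fun s : ℝ => 1 * s + (-1)) '' Ioo 1 2 = Ioo 0 1 := by
        rw [image_affine_Ioo one_pos]; norm_num
      rw [this]
      rfl
  conv_rhs => rw [lengthDist, lengthDist]
  simp only [ENNReal.iInf_add, ENNReal.add_iInf]
  exact le_iInf₂ fun c₂ h₂ => le_iInf₂ fun c₁ h₁ => key c₁ c₂ h₁ h₂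

/-- Comparison of the lengths of two curves. -/
lemma arcLength_le_mul {g g' : HermField} {c c' : ℝ → ℂ × ℂ} {a b K : ℝ} (hK : 0 ≤ K)
    (T : Finset ℝ) (h : ∀ t ∈ Ioo a b \ (T : Set ℝ),
      normSq g (c t) (deriv c t) ≤ K ^ 2 * normSq g' (c' t) (deriv c' t)) :
    arcLength g c a b ≤ ENNReal.ofReal K * arcLength g' c' a b := by
  rw [arcLength, arcLength, ← lintegral_const_mul' _ _ ENNReal.ofReal_ne_top]
  refine setLIntegral_mono_ae' measurableSet_Ioo ?_
  have hT : ∀ᵐ t : ℝ, t ∉ (T : Set ℝ) := by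
    rw [ae_iff]; simp only [not_not]; exact T.finite_toSet.measure_zero _
  filter_upwards [hT] with t ht hab
  rw [← ENNReal.ofReal_mul hK]
  refine ENNReal.ofReal_le_ofReal ?_
  rw [← Real.sqrt_sq hK, ← Real.sqrt_mul (sq_nonneg K)]
  exact Real.sqrt_le_sqrt (h t ⟨hab, ht⟩)

/-! ### The distance of the cone -/

/-- The point of `ℂ_{β₁} × ℂ_γ` at distances `r` and `R` from the two singular lines, in the
directions `u₁` and `u₂`. -/
def conePoint (β₁ γ : ℝ) (u₁ u₂ : ℂ) (r R : ℝ) : ℂ × ℂ :=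
  ((r ^ (1 / β₁) : ℝ) * u₁, (R ^ (1 / γ) : ℝ) * u₂)

lemma norm_polar {β r : ℝ} {u : ℂ} (hu : ‖u‖ = 1) (hr : 0 ≤ r) :
    ‖((r ^ (1 / β) : ℝ) : ℂ) * u‖ = r ^ (1 / β) := by
  rw [norm_mul, hu, mul_one, norm_real, norm_of_nonneg (by positivity)]

lemma norm_polar_rpow {β r : ℝ} {u : ℂ} (hβ : 0 < β) (hu : ‖u‖ = 1) (hr : 0 ≤ r) :
    ‖((r ^ (1 / β) : ℝ) : ℂ) * u‖ ^ β = r := by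
  rw [norm_polar hu hr, ← rpow_mul hr, one_div_mul_cancel hβ.ne', rpow_one]

lemma norm_polar_rpow_two {β r : ℝ} {u : ℂ} (hβ : 0 < β) (hu : ‖u‖ = 1) (hr : 0 ≤ r) :
    ‖((r ^ (1 / β) : ℝ) : ℂ) * u‖ ^ (2 * β) = r ^ 2 := by
  rw [mul_comm 2 β, rpow_mul (norm_nonneg _), norm_polar_rpow hβ hu hr, rpow_two]

lemma exists_polar {β : ℝ} (hβ : 0 < β) (z : ℂ) :
    ∃ u : ℂ, ‖u‖ = 1 ∧ (((‖z‖ ^ β) ^ (1 / β) : ℝ) : ℂ) * u = z := by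
  have e : (‖z‖ ^ β) ^ (1 / β) = ‖z‖ := by
    rw [← rpow_mul (norm_nonneg _), mul_one_div_cancel hβ.ne', rpow_one]
  rw [e]
  rcases eq_or_ne z 0 with rfl | h
  · exact ⟨1, by simp, by simp⟩
  · have h0 : ‖z‖ ≠ 0 := norm_ne_zero_iff.2 h
    refine ⟨z / ‖z‖, by simp [h0], ?_⟩
    have : (‖z‖ : ℂ) ≠ 0 := by exact_mod_cast h0
    field_simp

lemma hasDerivAt_polar {β : ℝ} (hβ : 0 < β) {u : ℂ} (hu : ‖u‖ = 1) {r : ℝ → ℝ} {r' t : ℝ}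
    (hr : HasDerivAt r r' t) (h0 : 0 < r t) :
    ∃ v : ℂ, HasDerivAt (fun s => ((r s ^ (1 / β) : ℝ) : ℂ) * u) v t ∧
      β ^ 2 * ‖((r t ^ (1 / β) : ℝ) : ℂ) * u‖ ^ (2 * β - 2) * ‖v‖ ^ 2 = r' ^ 2 := by
  have h1 := hr.rpow_const (p := 1 / β) (Or.inl h0.ne')
  refine ⟨_, h1.ofReal_comp.mul_const u, ?_⟩
  rw [norm_polar hu h0.le, norm_mul, hu, mul_one, norm_real, norm_eq_abs, sq_abs,
    ← rpow_mul h0.le, mul_pow, ← rpow_natCast (r t ^ (1 / β - 1)), ← rpow_mul h0.le]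
  have e : r t ^ (1 / β * (2 * β - 2)) * r t ^ ((1 / β - 1) * ((2 : ℕ) : ℝ)) = 1 := by
    have : 1 / β * (2 * β - 2) + (1 / β - 1) * ((2 : ℕ) : ℝ) = 0 := by
      push_cast; field_simp; ring
    rw [← rpow_add h0, this, Real.rpow_zero]
  have e2 : β ^ 2 * (1 / β) ^ 2 = 1 := by field_simp
  rw [mul_pow]
  linear_combination r' ^ 2 * β ^ 2 * (1 / β) ^ 2 * e + r' ^ 2 * e2

lemma continuous_conePoint {β₁ γ : ℝ} (hβ : 0 < β₁) (hγ : 0 < γ) (u₁ u₂ : ℂ) {r R : ℝ → ℝ}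
    (hr : Continuous r) (hR : Continuous R) :
    Continuous fun t => conePoint β₁ γ u₁ u₂ (r t) (R t) := by
  have h : ∀ {β : ℝ} (u : ℂ) {f : ℝ → ℝ}, 0 < β → Continuous f →
      Continuous fun t => ((f t ^ (1 / β) : ℝ) : ℂ) * u := fun u f hβ hf =>
    (continuous_ofReal.comp (hf.rpow_const fun t => Or.inr (by positivity))).mul
      continuous_const
  exact (h u₁ hβ hr).prodMk (h u₂ hγ hR)

lemma contDiffAt_conePoint {β₁ γ : ℝ} (u₁ u₂ : ℂ) {r R : ℝ → ℝ} {t : ℝ}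
    (hr : ContDiffAt ℝ 1 r t) (hR : ContDiffAt ℝ 1 R t) (h1 : r t ≠ 0) (h2 : R t ≠ 0) :
    ContDiffAt ℝ 1 (fun t => conePoint β₁ γ u₁ u₂ (r t) (R t)) t := by
  have h : ∀ {β : ℝ} (u : ℂ) {f : ℝ → ℝ}, ContDiffAt ℝ 1 f t → f t ≠ 0 →
      ContDiffAt ℝ 1 (fun t => ((f t ^ (1 / β) : ℝ) : ℂ) * u) t := fun u f hf h0 =>
    (ContDiffAt.comp (g := fun x : ℝ => (x : ℂ)) t ofRealCLM.contDiff.contDiffAt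
      (hf.rpow_const_of_ne h0)).mul contDiffAt_const
  exact (h u₁ hr h1).prodMk (h u₂ hR h2)

lemma affine_pos {a b t : ℝ} (ha : 0 ≤ a) (hb : 0 ≤ b) (hab : 0 < a + b) (ht : t ∈ Ioo (0 : ℝ) 1) :
    0 < a + t * (b - a) := by
  have h1 : a + t * (b - a) = (1 - t) * a + t * b := by ring
  have h2 : 0 < 1 - t := by linarith [ht.2]
  have h3 := ht.1
  rw [h1]
  rcases ha.eq_or_lt with rfl | h
  · have : 0 < b := by linarith
    positivity
  · positivity

lemma conePoint_fst_ne {β₁ γ : ℝ} {u₁ u₂ : ℂ} (hu : ‖u₁‖ = 1) {r R : ℝ} (hr : 0 < r) :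
    (conePoint β₁ γ u₁ u₂ r R).1 ≠ 0 := by
  rw [← norm_ne_zero_iff, conePoint, norm_polar hu hr.le]
  positivity

lemma conePoint_snd_ne {β₁ γ : ℝ} {u₁ u₂ : ℂ} (hu : ‖u₂‖ = 1) {r R : ℝ} (hR : 0 < R) :
    (conePoint β₁ γ u₁ u₂ r R).2 ≠ 0 := by
  rw [← norm_ne_zero_iff, conePoint, norm_polar hu hR.le]
  positivity

/-- Distance of the end points of a radial segment, for a metric bounded by the cone metric. -/
lemma lengthDist_radial_le {β₁ γ : ℝ} (hβ : 0 < β₁) (hγ : 0 < γ) {g : HermField}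
    {S U : Set (ℂ × ℂ)} {K : ℝ} (hK : 0 ≤ K) {u₁ u₂ : ℂ} (hu₁ : ‖u₁‖ = 1) (hu₂ : ‖u₂‖ = 1)
    {r₀ r₁ R₀ R₁ : ℝ} (hr₀ : 0 ≤ r₀) (hr₁ : 0 ≤ r₁) (hR₀ : 0 ≤ R₀) (hR₁ : 0 ≤ R₁)
    (hr : 0 < r₀ + r₁) (hR : 0 < R₀ + R₁)
    (hU : ∀ t ∈ Icc (0 : ℝ) 1,
      conePoint β₁ γ u₁ u₂ (r₀ + t * (r₁ - r₀)) (R₀ + t * (R₁ - R₀)) ∈ U)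
    (hg : ∀ t ∈ Ioo (0 : ℝ) 1,
      conePoint β₁ γ u₁ u₂ (r₀ + t * (r₁ - r₀)) (R₀ + t * (R₁ - R₀)) ∉ S ∧
      ∀ v, normSq g (conePoint β₁ γ u₁ u₂ (r₀ + t * (r₁ - r₀)) (R₀ + t * (R₁ - R₀))) v
        ≤ K ^ 2 * normSq (coneMetric β₁ γ)
          (conePoint β₁ γ u₁ u₂ (r₀ + t * (r₁ - r₀)) (R₀ + t * (R₁ - R₀))) v) :
    lengthDist g S U (conePoint β₁ γ u₁ u₂ r₀ R₀) (conePoint β₁ γ u₁ u₂ r₁ R₁)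
      ≤ ENNReal.ofReal (K * (|r₁ - r₀| + |R₁ - R₀|)) := by
  set c : ℝ → ℂ × ℂ := fun t =>
    conePoint β₁ γ u₁ u₂ (r₀ + t * (r₁ - r₀)) (R₀ + t * (R₁ - R₀)) with hc
  have hc0 : c 0 = conePoint β₁ γ u₁ u₂ r₀ R₀ := by simp [hc]
  have hc1 : c 1 = conePoint β₁ γ u₁ u₂ r₁ R₁ := by simp [hc]
  have arc : IsArc S U 0 1 c := by
    refine ⟨(continuous_conePoint hβ hγ u₁ u₂ (by fun_prop) (by fun_prop)).continuousOn, hU, ∅,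
      fun t ht => ContDiffAt.contDiffWithinAt ?_, fun t ht => (hg t ht.1).1⟩
    exact contDiffAt_conePoint u₁ u₂ (by fun_prop) (by fun_prop) (affine_pos hr₀ hr₁ hr ht.1).ne'
      (affine_pos hR₀ hR₁ hR ht.1).ne'
  rw [← hc0, ← hc1]
  refine (lengthDist_le arc one_pos).trans ?_
  have hsp : ∀ t ∈ Ioo (0 : ℝ) 1, ENNReal.ofReal (Real.sqrt (normSq g (c t) (deriv c t)))
      ≤ ENNReal.ofReal (K * (|r₁ - r₀| + |R₁ - R₀|)) := by
    intro t ht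
    refine ENNReal.ofReal_le_ofReal (Real.sqrt_le_iff.2 ⟨by positivity, ?_⟩)
    refine ((hg t ht).2 _).trans ?_
    rw [mul_pow]
    refine mul_le_mul_of_nonneg_left ?_ (sq_nonneg K)
    have hd : ∀ a b : ℝ, HasDerivAt (fun t => a + t * (b - a)) (b - a) t := fun a b => by
      simpa using ((hasDerivAt_id t).mul_const (b - a)).const_add a
    obtain ⟨v₁, hv₁, e₁⟩ := hasDerivAt_polar hβ hu₁ (hd r₀ r₁) (affine_pos hr₀ hr₁ hr ht)
    obtain ⟨v₂, hv₂, e₂⟩ := hasDerivAt_polar hγ hu₂ (hd R₀ R₁) (affine_pos hR₀ hR₁ hR ht)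
    have hder : HasDerivAt c (v₁, v₂) t := hv₁.prodMk hv₂
    rw [hder.deriv, normSq_coneMetric]
    have e3 : β₁ ^ 2 * ‖(c t).1‖ ^ (2 * β₁ - 2) * ‖v₁‖ ^ 2 = (r₁ - r₀) ^ 2 := e₁
    have e4 : γ ^ 2 * ‖(c t).2‖ ^ (2 * γ - 2) * ‖v₂‖ ^ 2 = (R₁ - R₀) ^ 2 := e₂
    rw [e3, e4, ← sq_abs (r₁ - r₀), ← sq_abs (R₁ - R₀)]
    nlinarith [abs_nonneg (r₁ - r₀), abs_nonneg (R₁ - R₀)]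
  refine (setLIntegral_mono' measurableSet_Ioo hsp).trans ?_
  simp

lemma conePoint_eq {β₁ γ : ℝ} (hβ : 0 < β₁) (hγ : 0 < γ) (x : ℂ × ℂ) :
    ∃ u₁ u₂ : ℂ, ‖u₁‖ = 1 ∧ ‖u₂‖ = 1 ∧ conePoint β₁ γ u₁ u₂ (‖x.1‖ ^ β₁) (‖x.2‖ ^ γ) = x := by
  obtain ⟨u₁, h1, e1⟩ := exists_polar hβ x.1
  obtain ⟨u₂, h2, e2⟩ := exists_polar hγ x.2
  exact ⟨u₁, u₂, h1, h2, Prod.ext e1 e2⟩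

lemma coneDist_radial_le {β₁ γ : ℝ} (hβ : 0 < β₁) (hγ : 0 < γ) {u₁ u₂ : ℂ} (hu₁ : ‖u₁‖ = 1)
    (hu₂ : ‖u₂‖ = 1) {r₀ r₁ R₀ R₁ : ℝ} (hr₀ : 0 ≤ r₀) (hr₁ : 0 ≤ r₁) (hR₀ : 0 ≤ R₀) (hR₁ : 0 ≤ R₁)
    (hr : 0 < r₀ + r₁) (hR : 0 < R₀ + R₁) :
    coneDist β₁ γ (conePoint β₁ γ u₁ u₂ r₀ R₀) (conePoint β₁ γ u₁ u₂ r₁ R₁)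
      ≤ ENNReal.ofReal (|r₁ - r₀| + |R₁ - R₀|) := by
  have := lengthDist_radial_le hβ hγ (g := coneMetric β₁ γ) (S := {x | x.1 = 0 ∨ x.2 = 0})
    (U := univ) zero_le_one hu₁ hu₂ hr₀ hr₁ hR₀ hR₁ hr hR (fun _ _ => mem_univ _) (fun t ht => ?_)
  · rwa [one_mul] at this
  have p1 := affine_pos hr₀ hr₁ hr ht
  have p2 := affine_pos hR₀ hR₁ hR ht
  refine ⟨?_, fun v => by rw [one_pow, one_mul]⟩
  rw [mem_ofPred_eq, not_or]
  exact ⟨conePoint_fst_ne hu₁ p1, conePoint_snd_ne hu₂ p2⟩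

lemma conePoint_snd_zero {β₁ γ : ℝ} (hγ : 0 < γ) (u₁ u₂ v : ℂ) (r : ℝ) :
    conePoint β₁ γ u₁ u₂ r 0 = conePoint β₁ γ u₁ v r 0 := by
  simp [conePoint, zero_rpow (inv_pos.2 hγ).ne']

lemma conePoint_fst_zero {β₁ γ : ℝ} (hβ : 0 < β₁) (u₁ u₂ v : ℂ) (R : ℝ) :
    conePoint β₁ γ u₁ u₂ 0 R = conePoint β₁ γ v u₂ 0 R := by
  simp [conePoint, zero_rpow (inv_pos.2 hβ).ne']

/-- Points on a common fibre of the projection to `ℂ_{β₁}` are close if they are close to the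
singular line `{w = 0}`. -/
lemma coneDist_fibre_le {β₁ γ : ℝ} (hβ : 0 < β₁) (hγ : 0 < γ) {η : ℝ} (hη : 0 < η) {z w w' : ℂ}
    (hw : ‖w‖ ^ γ ≤ η) (hw' : ‖w'‖ ^ γ = η) :
    coneDist β₁ γ (z, w) (z, w') ≤ ENNReal.ofReal (5 * η) := by
  obtain ⟨u₁, u₂, h1, h2, e⟩ := conePoint_eq hβ hγ (z, w)
  obtain ⟨v, h3, e'⟩ := exists_polar hγ w'
  have ez : ((((‖z‖ ^ β₁) ^ (1 / β₁) : ℝ) : ℂ)) * u₁ = z := congrArg Prod.fst e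
  have e2 : conePoint β₁ γ u₁ v (‖z‖ ^ β₁) η = (z, w') := by
    rw [← hw']; exact Prod.ext ez e'
  simp only at e
  rw [← e, ← e2]
  set r := ‖z‖ ^ β₁
  set R := ‖w‖ ^ γ
  have hr : 0 ≤ r := by positivity
  have hR : 0 ≤ R := by positivity
  -- through the singular line, moving away from `{z = 0}` meanwhile
  have s1 := coneDist_radial_le hβ hγ h1 h2 hr (by positivity : 0 ≤ r + η) hR hη.le
    (by positivity) (by positivity)
  have s2 := coneDist_radial_le hβ hγ h1 h2 (by positivity : 0 ≤ r + η) (by positivity : 0 ≤ r + η)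
    hη.le le_rfl (by positivity) (by positivity)
  have s3 := coneDist_radial_le hβ hγ h1 h3 (by positivity : 0 ≤ r + η) (by positivity : 0 ≤ r + η)
    le_rfl hη.le (by positivity) (by positivity)
  have s4 := coneDist_radial_le hβ hγ h1 h3 (by positivity : 0 ≤ r + η) hr hη.le hη.le
    (by positivity) (by positivity)
  rw [conePoint_snd_zero hγ u₁ v u₂] at s3
  refine ((lengthDist_triangle _ _ _ _ _ _).trans (add_le_add ((lengthDist_triangle _ _ _ _ _ _).trans
    (add_le_add ((lengthDist_triangle _ _ _ _ _ _).trans (add_le_add s1 s2)) s3)) s4)).trans ?_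
  rw [← ENNReal.ofReal_add (by positivity) (by positivity),
    ← ENNReal.ofReal_add (by positivity) (by positivity),
    ← ENNReal.ofReal_add (by positivity) (by positivity)]
  refine ENNReal.ofReal_le_ofReal ?_
  have : |η - R| = η - R := abs_of_nonneg (by linarith)
  simp [this, abs_of_pos hη]
  linarith

lemma rpow_le_one_of_mem {β₁ γ : ℝ} {x : ℂ × ℂ} (hx : x ∈ coneUnitBall β₁ γ) :
    ‖x.1‖ ^ β₁ ≤ 1 ∧ ‖x.2‖ ^ γ ≤ 1 := by
  have h : ‖x.1‖ ^ (2 * β₁) + ‖x.2‖ ^ (2 * γ) < 1 := hx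
  rw [mul_comm 2 β₁, mul_comm 2 γ, rpow_mul (norm_nonneg _), rpow_mul (norm_nonneg _),
    rpow_two, rpow_two] at h
  exact ⟨abs_le_one_iff_mul_self_le_one.2 (by nlinarith) |> le_of_abs_le,
    abs_le_one_iff_mul_self_le_one.2 (by nlinarith) |> le_of_abs_le⟩

lemma coneDist_le_of_mem {β₁ γ : ℝ} (hβ : 0 < β₁) (hγ : 0 < γ) {x y : ℂ × ℂ}
    (hx : x ∈ coneUnitBall β₁ γ) (hy : y ∈ coneUnitBall β₁ γ) :
    coneDist β₁ γ x y ≤ ENNReal.ofReal 12 := by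
  have key : ∀ x ∈ coneUnitBall β₁ γ,
      coneDist β₁ γ x (conePoint β₁ γ 1 1 1 1) ≤ ENNReal.ofReal 6 := by
    intro x hx
    obtain ⟨u₁, u₂, h1, h2, e⟩ := conePoint_eq hβ hγ x
    obtain ⟨b1, b2⟩ := rpow_le_one_of_mem hx
    have a1 : 0 ≤ ‖x.1‖ ^ β₁ := by positivity
    have a2 : 0 ≤ ‖x.2‖ ^ γ := by positivity
    have o : ‖(1 : ℂ)‖ = 1 := norm_one
    -- go out to `r = R = 1`, then change the two directions `u₂`, `u₁` where `R = 0`, `r = 0`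
    have s1 := coneDist_radial_le hβ hγ h1 h2 a1 zero_le_one a2 zero_le_one (by positivity)
      (by positivity)
    have s2 := coneDist_radial_le hβ hγ h1 h2 zero_le_one zero_le_one zero_le_one (le_refl (0 : ℝ))
      (by norm_num) (by norm_num)
    have s3 := coneDist_radial_le hβ hγ h1 o zero_le_one zero_le_one (le_refl (0 : ℝ)) zero_le_one
      (by norm_num) (by norm_num)
    have s4 := coneDist_radial_le hβ hγ h1 o zero_le_one (le_refl (0 : ℝ)) zero_le_one zero_le_one
      (by norm_num) (by norm_num)
    have s5 := coneDist_radial_le hβ hγ o o (le_refl (0 : ℝ)) zero_le_one zero_le_one zero_le_one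
      (by norm_num) (by norm_num)
    rw [conePoint_snd_zero hγ u₁ 1 u₂] at s3
    rw [conePoint_fst_zero hβ 1 1 u₁] at s5
    rw [e] at s1
    refine ((lengthDist_triangle _ _ _ _ _ _).trans (add_le_add
      ((lengthDist_triangle _ _ _ _ _ _).trans (add_le_add ((lengthDist_triangle _ _ _ _ _ _).trans
        (add_le_add ((lengthDist_triangle _ _ _ _ _ _).trans (add_le_add s1 s2)) s3)) s4)) s5)).trans ?_
    rw [← ENNReal.ofReal_add (by positivity) (by positivity),
      ← ENNReal.ofReal_add (by positivity) (by positivity),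
      ← ENNReal.ofReal_add (by positivity) (by positivity),
      ← ENNReal.ofReal_add (by positivity) (by positivity)]
    refine ENNReal.ofReal_le_ofReal ?_
    rw [abs_of_nonneg (sub_nonneg.2 b1), abs_of_nonneg (sub_nonneg.2 b2)]
    norm_num
    linarith
  have h2 := key y hy
  rw [coneDist, lengthDist_comm] at h2
  refine (lengthDist_triangle _ _ _ _ (conePoint β₁ γ 1 1 1 1) _).trans
    ((add_le_add (key x hx) h2).trans ?_)
  rw [← ENNReal.ofReal_add (by norm_num) (by norm_num)]
  norm_num

/-! ### Contraction of curves into the unit ball -/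

lemma hasDerivAt_posPart_sq (x : ℝ) : HasDerivAt (fun x : ℝ => max 0 x ^ 2) (2 * max 0 x) x := by
  rcases lt_trichotomy x 0 with h | rfl | h
  · rw [max_eq_left h.le, mul_zero]
    refine (hasDerivAt_const x (0 : ℝ)).congr_of_eventuallyEq ?_
    filter_upwards [gt_mem_nhds h] with y hy
    rw [max_eq_left hy.le]; norm_num
  · rw [max_self, mul_zero, hasDerivAt_iff_hasFDerivAt]
    have h1 : (fun x : ℝ => max 0 x ^ 2) =O[𝓝 0] fun x => ‖x - 0‖ ^ 2 := by
      refine Asymptotics.isBigO_of_le _ fun x => ?_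
      rw [sub_zero, norm_pow, norm_pow, norm_norm]
      have : ‖max 0 x‖ ≤ ‖x‖ := by
        rw [norm_of_nonneg (le_max_left _ _)]
        exact max_le (norm_nonneg _) (le_abs_self x)
      gcongr
    refine (h1.hasFDerivAt one_lt_two).congr_fderiv ?_
    ext; simp
  · rw [max_eq_right h.le]
    have := hasDerivAt_pow 2 x
    norm_num at this
    refine this.congr_of_eventuallyEq ?_
    filter_upwards [lt_mem_nhds h] with y hy
    rw [max_eq_right hy.le]

/-- A `C¹` majorant of `max 1 N`, equal to `1` for `N ≤ N₀`, and of slope at most `1`. -/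
lemma exists_majorant {N₀ : ℝ} (h1 : N₀ < 1) :
    ∃ Y : ℝ → ℝ, ContDiff ℝ 1 Y ∧ (∀ N ≤ N₀, Y N = 1) ∧
      ∀ N, 1 ≤ Y N ∧ N < Y N ∧ 0 ≤ deriv Y N ∧ deriv Y N ≤ 1 := by
  set s : ℝ → ℝ := fun N => max 0 (N - N₀) with hs
  have hb : 0 < 1 - N₀ := by linarith
  have hpos : ∀ N, 0 < s N ^ 2 + (1 - N₀) ^ 2 := fun N => by positivity
  have hder : ∀ N, HasDerivAt (fun N => N₀ + √(s N ^ 2 + (1 - N₀) ^ 2))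
      (s N / √(s N ^ 2 + (1 - N₀) ^ 2)) N := by
    intro N
    have e1 : HasDerivAt (fun N => s N ^ 2) (2 * s N) N :=
      (HasDerivAt.comp (h₂ := fun x : ℝ => max 0 x ^ 2) (h := fun N => N - N₀) N
        (hasDerivAt_posPart_sq (N - N₀)) ((hasDerivAt_id N).sub_const N₀)).congr_deriv (mul_one _)
    refine (((e1.add_const ((1 - N₀) ^ 2)).sqrt (hpos N).ne').const_add N₀).congr_deriv ?_
    field_simp
  refine ⟨fun N => N₀ + √(s N ^ 2 + (1 - N₀) ^ 2), ?_, fun N hN => ?_, fun N => ⟨?_, ?_, ?_, ?_⟩⟩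
  · rw [contDiff_one_iff_deriv]
    refine ⟨fun N => (hder N).differentiableAt, ?_⟩
    rw [funext fun N => (hder N).deriv]
    have hsc : Continuous s := by fun_prop
    exact hsc.div (by fun_prop) fun N => (Real.sqrt_pos.2 (hpos N)).ne'
  · have : s N = 0 := max_eq_left (by linarith)
    simp only [this]
    rw [zero_pow two_ne_zero, zero_add, Real.sqrt_sq hb.le]
    ring
  · have : 1 - N₀ ≤ √(s N ^ 2 + (1 - N₀) ^ 2) := Real.le_sqrt_of_sq_le (by nlinarith [sq_nonneg (s N)])
    simp only
    linarith
  · have h2 : s N < √(s N ^ 2 + (1 - N₀) ^ 2) := Real.lt_sqrt_of_sq_lt (by nlinarith)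
    have h3 : N - N₀ ≤ s N := le_max_right _ _
    simp only
    linarith
  · rw [(hder N).deriv]
    have : 0 ≤ s N := le_max_left _ _
    positivity
  · rw [(hder N).deriv, div_le_one (Real.sqrt_pos.2 (hpos N))]
    exact Real.le_sqrt_of_sq_le (by nlinarith)

/-- The speed in `ℂ_β` of a curve rescaled by a variable dilation. -/
lemma hasDerivAt_dilate {β : ℝ} (hβ : 0 < β) {z : ℝ → ℂ} {z' : ℂ} {t : ℝ} (hz : HasDerivAt z z' t)
    (h0 : z t ≠ 0) :
    ∃ n' : ℝ, HasDerivAt (fun s => ‖z s‖ ^ (2 * β)) n' t ∧ ∀ (m : ℝ → ℝ) (m' : ℝ),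
      HasDerivAt m m' t → 0 < m t →
      ∃ v : ℂ, HasDerivAt (fun s => ((m s ^ (-(1 / (2 * β))) : ℝ) : ℂ) * z s) v t ∧
        β ^ 2 * ‖((m t ^ (-(1 / (2 * β))) : ℝ) : ℂ) * z t‖ ^ (2 * β - 2) * ‖v‖ ^ 2
          = (m t)⁻¹ * (β ^ 2 * ‖z t‖ ^ (2 * β - 2) * ‖z'‖ ^ 2 - m' / m t * n' / 2
            + (m' / m t) ^ 2 / 4 * ‖z t‖ ^ (2 * β)) := by
  have hp : 0 < ‖z t‖ := norm_pos_iff.2 h0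
  have e : ∀ s, (‖z s‖ ^ 2) ^ β = ‖z s‖ ^ (2 * β) := fun s => by
    rw [← rpow_natCast, ← rpow_mul (norm_nonneg _)]; norm_num
  have hn := (hz.norm_sq).rpow_const (p := β) (Or.inl (by positivity))
  simp_rw [e] at hn
  refine ⟨_, hn, fun m m' hm hm0 => ?_⟩
  have e1 : (‖z t‖ ^ 2) ^ (β - 1) = ‖z t‖ ^ (2 * β - 2) := by
    rw [← rpow_natCast, ← rpow_mul (norm_nonneg _)]; congr 1; push_cast; ring
  set p : ℝ := -(1 / (2 * β)) with hpdef
  have hd := (hm.rpow_const (p := p) (Or.inl hm0.ne')).ofReal_comp.mul hz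
  refine ⟨_, hd, ?_⟩
  have e2 : m t ^ (p - 1) = m t ^ p / m t := by rw [Real.rpow_sub_one hm0.ne']
  have hv : ((m' * p * m t ^ (p - 1) : ℝ) : ℂ) * z t + ((m t ^ p : ℝ) : ℂ) * z'
      = ((m t ^ p : ℝ) : ℂ) * (((p * (m' / m t) : ℝ) : ℂ) * z t + z') := by
    rw [e2]; push_cast; ring
  have hm1 : 0 < m t ^ p := by positivity
  have hsq : ‖((p * (m' / m t) : ℝ) : ℂ) * z t + z'‖ ^ 2
      = (p * (m' / m t)) ^ 2 * ‖z t‖ ^ 2 + 2 * (p * (m' / m t)) * inner ℝ (z t) z' + ‖z'‖ ^ 2 := by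
    rw [← Complex.real_smul, norm_add_sq_real, norm_smul, mul_pow, norm_eq_abs, sq_abs,
      real_inner_smul_left]
    ring
  have e3 : (m t ^ p) ^ (2 * β - 2) * (m t ^ p) ^ 2 = (m t)⁻¹ := by
    rw [← rpow_natCast, ← rpow_add hm1, ← rpow_mul hm0.le, ← rpow_neg_one]
    congr 1
    rw [hpdef]; push_cast; field_simp; ring
  have e4 : ‖z t‖ ^ (2 * β) = ‖z t‖ ^ (2 * β - 2) * ‖z t‖ ^ 2 := by
    rw [← rpow_natCast, ← rpow_add hp]; congr 1; push_cast; ring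
  have hpb : p * β = -(1 / 2) := by rw [hpdef]; field_simp
  rw [hv, norm_mul, norm_mul, norm_real, norm_of_nonneg hm1.le,
    mul_rpow hm1.le hp.le, mul_pow, hsq, e1, e4]
  linear_combination (β ^ 2 * ‖z t‖ ^ (2 * β - 2) * ((p * (m' / m t)) ^ 2 * ‖z t‖ ^ 2
    + 2 * (p * (m' / m t)) * inner ℝ (z t) z' + ‖z'‖ ^ 2)) * e3
    + (m t)⁻¹ * ‖z t‖ ^ (2 * β - 2) * ((m' / m t) ^ 2 * ‖z t‖ ^ 2 * (p * β - 1 / 2)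
      + 2 * β * (m' / m t) * inner ℝ (z t) z') * hpb

/-- A curve of the cone with end points in the unit ball may be replaced by one in the unit ball
which is not longer. The dilation applied to a point at distance `√N` from the apex is `Y(N)^(-1/2)`
with `Y` as in `exists_majorant`. -/
lemma exists_curve_in_ball {β₁ γ : ℝ} (hβ : 0 < β₁) (hγ : 0 < γ) {x y : ℂ × ℂ}
    (hx : x ∈ coneUnitBall β₁ γ) (hy : y ∈ coneUnitBall β₁ γ) {c : ℝ → ℂ × ℂ}
    (hc : IsAdmissible {x | x.1 = 0 ∨ x.2 = 0} univ x y c) :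
    ∃ c', IsAdmissible {x | x.1 = 0 ∨ x.2 = 0} (coneUnitBall β₁ γ) x y c' ∧
      curveLength (coneMetric β₁ γ) c' ≤ curveLength (coneMetric β₁ γ) c := by
  set N : ℂ × ℂ → ℝ := fun x => ‖x.1‖ ^ (2 * β₁) + ‖x.2‖ ^ (2 * γ) with hN
  have hNx : N x < 1 := hx
  have hNy : N y < 1 := hy
  have hN0 : ∀ x, 0 ≤ N x := fun x => by simp only [hN]; positivity
  have hNc : Continuous N :=
    (Continuous.rpow_const (by fun_prop) fun _ => Or.inr (by positivity)).add
      (Continuous.rpow_const (by fun_prop) fun _ => Or.inr (by positivity))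
  -- with this choice of `N₀` the end points are not moved
  obtain ⟨Y, hY, hY1, hYp⟩ := exists_majorant (max_lt hNx hNy)
  set m : ℝ → ℝ := fun t => Y (N (c t)) with hm
  have hm1 : ∀ t, 1 ≤ m t := fun t => (hYp _).1
  have hm0 : ∀ t, 0 < m t := fun t => one_pos.trans_le (hm1 t)
  set c' : ℝ → ℂ × ℂ := fun t => (((m t ^ (-(1 / (2 * β₁))) : ℝ) : ℂ) * (c t).1,
    ((m t ^ (-(1 / (2 * γ))) : ℝ) : ℂ) * (c t).2) with hc'
  have hfix : ∀ t, N (c t) ≤ max (N x) (N y) → c' t = c t := by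
    intro t ht
    have : m t = 1 := hY1 _ ht
    simp [hc', this]
  have hmc : ContinuousOn m (Icc 0 1) := hY.continuous.comp_continuousOn (hNc.comp_continuousOn hc.cont)
  obtain ⟨T, hT1, hT2⟩ := hc.regular
  have hreg : ∀ t ∈ Ioo (0 : ℝ) 1 \ (T : Set ℝ), ContDiffAt ℝ 1 c t := fun t ht =>
    hT1.contDiffAt ((isOpen_Ioo_diff_finset _ _ _).mem_nhds ht)
  have hne : ∀ t ∈ Ioo (0 : ℝ) 1 \ (T : Set ℝ), (c t).1 ≠ 0 ∧ (c t).2 ≠ 0 := fun t ht => by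
    have := hT2 t ht
    rwa [mem_ofPred_eq, not_or] at this
  have l1 : (1 : WithTop ℕ∞) ≤ ((⊤ : ℕ∞) : WithTop ℕ∞) := by exact_mod_cast le_top
  have hmd : ∀ t ∈ Ioo (0 : ℝ) 1 \ (T : Set ℝ), ContDiffAt ℝ 1 m t := by
    intro t ht
    have c1 := hreg t ht
    have p : ∀ (s : ℝ) (f : ℝ → ℂ), ContDiffAt ℝ 1 f t → f t ≠ 0 →
        ContDiffAt ℝ 1 (fun t => ‖f t‖ ^ s) t := fun s f hf h0 =>
      ContDiffAt.comp (g := fun z : ℂ => ‖z‖ ^ s) t ((contDiffAt_norm_rpow s h0).of_le l1) hf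
    exact ContDiffAt.comp (g := Y) t hY.contDiffAt
      ((p _ (fun t => (c t).1) c1.fst (hne t ht).1).add (p _ (fun t => (c t).2) c1.snd (hne t ht).2))
  have hscal : ∀ (t : ℝ) (β : ℝ) (z : ℂ), 0 < β →
      ‖((m t ^ (-(1 / (2 * β))) : ℝ) : ℂ) * z‖ ^ (2 * β) = (m t)⁻¹ * ‖z‖ ^ (2 * β) := by
    intro t β z hβ
    have := hm0 t
    rw [norm_mul, norm_real, norm_of_nonneg (by positivity),
      mul_rpow (by positivity) (norm_nonneg _), ← rpow_mul this.le, neg_mul,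
      one_div_mul_cancel (by positivity), rpow_neg_one]
  refine ⟨c', ⟨?_, ?_, ?_, ?_, T, ?_, ?_⟩, ?_⟩
  · have p : ∀ s : ℝ, ContinuousOn (fun t => ((m t ^ s : ℝ) : ℂ)) (Icc 0 1) := fun s =>
      continuous_ofReal.comp_continuousOn (hmc.rpow_const fun t _ => Or.inl (hm0 t).ne')
    exact ((p _).mul (continuous_fst.comp_continuousOn hc.cont)).prodMk
      ((p _).mul (continuous_snd.comp_continuousOn hc.cont))
  · intro t _
    change ‖_‖ ^ (2 * β₁) + ‖_‖ ^ (2 * γ) < 1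
    rw [hscal t β₁ _ hβ, hscal t γ _ hγ, ← mul_add, inv_mul_lt_iff₀ (hm0 t), mul_one]
    exact (hYp (N (c t))).2.1
  · rw [hfix 0 (by rw [hc.source]; exact le_max_left _ _), hc.source]
  · rw [hfix 1 (by rw [hc.target]; exact le_max_right _ _), hc.target]
  · intro t ht
    have p : ∀ s : ℝ, ContDiffAt ℝ 1 (fun t => ((m t ^ s : ℝ) : ℂ)) t := fun s =>
      ContDiffAt.comp (g := fun x : ℝ => (x : ℂ)) t ofRealCLM.contDiff.contDiffAt
        ((hmd t ht).rpow_const_of_ne (hm0 t).ne')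
    exact (((p _).mul (hreg t ht).fst).prodMk ((p _).mul (hreg t ht).snd)).contDiffWithinAt
  · intro t ht
    rw [mem_ofPred_eq, not_or]
    have := hm0 t
    refine ⟨mul_ne_zero ?_ (hne t ht).1, mul_ne_zero ?_ (hne t ht).2⟩ <;>
    · rw [ofReal_ne_zero]; positivity
  · have := arcLength_le_mul (g := coneMetric β₁ γ) (g' := coneMetric β₁ γ) (c := c') (c' := c)
      (a := 0) (b := 1) zero_le_one T fun t ht => ?_
    · rw [ENNReal.ofReal_one, one_mul] at this; exact this
    have hct : HasDerivAt c (deriv c t) t := ((hreg t ht).differentiableAt one_ne_zero).hasDerivAt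
    have h1 : HasDerivAt (fun t => (c t).1) (deriv c t).1 t := hct.fst
    have h2 : HasDerivAt (fun t => (c t).2) (deriv c t).2 t := hct.snd
    obtain ⟨n₁, hn₁, H₁⟩ := hasDerivAt_dilate hβ h1 (hne t ht).1
    obtain ⟨n₂, hn₂, H₂⟩ := hasDerivAt_dilate hγ h2 (hne t ht).2
    have hmder : HasDerivAt m (deriv Y (N (c t)) * (n₁ + n₂)) t :=
      ((hY.differentiable one_ne_zero _).hasDerivAt).comp t (hn₁.add hn₂)
    obtain ⟨v₁, hv₁, e₁⟩ := H₁ m _ hmder (hm0 t)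
    obtain ⟨v₂, hv₂, e₂⟩ := H₂ m _ hmder (hm0 t)
    have hder : HasDerivAt c' (v₁, v₂) t := hv₁.prodMk hv₂
    rw [hder.deriv, normSq_coneMetric, normSq_coneMetric, one_pow, one_mul]
    change β₁ ^ 2 * ‖((m t ^ (-(1 / (2 * β₁))) : ℝ) : ℂ) * (c t).1‖ ^ (2 * β₁ - 2) * ‖v₁‖ ^ 2
      + γ ^ 2 * ‖((m t ^ (-(1 / (2 * γ))) : ℝ) : ℂ) * (c t).2‖ ^ (2 * γ - 2) * ‖v₂‖ ^ 2 ≤ _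
    rw [e₁, e₂]
    obtain ⟨q1, q2, q3, q4⟩ := hYp (N (c t))
    have hYm : Y (N (c t)) = m t := rfl
    rw [hYm] at q1 q2
    set A₁ := β₁ ^ 2 * ‖(c t).1‖ ^ (2 * β₁ - 2) * ‖(deriv c t).1‖ ^ 2
    set A₂ := γ ^ 2 * ‖(c t).2‖ ^ (2 * γ - 2) * ‖(deriv c t).2‖ ^ 2
    have hA : 0 ≤ A₁ + A₂ := by positivity
    -- the speed decreases as long as `d N ≤ 2`, where `d = Y'(N) / Y(N)`
    set d := deriv Y (N (c t)) / m t with hd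
    have hd0 : 0 ≤ d := div_nonneg q3 (hm0 t).le
    have hdN : d * N (c t) ≤ 1 := by
      have : d ≤ 1 / m t := by rw [hd]; gcongr
      calc d * N (c t) ≤ 1 / m t * m t := by
            have := hN0 (c t)
            have := hm0 t
            gcongr
        _ = 1 := one_div_mul_cancel (hm0 t).ne'
    have hquot : deriv Y (N (c t)) * (n₁ + n₂) / m t = d * (n₁ + n₂) := by rw [hd]; ring
    rw [hquot]
    have hkey : A₁ + A₂ - d * (n₁ + n₂) * (n₁ + n₂) / 2 + (d * (n₁ + n₂)) ^ 2 / 4 * N (c t)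
        ≤ A₁ + A₂ := by
      have : (d * (n₁ + n₂)) ^ 2 / 4 * N (c t) ≤ d * (n₁ + n₂) ^ 2 / 4 := by
        have := mul_le_mul_of_nonneg_left hdN (by positivity : 0 ≤ d * (n₁ + n₂) ^ 2 / 4)
        linarith
      nlinarith [mul_nonneg hd0 (sq_nonneg (n₁ + n₂))]
    have hinv : (m t)⁻¹ ≤ 1 := inv_le_one_of_one_le₀ q1
    have hinv0 : 0 ≤ (m t)⁻¹ := inv_nonneg.2 (hm0 t).le
    calc _ = (m t)⁻¹ * (A₁ + A₂ - d * (n₁ + n₂) * (n₁ + n₂) / 2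
            + (d * (n₁ + n₂)) ^ 2 / 4 * N (c t)) := by simp only [hN]; ring
      _ ≤ (m t)⁻¹ * (A₁ + A₂) := by gcongr
      _ ≤ A₁ + A₂ := mul_le_of_le_one_left hA hinv

/-! ### Metrics close to the cone metric away from the singular line -/

/-- The union of the lines `{z = 0}`, `{w = b₂ z}` and `{w = b₃ z}`. -/
def threeLines (b₂ b₃ : ℂ) : Set (ℂ × ℂ) := verticalLine ∪ lineOfSlope b₂ ∪ lineOfSlope b₃

lemma notMem_threeLines {b₂ b₃ : ℂ} {x : ℂ × ℂ} :
    x ∉ threeLines b₂ b₃ ↔ x.1 ≠ 0 ∧ x.2 ≠ b₂ * x.1 ∧ x.2 ≠ b₃ * x.1 := by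
  simp only [threeLines, mem_union, not_or, and_assoc]
  rfl

/-- A metric `g` on the unit ball, singular along three lines, which in the sector `κ|z| ≤ |w|` is
`ε`-close to the cone metric, and which is controlled in the remaining sector by one-sided bounds
on its diagonal coefficients. -/
structure IsNearCone (β₁ β₂ β₃ γ ε κ C : ℝ) (b₂ b₃ : ℂ) (g : HermField) : Prop where
  ne₂ : b₂ ≠ 0
  ne₃ : b₃ ≠ 0
  lt₂ : ‖b₂‖ < κ
  lt₃ : ‖b₃‖ < κ
  const_nonneg : 0 ≤ C
  close : ∀ x ∈ coneUnitBall β₁ γ, ∀ v, x.1 ≠ 0 → κ * ‖x.1‖ ≤ ‖x.2‖ →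
    |normSq g x v - normSq (coneMetric β₁ γ) x v| ≤ ε * normSq (coneMetric β₁ γ) x v
  fst_lower : ∀ x ∈ coneUnitBall β₁ γ, ∀ v : ℂ × ℂ, x ∉ threeLines b₂ b₃ →
    (1 - ε) * (β₁ ^ 2 * ‖x.1‖ ^ (2 * β₁ - 2) * ‖v.1‖ ^ 2) ≤ normSq g x v
  snd_upper : ∀ x ∈ coneUnitBall β₁ γ, ∀ v : ℂ, x ∉ threeLines b₂ b₃ → normSq g x (0, v)
    ≤ C * (‖x.2 - b₂ * x.1‖ ^ (2 * β₂ - 2) * ‖x.2 - b₃ * x.1‖ ^ (2 * β₃ - 2)) * ‖v‖ ^ 2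
  fst_upper : ∀ z v : ℂ, z ≠ 0 → (z, 0) ∈ coneUnitBall β₁ γ →
    normSq g (z, 0) (v, 0) ≤ C * ‖z‖ ^ (2 * β₁ - 2) * ‖v‖ ^ 2

/-- A bound for the distance of the end points of a curve `c` by its length, when the parts of the
curve between the first and the last time with `f ≤ η` are replaced by their image under `π`. -/
lemma lengthDist_le_of_proj {g G : HermField} {S U : Set (ℂ × ℂ)} {c : ℝ → ℂ × ℂ}
    {π : ℂ × ℂ → ℂ × ℂ} {f : ℝ → ℝ} {η : ℝ} {K E : ℝ≥0∞} (hf : ContinuousOn f (Icc 0 1))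
    (hout : ∀ a b, 0 ≤ a → a < b → b ≤ 1 → (∀ t ∈ Ioo a b, η < f t) →
      lengthDist G S U (c a) (c b) ≤ K * arcLength g c a b)
    (hproj : ∀ a b, 0 ≤ a → a < b → b ≤ 1 →
      lengthDist G S U (π (c a)) (π (c b)) ≤ K * arcLength g c a b)
    (hnear : ∀ t ∈ Icc (0 : ℝ) 1, f t ≤ η → lengthDist G S U (c t) (π (c t)) ≤ E) :
    lengthDist G S U (c 0) (c 1) ≤ K * arcLength g c 0 1 + (E + E) := by
  by_cases hne : ({t ∈ Icc (0 : ℝ) 1 | f t ≤ η}).Nonempty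
  swap
  · have : ∀ t ∈ Ioo (0 : ℝ) 1, η < f t := fun t ht => by
      by_contra h
      exact hne ⟨t, Ioo_subset_Icc_self ht, not_lt.1 h⟩
    exact (hout 0 1 le_rfl one_pos le_rfl this).trans le_self_add
  have hcl : IsClosed {t ∈ Icc (0 : ℝ) 1 | f t ≤ η} := by
    have := hf.preimage_isClosed_of_isClosed isClosed_Icc (isClosed_Iic (a := η))
    exact this
  have hcomp : IsCompact {t ∈ Icc (0 : ℝ) 1 | f t ≤ η} :=
    isCompact_Icc.of_isClosed_subset hcl fun t ht => ht.1
  -- the first and the last time with `f ≤ η`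
  obtain ⟨t₁, ht₁, hl⟩ := hcomp.exists_isLeast hne
  obtain ⟨t₂, ht₂, hu⟩ := hcomp.exists_isGreatest hne
  have h12 : t₁ ≤ t₂ := hl ht₂
  have d1 : lengthDist G S U (c 0) (π (c t₁)) ≤ K * arcLength g c 0 t₁ + E := by
    rcases ht₁.1.1.eq_or_lt with h | h
    · rw [← h]
      exact (hnear 0 (by simp) (h ▸ ht₁.2)).trans le_add_self
    · refine (lengthDist_triangle _ _ _ _ (c t₁) _).trans (add_le_add
        (hout 0 t₁ le_rfl h ht₁.1.2 fun t ht => ?_) (hnear t₁ ht₁.1 ht₁.2))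
      by_contra h'
      exact absurd (hl ⟨⟨ht.1.le, ht.2.le.trans ht₁.1.2⟩, not_lt.1 h'⟩) (not_le.2 ht.2)
  have d3 : lengthDist G S U (π (c t₂)) (c 1) ≤ E + K * arcLength g c t₂ 1 := by
    have hn := hnear t₂ ht₂.1 ht₂.2
    rw [lengthDist_comm] at hn
    rcases ht₂.1.2.eq_or_lt with h | h
    · rw [h] at hn ⊢
      exact hn.trans le_self_add
    · refine (lengthDist_triangle _ _ _ _ (c t₂) _).trans (add_le_add hn
        (hout t₂ 1 ht₂.1.1 h le_rfl fun t ht => ?_))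
      by_contra h'
      exact absurd (hu ⟨⟨ht₂.1.1.trans ht.1.le, ht.2.le⟩, not_lt.1 h'⟩) (not_le.2 ht.1)
  rcases h12.eq_or_lt with h | h
  · subst h
    calc _ ≤ _ := lengthDist_triangle _ _ _ _ (π (c t₁)) _
      _ ≤ (K * arcLength g c 0 t₁ + E) + (E + K * arcLength g c t₁ 1) := add_le_add d1 d3
      _ = K * (arcLength g c 0 t₁ + arcLength g c t₁ 1) + (E + E) := by ring
      _ ≤ _ := by
        gcongr
        exact arcLength_add_le g c ht₁.1.1 ht₁.1.2
  · calc _ ≤ _ := lengthDist_triangle _ _ _ _ (π (c t₁)) _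
      _ ≤ _ := add_le_add_right (lengthDist_triangle _ _ _ _ (π (c t₂)) _) _
      _ ≤ (K * arcLength g c 0 t₁ + E) + (K * arcLength g c t₁ t₂ + (E + K * arcLength g c t₂ 1)) :=
        add_le_add d1 (add_le_add (hproj t₁ t₂ ht₁.1.1 h ht₂.1.2) d3)
      _ = K * (arcLength g c 0 t₁ + arcLength g c t₁ t₂ + arcLength g c t₂ 1) + (E + E) := by ring
      _ ≤ _ := by
        gcongr
        exact (add_le_add_left (arcLength_add_le g c ht₁.1.1 h12) _).trans
          (arcLength_add_le g c ht₂.1.1 ht₂.1.2)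

/-- A bound for the integral which is uniform in the position `s` of the singularity. -/
lemma exists_lintegral_abs_rpow_le {γ : ℝ} (h0 : 0 < γ) (h1 : γ < 1) :
    ∃ C : ℝ, 0 ≤ C ∧ ∀ s : ℝ, ∫⁻ t in Ioo (0 : ℝ) 1, ENNReal.ofReal (|t - s| ^ (γ - 1))
      ≤ ENNReal.ofReal C := by
  set f : ℝ → ℝ≥0∞ := (Ioo (-1 : ℝ) 1).indicator fun t => ENNReal.ofReal (|t| ^ (γ - 1)) with hf
  have hint : IntervalIntegrable (fun t : ℝ => |t| ^ (γ - 1)) volume (-1) 1 := by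
    refine intervalIntegrable_of_even (fun x => by rw [abs_neg]) (fun x hx => ?_)
    refine (intervalIntegral.intervalIntegrable_rpow' (by linarith : -1 < γ - 1)).congr ?_
    intro t ht
    rw [uIoc_of_le hx.le] at ht
    simp only [abs_of_pos ht.1]
  have hfin : ∫⁻ t, f t ≠ ⊤ := by
    rw [hf, lintegral_indicator measurableSet_Ioo]
    have h2 := ((intervalIntegrable_iff_integrableOn_Ioo_of_le (by norm_num)).1 hint).2
    rw [hasFiniteIntegral_iff_ofReal (Eventually.of_forall fun t => by positivity)] at h2
    exact h2.ne
  refine ⟨1 + (∫⁻ t, f t).toReal, by positivity, fun s => ?_⟩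
  have hle : ∀ t, ENNReal.ofReal (|t| ^ (γ - 1)) ≤ 1 + f t := by
    intro t
    by_cases ht : t ∈ Ioo (-1 : ℝ) 1
    · rw [hf, indicator_of_mem ht]; exact le_add_self
    · rw [hf, indicator_of_notMem ht, add_zero, ← ENNReal.ofReal_one]
      refine ENNReal.ofReal_le_ofReal (Real.rpow_le_one_of_one_le_of_nonpos ?_ (by linarith))
      rw [mem_Ioo, ← abs_lt] at ht
      exact not_lt.1 ht
  calc _ ≤ ∫⁻ t in Ioo (0 : ℝ) 1, (1 + f (t - s)) := lintegral_mono fun t => hle _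
    _ = 1 + ∫⁻ t in Ioo (0 : ℝ) 1, f (t - s) := by
      rw [lintegral_add_left measurable_const]; simp
    _ ≤ 1 + ∫⁻ t, f (t - s) := add_le_add le_rfl (setLIntegral_le_lintegral _ _)
    _ = 1 + ∫⁻ t, f t := by rw [lintegral_sub_right_eq_self]
    _ = ENNReal.ofReal (1 + (∫⁻ t, f t).toReal) := by
      rw [ENNReal.ofReal_add zero_le_one (by positivity), ENNReal.ofReal_one, ENNReal.ofReal_toReal hfin]

lemma rpow_mul_rpow_le_add {X Y p q : ℝ} (hX : 0 < X) (hY : 0 < Y) (hp : p ≤ 0) (hq : q ≤ 0) :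
    X ^ p * Y ^ q ≤ X ^ (p + q) + Y ^ (p + q) := by
  rcases le_total X Y with h | h
  · have := rpow_le_rpow_of_nonpos hX h hq
    calc X ^ p * Y ^ q ≤ X ^ p * X ^ q := by gcongr
      _ = X ^ (p + q) := (rpow_add hX _ _).symm
      _ ≤ _ := le_add_of_nonneg_right (by positivity)
  · have := rpow_le_rpow_of_nonpos hY h hp
    calc X ^ p * Y ^ q ≤ Y ^ p * Y ^ q := by gcongr
      _ = Y ^ (p + q) := (rpow_add hY _ _).symm
      _ ≤ _ := le_add_of_nonneg_left (by positivity)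

lemma norm_mul_rpow_le {γ : ℝ} (h0 : 0 < γ) (h1 : γ < 1) {t : ℝ} {w d : ℂ} (ht : t ≠ (d / w).re) :
    ‖w‖ * ‖t * w - d‖ ^ (γ - 1) ≤ ‖w‖ ^ γ * |t - (d / w).re| ^ (γ - 1) := by
  rcases eq_or_ne w 0 with rfl | hw
  · simp [zero_rpow h0.ne']
  have hw0 : 0 < ‖w‖ := norm_pos_iff.2 hw
  have e : (t : ℂ) * w - d = w * (t - d / w) := by field_simp
  have hpos : 0 < |t - (d / w).re| := abs_pos.2 (sub_ne_zero.2 ht)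
  have hle : |t - (d / w).re| ≤ ‖(t : ℂ) - d / w‖ := by
    have := Complex.abs_re_le_norm ((t : ℂ) - d / w)
    simpa using this
  rw [e, norm_mul, mul_rpow hw0.le (norm_nonneg _)]
  have h2 := rpow_le_rpow_of_nonpos hpos hle (by linarith : γ - 1 ≤ 0)
  calc ‖w‖ * (‖w‖ ^ (γ - 1) * ‖(t : ℂ) - d / w‖ ^ (γ - 1))
      = ‖w‖ ^ γ * ‖(t : ℂ) - d / w‖ ^ (γ - 1) := by
        rw [← mul_assoc, ← Real.rpow_one_add' hw0.le (by linarith)]; congr 2; ring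
    _ ≤ _ := by gcongr

section

variable {β₁ β₂ β₃ γ ε κ C : ℝ} {b₂ b₃ : ℂ} {g : HermField}

/-! ### Comparison of distances -/

lemma IsNearCone.notMem_of_le (h : IsNearCone β₁ β₂ β₃ γ ε κ C b₂ b₃ g) {x : ℂ × ℂ} (h1 : x.1 ≠ 0)
    (h2 : κ * ‖x.1‖ ≤ ‖x.2‖) : x ∉ threeLines b₂ b₃ := by
  have h0 : 0 < ‖x.1‖ := norm_pos_iff.2 h1
  have key : ∀ b : ℂ, ‖b‖ < κ → x.2 ≠ b * x.1 := fun b hb e => by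
    rw [e, norm_mul] at h2
    exact absurd (le_of_mul_le_mul_right h2 h0) (not_le.2 hb)
  exact notMem_threeLines.2 ⟨h1, key b₂ h.lt₂, key b₃ h.lt₃⟩

lemma normSq_coneMetric_nonneg (β₁ γ : ℝ) (x v : ℂ × ℂ) : 0 ≤ normSq (coneMetric β₁ γ) x v := by
  rw [normSq_coneMetric]; positivity

lemma IsNearCone.normSq_le (h : IsNearCone β₁ β₂ β₃ γ ε κ C b₂ b₃ g) (hε : 0 ≤ ε) {x : ℂ × ℂ}
    (hx : x ∈ coneUnitBall β₁ γ) (h1 : x.1 ≠ 0) (h2 : κ * ‖x.1‖ ≤ ‖x.2‖) (v : ℂ × ℂ) :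
    normSq g x v ≤ (1 + ε) ^ 2 * normSq (coneMetric β₁ γ) x v := by
  have e := (abs_le.1 (h.close x hx v h1 h2)).2
  have := normSq_coneMetric_nonneg β₁ γ x v
  nlinarith [mul_nonneg hε this, mul_nonneg (mul_nonneg hε hε) this]

lemma IsNearCone.le_normSq (h : IsNearCone β₁ β₂ β₃ γ ε κ C b₂ b₃ g) (hε : 0 ≤ ε) (hε1 : ε < 1)
    {x : ℂ × ℂ} (hx : x ∈ coneUnitBall β₁ γ) (h1 : x.1 ≠ 0) (h2 : κ * ‖x.1‖ ≤ ‖x.2‖) (v : ℂ × ℂ) :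
    normSq (coneMetric β₁ γ) x v ≤ (1 / (1 - ε)) ^ 2 * normSq g x v := by
  have e := (abs_le.1 (h.close x hx v h1 h2)).1
  have := normSq_coneMetric_nonneg β₁ γ x v
  have h3 : 0 < 1 - ε := by linarith
  rw [div_pow, one_pow, div_mul_eq_mul_div, le_div_iff₀ (by positivity)]
  nlinarith [mul_nonneg hε this, mul_nonneg (mul_nonneg hε this) h3.le]

lemma norm_fst_le_one {x : ℂ × ℂ} (hβ : 0 < β₁) (hx : x ∈ coneUnitBall β₁ γ) : ‖x.1‖ ≤ 1 := by
  have h1 := (rpow_le_one_of_mem hx).1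
  by_contra h
  exact absurd h1 (not_le.2 (Real.one_lt_rpow (not_le.1 h) hβ))

/-- Outside the neighbourhood `{R ≤ η}` of the line `{w = 0}` the metric is close to the cone. -/
lemma sector_of_le (h : κ ≤ η ^ (1 / γ)) (hβ : 0 < β₁) (hγ : 0 < γ) (hη : 0 < η) (hκ : 0 ≤ κ)
    {x : ℂ × ℂ} (hx : x ∈ coneUnitBall β₁ γ) (hR : η ≤ ‖x.2‖ ^ γ) : κ * ‖x.1‖ ≤ ‖x.2‖ := by
  have h1 : η ^ (1 / γ) ≤ ‖x.2‖ := by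
    calc η ^ (1 / γ) ≤ (‖x.2‖ ^ γ) ^ (1 / γ) := by gcongr
      _ = ‖x.2‖ := by
        rw [← rpow_mul (norm_nonneg _), mul_one_div_cancel hγ.ne', rpow_one]
  calc κ * ‖x.1‖ ≤ κ * 1 := by gcongr; exact norm_fst_le_one hβ hx
    _ ≤ ‖x.2‖ := by rw [mul_one]; exact h.trans h1

lemma IsNearCone.nonneg (h : IsNearCone β₁ β₂ β₃ γ ε κ C b₂ b₃ g) : 0 ≤ κ :=
  (norm_nonneg b₂).trans h.lt₂.le

lemma norm_reference {η : ℝ} (hγ : 0 < γ) (hη : 0 < η) : ‖((η ^ (1 / γ) : ℝ) : ℂ)‖ ^ γ = η := by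
  have := norm_polar_rpow hγ (norm_one (α := ℂ)) hη.le
  rwa [mul_one] at this

lemma continuousOn_snd_rpow {S U : Set (ℂ × ℂ)} {c : ℝ → ℂ × ℂ} (hγ : 0 < γ) (hc : IsArc S U 0 1 c) :
    ContinuousOn (fun t => ‖(c t).2‖ ^ γ) (Icc 0 1) :=
  ((continuous_snd.comp_continuousOn hc.cont).norm).rpow_const fun _ _ => Or.inr hγ.le

lemma IsArc.prod_const {S U S' U' : Set (ℂ × ℂ)} {a b : ℝ} {c : ℝ → ℂ × ℂ} (hc : IsArc S U a b c)
    (s w : ℂ) (hU : ∀ t ∈ Icc a b, (s * (c t).1, w) ∈ U')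
    (hS : ∀ t, c t ∉ S → (s * (c t).1, w) ∉ S') : IsArc S' U' a b (fun t => (s * (c t).1, w)) := by
  obtain ⟨T, h1, h2⟩ := hc.regular
  exact ⟨(continuousOn_const.mul (continuous_fst.comp_continuousOn hc.cont)).prodMk continuousOn_const,
    hU, T, (contDiffOn_const.mul h1.fst).prodMk contDiffOn_const, fun t ht => hS t (h2 t ht)⟩

lemma hasDerivAt_prod_const {c : ℝ → ℂ × ℂ} {c' : ℂ × ℂ} {t : ℝ} (hc : HasDerivAt c c' t) (s w : ℂ) :
    HasDerivAt (fun t => (s * (c t).1, w)) (s * c'.1, 0) t := by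
  have h1 : HasDerivAt (fun t => (c t).1) c'.1 t := hc.fst
  exact (h1.const_mul s).prodMk (hasDerivAt_const t w)

lemma IsArc.differentiableAt {S U : Set (ℂ × ℂ)} {a b : ℝ} {c : ℝ → ℂ × ℂ} (hc : IsArc S U a b c) :
    ∃ T : Finset ℝ, ∀ t ∈ Ioo a b \ (T : Set ℝ), HasDerivAt c (deriv c t) t ∧ c t ∉ S := by
  obtain ⟨T, h1, h2⟩ := hc.regular
  exact ⟨T, fun t ht => ⟨((h1.contDiffAt ((isOpen_Ioo_diff_finset _ _ _).mem_nhds ht)).differentiableAt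
    one_ne_zero).hasDerivAt, h2 t ht⟩⟩

/-- The distance of the cone is bounded by the length of curves for the perturbed metric: near
`{w = 0}` these are projected to `{w = η^(1/γ)}`, which does not make them much longer. -/
theorem IsNearCone.coneDist_le (h : IsNearCone β₁ β₂ β₃ γ ε κ C b₂ b₃ g) (hβ : 0 < β₁) (hγ : 0 < γ)
    (hε : 0 ≤ ε) (hε1 : ε < 1) {η : ℝ} (hη : 0 < η) (hκ : κ ≤ η ^ (1 / γ)) {x y : ℂ × ℂ}
    {c : ℝ → ℂ × ℂ} (hc : IsAdmissible (threeLines b₂ b₃) (coneUnitBall β₁ γ) x y c) :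
    coneDist β₁ γ x y ≤ ENNReal.ofReal (1 / (1 - ε)) * curveLength g c
      + (ENNReal.ofReal (5 * η) + ENNReal.ofReal (5 * η)) := by
  have h3 : 0 < 1 - ε := by linarith
  have hw0 : ((η ^ (1 / γ) : ℝ) : ℂ) ≠ 0 := by
    rw [ofReal_ne_zero]; positivity
  rw [← hc.source, ← hc.target]
  refine lengthDist_le_of_proj (g := g) (π := fun x => (1 * x.1, ((η ^ (1 / γ) : ℝ) : ℂ)))
    (continuousOn_snd_rpow hγ hc.isArc) (η := η) ?_ ?_ ?_
  · intro a b ha hab hb hR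
    have harc := hc.isArc.mono ha hb
    obtain ⟨T, hT1, hT2⟩ := harc.regular
    have hR2 : ∀ t ∈ Ioo a b, (c t).2 ≠ 0 := fun t ht h0 => by
      have := hR t ht
      rw [h0, norm_zero, zero_rpow hγ.ne'] at this
      linarith
    refine (lengthDist_le (g := coneMetric β₁ γ) ⟨harc.cont, fun _ _ => mem_univ _, T, hT1,
      fun t ht => ?_⟩ hab).trans (arcLength_le_mul (by positivity) T fun t ht => ?_)
    · rw [mem_ofPred_eq, not_or]
      exact ⟨(notMem_threeLines.1 (hT2 t ht)).1, hR2 t ht.1⟩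
    · have hB := harc.mapsTo (Ioo_subset_Icc_self ht.1)
      exact h.le_normSq hε hε1 hB (notMem_threeLines.1 (hT2 t ht)).1
        (sector_of_le hκ hβ hγ hη h.nonneg hB (hR t ht.1).le) _
  · intro a b ha hab hb
    have harc := hc.isArc.mono ha hb
    obtain ⟨T, hT⟩ := harc.differentiableAt
    refine (lengthDist_le (g := coneMetric β₁ γ) (harc.prod_const 1 _ (fun _ _ => mem_univ _)
      fun t ht => ?_) hab).trans (arcLength_le_mul (by positivity) T fun t ht => ?_)
    · rw [mem_ofPred_eq, not_or, one_mul]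
      exact ⟨(notMem_threeLines.1 ht).1, hw0⟩
    · have hB := harc.mapsTo (Ioo_subset_Icc_self ht.1)
      have e := h.fst_lower _ hB (deriv c t) (hT t ht).2
      rw [(hasDerivAt_prod_const (hT t ht).1 1 _).deriv, normSq_coneMetric]
      simp only [one_mul, norm_zero]
      rw [div_pow, one_pow, div_mul_eq_mul_div, one_mul, le_div_iff₀ (by positivity)]
      have : 0 ≤ β₁ ^ 2 * ‖(c t).1‖ ^ (2 * β₁ - 2) * ‖(deriv c t).1‖ ^ 2 := by positivity
      nlinarith [mul_nonneg hε (mul_nonneg h3.le this)]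
  · intro t ht hR
    rw [one_mul]
    exact coneDist_fibre_le hβ hγ hη hR (norm_reference hγ hη)

end

section

variable {β₁ β₂ β₃ γ ε κ C : ℝ} {b₂ b₃ : ℂ} {g : HermField}

lemma mem_coneUnitBall_of_le (hβ : 0 < β₁) (hγ : 0 < γ) {x y : ℂ × ℂ} (hx : x ∈ coneUnitBall β₁ γ)
    (h1 : ‖y.1‖ ≤ ‖x.1‖) (h2 : ‖y.2‖ ≤ ‖x.2‖) : y ∈ coneUnitBall β₁ γ := by
  have a1 := rpow_le_rpow (norm_nonneg _) h1 (by positivity : 0 ≤ 2 * β₁)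
  have a2 := rpow_le_rpow (norm_nonneg _) h2 (by positivity : 0 ≤ 2 * γ)
  have : ‖x.1‖ ^ (2 * β₁) + ‖x.2‖ ^ (2 * γ) < 1 := hx
  exact lt_of_le_of_lt (add_le_add a1 a2) this

lemma conePoint_mem_coneUnitBall (hβ : 0 < β₁) (hγ : 0 < γ) {u₁ u₂ : ℂ} (h1 : ‖u₁‖ = 1)
    (h2 : ‖u₂‖ = 1) {r R : ℝ} (hr : 0 ≤ r) (hR : 0 ≤ R) (h : r ^ 2 + R ^ 2 < 1) :
    conePoint β₁ γ u₁ u₂ r R ∈ coneUnitBall β₁ γ := by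
  change ‖_‖ ^ (2 * β₁) + ‖_‖ ^ (2 * γ) < 1
  rwa [conePoint, norm_polar_rpow_two hβ h1 hr, norm_polar_rpow_two hγ h2 hR]

/-- Moving along a fibre of the projection to `{w = 0}` through the two other singular lines. -/
lemma IsNearCone.exists_fibre_le (hβ : 0 < β₁) (hγ : 0 < γ) (hγ1 : γ < 1) (hβ₂ : β₂ < 1)
    (hβ₃ : β₃ < 1) (hang : 1 - γ = (1 - β₂) + (1 - β₃)) (hC : 0 ≤ C) :
    ∃ M : ℝ, 0 ≤ M ∧ ∀ (ε κ : ℝ) (b₂ b₃ : ℂ) (g : HermField),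
      IsNearCone β₁ β₂ β₃ γ ε κ C b₂ b₃ g → ∀ z w : ℂ, z ≠ 0 → (z, w) ∈ coneUnitBall β₁ γ →
        lengthDist g (threeLines b₂ b₃) (coneUnitBall β₁ γ) (z, 0) (z, w)
          ≤ ENNReal.ofReal (M * ‖w‖ ^ γ) := by
  obtain ⟨D, hD, hint⟩ := exists_lintegral_abs_rpow_le hγ hγ1
  refine ⟨√C * (D + D), by positivity, fun ε κ b₂ b₃ g h z w hz hzw => ?_⟩
  -- the segment from `(z, 0)` to `(z, w)` meets the lines at most at the times `s b₂` and `s b₃`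
  set s : ℂ → ℝ := fun b => (b * z / w).re with hs
  set c : ℝ → ℂ × ℂ := fun t => (z, t * w) with hc
  have hder : ∀ t, HasDerivAt c (0, w) t := fun t => by
    have : HasDerivAt (fun t : ℝ => (t : ℂ) * w) w t := by
      simpa using (hasDerivAt_id t).ofReal_comp.mul_const w
    exact (hasDerivAt_const t z).prodMk this
  have hne : ∀ b : ℂ, b ≠ 0 → ∀ t : ℝ, t ≠ s b → t * w ≠ b * z := by
    intro b hb t ht e
    rcases eq_or_ne w 0 with rfl | hw
    · rw [mul_zero] at e
      exact mul_ne_zero hb hz e.symm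
    · apply ht
      have : (t : ℂ) = b * z / w := by rw [← e]; field_simp
      rw [hs]
      simp only
      rw [← this, Complex.ofReal_re]
  have hmem : ∀ t ∈ Icc (0 : ℝ) 1, c t ∈ coneUnitBall β₁ γ := fun t ht => by
    refine mem_coneUnitBall_of_le hβ hγ hzw le_rfl ?_
    change ‖(t : ℂ) * w‖ ≤ ‖w‖
    rw [norm_mul, norm_real, norm_of_nonneg ht.1]
    exact mul_le_of_le_one_left (norm_nonneg _) ht.2
  have hout : ∀ t ∈ Ioo (0 : ℝ) 1 \ (({s b₂, s b₃} : Finset ℝ) : Set ℝ), t ≠ s b₂ ∧ t ≠ s b₃ :=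
    fun t ht => by
      have := ht.2
      simpa only [Finset.coe_insert, Finset.coe_singleton, mem_insert_iff, mem_singleton_iff,
        not_or] using this
  have hS : ∀ t, t ≠ s b₂ ∧ t ≠ s b₃ → c t ∉ threeLines b₂ b₃ := fun t ht =>
    notMem_threeLines.2 ⟨hz, hne b₂ h.ne₂ t ht.1, hne b₃ h.ne₃ t ht.2⟩
  have arc : IsArc (threeLines b₂ b₃) (coneUnitBall β₁ γ) 0 1 c := by
    refine ⟨fun t _ => (hder t).continuousAt.continuousWithinAt, hmem, {s b₂, s b₃}, ?_,
      fun t ht => hS t (hout t ht)⟩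
    refine ContDiff.contDiffOn ?_
    exact contDiff_const.prodMk (ofRealCLM.contDiff.mul contDiff_const)
  have hc0 : c 0 = (z, 0) := by simp [hc]
  have hc1 : c 1 = (z, w) := by simp [hc]
  rw [← hc0, ← hc1]
  refine (lengthDist_le arc one_pos).trans ?_
  have hsp : ∀ t ∈ Ioo (0 : ℝ) 1, t ≠ s b₂ ∧ t ≠ s b₃ →
      ENNReal.ofReal (√(normSq g (c t) (deriv c t)))
        ≤ ENNReal.ofReal (√C * ‖w‖ ^ γ) * (ENNReal.ofReal (|t - s b₂| ^ (γ - 1))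
          + ENNReal.ofReal (|t - s b₃| ^ (γ - 1))) := by
    intro t ht hts
    rw [← ENNReal.ofReal_add (by positivity) (by positivity), ← ENNReal.ofReal_mul (by positivity)]
    refine ENNReal.ofReal_le_ofReal (Real.sqrt_le_iff.2 ⟨by positivity, ?_⟩)
    rw [(hder t).deriv]
    refine (h.snd_upper _ (hmem t (Ioo_subset_Icc_self ht)) w (hS t hts)).trans ?_
    have X2 : 0 < ‖(t : ℂ) * w - b₂ * z‖ := norm_pos_iff.2 (sub_ne_zero.2 (hne b₂ h.ne₂ t hts.1))
    have X3 : 0 < ‖(t : ℂ) * w - b₃ * z‖ := norm_pos_iff.2 (sub_ne_zero.2 (hne b₃ h.ne₃ t hts.2))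
    have e2 : ∀ (X p : ℝ), 0 < X → X ^ (2 * p - 2) = (X ^ (p - 1)) ^ 2 := fun X p hX => by
      rw [← rpow_natCast (X ^ (p - 1)), ← rpow_mul hX.le]; congr 1; push_cast; ring
    have hle := rpow_mul_rpow_le_add X2 X3 (by linarith : β₂ - 1 ≤ 0) (by linarith : β₃ - 1 ≤ 0)
    rw [show β₂ - 1 + (β₃ - 1) = γ - 1 by linarith] at hle
    have n2 := norm_mul_rpow_le hγ hγ1 (w := w) (d := b₂ * z) hts.1
    have n3 := norm_mul_rpow_le hγ hγ1 (w := w) (d := b₃ * z) hts.2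
    change C * (‖(t : ℂ) * w - b₂ * z‖ ^ (2 * β₂ - 2) * ‖(t : ℂ) * w - b₃ * z‖ ^ (2 * β₃ - 2))
      * ‖w‖ ^ 2 ≤ _
    rw [e2 _ _ X2, e2 _ _ X3, mul_assoc √C, mul_pow, Real.sq_sqrt hC, ← mul_pow, mul_assoc,
      ← mul_pow]
    refine mul_le_mul_of_nonneg_left ?_ hC
    refine pow_le_pow_left₀ (by positivity) ?_ 2
    calc _ ≤ (‖(t : ℂ) * w - b₂ * z‖ ^ (γ - 1) + ‖(t : ℂ) * w - b₃ * z‖ ^ (γ - 1)) * ‖w‖ := by gcongr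
      _ = ‖w‖ * ‖(t : ℂ) * w - b₂ * z‖ ^ (γ - 1) + ‖w‖ * ‖(t : ℂ) * w - b₃ * z‖ ^ (γ - 1) := by ring
      _ ≤ _ := by rw [mul_add]; exact add_le_add n2 n3
  have hae : ∀ᵐ t : ℝ, t ≠ s b₂ ∧ t ≠ s b₃ := by
    have : ∀ a : ℝ, ∀ᵐ t : ℝ, t ≠ a := fun a => by simp [ae_iff]
    exact (this _).and (this _)
  calc _ ≤ ∫⁻ t in Ioo (0 : ℝ) 1, ENNReal.ofReal (√C * ‖w‖ ^ γ) *
        (ENNReal.ofReal (|t - s b₂| ^ (γ - 1)) + ENNReal.ofReal (|t - s b₃| ^ (γ - 1))) :=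
        setLIntegral_mono_ae' measurableSet_Ioo (by filter_upwards [hae] with t ht ht' using hsp t ht' ht)
    _ = ENNReal.ofReal (√C * ‖w‖ ^ γ) * ((∫⁻ t in Ioo (0 : ℝ) 1, ENNReal.ofReal (|t - s b₂| ^ (γ - 1)))
        + ∫⁻ t in Ioo (0 : ℝ) 1, ENNReal.ofReal (|t - s b₃| ^ (γ - 1))) := by
      rw [lintegral_const_mul' _ _ ENNReal.ofReal_ne_top, lintegral_add_left (by fun_prop)]
    _ ≤ ENNReal.ofReal (√C * ‖w‖ ^ γ) * (ENNReal.ofReal D + ENNReal.ofReal D) :=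
      mul_le_mul_right (add_le_add (hint _) (hint _)) _
    _ = _ := by
      rw [← ENNReal.ofReal_add hD hD, ← ENNReal.ofReal_mul (by positivity)]
      congr 1; ring

/-- Moving radially along the line `{w = 0}`. -/
lemma IsNearCone.lengthDist_base_le (h : IsNearCone β₁ β₂ β₃ γ ε κ C b₂ b₃ g) (hβ : 0 < β₁)
    (hγ : 0 < γ) {z : ℂ} (hz : z ≠ 0) (hzB : (z, 0) ∈ coneUnitBall β₁ γ) {η : ℝ} (hη : 0 < η)
    (hη1 : η < 1) :
    lengthDist g (threeLines b₂ b₃) (coneUnitBall β₁ γ) (z, 0)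
      ((((1 - η) ^ (1 / β₁) : ℝ) : ℂ) * z, 0) ≤ ENNReal.ofReal (√C / β₁ * η) := by
  have hC := h.const_nonneg
  obtain ⟨u, hu, e⟩ := exists_polar hβ z
  have hz0 : 0 < ‖z‖ := norm_pos_iff.2 hz
  set r := ‖z‖ ^ β₁ with hr
  have hr0 : 0 < r := by positivity
  have hr1 : r ≤ 1 := (rpow_le_one_of_mem hzB).1
  set ρ : ℝ → ℝ := fun t => r * (1 - η * t) with hρ
  have hρ0 : ∀ t ∈ Icc (0 : ℝ) 1, 0 < ρ t := fun t ht => by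
    have : η * t ≤ η := mul_le_of_le_one_right hη.le ht.2
    exact mul_pos hr0 (by linarith)
  have hρr : ∀ t ∈ Icc (0 : ℝ) 1, ρ t ≤ r := fun t ht =>
    mul_le_of_le_one_right hr0.le (by nlinarith [mul_nonneg hη.le ht.1])
  set c : ℝ → ℂ × ℂ := fun t => (((ρ t ^ (1 / β₁) : ℝ) : ℂ) * u, 0) with hc
  have hmem : ∀ t ∈ Icc (0 : ℝ) 1, c t ∈ coneUnitBall β₁ γ := fun t ht => by
    refine mem_coneUnitBall_of_le hβ hγ hzB ?_ le_rfl
    change ‖((ρ t ^ (1 / β₁) : ℝ) : ℂ) * u‖ ≤ ‖z‖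
    rw [← e, norm_polar hu (hρ0 t ht).le, norm_polar hu hr0.le]
    exact rpow_le_rpow (hρ0 t ht).le (hρr t ht) (by positivity)
  have hne : ∀ t ∈ Icc (0 : ℝ) 1, (c t).1 ≠ 0 := fun t ht => by
    have := hρ0 t ht
    rw [← norm_ne_zero_iff, hc, norm_polar hu this.le]
    positivity
  have hder : ∀ t ∈ Icc (0 : ℝ) 1, ∃ v, HasDerivAt c (v, 0) t ∧
      β₁ ^ 2 * ‖(c t).1‖ ^ (2 * β₁ - 2) * ‖v‖ ^ 2 = (r * η) ^ 2 := fun t ht => by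
    have h1 : HasDerivAt ρ (r * (-(η * 1))) t :=
      (((hasDerivAt_id t).const_mul η).const_sub 1).const_mul r
    obtain ⟨v, hv, ev⟩ := hasDerivAt_polar hβ hu h1 (hρ0 t ht)
    exact ⟨v, hv.prodMk (hasDerivAt_const t 0), ev.trans (by ring)⟩
  have arc : IsArc (threeLines b₂ b₃) (coneUnitBall β₁ γ) 0 1 c := by
    refine ⟨fun t ht => ?_, hmem, ∅, fun t ht => ?_, fun t ht => notMem_threeLines.2
      ⟨hne t (Ioo_subset_Icc_self ht.1), ?_, ?_⟩⟩
    · obtain ⟨v, hv, -⟩ := hder t ht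
      exact hv.continuousAt.continuousWithinAt
    · have h1 : ContDiffAt ℝ 1 ρ t := by fun_prop
      have h2 : ContDiffAt ℝ 1 (fun t => ((ρ t ^ (1 / β₁) : ℝ) : ℂ) * u) t :=
        (ContDiffAt.comp (g := fun x : ℝ => (x : ℂ)) t ofRealCLM.contDiff.contDiffAt
          (h1.rpow_const_of_ne (hρ0 t (Ioo_subset_Icc_self ht.1)).ne')).mul contDiffAt_const
      exact (h2.prodMk contDiffAt_const).contDiffWithinAt
    · exact (mul_ne_zero h.ne₂ (hne t (Ioo_subset_Icc_self ht.1))).symm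
    · exact (mul_ne_zero h.ne₃ (hne t (Ioo_subset_Icc_self ht.1))).symm
  have hc0 : c 0 = (z, 0) := by simp only [hc, hρ, mul_zero, sub_zero, mul_one]; rw [e]
  have hc1 : c 1 = ((((1 - η) ^ (1 / β₁) : ℝ) : ℂ) * z, 0) := by
    simp only [hc, hρ, mul_one]
    rw [mul_rpow hr0.le (by linarith), Complex.ofReal_mul, mul_comm (Complex.ofReal _),
      mul_assoc, e]
  rw [← hc0, ← hc1]
  refine (lengthDist_le arc one_pos).trans ?_
  have hsp : ∀ t ∈ Ioo (0 : ℝ) 1, ENNReal.ofReal (√(normSq g (c t) (deriv c t)))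
      ≤ ENNReal.ofReal (√C / β₁ * η) := by
    intro t ht
    have ht' := Ioo_subset_Icc_self ht
    obtain ⟨v, hv, ev⟩ := hder t ht'
    refine ENNReal.ofReal_le_ofReal (Real.sqrt_le_iff.2 ⟨by positivity, ?_⟩)
    rw [hv.deriv]
    refine (h.fst_upper _ v (hne t ht') (hmem t ht')).trans ?_
    have e1 : C * ‖(c t).1‖ ^ (2 * β₁ - 2) * ‖v‖ ^ 2 = C / β₁ ^ 2 * (r * η) ^ 2 := by
      rw [← ev]; field_simp
    have e2 : (r * η) ^ 2 ≤ η ^ 2 := by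
      have : r * η ≤ η := mul_le_of_le_one_left hη.le hr1
      gcongr
    calc _ = C / β₁ ^ 2 * (r * η) ^ 2 := e1
      _ ≤ C / β₁ ^ 2 * η ^ 2 := by gcongr
      _ = _ := by rw [mul_pow, div_pow, Real.sq_sqrt hC]
  refine (setLIntegral_mono' measurableSet_Ioo hsp).trans ?_
  simp

end

section

variable {β₁ β₂ β₃ γ ε κ C : ℝ} {b₂ b₃ : ℂ} {g : HermField}

/-- Contracting `z` makes room in the unit ball for a coordinate `w` with `|w|^γ = η`. -/
lemma shrink_mem (hβ : 0 < β₁) (hγ : 0 < γ) {η : ℝ} (hη : 0 < η) (hη1 : η < 1) {x : ℂ × ℂ}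
    (hx : x ∈ coneUnitBall β₁ γ) :
    ((((1 - η) ^ (1 / β₁) : ℝ) : ℂ) * x.1, ((η ^ (1 / γ) : ℝ) : ℂ)) ∈ coneUnitBall β₁ γ := by
  obtain ⟨u, hu, e⟩ := exists_polar hβ x.1
  have hr := (rpow_le_one_of_mem hx).1
  have h0 : 0 < 1 - η := by linarith
  have := conePoint_mem_coneUnitBall hβ hγ hu (norm_one (α := ℂ)) (r := (1 - η) * ‖x.1‖ ^ β₁) (R := η)
    (by positivity) hη.le (by
      have : ((1 - η) * ‖x.1‖ ^ β₁) ^ 2 ≤ (1 - η) ^ 2 := by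
        have : (1 - η) * ‖x.1‖ ^ β₁ ≤ 1 - η := mul_le_of_le_one_right h0.le hr
        gcongr
      nlinarith)
  rwa [conePoint, mul_rpow h0.le (by positivity), Complex.ofReal_mul, mul_assoc, e, mul_one]
    at this

/-- Leaving the line `{z = 0}` inside the sector where the metric is close to the cone. -/
lemma IsNearCone.lengthDist_leave_line_le (h : IsNearCone β₁ β₂ β₃ γ ε κ C b₂ b₃ g) (hβ : 0 < β₁)
    (hβγ : β₁ < γ) (hε : 0 ≤ ε) {η : ℝ} (hη : 0 < η) (hη2 : η < 1 / 2) (hκ : κ ≤ η ^ (1 / γ))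
    {u₁ u₂ : ℂ} (h1 : ‖u₁‖ = 1) (h2 : ‖u₂‖ = 1) {R : ℝ} (hR0 : 0 ≤ R) (hR : R ≤ η) :
    lengthDist g (threeLines b₂ b₃) (coneUnitBall β₁ γ) (conePoint β₁ γ u₁ u₂ 0 R)
      (conePoint β₁ γ u₁ u₂ η η) ≤ ENNReal.ofReal ((1 + ε) * (2 * η)) := by
  have hγ : 0 < γ := hβ.trans hβγ
  have hη1 : η < 1 := by linarith
  have s1 := lengthDist_radial_le hβ hγ (g := g) (S := threeLines b₂ b₃) (U := coneUnitBall β₁ γ)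
    (K := 1 + ε) (by positivity) h1 h2 le_rfl hη.le hR0 hη.le (by positivity) (by positivity)
    (fun t ht => conePoint_mem_coneUnitBall hβ hγ h1 h2 (by nlinarith [mul_nonneg ht.1 hη.le])
      (by nlinarith [mul_nonneg ht.1 (sub_nonneg.2 hR)]) ?_) (fun t ht => ?_)
  rotate_left
  · have q1 : 0 ≤ 0 + t * (η - 0) := by nlinarith [mul_nonneg ht.1 hη.le]
    have q2 : 0 + t * (η - 0) ≤ η := by nlinarith [mul_nonneg (sub_nonneg.2 ht.2) hη.le]
    have q3 : 0 ≤ R + t * (η - R) := by nlinarith [mul_nonneg ht.1 (sub_nonneg.2 hR)]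
    have q4 : R + t * (η - R) ≤ η := by nlinarith [mul_nonneg (sub_nonneg.2 ht.2) (sub_nonneg.2 hR)]
    nlinarith
  · have p1 : 0 < 0 + t * (η - 0) := affine_pos le_rfl hη.le (by positivity) ht
    have p2 : 0 < R + t * (η - R) := affine_pos hR0 hη.le (by positivity) ht
    have q2 : 0 + t * (η - 0) ≤ η := by nlinarith [mul_nonneg (sub_nonneg.2 ht.2.le) hη.le]
    have q4 : R + t * (η - R) ≤ η := by
      nlinarith [mul_nonneg (sub_nonneg.2 ht.2.le) (sub_nonneg.2 hR)]
    have hB : conePoint β₁ γ u₁ u₂ (0 + t * (η - 0)) (R + t * (η - R)) ∈ coneUnitBall β₁ γ :=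
      conePoint_mem_coneUnitBall hβ hγ h1 h2 p1.le p2.le (by nlinarith)
    have hsec : κ * ‖(conePoint β₁ γ u₁ u₂ (0 + t * (η - 0)) (R + t * (η - R))).1‖
        ≤ ‖(conePoint β₁ γ u₁ u₂ (0 + t * (η - 0)) (R + t * (η - R))).2‖ := by
      rw [conePoint, norm_polar h1 p1.le, norm_polar h2 p2.le, zero_add, sub_zero]
      have t0 := ht.1
      calc κ * (t * η) ^ (1 / β₁) ≤ η ^ (1 / γ) * t ^ (1 / γ) := by
            have hexp : 1 / γ ≤ 1 / β₁ := one_div_le_one_div_of_le hβ hβγ.le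
            have k1 : (t * η) ^ (1 / β₁) ≤ t ^ (1 / γ) := by
              calc (t * η) ^ (1 / β₁) ≤ t ^ (1 / β₁) := by
                    have : t * η ≤ t := mul_le_of_le_one_right t0.le hη1.le
                    gcongr
                _ ≤ t ^ (1 / γ) := rpow_le_rpow_of_exponent_ge t0 ht.2.le hexp
            have := h.nonneg
            gcongr
        _ = (t * η) ^ (1 / γ) := by rw [mul_rpow t0.le hη.le, mul_comm]
        _ ≤ (R + t * (η - R)) ^ (1 / γ) := by
            have : t * η ≤ R + t * (η - R) := by nlinarith [mul_nonneg (sub_nonneg.2 ht.2.le) hR0]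
            gcongr
    exact ⟨h.notMem_of_le (conePoint_fst_ne h1 p1) hsec,
      h.normSq_le hε hB (conePoint_fst_ne h1 p1) hsec⟩
  refine s1.trans (ENNReal.ofReal_le_ofReal ?_)
  rw [sub_zero, abs_of_pos hη, abs_of_nonneg (sub_nonneg.2 hR)]
  exact mul_le_mul_of_nonneg_left (by linarith) (by positivity)

/-- Reaching the line `{z = 0}` inside the sector where the metric is close to the cone. -/
lemma IsNearCone.lengthDist_to_line_le (h : IsNearCone β₁ β₂ β₃ γ ε κ C b₂ b₃ g) (hβ : 0 < β₁)
    (hγ : 0 < γ) (hε : 0 ≤ ε) {η : ℝ} (hη : 0 < η) (hη2 : η < 1 / 2) (hκ : κ ≤ η ^ (1 / γ))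
    {u₁ u₂ : ℂ} (h1 : ‖u₁‖ = 1) (h2 : ‖u₂‖ = 1) {r : ℝ} (hη' : 0 < r) (hη'' : r ≤ η) :
    lengthDist g (threeLines b₂ b₃) (coneUnitBall β₁ γ) (conePoint β₁ γ u₁ u₂ r η)
      (conePoint β₁ γ u₁ u₂ 0 η) ≤ ENNReal.ofReal ((1 + ε) * η) := by
  have s3 := lengthDist_radial_le hβ hγ (g := g) (S := threeLines b₂ b₃) (U := coneUnitBall β₁ γ)
    (K := 1 + ε) (by positivity) h1 h2 hη'.le le_rfl hη.le hη.le (by positivity)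
    (by positivity)
    (fun t ht => conePoint_mem_coneUnitBall hβ hγ h1 h2
      (by nlinarith [mul_nonneg (sub_nonneg.2 ht.2) hη'.le]) (by simpa using hη.le) ?_)
    (fun t ht => ?_)
  rotate_left
  · have q1 : 0 ≤ r + t * (0 - r) := by
      nlinarith [mul_nonneg (sub_nonneg.2 ht.2) hη'.le]
    have q2 : r + t * (0 - r) ≤ η := by nlinarith [mul_nonneg ht.1 hη'.le]
    rw [sub_self, mul_zero, add_zero]
    nlinarith
  · have p1 : 0 < r + t * (0 - r) :=
      affine_pos hη'.le le_rfl (by positivity) ht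
    have q2 : r + t * (0 - r) ≤ η := by nlinarith [mul_nonneg ht.1.le hη'.le]
    rw [sub_self, mul_zero, add_zero]
    have hB : conePoint β₁ γ u₁ u₂ (r + t * (0 - r)) η ∈ coneUnitBall β₁ γ :=
      conePoint_mem_coneUnitBall hβ hγ h1 h2 p1.le hη.le (by nlinarith)
    have hsec : κ * ‖(conePoint β₁ γ u₁ u₂ (r + t * (0 - r)) η).1‖
        ≤ ‖(conePoint β₁ γ u₁ u₂ (r + t * (0 - r)) η).2‖ :=
      sector_of_le hκ hβ hγ hη h.nonneg hB (norm_polar_rpow hγ h2 hη.le).ge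
    exact ⟨h.notMem_of_le (conePoint_fst_ne h1 p1) hsec,
      h.normSq_le hε hB (conePoint_fst_ne h1 p1) hsec⟩
  refine s3.trans (ENNReal.ofReal_le_ofReal ?_)
  rw [sub_self, abs_zero, add_zero, zero_sub, abs_neg, abs_of_pos hη']
  exact mul_le_mul_of_nonneg_left hη'' (by positivity)

/-- Every point near the line `{w = 0}` can be joined by a short curve in the unit ball to the point
of its fibre, slightly contracted, at distance `η` from this line. -/
lemma IsNearCone.exists_connect_le (hβ : 0 < β₁) (hβγ : β₁ < γ) (hγ1 : γ < 1) (hβ₂ : β₂ < 1)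
    (hβ₃ : β₃ < 1) (hang : 1 - γ = (1 - β₂) + (1 - β₃)) (hC : 0 ≤ C) :
    ∃ M : ℝ, 0 ≤ M ∧ ∀ (ε κ : ℝ) (b₂ b₃ : ℂ) (g : HermField),
      IsNearCone β₁ β₂ β₃ γ ε κ C b₂ b₃ g → 0 ≤ ε → ε ≤ 1 → ∀ η : ℝ, 0 < η → η < 1 / 2 →
      κ ≤ η ^ (1 / γ) → ∀ x ∈ coneUnitBall β₁ γ, ‖x.2‖ ^ γ ≤ η →
        lengthDist g (threeLines b₂ b₃) (coneUnitBall β₁ γ) x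
          ((((1 - η) ^ (1 / β₁) : ℝ) : ℂ) * x.1, ((η ^ (1 / γ) : ℝ) : ℂ)) ≤ ENNReal.ofReal (M * η) := by
  have hγ : 0 < γ := hβ.trans hβγ
  obtain ⟨M, hM, hfib⟩ := IsNearCone.exists_fibre_le hβ hγ hγ1 hβ₂ hβ₃ hang hC
  refine ⟨2 * M + √C / β₁ + 6, by positivity, fun ε κ b₂ b₃ g h hε hε1 η hη hη2 hκ => ?_⟩
  have hη1 : η < 1 := by linarith
  have hs0 : 0 < (1 - η) ^ (1 / β₁) := rpow_pos_of_pos (by linarith) _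
  have hκ1 : η ^ (1 / γ) ≤ 1 := rpow_le_one hη.le hη1.le (by positivity)
  -- off the line `{z = 0}`: down the fibre, along `{w = 0}`, and up the fibre
  have main : ∀ x ∈ coneUnitBall β₁ γ, ‖x.2‖ ^ γ ≤ η → x.1 ≠ 0 →
      lengthDist g (threeLines b₂ b₃) (coneUnitBall β₁ γ) x
        ((((1 - η) ^ (1 / β₁) : ℝ) : ℂ) * x.1, ((η ^ (1 / γ) : ℝ) : ℂ))
          ≤ ENNReal.ofReal ((2 * M + √C / β₁) * η) := by
    intro x hx hR hz
    have hx0 : (x.1, (0 : ℂ)) ∈ coneUnitBall β₁ γ :=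
      mem_coneUnitBall_of_le hβ hγ hx le_rfl (by simp)
    have s1 := hfib ε κ b₂ b₃ g h x.1 x.2 hz hx
    rw [lengthDist_comm] at s1
    have s2 := h.lengthDist_base_le hβ hγ hz hx0 hη hη1
    have s3 := hfib ε κ b₂ b₃ g h ((((1 - η) ^ (1 / β₁) : ℝ) : ℂ) * x.1) ((η ^ (1 / γ) : ℝ) : ℂ)
      (mul_ne_zero (ofReal_ne_zero.2 hs0.ne') hz) (shrink_mem hβ hγ hη hη1 hx)
    rw [norm_reference hγ hη] at s3
    refine ((lengthDist_triangle _ _ _ _ _ _).trans (add_le_add ((lengthDist_triangle _ _ _ _ _ _).trans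
      (add_le_add s1 s2)) s3)).trans ?_
    rw [← ENNReal.ofReal_add (by positivity) (by positivity),
      ← ENNReal.ofReal_add (by positivity) (by positivity)]
    refine ENNReal.ofReal_le_ofReal ?_
    have : M * ‖x.2‖ ^ γ ≤ M * η := by gcongr
    linarith
  intro x hx hR
  by_cases hz : x.1 = 0
  swap
  · exact (main x hx hR hz).trans (ENNReal.ofReal_le_ofReal
      (mul_le_mul_of_nonneg_right (by linarith) hη.le))
  -- points of the line `{z = 0}` are first moved off this line
  obtain ⟨u₁, u₂, h1, h2, e⟩ := conePoint_eq hβ hγ x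
  rw [hz, norm_zero, zero_rpow hβ.ne'] at e
  set R := ‖x.2‖ ^ γ
  have hR0 : 0 ≤ R := by positivity
  have hmid : conePoint β₁ γ u₁ u₂ η η ∈ coneUnitBall β₁ γ :=
    conePoint_mem_coneUnitBall hβ hγ h1 h2 hη.le hη.le (by nlinarith)
  have s1 := h.lengthDist_leave_line_le hβ hβγ hε hη hη2 hκ h1 h2 hR0 hR
  have hne := conePoint_fst_ne (β₁ := β₁) (γ := γ) (u₂ := u₂) (R := η) h1 hη
  have s2 := main _ hmid (norm_polar_rpow hγ h2 hη.le).le hne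
  set s : ℝ := (1 - η) ^ (1 / β₁) with hs
  have epnt : ((s : ℂ) * (conePoint β₁ γ u₁ u₂ η η).1, ((η ^ (1 / γ) : ℝ) : ℂ))
      = conePoint β₁ γ u₁ 1 ((1 - η) * η) η := by
    rw [conePoint, conePoint, mul_rpow (by linarith) hη.le, Complex.ofReal_mul, mul_one,
      mul_assoc]
  rw [epnt] at s2
  have hη' : 0 < (1 - η) * η := mul_pos (by linarith) hη
  have hη'' : (1 - η) * η ≤ η := mul_le_of_le_one_left hη.le (by linarith)
  have s3 := h.lengthDist_to_line_le hβ hγ hε hη hη2 hκ h1 norm_one hη' hη''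
  have eend : conePoint β₁ γ u₁ 1 0 η = ((s : ℂ) * x.1, ((η ^ (1 / γ) : ℝ) : ℂ)) := by
    rw [hz, conePoint, zero_rpow (by positivity), mul_zero, mul_one]; simp
  rw [eend] at s3
  rw [e] at s1
  refine ((lengthDist_triangle _ _ _ _ _ _).trans (add_le_add ((lengthDist_triangle _ _ _ _ _ _).trans
    (add_le_add s1 s2)) s3)).trans ?_
  rw [← ENNReal.ofReal_add (by positivity) (by positivity),
    ← ENNReal.ofReal_add (by positivity) (by positivity)]
  refine ENNReal.ofReal_le_ofReal ?_
  have k1 : (1 + ε) * (2 * η) ≤ 2 * (2 * η) := mul_le_mul_of_nonneg_right (by linarith) (by positivity)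
  have k2 : (1 + ε) * η ≤ 2 * η := mul_le_mul_of_nonneg_right (by linarith) hη.le
  linarith

/-- The distance of the perturbed metric is bounded by the length of curves of the cone: their part
near `{w = 0}` is contracted and projected to `{w = η^(1/γ)}`. -/
theorem IsNearCone.lengthDist_le_curveLength (h : IsNearCone β₁ β₂ β₃ γ ε κ C b₂ b₃ g) (hβ : 0 < β₁)
    (hγ : 0 < γ) (hε : 0 ≤ ε) {η : ℝ} (hη : 0 < η) (hη1 : η < 1) (hκ : κ ≤ η ^ (1 / γ)) {E : ℝ≥0∞}
    (hconn : ∀ x ∈ coneUnitBall β₁ γ, ‖x.2‖ ^ γ ≤ η →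
        lengthDist g (threeLines b₂ b₃) (coneUnitBall β₁ γ) x
          ((((1 - η) ^ (1 / β₁) : ℝ) : ℂ) * x.1, ((η ^ (1 / γ) : ℝ) : ℂ)) ≤ E)
    {x y : ℂ × ℂ} {c : ℝ → ℂ × ℂ}
    (hc : IsAdmissible {x | x.1 = 0 ∨ x.2 = 0} (coneUnitBall β₁ γ) x y c) :
    lengthDist g (threeLines b₂ b₃) (coneUnitBall β₁ γ) x y
      ≤ ENNReal.ofReal (1 + ε) * curveLength (coneMetric β₁ γ) c + (E + E) := by
  have hs0 : 0 < (1 - η) ^ (1 / β₁) := rpow_pos_of_pos (by linarith) _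
  have hs1 : (1 - η) ^ (1 / β₁) ≤ 1 := rpow_le_one (by linarith) (by linarith) (by positivity)
  have hreg : ∀ x : ℂ × ℂ, x ∉ {x : ℂ × ℂ | x.1 = 0 ∨ x.2 = 0} → x.1 ≠ 0 ∧ x.2 ≠ 0 := fun x hx => by
    rwa [mem_ofPred_eq, not_or] at hx
  rw [← hc.source, ← hc.target]
  refine lengthDist_le_of_proj (g := coneMetric β₁ γ)
    (π := fun x => ((((1 - η) ^ (1 / β₁) : ℝ) : ℂ) * x.1, ((η ^ (1 / γ) : ℝ) : ℂ)))
    (continuousOn_snd_rpow hγ hc.isArc) (η := η) ?_ ?_ fun t ht => hconn _ (hc.mapsTo ht)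
  · intro a b ha hab hb hR
    have harc := hc.isArc.mono ha hb
    obtain ⟨T, hT1, hT2⟩ := harc.regular
    have hB : ∀ t ∈ Ioo a b, c t ∈ coneUnitBall β₁ γ := fun t ht => harc.mapsTo (Ioo_subset_Icc_self ht)
    have hsec : ∀ t ∈ Ioo a b, κ * ‖(c t).1‖ ≤ ‖(c t).2‖ := fun t ht =>
      sector_of_le hκ hβ hγ hη h.nonneg (hB t ht) (hR t ht).le
    refine (lengthDist_le ⟨harc.cont, harc.mapsTo, T, hT1,
      fun t ht => ?_⟩ hab).trans (arcLength_le_mul (by positivity) T fun t ht => ?_)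
    · exact h.notMem_of_le (hreg _ (hT2 t ht)).1 (hsec t ht.1)
    · exact h.normSq_le hε (hB t ht.1) (hreg _ (hT2 t ht)).1 (hsec t ht.1) _
  · intro a b ha hab hb
    have harc := hc.isArc.mono ha hb
    obtain ⟨T, hT⟩ := harc.differentiableAt
    set s : ℝ := (1 - η) ^ (1 / β₁)
    have hB : ∀ t ∈ Icc a b, ((s : ℂ) * (c t).1, ((η ^ (1 / γ) : ℝ) : ℂ)) ∈ coneUnitBall β₁ γ :=
      fun t ht => shrink_mem hβ hγ hη hη1 (harc.mapsTo ht)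
    have hsec : ∀ x : ℂ × ℂ, ((s : ℂ) * x.1, ((η ^ (1 / γ) : ℝ) : ℂ)) ∈ coneUnitBall β₁ γ →
        κ * ‖(s : ℂ) * x.1‖ ≤ ‖((η ^ (1 / γ) : ℝ) : ℂ)‖ := fun x hx =>
      sector_of_le hκ hβ hγ hη h.nonneg hx (norm_reference hγ hη).ge
    have hne : ∀ x : ℂ × ℂ, x ∉ {x : ℂ × ℂ | x.1 = 0 ∨ x.2 = 0} → (s : ℂ) * x.1 ≠ 0 := fun x hx =>
      mul_ne_zero (ofReal_ne_zero.2 hs0.ne') (hreg _ hx).1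
    obtain ⟨T', hT'1, hT'2⟩ := harc.regular
    have harc' : IsArc (threeLines b₂ b₃) (coneUnitBall β₁ γ) a b
        (fun t => ((s : ℂ) * (c t).1, ((η ^ (1 / γ) : ℝ) : ℂ))) := by
      have h0 := harc.prod_const (S' := ∅) (U' := coneUnitBall β₁ γ) (s : ℂ) ((η ^ (1 / γ) : ℝ) : ℂ) hB
        (fun t _ => notMem_empty _)
      refine ⟨h0.cont, h0.mapsTo, T', (contDiffOn_const.mul hT'1.fst).prodMk contDiffOn_const,
        fun t ht => ?_⟩
      exact h.notMem_of_le (x := ((s : ℂ) * (c t).1, ((η ^ (1 / γ) : ℝ) : ℂ))) (hne _ (hT'2 t ht))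
        (hsec _ (hB t (Ioo_subset_Icc_self ht.1)))
    refine (lengthDist_le harc' hab).trans (arcLength_le_mul (by positivity) T fun t ht => ?_)
    have hd := hT t ht
    have hBt := hB t (Ioo_subset_Icc_self ht.1)
    rw [(hasDerivAt_prod_const hd.1 _ _).deriv]
    refine (h.normSq_le hε hBt (hne _ hd.2) (hsec _ hBt) _).trans ?_
    refine mul_le_mul_of_nonneg_left ?_ (sq_nonneg _)
    rw [normSq_coneMetric, normSq_coneMetric]
    simp only [norm_mul, norm_zero, norm_real, norm_of_nonneg hs0.le]
    have hz0 : 0 < ‖(c t).1‖ := norm_pos_iff.2 (hreg _ hd.2).1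
    rw [mul_rpow hs0.le hz0.le, mul_pow]
    have e1 : s ^ (2 * β₁ - 2) * s ^ 2 ≤ 1 := by
      rw [← rpow_natCast, ← rpow_add hs0]
      exact rpow_le_one hs0.le hs1 (by push_cast; linarith)
    have e2 : 0 ≤ γ ^ 2 * ‖(c t).2‖ ^ (2 * γ - 2) * ‖(deriv c t).2‖ ^ 2 := by positivity
    have e3 := mul_le_mul_of_nonneg_left e1
      (by positivity : 0 ≤ β₁ ^ 2 * ‖(c t).1‖ ^ (2 * β₁ - 2) * ‖(deriv c t).1‖ ^ 2)
    nlinarith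

/-- Uniform comparison of the distance of a perturbed metric with that of the cone. -/
theorem IsNearCone.exists_abs_dist_sub_le (hβ : 0 < β₁) (hβγ : β₁ < γ) (hγ1 : γ < 1) (hβ₂ : β₂ < 1)
    (hβ₃ : β₃ < 1) (hang : 1 - γ = (1 - β₂) + (1 - β₃)) (hC : 0 ≤ C) :
    ∃ M : ℝ, 0 ≤ M ∧ ∀ (ε κ : ℝ) (b₂ b₃ : ℂ) (g : HermField),
      IsNearCone β₁ β₂ β₃ γ ε κ C b₂ b₃ g → 0 ≤ ε → ε ≤ 1 / 2 → ∀ η : ℝ, 0 < η → η < 1 / 2 →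
      κ ≤ η ^ (1 / γ) → ∀ x ∈ coneUnitBall β₁ γ, ∀ y ∈ coneUnitBall β₁ γ,
        lengthDist g (threeLines b₂ b₃) (coneUnitBall β₁ γ) x y ≠ ⊤ ∧ coneDist β₁ γ x y ≠ ⊤ ∧
        |(lengthDist g (threeLines b₂ b₃) (coneUnitBall β₁ γ) x y).toReal
          - (coneDist β₁ γ x y).toReal| ≤ 12 * ε + M * η := by
  have hγ : 0 < γ := hβ.trans hβγ
  obtain ⟨M, hM, hconn⟩ := IsNearCone.exists_connect_le hβ hβγ hγ1 hβ₂ hβ₃ hang hC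
  refine ⟨2 * M + 12, by positivity, fun ε κ b₂ b₃ g h hε hε1 η hη hη2 hκ x hx y hy => ?_⟩
  have hc12 := coneDist_le_of_mem hβ hγ hx hy
  have hcfin : coneDist β₁ γ x y ≠ ⊤ := ne_top_of_le_ne_top ENNReal.ofReal_ne_top hc12
  set dc := (coneDist β₁ γ x y).toReal with hdc
  have hdc0 : 0 ≤ dc := ENNReal.toReal_nonneg
  have hdc12 : dc ≤ 12 := by
    have := ENNReal.toReal_mono ENNReal.ofReal_ne_top hc12
    rwa [ENNReal.toReal_ofReal (by norm_num)] at this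
  have hη0 : ENNReal.ofReal η ≠ 0 := by simpa using hη
  have near : ∀ d : ℝ≥0∞, d ≠ ⊤ → d < d + ENNReal.ofReal η := fun d hd =>
    ENNReal.lt_add_right hd hη0
  -- the upper bound
  have up : lengthDist g (threeLines b₂ b₃) (coneUnitBall β₁ γ) x y
      ≤ ENNReal.ofReal ((1 + ε) * (dc + η) + 2 * (M * η)) := by
    have h1 := near _ hcfin
    conv_lhs at h1 => rw [coneDist, lengthDist]
    obtain ⟨c, hc⟩ := iInf_lt_iff.1 h1
    obtain ⟨hadm, hlen⟩ := iInf_lt_iff.1 hc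
    obtain ⟨c', hadm', hlen'⟩ := exists_curve_in_ball hβ hγ hx hy hadm
    have h2 := h.lengthDist_le_curveLength hβ hγ hε hη (by linarith) hκ
      (hconn ε κ b₂ b₃ g h hε (by linarith) η hη hη2 hκ) hadm'
    have h3 : curveLength (coneMetric β₁ γ) c' ≤ ENNReal.ofReal (dc + η) := by
      rw [ENNReal.ofReal_add hdc0 hη.le, hdc, ENNReal.ofReal_toReal hcfin]
      exact hlen'.trans hlen.le
    refine h2.trans ((add_le_add_left (mul_le_mul_right h3 _) _).trans ?_)
    rw [← ENNReal.ofReal_mul (by positivity), ← ENNReal.ofReal_add (by positivity) (by positivity),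
      ← ENNReal.ofReal_add (by positivity) (by positivity)]
    exact ENNReal.ofReal_le_ofReal (by linarith)
  have hgfin := ne_top_of_le_ne_top ENNReal.ofReal_ne_top up
  refine ⟨hgfin, hcfin, ?_⟩
  set dg := (lengthDist g (threeLines b₂ b₃) (coneUnitBall β₁ γ) x y).toReal with hdg
  have hdg0 : 0 ≤ dg := ENNReal.toReal_nonneg
  have up' : dg ≤ (1 + ε) * (dc + η) + 2 * (M * η) := by
    have := ENNReal.toReal_mono ENNReal.ofReal_ne_top up
    rwa [ENNReal.toReal_ofReal (by positivity)] at this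
  -- the lower bound
  have h3 : 0 < 1 - ε := by linarith
  have low : dc ≤ 1 / (1 - ε) * (dg + η) + 10 * η := by
    have h1 := near _ hgfin
    conv_lhs at h1 => rw [lengthDist]
    obtain ⟨c, hc⟩ := iInf_lt_iff.1 h1
    obtain ⟨hadm, hlen⟩ := iInf_lt_iff.1 hc
    have h2 := h.coneDist_le hβ hγ hε (by linarith) hη hκ hadm
    have h4 : curveLength g c ≤ ENNReal.ofReal (dg + η) := by
      rw [ENNReal.ofReal_add hdg0 hη.le, hdg, ENNReal.ofReal_toReal hgfin]
      exact hlen.le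
    have h5 := h2.trans (add_le_add_left (mul_le_mul_right h4 _) _)
    rw [← ENNReal.ofReal_mul (by positivity), ← ENNReal.ofReal_add (by positivity) (by positivity),
      ← ENNReal.ofReal_add (by positivity) (by positivity)] at h5
    have h6 := ENNReal.toReal_mono ENNReal.ofReal_ne_top h5
    rw [ENNReal.toReal_ofReal (by positivity)] at h6
    linarith
  have low' : (1 - ε) * dc ≤ dg + η + 10 * η := by
    have := mul_le_mul_of_nonneg_left low h3.le
    have e1 : (1 - ε) * (1 / (1 - ε) * (dg + η) + 10 * η) = dg + η + (1 - ε) * (10 * η) := by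
      field_simp
    rw [e1] at this
    nlinarith [mul_nonneg hε hη.le]
  rw [abs_le]
  constructor
  · nlinarith [mul_le_mul_of_nonneg_left hdc12 hε, mul_nonneg hM hη.le]
  · nlinarith [mul_le_mul_of_nonneg_left hdc12 hε, mul_nonneg hM hη.le, mul_nonneg hε hη.le]

end

section

variable {β₁ β₂ β₃ γ α₀ : ℝ} {a₂ a₃ : ℂ} {χ₁ χ₂ : ℝ → ℝ}
  (D : GlueData β₁ β₂ β₃ γ α₀ a₂ a₃ χ₁ χ₂)

/-! ### Rescaling and the tangent cone -/

lemma fderiv_dilation (β₁ γ s : ℝ) (x v : ℂ × ℂ) :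
    fderiv ℂ (dilation β₁ γ s) x v = dilation β₁ γ s v := by
  have h : HasFDerivAt (𝕜 := ℂ) (dilation β₁ γ s)
      ((((s ^ (1 / β₁) : ℝ) : ℂ) • ContinuousLinearMap.fst ℂ ℂ ℂ).prod
        (((s ^ (1 / γ) : ℝ) : ℂ) • ContinuousLinearMap.snd ℂ ℂ ℂ)) x := by
    exact ContinuousLinearMap.hasFDerivAt ((((s ^ (1 / β₁) : ℝ) : ℂ) •
      ContinuousLinearMap.fst ℂ ℂ ℂ).prod (((s ^ (1 / γ) : ℝ) : ℂ) • ContinuousLinearMap.snd ℂ ℂ ℂ))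
  rw [h.fderiv]
  rfl

lemma normSq_rescaled (β₁ γ s : ℝ) (g : HermField) (x v : ℂ × ℂ) :
    normSq (fun x => (((s ^ 2)⁻¹ : ℝ) : ℂ) • pullback (dilation β₁ γ s) g x) x v
      = (s ^ 2)⁻¹ * normSq g (dilation β₁ γ s x) (dilation β₁ γ s v) := by
  rw [← fderiv_dilation β₁ γ s x v, ← normSq_pullback, normSq, normSq, ← re_ofReal_mul,
    Finset.mul_sum]
  simp only [Finset.mul_sum, Matrix.smul_apply, smul_eq_mul, mul_assoc]

lemma rpow_one_div_rpow_two_mul {s β : ℝ} (hs : 0 ≤ s) (hβ : β ≠ 0) :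
    (s ^ (1 / β)) ^ (2 * β) = s ^ 2 := by
  rw [← rpow_mul hs, show 1 / β * (2 * β) = 2 by field_simp, rpow_two]

lemma norm_rpow_scale {s β : ℝ} (hs : 0 < s) (hβ : β ≠ 0) (z v : ℂ) :
    ‖((s ^ (1 / β) : ℝ) : ℂ) * z‖ ^ (2 * β - 2) * ‖((s ^ (1 / β) : ℝ) : ℂ) * v‖ ^ 2
      = s ^ 2 * (‖z‖ ^ (2 * β - 2) * ‖v‖ ^ 2) := by
  have hA : 0 < s ^ (1 / β) := by positivity
  rw [norm_mul, norm_mul, norm_real, norm_of_nonneg hA.le,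
    mul_rpow hA.le (norm_nonneg _), ← rpow_one_div_rpow_two_mul hs.le hβ]
  have : (s ^ (1 / β)) ^ (2 * β) = (s ^ (1 / β)) ^ (2 * β - 2) * (s ^ (1 / β)) ^ 2 := by
    rw [← rpow_two, ← rpow_add hA]; congr 1; ring
  rw [this]
  ring

lemma normSq_coneMetric_dilation {s : ℝ} (hs : 0 < s) (hβ : β₁ ≠ 0) (hγ : γ ≠ 0) (x v : ℂ × ℂ) :
    normSq (coneMetric β₁ γ) (dilation β₁ γ s x) (dilation β₁ γ s v)
      = s ^ 2 * normSq (coneMetric β₁ γ) x v := by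
  simp only [normSq_coneMetric, dilation, mul_assoc, norm_rpow_scale hs hβ, norm_rpow_scale hs hγ]
  ring

lemma dilation_snd_sub {s : ℝ} (hs : 0 < s) (a : ℂ) (x : ℂ × ℂ) :
    (dilation β₁ γ s x).2 - a * (dilation β₁ γ s x).1
      = ((s ^ (1 / γ) : ℝ) : ℂ) * (x.2 - a * ((s ^ (1 / β₁ - 1 / γ) : ℝ) : ℂ) * x.1) := by
  have h : s ^ (1 / β₁) = s ^ (1 / γ) * s ^ (1 / β₁ - 1 / γ) := by
    rw [← rpow_add hs]; congr 1; ring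
  simp only [dilation, h]
  push_cast
  ring

lemma dilation_mem_lineOfSlope_iff {s : ℝ} (hs : 0 < s) (a : ℂ) (x : ℂ × ℂ) :
    dilation β₁ γ s x ∈ lineOfSlope a
      ↔ x ∈ lineOfSlope (a * ((s ^ (1 / β₁ - 1 / γ) : ℝ) : ℂ)) := by
  have hB : ((s ^ (1 / γ) : ℝ) : ℂ) ≠ 0 := ofReal_ne_zero.2 (by positivity)
  change (_ : ℂ) = _ ↔ (_ : ℂ) = _
  rw [← sub_eq_zero, dilation_snd_sub hs, mul_eq_zero, or_iff_right hB, sub_eq_zero]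

lemma preimage_dilation_threeLines {s : ℝ} (hs : 0 < s) (a₂ a₃ : ℂ) :
    dilation β₁ γ s ⁻¹' threeLines a₂ a₃ = threeLines (a₂ * ((s ^ (1 / β₁ - 1 / γ) : ℝ) : ℂ))
      (a₃ * ((s ^ (1 / β₁ - 1 / γ) : ℝ) : ℂ)) := by
  ext x
  have hA : ((s ^ (1 / β₁) : ℝ) : ℂ) ≠ 0 := ofReal_ne_zero.2 (by positivity)
  have h1 : dilation β₁ γ s x ∈ verticalLine ↔ x ∈ verticalLine := by
    change _ * _ = (0 : ℂ) ↔ _ = _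
    rw [mul_eq_zero, or_iff_right hA]
  simp only [threeLines, mem_preimage, mem_union, dilation_mem_lineOfSlope_iff hs, h1]

/-- After rescaling, the metric satisfies the hypotheses of the comparison of distances. The slopes
of the two lines and the aperture of the sector shrink by `s^(1/β₁ - 1/γ)`, whereas the constant `C`
does not depend on `s`. -/
theorem GlueData.isNearCone_rescaled :
    ∃ C : ℝ, 0 ≤ C ∧ ∀ ε : ℝ, 0 < ε → ∃ K r₀ : ℝ, 0 < K ∧ 0 < r₀ ∧ ∀ s : ℝ, 0 < s →
      s ^ (1 / β₁) < r₀ → IsNearCone β₁ β₂ β₃ γ ε (K * s ^ (1 / β₁ - 1 / γ)) C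
        (a₂ * ((s ^ (1 / β₁ - 1 / γ) : ℝ) : ℂ)) (a₃ * ((s ^ (1 / β₁ - 1 / γ) : ℝ) : ℂ))
        (fun x => (((s ^ 2)⁻¹ : ℝ) : ℂ) • pullback (dilation β₁ γ s) (ddbar D.pot) x) := by
  obtain ⟨r₁, C₁, h10, -, hC₁, hsnd⟩ := D.exists_snd_upper
  obtain ⟨r₂, C₂, h20, -, hC₂, hfst⟩ := D.exists_fst_upper
  have hβ := D.pos₁
  have hγ := D.pos
  have hang := D.angle
  refine ⟨max C₁ C₂, hC₁.trans (le_max_left _ _), fun ε hε => ?_⟩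
  obtain ⟨K, r₃, hK1, hK2, hK3, h30, -, hclose⟩ := D.exists_close_to_cone hε
  obtain ⟨r₄, h40, -, hlow⟩ := D.exists_fst_lower hε
  refine ⟨K, min (min r₁ r₂) (min r₃ r₄), by linarith, by positivity, fun s hs hsr => ?_⟩
  simp only [lt_min_iff] at hsr
  obtain ⟨⟨hs1, hs2⟩, hs3, hs4⟩ := hsr
  have hA : 0 < s ^ (1 / β₁) := by positivity
  have hB : 0 < s ^ (1 / γ) := by positivity
  have hμ : 0 < s ^ (1 / β₁ - 1 / γ) := by positivity
  have hAB : s ^ (1 / β₁) = s ^ (1 / γ) * s ^ (1 / β₁ - 1 / γ) := by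
    rw [← rpow_add hs]; congr 1; ring
  have hA' : ((s ^ (1 / β₁) : ℝ) : ℂ) ≠ 0 := ofReal_ne_zero.2 hA.ne'
  have hs20 : 0 < s ^ 2 := by positivity
  have hμ' : ((s ^ (1 / β₁ - 1 / γ) : ℝ) : ℂ) ≠ 0 := ofReal_ne_zero.2 hμ.ne'
  have hμn : ‖((s ^ (1 / β₁ - 1 / γ) : ℝ) : ℂ)‖ = s ^ (1 / β₁ - 1 / γ) := by
    rw [norm_real, norm_of_nonneg hμ.le]
  have hn1 : ∀ x : ℂ × ℂ, ‖(dilation β₁ γ s x).1‖ = s ^ (1 / β₁) * ‖x.1‖ := fun x => by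
    rw [dilation, norm_mul, norm_real, norm_of_nonneg hA.le]
  have hn2 : ∀ x : ℂ × ℂ, ‖(dilation β₁ γ s x).2‖ = s ^ (1 / γ) * ‖x.2‖ := fun x => by
    rw [dilation, norm_mul, norm_real, norm_of_nonneg hB.le]
  have hfst_le : ∀ x ∈ coneUnitBall β₁ γ, ‖(dilation β₁ γ s x).1‖ ≤ s ^ (1 / β₁) := fun x hx => by
    rw [hn1]; exact mul_le_of_le_one_right hA.le (norm_fst_le_one hβ hx)
  have hoff : ∀ x : ℂ × ℂ, x ∉ threeLines (a₂ * ((s ^ (1 / β₁ - 1 / γ) : ℝ) : ℂ))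
      (a₃ * ((s ^ (1 / β₁ - 1 / γ) : ℝ) : ℂ)) → (dilation β₁ γ s x).1 ≠ 0 ∧
      (dilation β₁ γ s x).2 / (dilation β₁ γ s x).1 ≠ a₂ ∧
      (dilation β₁ γ s x).2 / (dilation β₁ γ s x).1 ≠ a₃ := fun x hx => by
    rw [← preimage_dilation_threeLines hs, mem_preimage, notMem_threeLines] at hx
    exact ⟨hx.1, quotient_ne hx.1 hx.2.1, quotient_ne hx.1 hx.2.2⟩
  refine ⟨mul_ne_zero D.ne_zero.1 hμ', mul_ne_zero D.ne_zero.2 hμ', ?_, ?_,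
    hC₁.trans (le_max_left _ _), ?_, ?_, ?_, ?_⟩
  · rw [norm_mul, hμn]; exact mul_lt_mul_of_pos_right hK2 hμ
  · rw [norm_mul, hμn]; exact mul_lt_mul_of_pos_right hK3 hμ
  · intro x hx v h1 h2
    have h := hclose (dilation β₁ γ s x) (dilation β₁ γ s v) (mul_ne_zero hA' h1)
      ((hfst_le x hx).trans_lt hs3) (by
        rw [norm_div, hn1, hn2, le_div_iff₀ (mul_pos hA (norm_pos_iff.2 h1)), hAB]
        have := mul_le_mul_of_nonneg_left h2 hB.le
        linarith)
    rw [normSq_coneMetric_dilation hs hβ.ne' hγ.ne'] at h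
    rw [normSq_rescaled]
    have e : (s ^ 2)⁻¹ * normSq (ddbar D.pot) (dilation β₁ γ s x) (dilation β₁ γ s v)
        - normSq (coneMetric β₁ γ) x v = (s ^ 2)⁻¹ *
        (normSq (ddbar D.pot) (dilation β₁ γ s x) (dilation β₁ γ s v)
          - s ^ 2 * normSq (coneMetric β₁ γ) x v) := by field_simp
    rw [e, abs_mul, abs_of_pos (inv_pos.2 hs20), inv_mul_le_iff₀ hs20]
    linarith
  · intro x hx v hx3
    obtain ⟨h1, h2, h3⟩ := hoff x hx3
    have h := hlow _ (dilation β₁ γ s v) h1 ((hfst_le x hx).trans_lt hs4) h2 h3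
    have e := norm_rpow_scale hs hβ.ne' x.1 v.1
    rw [normSq_rescaled, le_inv_mul_iff₀ hs20]
    refine le_trans (le_of_eq ?_) h
    simp only [dilation]
    rw [mul_assoc (β₁ ^ 2), mul_assoc (β₁ ^ 2), e]
    ring
  · intro x hx v hx3
    obtain ⟨h1, h2, h3⟩ := hoff x hx3
    have h := hsnd _ (((s ^ (1 / γ) : ℝ) : ℂ) * v) h1 ((hfst_le x hx).trans_lt hs1) h2 h3
    rw [dilation_snd_sub hs, dilation_snd_sub hs] at h
    simp only [norm_mul (((s ^ (1 / γ) : ℝ) : ℂ)), norm_real, norm_of_nonneg hB.le,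
      mul_rpow hB.le (norm_nonneg _)] at h
    have e : (s ^ (1 / γ)) ^ (2 * β₂ - 2) * (s ^ (1 / γ)) ^ (2 * β₃ - 2) * (s ^ (1 / γ)) ^ 2
        = s ^ 2 := by
      rw [← rpow_one_div_rpow_two_mul hs.le hγ.ne', ← rpow_two ((s ^ (1 / γ))),
        ← rpow_add hB, ← rpow_add hB]
      congr 1
      linarith
    have e0 : dilation β₁ γ s (0, v) = (0, ((s ^ (1 / γ) : ℝ) : ℂ) * v) := by simp [dilation]
    rw [normSq_rescaled, inv_mul_le_iff₀ hs20, e0]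
    refine h.trans ?_
    set X := ‖x.2 - a₂ * ((s ^ (1 / β₁ - 1 / γ) : ℝ) : ℂ) * x.1‖ ^ (2 * β₂ - 2)
    set Y := ‖x.2 - a₃ * ((s ^ (1 / β₁ - 1 / γ) : ℝ) : ℂ) * x.1‖ ^ (2 * β₃ - 2)
    have hXY : 0 ≤ X * Y * ‖v‖ ^ 2 := by positivity
    have := mul_le_mul_of_nonneg_right (le_max_left C₁ C₂) (mul_nonneg hs20.le hXY)
    calc _ = C₁ * (((s ^ (1 / γ)) ^ (2 * β₂ - 2) * (s ^ (1 / γ)) ^ (2 * β₃ - 2)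
          * (s ^ (1 / γ)) ^ 2) * (X * Y * ‖v‖ ^ 2)) := by ring
      _ ≤ _ := by rw [e]; linarith
  · intro z v hz hzB
    have h := hfst (((s ^ (1 / β₁) : ℝ) : ℂ) * z) (((s ^ (1 / β₁) : ℝ) : ℂ) * v)
      (mul_ne_zero hA' hz) ((hfst_le _ hzB).trans_lt hs2)
    have e0 : ∀ z : ℂ, dilation β₁ γ s (z, 0) = (((s ^ (1 / β₁) : ℝ) : ℂ) * z, 0) := fun z => by
      simp [dilation]
    rw [normSq_rescaled, inv_mul_le_iff₀ hs20, e0, e0]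
    refine h.trans ?_
    rw [mul_assoc, norm_rpow_scale hs hβ.ne']
    have := mul_le_mul_of_nonneg_right (le_max_right C₁ C₂)
      (by positivity : 0 ≤ s ^ 2 * (‖z‖ ^ (2 * β₁ - 2) * ‖v‖ ^ 2))
    linarith

theorem GlueData.hasTangentCone :
    HasTangentCone β₁ γ (ddbar D.pot) (verticalLine ∪ lineOfSlope a₂ ∪ lineOfSlope a₃) := by
  intro e he
  have hβ := D.pos₁
  have hγ := D.pos
  obtain ⟨C, hC, hnear⟩ := D.isNearCone_rescaled
  obtain ⟨M, hM, hdist⟩ := IsNearCone.exists_abs_dist_sub_le hβ D.lt_γ D.lt D.lt₂ D.lt₃ D.angle hC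
  -- with these choices of `ε` and `η` the error `12 ε + M η` is at most `e / 2`
  have hε0 : 0 < min (1 / 2) (e / 48) := by positivity
  obtain ⟨K, r₀, hK, hr₀, hnear⟩ := hnear _ hε0
  have hη0 : 0 < min (1 / 4) (e / (4 * (M + 1))) := by positivity
  set η := min (1 / 4) (e / (4 * (M + 1))) with hη
  have hexp : 0 < 1 / β₁ - 1 / γ := sub_pos.2 (one_div_lt_one_div_of_lt hβ D.lt_γ)
  obtain ⟨s₁, h10, -, hs₁⟩ := exists_rpow_lt (by positivity : 0 < 1 / β₁) hr₀
  obtain ⟨s₂, h20, -, hs₂⟩ := exists_rpow_lt hexp (by positivity : 0 < η ^ (1 / γ) / K)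
  refine ⟨min s₁ s₂, lt_min h10 h20, fun s hs hlt x hx y hy => ?_⟩
  rw [lt_min_iff] at hlt
  have hκ : K * s ^ (1 / β₁ - 1 / γ) ≤ η ^ (1 / γ) := by
    have := (hs₂ s hs.le hlt.2).le
    rw [le_div_iff₀ hK] at this
    linarith
  have h := hdist _ _ _ _ _ (hnear s hs (hs₁ s hs.le hlt.1)) hε0.le (min_le_left _ _) η hη0
    ((min_le_left _ _).trans_lt (by norm_num)) hκ x hx y hy
  rw [← preimage_dilation_threeLines hs] at h
  refine ⟨h.1, h.2.1, h.2.2.trans_lt ?_⟩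
  have h1 : min (1 / 2) (e / 48) ≤ e / 48 := min_le_right _ _
  have h2 : M * η ≤ e / 4 := by
    have h3 : η ≤ e / (4 * (M + 1)) := min_le_right _ _
    rw [le_div_iff₀ (by positivity)] at h3
    nlinarith
  linarith

end

end ConicalLines

end

theorem mainTheorem5
    (β₁ β₂ β₃ γ α₀ : ℝ) (a₂ a₃ : ℂ) (χ₁ χ₂ : ℝ → ℝ)
    (hβ₁ : 0 < β₁) (hβ₂ : β₂ < 1) (hβ₃ : β₃ < 1)
    (hangle : (1 - β₂) + (1 - β₃) < 1 - β₁)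
    (hγ : 1 - γ = (1 - β₂) + (1 - β₃))
    (ha : a₂ ≠ a₃) (hmass : (1 - β₂ : ℂ) * a₂ + (1 - β₃ : ℂ) * a₃ = 0)
    (hα₀ : 1 < α₀) (hα₀' : α₀ < γ / β₁)
    (hχ₁ : ContDiff ℝ ∞ χ₁) (hχ₂ : ContDiff ℝ ∞ χ₂)
    (hχ : ∀ s, χ₁ s + χ₂ s = 1)
    (hχ₁_one : ∀ s, 2 < s → χ₁ s = 1) (hχ₂_one : ∀ s, s < 1 → χ₂ s = 1) :
    let L₁ := verticalLine
    let L₂ := lineOfSlope a₂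
    let L₃ := lineOfSlope a₃
    let ψ := gluedPotential β₁ β₂ β₃ γ α₀ a₂ a₃ χ₁ χ₂
    let g := ddbar ψ
    ∃ U : Set (ℂ × ℂ), IsOpen U ∧ (0 : ℂ × ℂ) ∈ U ∧
      ContinuousOn ψ U ∧
      ContDiffOn ℝ ∞ ψ (U \ (L₁ ∪ L₂ ∪ L₃)) ∧
      IsKahlerOn g (U \ (L₁ ∪ L₂ ∪ L₃)) ∧
      (∀ p ∈ U ∩ L₁, p ≠ 0 → HasConeSingularityAt g L₁ β₁ p) ∧
      (∀ p ∈ U ∩ L₂, p ≠ 0 → HasConeSingularityAt g L₂ β₂ p) ∧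
      (∀ p ∈ U ∩ L₃, p ≠ 0 → HasConeSingularityAt g L₃ β₃ p) ∧
      HasTangentCone β₁ γ g (L₁ ∪ L₂ ∪ L₃) := by
  intro L₁ L₂ L₃ ψ g
  have hβ₁γ : β₁ < γ := by linarith
  have D : GlueData β₁ β₂ β₃ γ α₀ a₂ a₃ χ₁ χ₂ :=
    { pos₂ := by linarith, lt₂ := hβ₂, pos₃ := by linarith, lt₃ := hβ₃, pos := by linarith
      lt := by linarith, angle := hγ, ne := ha, mass := hmass, pos₁ := hβ₁, lt_γ := hβ₁γ
      one_lt := hα₀, mul_lt := (lt_div_iff₀ hβ₁).1 hα₀', smooth := hχ₂, sum := hχ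
      eq_one := hχ₁_one, eq_one' := hχ₂_one }
  obtain ⟨r₁, h10, -, hpos⟩ := D.exists_pos
  obtain ⟨r₂, h20, hcone₂⟩ :=
    D.exists_hasConeSingularityAt_slope (p := a₂) (β := β₂) (p' := a₃) (β' := β₃)
      (Or.inl ⟨rfl, rfl, rfl, rfl⟩)
  obtain ⟨r₃, h30, hcone₃⟩ :=
    D.exists_hasConeSingularityAt_slope (p := a₃) (β := β₃) (p' := a₂) (β' := β₂)
      (Or.inr ⟨rfl, rfl, rfl, rfl⟩)
  have hU : ∀ x ∈ Metric.ball (0 : ℂ × ℂ) (min r₁ (min r₂ r₃)),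
      ‖x.1‖ < r₁ ∧ ‖x.1‖ < r₂ ∧ ‖x.1‖ < r₃ := fun x hx => by
    have := (norm_fst_le x).trans_lt (mem_ball_zero_iff.1 hx)
    rwa [lt_min_iff, lt_min_iff] at this
  have hoff : ∀ x, x ∉ L₁ ∪ L₂ ∪ L₃ → x.1 ≠ 0 ∧ x.2 / x.1 ≠ a₂ ∧ x.2 / x.1 ≠ a₃ := fun x hx => by
    obtain ⟨h1, h2, h3⟩ := notMem_threeLines.1 hx
    exact ⟨h1, quotient_ne h1 h2, quotient_ne h1 h3⟩
  have hsmooth : ∀ x, x ∉ L₁ ∪ L₂ ∪ L₃ → ContDiffAt ℝ ∞ ψ x := fun x hx =>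
    D.contDiffAt_pot (hoff x hx).1 (hoff x hx).2.1 (hoff x hx).2.2
  refine ⟨Metric.ball 0 (min r₁ (min r₂ r₃)), Metric.isOpen_ball,
    Metric.mem_ball_self (lt_min h10 (lt_min h20 h30)), D.continuous_pot.continuousOn,
    fun x hx => (hsmooth x hx.2).contDiffWithinAt, isKahlerOn_ddbar (fun x hx => hsmooth x hx.2)
      fun x hx v hv => ?_, ?_, ?_, ?_, D.hasTangentCone⟩
  · obtain ⟨h1, h2, h3⟩ := hoff x hx.2
    exact hpos x v h1 (hU x hx.1).1 h2 h3 hv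
  · rintro ⟨z, w⟩ ⟨-, rfl : z = 0⟩ hp
    exact D.hasConeSingularityAt_vertical fun hw => hp (by rw [hw]; rfl)
  · rintro ⟨z, w⟩ ⟨hx, rfl : w = a₂ * z⟩ hp
    exact hcone₂ z (fun hz => hp (by rw [hz, mul_zero]; rfl)) (hU _ hx).2.1
  · rintro ⟨z, w⟩ ⟨hx, rfl : w = a₃ * z⟩ hp
    exact hcone₃ z (fun hz => hp (by rw [hz, mul_zero]; rfl)) (hU _ hx).2.2
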